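/- Let $m>0$, $s\in\mathbb R\setminus\{0\}$, and consider the motion of a material point of mass $m$ on the unit sphere $S^{n-1}\subset\mathbb R^n$ in the homogeneous magnetic field $\mathbf F=s\sum_{i=1}^{[n/2]}\kappa_{2i-1,2i}\,d\gamma_{2i-1}\wedge d\gamma_{2i}$. Let $\kappa=(\kappa_{ij})$ be the corresponding skew-symmetric matrix. The phase space is $T^*S^{n-1}=\{(\gamma,p)\in\mathbb R^{2n}\mid\langle\gamma,\gamma\rangle=1,\ \langle\gamma,p\rangle=0\}$ with the restriction of the twisted symplectic form $\sum_i dp_i\wedge d\gamma_i+\mathbf F$, and the flow (with Hamiltonian $H=\frac1{2m}\langle p,p\rangle$) is $$\dot\gamma=\tfrac1m p,\qquad \dot p=\tfrac sm\kappa p+\mu\gamma,\qquad \mu=\tfrac1m\big(s\langle p,\kappa\gamma\rangle-\langle p,p\rangle\big).$$ Set $$J=\tfrac{s^2}{m^2}\sum_{i=1}^{[n/2]}\kappa_{2i-1,2i}^2(p_{2i-1}^2+p_{2i}^2)-\mu^2,\qquad \Phi_{ij}=\gamma_ip_j-\gamma_jp_i+\tfrac{s\kappa_{ij}}2(\gamma_i^2+\gamma_j^2),$$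 $$\Psi^1=(\gamma_2p_3-\gamma_3p_2)-(\gamma_1p_4-\gamma_4p_1)-s\kappa_{12}(\gamma_1\gamma_3+\gamma_2\gamma_4),$$ $$\Psi^2=(\gamma_1p_3-\gamma_3p_1)+(\gamma_2p_4-\gamma_4p_2)-s\kappa_{12}(\gamma_1\gamma_4-\gamma_2\gamma_3).$$ The flow is called noncommutatively integrable by means of functions $f_i$ with $d$-dimensional isotropic tori if the $f_i$ are first integrals, the algebra they generate is closed under the Poisson bracket, and on an open dense subset of $T^*S^{n-1}$ the following holds: the dimension $\mathrm{ddim}$ of the span of the differentials $df_i$ and the dimension $\mathrm{dind}=d$ of the kernel of the Poisson tensor restricted to this span satisfy $\mathrm{ddim}+\mathrm{dind}=\dim T^*S^{n-1}=2(n-1)$, and the connected component through the point of the common level set of the $f_i$ is a $d$-dimensional isotropic invariant torus on which the flow is quasi-periodic (linear in suitable angle coordinates). It is called Liouville integrable by means of functions $f_i$ if these are Poisson commuting first integrals whose differentials span a space of dimension $n-1$ at every point of an open dense subset of $T^*S^{n-1}$. (i) Let $n\ge5$, $\kappa_{12}\ne0$ and $\kappa_{2i-1,2i}=0$ for $i>1$.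 Then the flow is noncommutatively integrable with $3$-dimensional isotropic tori by means of $H$, $J$, $\Phi_{12}$ and $\Phi_{ij}$, $3\le i<j\le n$. It is also Liouville integrable by means of $H$, $J$, $\Phi_{12}$, $\Phi_{34}$ and $I_k=\sum_{3\le i<j\le 4+k}\Phi_{ij}^2$, $k=1,\dots,n-4$. (ii) Let $n\ge7$, $\kappa_{12}=\kappa_{34}\ne0$ and $\kappa_{2i-1,2i}=0$ for $i>2$. Then the flow is noncommutatively integrable with $4$-dimensional isotropic tori by means of $H$, $J$, $\Phi_{12}$, $\Phi_{34}$, $\Psi^1$, $\Psi^2$ and $\Phi_{ij}$, $5\le i<j\le n$. (iii) Let $n\ge7$, $\kappa_{12}\ne\kappa_{34}$, both nonzero, and $\kappa_{2i-1,2i}=0$ for $i>2$. Then the flow is noncommutatively integrable with $5$-dimensional isotropic tori by means of $H$, $J$, $\Phi_{12}$, $\Phi_{34}$ and $\Phi_{ij}$, $5\le i<j\le n$. In cases (ii) and (iii) the flow is also Liouville integrable by means of $H$, $J$, $\Phi_{12}$, $\Phi_{34}$, $\Phi_{56}$ and $I_k=\sum_{5\le i<j\le 6+k}\Phi_{ij}^2$,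 $k=1,\dots,n-6$. -/

import Mathlib

open scoped Matrix ContDiff

noncomputable section

namespace MagneticSphere

/-- The ambient space `ℝ²ⁿ` with coordinates `(γ, p)`. Only its topology and its differentiable
structure matter; all scalar products are written out as `⬝ᵥ`. -/
abbrev Phase (n : ℕ) : Type := (Fin n → ℝ) × (Fin n → ℝ)

/-- The skew-symmetric matrix of the magnetic form
`κ₁₂ dγ₁ ∧ dγ₂ + κ₃₄ dγ₃ ∧ dγ₄ + ⋯ + κ_{2[n/2]-1,2[n/2]} dγ_{2[n/2]-1} ∧ dγ_{2[n/2]}`.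
Indices are counted from `0`: `k l` is the parameter `κ_{2l+1,2l+2}` and the pairs of indices are
`(0,1), (2,3), …`. The values `k l` for `l ≥ [n/2]` do not enter. -/
def blockField (n : ℕ) (k : ℕ → ℝ) : Matrix (Fin n) (Fin n) ℝ :=
  Matrix.of fun i j =>
    if (i : ℕ) % 2 = 0 ∧ (j : ℕ) = i + 1 then k ((i : ℕ) / 2)
    else if (j : ℕ) % 2 = 0 ∧ (i : ℕ) = j + 1 then -k ((j : ℕ) / 2)
    else 0

section Geometry

variable {n : ℕ}

/-- The constraint `φ₁ = ⟨γ, γ⟩`. -/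
def phi₁ (x : Phase n) : ℝ := x.1 ⬝ᵥ x.1

/-- The constraint `φ₂ = ⟨p, γ⟩`. -/
def phi₂ (x : Phase n) : ℝ := x.2 ⬝ᵥ x.1

/-- The phase space `T*Sⁿ⁻¹ = {φ₁ = 1, φ₂ = 0}`. -/
def cotangentSphere (n : ℕ) : Set (Phase n) := {x | phi₁ x = 1 ∧ phi₂ x = 0}

/-- The tangent space of `T*Sⁿ⁻¹` at `x = (γ, p)`: the vectors on which `dφ₁` and `dφ₂` vanish. -/
def tangentAt (x : Phase n) : Submodule ℝ (Phase n) where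
  carrier := {v | x.1 ⬝ᵥ v.1 = 0 ∧ x.2 ⬝ᵥ v.1 + x.1 ⬝ᵥ v.2 = 0}
  zero_mem' := by simp
  add_mem' := by
    rintro v w ⟨hv, hv'⟩ ⟨hw, hw'⟩
    refine ⟨by simp [dotProduct_add, hv, hw], ?_⟩
    simp only [Prod.fst_add, Prod.snd_add, dotProduct_add]
    linarith
  smul_mem' := by
    rintro c v ⟨hv, hv'⟩
    refine ⟨by simp [hv], ?_⟩
    simp only [Prod.smul_fst, Prod.smul_snd, dotProduct_smul, smul_eq_mul]
    rw [← mul_add, hv', mul_zero]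

/-- The twisted symplectic form `Ω + F` with `Ω = ∑ dpᵢ ∧ dγᵢ`, `F = s ∑_{i<j} κᵢⱼ dγᵢ ∧ dγⱼ`. -/
def twistedForm (s : ℝ) (κ : Matrix (Fin n) (Fin n) ℝ) (v w : Phase n) : ℝ :=
  (v.2 ⬝ᵥ w.1 - v.1 ⬝ᵥ w.2) + s * (v.1 ⬝ᵥ (κ *ᵥ w.1))

/-- `∂f/∂γᵢ`. -/
def dGamma (f : Phase n → ℝ) (i : Fin n) (x : Phase n) : ℝ := fderiv ℝ f x (Pi.single i 1, 0)

/-- `∂f/∂pᵢ`. -/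
def dP (f : Phase n → ℝ) (i : Fin n) (x : Phase n) : ℝ := fderiv ℝ f x (0, Pi.single i 1)

/-- The magnetic Poisson bracket on `ℝ²ⁿ` of the twisted symplectic form `Ω + F`. -/
def magneticBracket (s : ℝ) (κ : Matrix (Fin n) (Fin n) ℝ) (f g : Phase n → ℝ) (x : Phase n) : ℝ :=
  (∑ i, (dGamma f i x * dP g i x - dP f i x * dGamma g i x))
    + s * ∑ i, ∑ j, κ i j * dP f i x * dP g j x

/-- The Dirac magnetic Poisson bracket on `{φ₁ ≠ 0}`; its restriction to the symplectic leaf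
`T*Sⁿ⁻¹` is the Poisson bracket of the restricted twisted symplectic form. -/
def diracBracket (s : ℝ) (κ : Matrix (Fin n) (Fin n) ℝ) (f g : Phase n → ℝ) (x : Phase n) : ℝ :=
  magneticBracket s κ f g x
    - (magneticBracket s κ f phi₁ x * magneticBracket s κ g phi₂ x
        - magneticBracket s κ f phi₂ x * magneticBracket s κ g phi₁ x)
      / magneticBracket s κ phi₁ phi₂ x

/-- The Hamiltonian `H = ⟨p, p⟩ / (2m)`. -/
def energy (m : ℝ) (x : Phase n) : ℝ := (x.2 ⬝ᵥ x.2) / (2 * m)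

/-- The Lagrange multiplier `μ = (s⟨p, κγ⟩ - ⟨p, p⟩) / m`. -/
def multiplier (m s : ℝ) (κ : Matrix (Fin n) (Fin n) ℝ) (x : Phase n) : ℝ :=
  (s * (x.2 ⬝ᵥ (κ *ᵥ x.1)) - x.2 ⬝ᵥ x.2) / m

/-- The magnetic geodesic flow on `T*Sⁿ⁻¹`: `γ' = p / m`, `p' = (s/m) κp + μγ`. -/
def magneticField (m s : ℝ) (κ : Matrix (Fin n) (Fin n) ℝ) (x : Phase n) : Phase n :=
  (m⁻¹ • x.2, (s / m) • (κ *ᵥ x.2) + multiplier m s κ x • x.1)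

/-- The integral `J = (s²/m²) ⟨κp, κp⟩ - μ²`; for a matrix in normal form `⟨κp, κp⟩` is
`∑ᵢ κ_{2i-1,2i}² (p_{2i-1}² + p_{2i}²)`. -/
def integralJ (m s : ℝ) (κ : Matrix (Fin n) (Fin n) ℝ) (x : Phase n) : ℝ :=
  s ^ 2 / m ^ 2 * ((κ *ᵥ x.2) ⬝ᵥ (κ *ᵥ x.2)) - multiplier m s κ x ^ 2

/-- The Noether integrals `Φᵢⱼ = γᵢpⱼ - γⱼpᵢ + (s κᵢⱼ / 2)(γᵢ² + γⱼ²)`; the last term vanishes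
when `κᵢⱼ = 0`. -/
def integralΦ (s : ℝ) (κ : Matrix (Fin n) (Fin n) ℝ) (i j : Fin n) (x : Phase n) : ℝ :=
  x.1 i * x.2 j - x.1 j * x.2 i + s * κ i j / 2 * (x.1 i ^ 2 + x.1 j ^ 2)

/-- The integral `Ψ¹_{ab;cd}` for two pairs of indices `(a,b)`, `(c,d)` with `κ_{ab} = κ_{cd}`. -/
def integralΨ₁ (s : ℝ) (κ : Matrix (Fin n) (Fin n) ℝ) (a b c d : Fin n) (x : Phase n) : ℝ :=
  (x.1 b * x.2 c - x.1 c * x.2 b) - (x.1 a * x.2 d - x.1 d * x.2 a)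
    - s * κ a b * (x.1 a * x.1 c + x.1 b * x.1 d)

/-- The integral `Ψ²_{ab;cd}` for two pairs of indices `(a,b)`, `(c,d)` with `κ_{ab} = κ_{cd}`. -/
def integralΨ₂ (s : ℝ) (κ : Matrix (Fin n) (Fin n) ℝ) (a b c d : Fin n) (x : Phase n) : ℝ :=
  (x.1 a * x.2 c - x.1 c * x.2 a) + (x.1 b * x.2 d - x.1 d * x.2 b)
    - s * κ a b * (x.1 a * x.1 d - x.1 b * x.1 c)

/-- The family of all `Φᵢⱼ` with `a ≤ i < j` (indices from `0`): the integrals of the rotations of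
the last `n - a` coordinates. -/
def rotationIntegrals (s : ℝ) (κ : Matrix (Fin n) (Fin n) ℝ) (a : ℕ)
    (ij : {ij : Fin n × Fin n // a ≤ (ij.1 : ℕ) ∧ ij.1 < ij.2}) : Phase n → ℝ :=
  integralΦ s κ ij.1.1 ij.1.2

/-- `∑_{a ≤ i < j < b} Φᵢⱼ²` (indices from `0`). -/
def casimirSum (s : ℝ) (κ : Matrix (Fin n) (Fin n) ℝ) (a b : ℕ) (x : Phase n) : ℝ :=
  ∑ i : Fin n, ∑ j : Fin n,
    if a ≤ (i : ℕ) ∧ i < j ∧ (j : ℕ) < b then integralΦ s κ i j x ^ 2 else 0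

variable {ι : Type} [Fintype ι]

/-- `ddim` at `x`: the dimension of the span `𝓕ₓ` of the differentials at `x` of the functions
`fᵢ` restricted to `T*Sⁿ⁻¹`. (The algebra generated by the `fᵢ` has the same span.) -/
def ddimAt (f : ι → Phase n → ℝ) (x : Phase n) : ℕ :=
  Module.finrank ℝ (Submodule.span ℝ
    (Set.range fun i => (fderiv ℝ (f i) x).comp (tangentAt x).subtypeL))

/-- `dind` at `x`: the dimension of the kernel of the Poisson tensor restricted to `𝓕ₓ`, that is,
`ddim` minus the rank of the matrix of Poisson brackets `{fᵢ, fⱼ}(x)` (never larger than `ddim`). -/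
def dindAt (s : ℝ) (κ : Matrix (Fin n) (Fin n) ℝ) (f : ι → Phase n → ℝ) (x : Phase n) : ℕ :=
  ddimAt f x - (Matrix.of fun i j => diracBracket s κ (f i) (f j) x).rank

/-- `f` is a first integral of the magnetic flow on `T*Sⁿ⁻¹`. -/
def IsFirstIntegral (m s : ℝ) (κ : Matrix (Fin n) (Fin n) ℝ) (f : Phase n → ℝ) : Prop :=
  ∀ x ∈ cotangentSphere n, fderiv ℝ f x (magneticField m s κ x) = 0

/-- `P` holds at a generic point of `T*Sⁿ⁻¹`: on a relatively open and dense subset. -/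
def Generically (P : Phase n → Prop) : Prop :=
  ∃ O : Set (Phase n), IsOpen O ∧ cotangentSphere n ⊆ closure (O ∩ cotangentSphere n) ∧
    ∀ x ∈ O ∩ cotangentSphere n, P x

/-- The connected component, containing `x`, of the common level set in `T*Sⁿ⁻¹` of the
functions `fᵢ`. -/
def levelComponent (f : ι → Phase n → ℝ) (x : Phase n) : Set (Phase n) :=
  connectedComponentIn {y | y ∈ cotangentSphere n ∧ ∀ i, f i y = f i x} x

/-- `T` is a `d`-dimensional isotropic invariant torus of the magnetic flow on which the flow is
quasi-periodic: `T` is the image of an immersion `Θ` of `ℝᵈ` that induces a bijection from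
`ℝᵈ/ℤᵈ`, the twisted symplectic form vanishes on `T`, and `Θ` carries a constant vector
field `ν` to the field of the flow, so that the motions on `T` are `t ↦ Θ(θ + tν)`. -/
def IsIsotropicInvariantTorus (m s : ℝ) (κ : Matrix (Fin n) (Fin n) ℝ) (d : ℕ)
    (T : Set (Phase n)) : Prop :=
  ∃ (Θ : (Fin d → ℝ) → Phase n) (ν : Fin d → ℝ),
    ContDiff ℝ ∞ Θ ∧ Set.range Θ = T ∧
    (∀ θ θ', Θ θ = Θ θ' ↔ ∃ z : Fin d → ℤ, ∀ i, θ' i = θ i + z i) ∧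
    (∀ θ, Function.Injective (fderiv ℝ Θ θ)) ∧
    (∀ θ u v, twistedForm s κ (fderiv ℝ Θ θ u) (fderiv ℝ Θ θ v) = 0) ∧
    ∀ θ, fderiv ℝ Θ θ ν = magneticField m s κ (Θ θ)

/-- The magnetic flow on `T*Sⁿ⁻¹` (of dimension `2(n-1)`) is completely integrable in the
noncommutative sense by means of the first integrals `fᵢ`, and its generic invariant manifolds,
the common level sets of the `fᵢ`, are `d`-dimensional isotropic tori. -/
structure IsNoncommutativelyIntegrable (m s : ℝ) (κ : Matrix (Fin n) (Fin n) ℝ)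
    (f : ι → Phase n → ℝ) (d : ℕ) : Prop where
  smooth : ∀ i, ContDiff ℝ ∞ (f i)
  first_integral : ∀ i, IsFirstIntegral m s κ (f i)
  /-- the algebra generated by the `fᵢ` is closed under the Poisson bracket -/
  closed : ∀ i j, ∃ g ∈ Algebra.adjoin ℝ (Set.range f),
    ∀ x ∈ cotangentSphere n, diracBracket s κ (f i) (f j) x = g x
  generic : Generically fun x =>
    ddimAt f x + dindAt s κ f x = 2 * (n - 1) ∧ dindAt s κ f x = d ∧
      IsIsotropicInvariantTorus m s κ d (levelComponent f x)

/-- The magnetic flow on `T*Sⁿ⁻¹` is Liouville integrable by means of the functions `fᵢ`: they are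
Poisson commuting first integrals and, generically, `n - 1 = dim Sⁿ⁻¹` is the number of
independent ones among them. -/
structure IsLiouvilleIntegrable (m s : ℝ) (κ : Matrix (Fin n) (Fin n) ℝ)
    (f : ι → Phase n → ℝ) : Prop where
  smooth : ∀ i, ContDiff ℝ ∞ (f i)
  first_integral : ∀ i, IsFirstIntegral m s κ (f i)
  commute : ∀ i j, ∀ x ∈ cotangentSphere n, diracBracket s κ (f i) (f j) x = 0
  generic : Generically fun x => ddimAt f x = n - 1

end Geometry

end MagneticSphere

end

open MagneticSphere

section

open Set Filter Topology Metric
open scoped NNReal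

section CommutingFields

variable {E : Type*} [NormedAddCommGroup E] [NormedSpace ℝ E]

theorem exists_forall_hasDerivAt_of_lipschitz [CompleteSpace E] {v : E → E} {C L : ℝ≥0}
    (hv : LipschitzWith C v) (hL : ∀ x, ‖v x‖ ≤ L) (x : E) :
    ∃ c : ℝ → E, c 0 = x ∧ ∀ t, HasDerivAt c (v (c t)) t := by
  have loc : ∀ N : ℕ, ∃ c : ℝ → E, c 0 = x ∧
      ∀ t ∈ Ioo (-(N : ℝ)) N, HasDerivAt c (v (c t)) t := by
    intro N
    have h0 : (0 : ℝ) ∈ Icc (-(N : ℝ)) N := by constructor <;> simp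
    have hP : IsPicardLindelof (fun _ => v) (⟨0, h0⟩ : Icc (-(N : ℝ)) N) x (L * N) 0 L C := by
      refine ⟨fun t _ => hv.lipschitzOnWith, fun y _ => continuousOn_const,
        fun t _ y _ => hL y, ?_⟩
      simp
    obtain ⟨c, hc0, hc⟩ := hP.exists_eq_forall_mem_Icc_hasDerivWithinAt₀
    exact ⟨c, hc0, fun t ht => (hc t ⟨ht.1.le, ht.2.le⟩).hasDerivAt (Icc_mem_nhds ht.1 ht.2)⟩
  choose c hc0 hc using loc
  have key : ∀ N M : ℕ, ∀ t ∈ Ioo (-(N : ℝ)) N, t ∈ Ioo (-(M : ℝ)) M → c N t = c M t := by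
    have aux : ∀ N M : ℕ, N ≤ M → ∀ t ∈ Ioo (-(N : ℝ)) N, c N t = c M t := by
      intro N M hNM t ht
      have hNM' : (N : ℝ) ≤ M := by exact_mod_cast hNM
      have hN : (0 : ℝ) < N := by linarith [ht.1, ht.2]
      refine ODE_solution_unique_of_mem_Ioo (v := fun _ => v) (s := fun _ => univ) (t₀ := 0)
        (fun _ _ => hv.lipschitzOnWith) ⟨by linarith, hN⟩ (fun τ hτ => ⟨hc N τ hτ, trivial⟩)
        (fun τ hτ => ⟨hc M τ ⟨by linarith [hτ.1], by linarith [hτ.2]⟩, trivial⟩)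
        ((hc0 N).trans (hc0 M).symm) ht
    intro N M t hN hM
    rcases le_total N M with h | h
    · exact aux N M h t hN
    · exact (aux M N h t hM).symm
  have hmem : ∀ t : ℝ, t ∈ Ioo (-((⌈|t|⌉₊ + 1 : ℕ) : ℝ)) ((⌈|t|⌉₊ + 1 : ℕ) : ℝ) := by
    intro t
    have := Nat.le_ceil |t|
    push_cast
    exact abs_lt.1 (by linarith)
  refine ⟨fun t => c (⌈|t|⌉₊ + 1) t, hc0 _, fun t => ?_⟩
  refine (hc _ t (hmem t)).congr_of_eventuallyEq ?_
  filter_upwards [Ioo_mem_nhds (hmem t).1 (hmem t).2] with τ hτ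
  exact key _ _ τ (hmem τ) hτ

theorem norm_sub_sub_fderiv_le {F : Type*} [NormedAddCommGroup F] [NormedSpace ℝ F] {f : E → F}
    {C : ℝ≥0} (hf : Differentiable ℝ f) (hC : LipschitzWith C (fderiv ℝ f)) (x y : E) :
    ‖f y - f x - fderiv ℝ f x (y - x)‖ ≤ C * ‖y - x‖ ^ 2 := by
  have := (convex_closedBall x ‖y - x‖).norm_image_sub_le_of_norm_fderiv_le' (𝕜 := ℝ) (f := f)
    (φ := fderiv ℝ f x) (C := C * ‖y - x‖) (x := x) (y := y) (fun z _ => hf z) (fun z hz => by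
      have h1 := hC.dist_le_mul z x
      rw [dist_eq_norm] at h1
      have h2 : dist z x ≤ ‖y - x‖ := mem_closedBall.1 hz
      exact h1.trans (mul_le_mul_of_nonneg_left h2 C.2)) (by simp) (by simp [dist_eq_norm])
  calc _ ≤ _ := this
    _ = _ := by ring

variable {V : Type*} [NormedAddCommGroup V] [NormedSpace ℝ V]

/-- The fields `X · u`, `u ∈ V`, are smooth, compactly supported, commute along `K` and their
integral curves that start in `K` stay in `K`. -/
structure IsCommutingFrame (X : E → V →L[ℝ] E) (K : Set E) : Prop where
  smooth : ContDiff ℝ ∞ X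
  compact_support : HasCompactSupport X
  commute : ∀ y ∈ K, ∀ u v, fderiv ℝ X y (X y u) v = fderiv ℝ X y (X y v) u
  invariant : ∀ (c : ℝ → E) (u : V), (∀ t, HasDerivAt c (X (c t) u) t) → c 0 ∈ K → ∀ t, c t ∈ K

namespace IsCommutingFrame

variable {X : E → V →L[ℝ] E} {K : Set E}

theorem exists_lipschitz (h : IsCommutingFrame X K) : ∃ C : ℝ≥0, LipschitzWith C X :=
  ContDiff.lipschitzWith_of_hasCompactSupport h.compact_support h.smooth (by simp)

theorem exists_bound (h : IsCommutingFrame X K) : ∃ B : ℝ≥0, ∀ y, ‖X y‖ ≤ B := by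
  obtain ⟨B, hB⟩ := h.compact_support.exists_bound_of_continuous h.smooth.continuous
  exact ⟨B.toNNReal, fun y => (hB y).trans (Real.le_coe_toNNReal B)⟩

theorem exists_lipschitz_fderiv (h : IsCommutingFrame X K) :
    ∃ C : ℝ≥0, LipschitzWith C (fderiv ℝ X) :=
  ContDiff.lipschitzWith_of_hasCompactSupport (n := 1) (h.compact_support.fderiv (𝕜 := ℝ))
    (h.smooth.fderiv_right (by norm_cast)) (by simp)

theorem lipschitz_apply {C : ℝ≥0} (hC : LipschitzWith C X) (u : V) :
    LipschitzWith (C * ‖u‖₊) fun y => X y u := by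
  refine LipschitzWith.of_dist_le_mul fun y z => ?_
  rw [dist_eq_norm, ← sub_apply]
  refine (ContinuousLinearMap.le_opNorm _ _).trans ?_
  have := hC.dist_le_mul y z
  rw [dist_eq_norm] at this
  calc ‖X y - X z‖ * ‖u‖ ≤ (C * dist y z) * ‖u‖ := by gcongr
    _ = _ := by push_cast; ring

theorem exists_curve [CompleteSpace E] (h : IsCommutingFrame X K) (y : E) (u : V) :
    ∃ c : ℝ → E, c 0 = y ∧ ∀ t, HasDerivAt c (X (c t) u) t := by
  obtain ⟨C, hC⟩ := h.exists_lipschitz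
  obtain ⟨B, hB⟩ := h.exists_bound
  refine exists_forall_hasDerivAt_of_lipschitz (lipschitz_apply hC u) (L := B * ‖u‖₊) ?_ y
  intro x
  exact (ContinuousLinearMap.le_opNorm _ _).trans (mul_le_mul_of_nonneg_right (hB x) (norm_nonneg u))

theorem curve_unique (h : IsCommutingFrame X K) {u : V} {c c' : ℝ → E}
    (hc : ∀ t, HasDerivAt c (X (c t) u) t) (hc' : ∀ t, HasDerivAt c' (X (c' t) u) t)
    (h0 : c 0 = c' 0) : c = c' := by
  obtain ⟨C, hC⟩ := h.exists_lipschitz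
  exact ODE_solution_unique_univ (v := fun _ y => X y u) (s := fun _ => univ) (t₀ := 0)
    (fun _ => (lipschitz_apply hC u).lipschitzOnWith) (fun t => ⟨hc t, trivial⟩)
    (fun t => ⟨hc' t, trivial⟩) h0

variable [CompleteSpace E]

/-- The action of `V` by the flows: `h.orbit y u` is the time one flow of `X · u` from `y`. -/
noncomputable def orbit (h : IsCommutingFrame X K) (y : E) (u : V) : E :=
  (h.exists_curve y u).choose 1

theorem eq_orbit (h : IsCommutingFrame X K) {y : E} {u : V} {c : ℝ → E}
    (hc : ∀ t, HasDerivAt c (X (c t) u) t) (h0 : c 0 = y) : c 1 = h.orbit y u := by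
  have hs := (h.exists_curve y u).choose_spec
  rw [orbit, h.curve_unique hc hs.2 (h0.trans hs.1.symm)]

theorem eq_orbit_smul (h : IsCommutingFrame X K) {y : E} {u : V} {c : ℝ → E}
    (hc : ∀ t, HasDerivAt c (X (c t) u) t) (h0 : c 0 = y) (r : ℝ) :
    c r = h.orbit y (r • u) := by
  have : ∀ t, HasDerivAt (fun t => c (r * t)) (X (c (r * t)) (r • u)) t := by
    intro t
    have h1 : HasDerivAt (fun t : ℝ => r * t) r t := by
      simpa using (hasDerivAt_id t).const_mul r
    have := (hc (r * t)).scomp t h1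
    simpa [Function.comp_def] using this
  simpa using h.eq_orbit this (by simpa using h0)

theorem hasDerivAt_orbit_smul (h : IsCommutingFrame X K) (y : E) (u : V) (r : ℝ) :
    HasDerivAt (fun r : ℝ => h.orbit y (r • u)) (X (h.orbit y (r • u)) u) r := by
  obtain ⟨c, hc0, hc⟩ := h.exists_curve y u
  have : (fun r : ℝ => h.orbit y (r • u)) = c := by
    funext r
    exact (h.eq_orbit_smul hc hc0 r).symm
  rw [this, ← h.eq_orbit_smul hc hc0 r]
  exact hc r

theorem orbit_zero (h : IsCommutingFrame X K) (y : E) : h.orbit y 0 = y := by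
  refine (h.eq_orbit (c := fun _ => y) (fun t => ?_) rfl).symm
  simpa using hasDerivAt_const t y

theorem orbit_mem (h : IsCommutingFrame X K) {y : E} (hy : y ∈ K) (u : V) : h.orbit y u ∈ K := by
  have := h.invariant (fun r : ℝ => h.orbit y (r • u)) u (h.hasDerivAt_orbit_smul y u)
    (by simpa [h.orbit_zero] using hy) 1
  simpa using this

theorem hasFDerivAt_orbit (h : IsCommutingFrame X K) {y : E} (hy : y ∈ K) (u : V) :
    HasFDerivAt (h.orbit y) (X (h.orbit y u)) u := by
  obtain ⟨C, hC⟩ := h.exists_lipschitz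
  obtain ⟨B, hB⟩ := h.exists_bound
  obtain ⟨C₂, hC₂⟩ := h.exists_lipschitz_fderiv
  have hdiff : Differentiable ℝ X := h.smooth.differentiable (by simp)
  have hDX : ∀ z, ‖fderiv ℝ X z‖ ≤ C := fun z => norm_fderiv_le_of_lipschitz ℝ hC
  set κ : ℝ≥0 := C * (‖u‖₊ + 1) + 1 with hκ
  set A : ℝ := C₂ * B ^ 2 * (‖u‖ + 1) + C * B with hA
  have hA0 : 0 ≤ A := by positivity
  set M : ℝ := A / κ * (Real.exp κ - 1) with hM
  have bound : ∀ w : V, ‖w‖ ≤ 1 →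
      ‖h.orbit y (u + w) - h.orbit y u - X (h.orbit y u) w‖ ≤ M * ‖w‖ ^ 2 := by
    intro w hw
    set c : ℝ → E := fun r => h.orbit y (r • u) with hc
    have hcd := h.hasDerivAt_orbit_smul y u
    set g : ℝ → E := fun r => h.orbit y (r • (u + w)) with hg
    have hgd := h.hasDerivAt_orbit_smul y (u + w)
    have hcK : ∀ t, c t ∈ K := fun t => h.orbit_mem hy _
    set z : ℝ → E := fun t => c t + t • X (c t) w with hz
    set z' : ℝ → E := fun t => X (c t) u + (X (c t) w + t • fderiv ℝ X (c t) (X (c t) u) w) with hz'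
    have hzd : ∀ t, HasDerivAt z (z' t) t := by
      intro t
      have h1 : HasDerivAt (fun t => X (c t)) (fderiv ℝ X (c t) (X (c t) u)) t :=
        (hdiff (c t)).hasFDerivAt.comp_hasDerivAt t (hcd t)
      have h2 : HasDerivAt (fun t => X (c t) w) (fderiv ℝ X (c t) (X (c t) u) w) t := by
        have := h1.clm_apply (hasDerivAt_const t w)
        simpa using this
      have h3 := (hasDerivAt_id t).smul h2
      have h4 := (hcd t).add h3
      have h5 : z' t = X (c t) u + (t • fderiv ℝ X (c t) (X (c t) u) w + (1 : ℝ) • X (c t) w) := by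
        rw [one_smul, add_comm (t • _)]
      rw [h5]
      exact h4
    have lipv : LipschitzWith κ fun x => X x (u + w) := by
      refine (lipschitz_apply hC (u + w)).weaken ?_
      have : ‖u + w‖₊ ≤ ‖u‖₊ + 1 := by
        refine (nnnorm_add_le u w).trans ?_
        gcongr
        exact_mod_cast hw
      calc C * ‖u + w‖₊ ≤ C * (‖u‖₊ + 1) := by gcongr
        _ ≤ κ := by rw [hκ]; simp
    have approx : ∀ t ∈ Ico (0 : ℝ) 1, dist (z' t) (X (z t) (u + w)) ≤ A * ‖w‖ ^ 2 := by
      intro t ht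
      have hXw : ‖X (c t) w‖ ≤ B * ‖w‖ :=
        (ContinuousLinearMap.le_opNorm _ _).trans (by gcongr; exact hB _)
      have ht1 : ‖t • X (c t) w‖ ≤ B * ‖w‖ := by
        rw [norm_smul, Real.norm_eq_abs, abs_of_nonneg ht.1]
        calc t * ‖X (c t) w‖ ≤ 1 * ‖X (c t) w‖ := by gcongr; exact ht.2.le
          _ ≤ B * ‖w‖ := by rwa [one_mul]
      have hzc : z t - c t = t • X (c t) w := by simp [hz]
      set R := X (z t) - X (c t) - fderiv ℝ X (c t) (z t - c t) with hR
      have hRb : ‖R‖ ≤ C₂ * (B * ‖w‖) ^ 2 := by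
        refine (norm_sub_sub_fderiv_le hdiff hC₂ (c t) (z t)).trans ?_
        rw [hzc]
        gcongr
      have e1 : X (z t) (u + w) - z' t
          = R (u + w) + fderiv ℝ X (c t) (t • X (c t) w) w := by
        have hcm := h.commute (c t) (hcK t) u w
        simp only [hR, hzc, hz', sub_apply, map_add, map_smul,
          smul_apply, hcm]
        abel
      rw [dist_comm, dist_eq_norm, e1]
      have n1 : ‖R (u + w)‖ ≤ C₂ * (B * ‖w‖) ^ 2 * (‖u‖ + 1) := by
        refine (ContinuousLinearMap.le_opNorm _ _).trans ?_
        have : ‖u + w‖ ≤ ‖u‖ + 1 := (norm_add_le u w).trans (by gcongr)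
        gcongr
      have n2 : ‖fderiv ℝ X (c t) (t • X (c t) w) w‖ ≤ C * (B * ‖w‖) * ‖w‖ := by
        refine (ContinuousLinearMap.le_opNorm _ _).trans ?_
        gcongr
        refine (ContinuousLinearMap.le_opNorm _ _).trans ?_
        gcongr
        exact hDX _
      calc _ ≤ _ := norm_add_le _ _
        _ ≤ C₂ * (B * ‖w‖) ^ 2 * (‖u‖ + 1) + C * (B * ‖w‖) * ‖w‖ := add_le_add n1 n2
        _ = A * ‖w‖ ^ 2 := by rw [hA]; ring
    have grn := dist_le_of_approx_trajectories_ODE (v := fun _ x => X x (u + w)) (K := κ)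
      (f := g) (g := z) (f' := fun t => X (g t) (u + w)) (g' := z') (a := 0) (b := 1)
      (εf := 0) (εg := A * ‖w‖ ^ 2) (δ := 0)
      (fun _ => lipv) (fun t _ => (hgd t).continuousAt.continuousWithinAt)
      (fun t _ => (hgd t).hasDerivWithinAt) (fun t _ => by simp)
      (fun t _ => (hzd t).continuousAt.continuousWithinAt)
      (fun t _ => (hzd t).hasDerivWithinAt) approx
      (by simp [hg, hz, hc, h.orbit_zero]) 1 (by simp)
    have hκ0 : (κ : ℝ) ≠ 0 := by
      have : (0 : ℝ) < κ := by rw [hκ]; push_cast; positivity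
      exact this.ne'
    rw [gronwallBound_of_K_ne_0 hκ0, dist_eq_norm] at grn
    have e2 : g 1 - z 1 = h.orbit y (u + w) - h.orbit y u - X (h.orbit y u) w := by
      simp only [hg, hz, hc, one_smul]
      abel
    rw [e2] at grn
    calc _ ≤ _ := grn
      _ = M * ‖w‖ ^ 2 := by rw [hM]; simp; ring
  rw [hasFDerivAt_iff_isLittleO_nhds_zero]
  refine Asymptotics.IsBigO.trans_isLittleO (g := fun w : V => ‖w‖ ^ 2) ?_
    (Asymptotics.isLittleO_norm_pow_id one_lt_two)
  refine Asymptotics.IsBigO.of_bound M ?_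
  filter_upwards [closedBall_mem_nhds (0 : V) one_pos] with w hw
  have := bound w (by simpa using hw)
  simpa using this

theorem contDiff_orbit (h : IsCommutingFrame X K) {y : E} (hy : y ∈ K) :
    ContDiff ℝ ∞ (h.orbit y) := by
  have hd : Differentiable ℝ (h.orbit y) := fun u => (h.hasFDerivAt_orbit hy u).differentiableAt
  have hf : fderiv ℝ (h.orbit y) = fun u => X (h.orbit y u) :=
    funext fun u => (h.hasFDerivAt_orbit hy u).fderiv
  have : ∀ k : ℕ, ContDiff ℝ k (h.orbit y) := by
    intro k
    induction k with
    | zero => exact contDiff_zero.2 hd.continuous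
    | succ k ih =>
      push_cast
      rw [contDiff_succ_iff_fderiv]
      refine ⟨hd, by simp, ?_⟩
      rw [hf]
      exact (h.smooth.of_le (by exact_mod_cast le_top)).comp ih
  exact contDiff_infty.2 this

theorem orbit_add (h : IsCommutingFrame X K) {y : E} (hy : y ∈ K) (u v : V) :
    h.orbit y (u + v) = h.orbit (h.orbit y u) v := by
  have : ∀ t : ℝ, HasDerivAt (fun t : ℝ => h.orbit y (u + t • v))
      (X (h.orbit y (u + t • v)) v) t := by
    intro t
    have h1 : HasDerivAt (fun t : ℝ => u + t • v) v t := by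
      simpa using ((hasDerivAt_id t).smul_const v).const_add u
    exact (h.hasFDerivAt_orbit hy (u + t • v)).comp_hasDerivAt t h1
  simpa using h.eq_orbit this (by simp)

end IsCommutingFrame

end CommutingFields

section CommutingFields

variable {E : Type*} [NormedAddCommGroup E] [NormedSpace ℝ E]
  {V : Type*} [NormedAddCommGroup V] [NormedSpace ℝ V]

theorem HasStrictFDerivAt.eventually_injOn {F : Type*} [NormedAddCommGroup F] [NormedSpace ℝ F]
    [FiniteDimensional ℝ E] {f : E → F} {f' : E →L[ℝ] F} {x : E} (hf : HasStrictFDerivAt f f' x)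
    (hinj : Function.Injective f') : ∃ U ∈ 𝓝 x, InjOn f U := by
  obtain ⟨C, hC0, hC⟩ := (f' : E →ₗ[ℝ] F).exists_antilipschitzWith (LinearMap.ker_eq_bot.2 hinj)
  have hC0' : (0 : ℝ) < C := hC0
  have h1 := hf.isLittleO.def (c := (C : ℝ)⁻¹ / 2) (by positivity)
  rw [nhds_prod_eq] at h1
  obtain ⟨U, hU, hUf⟩ := mem_prod_self_iff.1 h1
  refine ⟨U, hU, fun a ha b hb hab => ?_⟩
  have h2 : ‖f a - f b - f' (a - b)‖ ≤ (C : ℝ)⁻¹ / 2 * ‖a - b‖ := hUf (mk_mem_prod ha hb)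
  have h3 : ‖a - b‖ ≤ C * ‖f' (a - b)‖ := by
    have := hC.le_mul_dist (a - b) 0
    simpa [dist_eq_norm] using this
  simp only [hab, sub_self, zero_sub, norm_neg] at h2
  have h4 : ‖a - b‖ ≤ ‖a - b‖ / 2 := by
    calc ‖a - b‖ ≤ C * ‖f' (a - b)‖ := h3
      _ ≤ C * ((C : ℝ)⁻¹ / 2 * ‖a - b‖) := by gcongr
      _ = _ := by field_simp
  have : ‖a - b‖ = 0 := le_antisymm (by linarith) (norm_nonneg _)
  exact sub_eq_zero.1 (norm_eq_zero.1 this)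

namespace IsCommutingFrame

variable {X : E → V →L[ℝ] E} {K : Set E} [CompleteSpace E]
  {F : Type*} [NormedAddCommGroup F] [NormedSpace ℝ F] {G : E → F}

/-- If `K` is contained in a level set of `G` whose tangent spaces along `K` are spanned by the
frame, then the orbits are open in `K`. -/
theorem eventually_mem_orbit [FiniteDimensional ℝ E] [FiniteDimensional ℝ V]
    (h : IsCommutingFrame X K) (hX : ∀ y ∈ K, Function.Injective (X y))
    (hG : ContDiff ℝ 1 G) (hGK : ∀ y ∈ K, ∀ z ∈ K, G y = G z)
    (hker : ∀ y ∈ K, ∀ v, fderiv ℝ G y v = 0 → ∃ u, X y u = v) {y : E} (hy : y ∈ K)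
    {ε : ℝ} (hε : 0 < ε) : ∀ᶠ z in 𝓝 y, z ∈ K → ∃ u, ‖u‖ < ε ∧ h.orbit y u = z := by
  obtain ⟨A₀, hA₀⟩ := (X y : V →ₗ[ℝ] E).exists_leftInverse_of_injective
    (LinearMap.ker_eq_bot.2 (hX y hy))
  set A : E →L[ℝ] V := A₀.toContinuousLinearMap
  have hA : ∀ u, A (X y u) = u := fun u => LinearMap.congr_fun hA₀ u
  have hstrict : HasStrictFDerivAt (fun z => (G z, A z)) ((fderiv ℝ G y).prod A) y :=
    (hG.contDiffAt.hasStrictFDerivAt (by simp)).prodMk A.hasStrictFDerivAt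
  obtain ⟨U, hU, hinj⟩ := hstrict.eventually_injOn (by
    rw [← ContinuousLinearMap.coe_coe, ← LinearMap.ker_eq_bot, LinearMap.ker_eq_bot']
    intro v hv
    have h1 : fderiv ℝ G y v = 0 := congrArg Prod.fst hv
    have h2 : A v = 0 := congrArg Prod.snd hv
    obtain ⟨u, rfl⟩ := hker y hy v h1
    rw [hA] at h2
    rw [h2, map_zero])
  have hO : HasStrictFDerivAt (h.orbit y) (X y) 0 := by
    have h1 := ((h.contDiff_orbit hy).contDiffAt (x := 0)).hasStrictFDerivAt (by simp)
    rwa [(h.hasFDerivAt_orbit hy 0).fderiv, h.orbit_zero] at h1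
  have hθ : HasStrictFDerivAt (fun u => A (h.orbit y u))
      ((ContinuousLinearEquiv.refl ℝ V : V ≃L[ℝ] V) : V →L[ℝ] V) 0 := by
    have h1 := A.hasStrictFDerivAt.comp (0 : V) hO
    have h2 : A.comp (X y) = ((ContinuousLinearEquiv.refl ℝ V : V ≃L[ℝ] V) : V →L[ℝ] V) :=
      ContinuousLinearMap.ext hA
    rwa [h2] at h1
  have hmap := hθ.map_nhds_eq_of_equiv
  rw [h.orbit_zero] at hmap
  have hW : {u : V | ‖u‖ < ε ∧ h.orbit y u ∈ U} ∈ 𝓝 (0 : V) := by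
    have h1 : ∀ᶠ u in 𝓝 (0 : V), ‖u‖ < ε := by
      filter_upwards [ball_mem_nhds (0 : V) hε] with u hu using by simpa using hu
    have h2 : ∀ᶠ u in 𝓝 (0 : V), h.orbit y u ∈ U :=
      (h.contDiff_orbit hy).continuous.continuousAt.eventually (by rwa [h.orbit_zero])
    exact h1.and h2
  have hW' : (fun u => A (h.orbit y u)) '' {u : V | ‖u‖ < ε ∧ h.orbit y u ∈ U} ∈ 𝓝 (A y) := by
    rw [← hmap]
    exact image_mem_map hW
  filter_upwards [hU, A.continuous.continuousAt.eventually hW'] with z hzU hz hzK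
  obtain ⟨u, ⟨hu, huU⟩, huz⟩ := hz
  refine ⟨u, hu, hinj huU hzU ?_⟩
  exact Prod.ext (hGK _ (h.orbit_mem hy u) _ hzK) huz

theorem range_orbit (h : IsCommutingFrame X K)
    (hopen : ∀ y ∈ K, ∀ ε > 0, ∀ᶠ z in 𝓝 y, z ∈ K → ∃ u, ‖u‖ < ε ∧ h.orbit y u = z)
    {x : E} (hx : x ∈ K) : range (h.orbit x) = connectedComponentIn K x := by
  apply Subset.antisymm
  · refine IsPreconnected.subset_connectedComponentIn
      (isPreconnected_range (h.contDiff_orbit hx).continuous) ⟨0, h.orbit_zero x⟩ ?_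
    rintro _ ⟨u, rfl⟩
    exact h.orbit_mem hx u
  · intro z hz
    by_contra hzr
    have hCK := connectedComponentIn_subset K x
    have hpre : IsPreconnected (connectedComponentIn K x) := isPreconnected_connectedComponentIn
    set R := range (h.orbit x) with hR
    have hRopen : ∀ y ∈ R, ∀ᶠ w in 𝓝 y, w ∈ K → w ∈ R := by
      rintro _ ⟨u, rfl⟩
      filter_upwards [hopen _ (h.orbit_mem hx u) 1 one_pos] with w hw hwK
      obtain ⟨u', -, rfl⟩ := hw hwK
      exact ⟨u + u', h.orbit_add hx u u'⟩
    have hRclosed : ∀ y ∈ K, y ∉ R → ∀ᶠ w in 𝓝 y, w ∈ K → w ∉ R := by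
      intro y hy hyR
      filter_upwards [hopen y hy 1 one_pos] with w hw hwK
      rintro ⟨u', hu'⟩
      obtain ⟨u, -, hu⟩ := hw hwK
      apply hyR
      refine ⟨u' + -u, ?_⟩
      rw [h.orbit_add hx, hu', ← hu, ← h.orbit_add hy, add_neg_cancel, h.orbit_zero]
    set O₁ := interior {w | w ∈ K → w ∈ R}
    set O₂ := interior {w | w ∈ K → w ∉ R}
    have h1 : connectedComponentIn K x ⊆ O₁ ∪ O₂ := by
      intro w hw
      by_cases hwR : w ∈ R
      · exact Or.inl (mem_interior_iff_mem_nhds.2 (hRopen w hwR))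
      · exact Or.inr (mem_interior_iff_mem_nhds.2 (hRclosed w (hCK hw) hwR))
    obtain ⟨w, hw, hw1, hw2⟩ := hpre O₁ O₂ isOpen_interior isOpen_interior h1
      ⟨x, mem_connectedComponentIn hx,
        mem_interior_iff_mem_nhds.2 (hRopen x ⟨0, h.orbit_zero x⟩)⟩
      ⟨z, hz, mem_interior_iff_mem_nhds.2 (hRclosed z (hCK hz) hzr)⟩
    exact interior_subset hw2 (hCK hw) (interior_subset hw1 (hCK hw))

/-- The periods of the action at `x`. -/
def periods (h : IsCommutingFrame X K) {x : E} (hx : x ∈ K) : Submodule ℤ V :=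
  AddSubgroup.toIntSubmodule
    { carrier := {u | h.orbit x u = x}
      zero_mem' := h.orbit_zero x
      add_mem' := fun {u v} (hu : h.orbit x u = x) (hv : h.orbit x v = x) => by
        change h.orbit x (u + v) = x
        rw [h.orbit_add hx, hu, hv]
      neg_mem' := fun {u} (hu : h.orbit x u = x) => by
        change h.orbit x (-u) = x
        conv_lhs => rw [← hu]
        rw [← h.orbit_add hx, add_neg_cancel, h.orbit_zero] }

theorem mem_periods (h : IsCommutingFrame X K) {x : E} (hx : x ∈ K) {u : V} :
    u ∈ h.periods hx ↔ h.orbit x u = x := Iff.rfl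

theorem orbit_eq_orbit_iff (h : IsCommutingFrame X K) {x : E} (hx : x ∈ K) {u v : V} :
    h.orbit x u = h.orbit x v ↔ v - u ∈ h.periods hx := by
  rw [mem_periods]
  constructor
  · intro huv
    rw [sub_eq_add_neg, h.orbit_add hx, ← huv, ← h.orbit_add hx, add_neg_cancel, h.orbit_zero]
  · intro hp
    have : v = (v - u) + u := by abel
    rw [this, h.orbit_add hx, hp]

theorem discreteTopology_periods [FiniteDimensional ℝ V]
    (h : IsCommutingFrame X K) {x : E} (hx : x ∈ K)
    (hX : Function.Injective (X x)) : DiscreteTopology (h.periods hx) := by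
  have hO : HasStrictFDerivAt (h.orbit x) (X x) 0 := by
    have h1 := ((h.contDiff_orbit hx).contDiffAt (x := 0)).hasStrictFDerivAt (by simp)
    rwa [(h.hasFDerivAt_orbit hx 0).fderiv, h.orbit_zero] at h1
  obtain ⟨U, hU, hinj⟩ := hO.eventually_injOn hX
  refine discreteTopology_of_isOpen_singleton_zero ?_
  have : ({0} : Set (h.periods hx)) ∈ 𝓝 (0 : h.periods hx) := by
    have h1 : (Subtype.val ⁻¹' U : Set (h.periods hx)) ∈ 𝓝 (0 : h.periods hx) :=
      continuous_subtype_val.continuousAt.preimage_mem_nhds (by simpa using hU)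
    filter_upwards [h1] with u hu
    have := hinj hu (mem_of_mem_nhds hU) (((h.mem_periods hx).1 u.2).trans (h.orbit_zero x).symm)
    exact Subtype.ext this
  rw [isOpen_iff_mem_nhds]
  rintro _ rfl
  exact this

theorem span_periods [FiniteDimensional ℝ V] (h : IsCommutingFrame X K) (hK : IsCompact K)
    (hopen : ∀ y ∈ K, ∀ ε > 0, ∀ᶠ z in 𝓝 y, z ∈ K → ∃ u, ‖u‖ < ε ∧ h.orbit y u = z)
    {x : E} (hx : x ∈ K) : Submodule.span ℝ (h.periods hx : Set V) = ⊤ := by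
  have hbdd : ∃ r : ℝ, ∀ u, ∃ v, ‖v‖ ≤ r ∧ v - u ∈ h.periods hx := by
    -- the component of `x` is compact, and covered by neighbourhoods on which periods are bounded
    have hloc : ∀ y ∈ K, ∃ W ∈ 𝓝 y, ∃ r : ℝ, ∀ u, h.orbit x u ∈ W →
        ∃ v, ‖v‖ ≤ r ∧ v - u ∈ h.periods hx := by
      intro y hy
      refine ⟨_, hopen y hy 1 one_pos, ?_⟩
      by_cases hyr : ∃ w, h.orbit x w = y
      · obtain ⟨w, rfl⟩ := hyr
        refine ⟨‖w‖ + 1, fun u hu => ?_⟩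
        obtain ⟨v, hv, hvu⟩ := hu (h.orbit_mem hx u)
        refine ⟨w + v, (norm_add_le _ _).trans (by linarith), ?_⟩
        rw [← h.orbit_eq_orbit_iff hx, h.orbit_add hx, hvu]
      · refine ⟨0, fun u hu => ?_⟩
        obtain ⟨v, hv, hvu⟩ := hu (h.orbit_mem hx u)
        refine absurd ⟨u + -v, ?_⟩ hyr
        rw [h.orbit_add hx, ← hvu, ← h.orbit_add hy, add_neg_cancel, h.orbit_zero]
    choose! W hW r hr using hloc
    obtain ⟨t, htK, ht⟩ := hK.elim_nhds_subcover W hW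
    refine ⟨∑ y ∈ t, |r y|, fun u => ?_⟩
    obtain ⟨y, hyt, hyu⟩ := mem_iUnion₂.1 (ht (h.orbit_mem hx u))
    obtain ⟨v, hv, hvu⟩ := hr y (htK y hyt) u hyu
    refine ⟨v, hv.trans ((le_abs_self _).trans ?_), hvu⟩
    exact Finset.single_le_sum (f := fun y => |r y|) (fun _ _ => abs_nonneg _) hyt
  by_contra hne
  obtain ⟨f, hf0, hf⟩ := Submodule.exists_le_ker_of_lt_top _ (lt_top_iff_ne_top.2 hne)
  obtain ⟨r, hr⟩ := hbdd
  obtain ⟨u, hu⟩ : ∃ u, f u ≠ 0 := by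
    by_contra! hz
    exact hf0 (LinearMap.ext hz)
  set f' : V →L[ℝ] ℝ := f.toContinuousLinearMap
  have hb : ∀ w, |f w| ≤ ‖f'‖ * r := by
    intro w
    obtain ⟨v, hv, hvw⟩ := hr w
    have h1 : f (v - w) = 0 := hf (Submodule.subset_span hvw)
    rw [map_sub, sub_eq_zero] at h1
    rw [← h1]
    exact (f'.le_opNorm v).trans (by gcongr)
  have h2 := hb (((‖f'‖ * r + 1) / |f u|) • u)
  rw [map_smul, smul_eq_mul, abs_mul, abs_div, abs_abs,
    div_mul_cancel₀ _ (abs_ne_zero.2 hu)] at h2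
  linarith [le_abs_self (‖f'‖ * r + 1)]

end IsCommutingFrame

/-- A compact component of a common level set that carries a frame of commuting fields tangent to
it and of the right dimension is a torus. -/
theorem IsCommutingFrame.exists_torus [FiniteDimensional ℝ E] [CompleteSpace E]
    {F : Type*} [NormedAddCommGroup F] [NormedSpace ℝ F] {G : E → F} {d : ℕ}
    {X : E → (Fin d → ℝ) →L[ℝ] E} {K : Set E} (h : IsCommutingFrame X K) (hK : IsCompact K)
    (hX : ∀ y ∈ K, Function.Injective (X y))
    (hG : ContDiff ℝ 1 G) (hGK : ∀ y ∈ K, ∀ z ∈ K, G y = G z)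
    (hker : ∀ y ∈ K, ∀ v, fderiv ℝ G y v = 0 → ∃ u, X y u = v) {x : E} (hx : x ∈ K) :
    ∃ (Θ : (Fin d → ℝ) → E) (L : (Fin d → ℝ) ≃L[ℝ] (Fin d → ℝ)), ContDiff ℝ ∞ Θ ∧
      range Θ = connectedComponentIn K x ∧
      (∀ θ θ', Θ θ = Θ θ' ↔ ∃ z : Fin d → ℤ, ∀ i, θ' i = θ i + z i) ∧
      (∀ θ, HasFDerivAt Θ ((X (Θ θ)).comp (L : (Fin d → ℝ) →L[ℝ] (Fin d → ℝ))) θ) ∧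
      ∀ θ, Θ θ ∈ K := by
  have hopen : ∀ y ∈ K, ∀ ε > 0, ∀ᶠ z in 𝓝 y, z ∈ K → ∃ u, ‖u‖ < ε ∧ h.orbit y u = z :=
    fun y hy ε hε => h.eventually_mem_orbit hX hG hGK hker hy hε
  have := h.discreteTopology_periods hx (hX x hx)
  have : IsZLattice ℝ (h.periods hx) := ⟨h.span_periods hK hopen hx⟩
  have : Module.Finite ℤ (h.periods hx) := ZLattice.module_finite ℝ _
  have : Module.Free ℤ (h.periods hx) := ZLattice.module_free ℝ _
  have hrank : Module.finrank ℤ (h.periods hx) = d := by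
    rw [ZLattice.rank ℝ (h.periods hx)]
    simp
  set b : Module.Basis (Fin d) ℤ (h.periods hx) := Module.finBasisOfFinrankEq ℤ _ hrank
  set B := b.ofZLatticeBasis ℝ (h.periods hx) with hB
  set L : (Fin d → ℝ) ≃L[ℝ] (Fin d → ℝ) := B.equivFun.symm.toContinuousLinearEquiv with hL
  have hLs : ∀ θ, L θ = ∑ i, θ i • B i := fun θ => B.equivFun_symm_apply θ
  refine ⟨fun θ => h.orbit x (L θ), L, (h.contDiff_orbit hx).comp L.contDiff, ?_, ?_, ?_,
    fun θ => h.orbit_mem hx _⟩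
  · rw [← h.range_orbit hopen hx]
    exact L.surjective.range_comp (h.orbit x)
  · intro θ θ'
    rw [h.orbit_eq_orbit_iff hx, ← map_sub]
    constructor
    · intro hp
      refine ⟨fun i => b.repr ⟨_, hp⟩ i, fun i => ?_⟩
      have h1 := b.ofZLatticeBasis_repr_apply ℝ (h.periods hx) ⟨_, hp⟩ i
      have h2 : B.repr (L (θ' - θ)) i = (θ' - θ) i := by
        have : B.equivFun (L (θ' - θ)) = θ' - θ := B.equivFun.apply_symm_apply _
        rw [← B.equivFun_apply, this]
      rw [← hB] at h1
      simp only [h2, Pi.sub_apply] at h1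
      linarith
    · rintro ⟨z, hz⟩
      have : L (θ' - θ) = ((∑ i, z i • b i : h.periods hx) : Fin d → ℝ) := by
        rw [hLs]
        push_cast
        refine Finset.sum_congr rfl fun i _ => ?_
        have h3 : (θ' - θ) i = z i := by rw [Pi.sub_apply, hz]; ring
        rw [h3, hB, b.ofZLatticeBasis_apply ℝ (h.periods hx) i]
        exact Int.cast_smul_eq_zsmul ℝ (z i) (b i : Fin d → ℝ)
      rw [this]
      exact SetLike.coe_mem _
  · intro θ
    exact (h.hasFDerivAt_orbit hx (L θ)).comp θ L.hasFDerivAt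

end CommutingFields

section Cutoff

variable {E : Type*} [NormedAddCommGroup E] [NormedSpace ℝ E] [FiniteDimensional ℝ E]

/-- `IsCommutingFrame.exists_torus` for fields that need not be complete outside `K`. -/
theorem exists_torus_of_commuting {F : Type*} [NormedAddCommGroup F] [NormedSpace ℝ F]
    {G : E → F} {d : ℕ} {X : E → (Fin d → ℝ) →L[ℝ] E} {K : Set E} (hK : IsCompact K)
    (hXs : ContDiff ℝ ∞ X)
    (hcomm : ∀ y ∈ K, ∀ u v, fderiv ℝ X y (X y u) v = fderiv ℝ X y (X y v) u)
    (hinv : ∀ (c : ℝ → E) (ψ : ℝ → ℝ) (u : Fin d → ℝ),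
      (∀ t, HasDerivAt c (ψ t • X (c t) u) t) → c 0 ∈ K → ∀ t, c t ∈ K)
    (hX : ∀ y ∈ K, Function.Injective (X y))
    (hG : ContDiff ℝ 1 G) (hGK : ∀ y ∈ K, ∀ z ∈ K, G y = G z)
    (hker : ∀ y ∈ K, ∀ v, fderiv ℝ G y v = 0 → ∃ u, X y u = v) {x : E} (hx : x ∈ K) :
    ∃ (Θ : (Fin d → ℝ) → E) (L : (Fin d → ℝ) ≃L[ℝ] (Fin d → ℝ)), ContDiff ℝ ∞ Θ ∧
      range Θ = connectedComponentIn K x ∧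
      (∀ θ θ', Θ θ = Θ θ' ↔ ∃ z : Fin d → ℤ, ∀ i, θ' i = θ i + z i) ∧
      (∀ θ, HasFDerivAt Θ ((X (Θ θ)).comp (L : (Fin d → ℝ) →L[ℝ] (Fin d → ℝ))) θ) ∧
      ∀ θ, Θ θ ∈ K := by
  have : CompleteSpace E := FiniteDimensional.complete ℝ E
  obtain ⟨R, hR0, hR⟩ := hK.isBounded.subset_ball_lt 0 0
  let χ : ContDiffBump (0 : E) := ⟨R, R + 1, hR0, by linarith⟩
  have hχ1 : ∀ y ∈ K, χ =ᶠ[𝓝 y] 1 := by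
    intro y hy
    filter_upwards [isOpen_ball.mem_nhds (hR hy)] with z hz
    exact χ.one_of_mem_closedBall (ball_subset_closedBall hz)
  set X' : E → (Fin d → ℝ) →L[ℝ] E := fun y => χ y • X y with hX'
  have heq : ∀ y ∈ K, X' =ᶠ[𝓝 y] X := by
    intro y hy
    filter_upwards [hχ1 y hy] with z hz
    simp [hX', hz]
  have heq' : ∀ y ∈ K, X' y = X y := fun y hy => (heq y hy).eq_of_nhds
  have hfr : IsCommutingFrame X' K := by
    refine ⟨χ.contDiff.smul hXs, ?_, ?_, ?_⟩
    · exact χ.hasCompactSupport.smul_right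
    · intro y hy u v
      rw [(heq y hy).fderiv_eq, heq' y hy]
      exact hcomm y hy u v
    · intro c u hc hc0
      exact hinv c (fun t => χ (c t)) u (fun t => hc t) hc0
  obtain ⟨Θ, L, h1, h2, h3, h4, h5⟩ := hfr.exists_torus hK
    (fun y hy => by rw [heq' y hy]; exact hX y hy) hG hGK
    (fun y hy v hv => by rw [heq' y hy]; exact hker y hy v hv) hx
  refine ⟨Θ, L, h1, h2, h3, fun θ => ?_, h5⟩
  rw [← heq' _ (h5 θ)]
  exact h4 θ

end Cutoff

section SymplecticLinearAlgebra

variable {T : Type*} [AddCommGroup T] [Module ℝ T] [FiniteDimensional ℝ T]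
  {B : LinearMap.BilinForm ℝ T} {ι : Type*}

theorem finrank_span_add_of_orthogonal (hB : B.Nondegenerate) (D : ι → T)
    {Z : Submodule ℝ T} (hZ : ∀ v, (∀ i, B (D i) v = 0) ↔ v ∈ Z) :
    Module.finrank ℝ (Submodule.span ℝ (range D)) + Module.finrank ℝ Z = Module.finrank ℝ T := by
  have : Z = B.orthogonal (Submodule.span ℝ (range D)) := by
    ext v
    rw [← hZ, LinearMap.BilinForm.mem_orthogonal_iff]
    constructor
    · intro h w hw
      induction hw using Submodule.span_induction with
      | mem _ hx => obtain ⟨i, rfl⟩ := hx; exact h i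
      | zero => simp
      | add _ _ _ _ h1 h2 =>
        simp only [map_add, LinearMap.add_apply] at *
        rw [h1, h2, add_zero]
      | smul a _ _ h1 =>
        simp only [map_smul, LinearMap.smul_apply] at *
        rw [h1, smul_zero]
    · exact fun h i => h _ (Submodule.subset_span ⟨i, rfl⟩)
  rw [this, LinearMap.BilinForm.finrank_orthogonal hB]
  have := Submodule.finrank_le (Submodule.span ℝ (range D))
  omega

theorem rank_matrix_of_isotropic [Fintype ι] (hB : B.Nondegenerate) (hA : B.IsAlt) (D : ι → T)
    {Z : Submodule ℝ T} (hZ : ∀ v, (∀ i, B (D i) v = 0) ↔ v ∈ Z)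
    (hiso : ∀ v ∈ Z, ∀ w ∈ Z, B v w = 0) :
    (Matrix.of fun i j => B (D i) (D j)).rank + Module.finrank ℝ Z
      = Module.finrank ℝ (Submodule.span ℝ (range D)) := by
  set W := Submodule.span ℝ (range D) with hW
  have h1 := finrank_span_add_of_orthogonal hB D hZ
  rw [← hW] at h1
  have hWZ : W ≤ B.orthogonal Z := by
    rw [hW, Submodule.span_le]
    rintro _ ⟨i, rfl⟩ v hv
    exact hA.isRefl _ _ ((hZ v).2 hv i)
  have hZZ : Z ≤ B.orthogonal Z := fun v hv w hw => hiso w hw v hv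
  have hWeq : W = B.orthogonal Z := by
    refine Submodule.eq_of_le_of_finrank_le hWZ ?_
    rw [LinearMap.BilinForm.finrank_orthogonal hB]
    omega
  have hZW : Z ≤ W := hWeq ▸ hZZ
  set g : (ι → ℝ) →ₗ[ℝ] T := Fintype.linearCombination ℝ D with hg
  have hgr : LinearMap.range g = W := by
    rw [hg, Fintype.range_linearCombination]
  set M : Matrix ι ι ℝ := Matrix.of fun i j => B (D i) (D j) with hM
  have hker : LinearMap.ker M.mulVecLin = LinearMap.ker (Z.mkQ ∘ₗ g) := by
    ext c
    rw [LinearMap.mem_ker, LinearMap.mem_ker, LinearMap.comp_apply, Submodule.mkQ_apply,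
      Submodule.Quotient.mk_eq_zero, ← hZ, funext_iff]
    refine forall_congr' fun i => ?_
    simp only [Matrix.mulVecLin_apply, Matrix.mulVec, dotProduct, hM, Matrix.of_apply, hg,
      Fintype.linearCombination_apply, map_sum, map_smul, smul_eq_mul, Pi.zero_apply]
    simp only [mul_comm]
  have h2 := M.mulVecLin.finrank_range_add_finrank_ker
  have h3 := (Z.mkQ ∘ₗ g).finrank_range_add_finrank_ker
  rw [hker] at h2
  have h4 : LinearMap.range (Z.mkQ ∘ₗ g) = LinearMap.range (Z.mkQ ∘ₗ W.subtype) := by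
    rw [LinearMap.range_comp, LinearMap.range_comp, hgr, Submodule.range_subtype]
  have h5 := (Z.mkQ ∘ₗ W.subtype).finrank_range_add_finrank_ker
  have h6 : LinearMap.ker (Z.mkQ ∘ₗ W.subtype) = Z.comap W.subtype := by
    rw [LinearMap.ker_comp, Submodule.ker_mkQ]
  have h7 : Module.finrank ℝ (Z.comap W.subtype) = Module.finrank ℝ Z :=
    (Submodule.comapSubtypeEquivOfLe hZW).finrank_eq
  rw [h6, h7] at h5
  rw [h4] at h3
  change Module.finrank ℝ (LinearMap.range M.mulVecLin) + _ = _
  omega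

end SymplecticLinearAlgebra

namespace MagneticSphere

variable {n : ℕ} {s : ℝ} {κ : Matrix (Fin n) (Fin n) ℝ}

theorem mem_tangentAt {x v : Phase n} :
    v ∈ tangentAt x ↔ x.1 ⬝ᵥ v.1 = 0 ∧ x.2 ⬝ᵥ v.1 + x.1 ⬝ᵥ v.2 = 0 := Iff.rfl

theorem dotProduct_mulVec_skew (hκ : κᵀ = -κ) (u v : Fin n → ℝ) :
    u ⬝ᵥ (κ *ᵥ v) = -(v ⬝ᵥ (κ *ᵥ u)) := by
  rw [Matrix.dotProduct_mulVec, ← Matrix.mulVec_transpose, hκ, Matrix.neg_mulVec, neg_dotProduct,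
    dotProduct_comm]

/-- `twistedForm` as a bilinear form. -/
def twistedBilin (s : ℝ) (κ : Matrix (Fin n) (Fin n) ℝ) : LinearMap.BilinForm ℝ (Phase n) :=
  LinearMap.mk₂ ℝ (twistedForm s κ)
    (fun a b c => by simp [twistedForm, add_dotProduct]; ring)
    (fun r a b => by simp [twistedForm, smul_dotProduct]; ring)
    (fun a b c => by simp [twistedForm, dotProduct_add, Matrix.mulVec_add]; ring)
    (fun r a b => by simp [twistedForm, dotProduct_smul, Matrix.mulVec_smul]; ring)

@[simp] theorem twistedBilin_apply (v w : Phase n) : twistedBilin s κ v w = twistedForm s κ v w :=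
  rfl

theorem twistedForm_swap (hκ : κᵀ = -κ) (v w : Phase n) :
    twistedForm s κ v w = -twistedForm s κ w v := by
  simp only [twistedForm, dotProduct_mulVec_skew hκ v.1 w.1, dotProduct_comm v.2 w.1,
    dotProduct_comm v.1 w.2]
  ring

theorem apply_eq_sum (L : Phase n →L[ℝ] ℝ) (v : Phase n) :
    L v = ∑ i, (L (Pi.single i 1, 0) * v.1 i + L (0, Pi.single i 1) * v.2 i) := by
  have hv : v = ∑ i, (v.1 i • ((Pi.single i 1, 0) : Phase n)
      + v.2 i • ((0, Pi.single i 1) : Phase n)) := by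
    ext j <;> simp [Prod.fst_sum, Prod.snd_sum, Pi.single_apply]
  conv_lhs => rw [hv]
  simp only [map_sum, map_add, map_smul, smul_eq_mul, mul_comm]

/-- The Hamiltonian vector field of `g` on `ℝ²ⁿ`. -/
noncomputable def hamVector (s : ℝ) (κ : Matrix (Fin n) (Fin n) ℝ) (g : Phase n → ℝ) (x : Phase n) : Phase n :=
  (fun i => dP g i x, fun i => -dGamma g i x + s * ∑ j, κ i j * dP g j x)

theorem magneticBracket_eq (f g : Phase n → ℝ) (x : Phase n) :
    magneticBracket s κ f g x = fderiv ℝ f x (hamVector s κ g x) := by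
  rw [apply_eq_sum, magneticBracket, Finset.mul_sum, ← Finset.sum_add_distrib]
  refine Finset.sum_congr rfl fun i _ => ?_
  simp only [hamVector, dGamma, dP, Finset.mul_sum]
  rw [mul_add, Finset.mul_sum]
  have : ∀ j, s * (κ i j * fderiv ℝ f x (0, Pi.single i 1) * fderiv ℝ g x (0, Pi.single j 1))
    = fderiv ℝ f x (0, Pi.single i 1) * (s * (κ i j * fderiv ℝ g x (0, Pi.single j 1))) :=
    fun j => by ring
  simp only [this]
  ring

theorem twistedForm_hamVector (hκ : κᵀ = -κ) (g : Phase n → ℝ) (x v : Phase n) :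
    twistedForm s κ (hamVector s κ g x) v = -fderiv ℝ g x v := by
  rw [apply_eq_sum]
  have h1 : (hamVector s κ g x).1 ⬝ᵥ (κ *ᵥ v.1)
      = -∑ i, (∑ j, κ i j * dP g j x) * v.1 i := by
    rw [dotProduct_mulVec_skew hκ, dotProduct]
    congr 1
    refine Finset.sum_congr rfl fun i _ => ?_
    rw [mul_comm]
    rfl
  rw [twistedForm, h1]
  simp only [hamVector, dotProduct, dGamma, dP]
  rw [mul_neg, Finset.mul_sum, ← Finset.sum_sub_distrib, ← sub_eq_add_neg,
    ← Finset.sum_sub_distrib, ← Finset.sum_neg_distrib]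
  refine Finset.sum_congr rfl fun i _ => ?_
  ring

theorem hasFDerivAt_dotProduct {E : Type*} [NormedAddCommGroup E] [NormedSpace ℝ E]
    (f g : E →L[ℝ] (Fin n → ℝ)) (x : E) :
    ∃ L : E →L[ℝ] ℝ, HasFDerivAt (fun x => f x ⬝ᵥ g x) L x ∧
      ∀ v, L v = f v ⬝ᵥ g x + f x ⬝ᵥ g v := by
  let L : E →L[ℝ] ℝ := ∑ i, (f x i • (ContinuousLinearMap.proj i).comp g
    + g x i • (ContinuousLinearMap.proj i).comp f)
  refine ⟨L, ?_, fun v => ?_⟩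
  · refine HasFDerivAt.fun_sum fun i _ => ?_
    have h1 : HasFDerivAt (fun x => f x i) ((ContinuousLinearMap.proj i).comp f) x :=
      ((ContinuousLinearMap.proj (R := ℝ) (φ := fun _ : Fin n => ℝ) i).comp f).hasFDerivAt
    have h2 : HasFDerivAt (fun x => g x i) ((ContinuousLinearMap.proj i).comp g) x :=
      ((ContinuousLinearMap.proj (R := ℝ) (φ := fun _ : Fin n => ℝ) i).comp g).hasFDerivAt
    exact h1.mul h2
  · simp only [L, sum_apply, add_apply, smul_apply, ContinuousLinearMap.comp_apply,
      ContinuousLinearMap.proj_apply, smul_eq_mul, dotProduct, ← Finset.sum_add_distrib]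
    exact Finset.sum_congr rfl fun i _ => by ring

theorem fderiv_dotProduct {E : Type*} [NormedAddCommGroup E] [NormedSpace ℝ E]
    (f g : E →L[ℝ] (Fin n → ℝ)) (x v : E) :
    fderiv ℝ (fun x => f x ⬝ᵥ g x) x v = f v ⬝ᵥ g x + f x ⬝ᵥ g v := by
  obtain ⟨L, hL, hv⟩ := hasFDerivAt_dotProduct f g x
  rw [hL.fderiv, hv]

theorem fderiv_phi₁ (x v : Phase n) : fderiv ℝ phi₁ x v = 2 * (x.1 ⬝ᵥ v.1) := by
  have := fderiv_dotProduct (ContinuousLinearMap.fst ℝ (Fin n → ℝ) (Fin n → ℝ))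
    (ContinuousLinearMap.fst ℝ (Fin n → ℝ) (Fin n → ℝ)) x v
  simp only [ContinuousLinearMap.coe_fst'] at this
  rw [dotProduct_comm v.1] at this
  rw [two_mul, ← this]
  rfl

theorem fderiv_phi₂ (x v : Phase n) : fderiv ℝ phi₂ x v = x.2 ⬝ᵥ v.1 + x.1 ⬝ᵥ v.2 := by
  have := fderiv_dotProduct (ContinuousLinearMap.snd ℝ (Fin n → ℝ) (Fin n → ℝ))
    (ContinuousLinearMap.fst ℝ (Fin n → ℝ) (Fin n → ℝ)) x v
  simp only [ContinuousLinearMap.coe_fst', ContinuousLinearMap.coe_snd'] at this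
  rw [dotProduct_comm v.2, add_comm] at this
  exact this

theorem mem_tangentAt_iff_fderiv {x v : Phase n} :
    v ∈ tangentAt x ↔ fderiv ℝ phi₁ x v = 0 ∧ fderiv ℝ phi₂ x v = 0 := by
  rw [mem_tangentAt, fderiv_phi₁, fderiv_phi₂]
  simp

theorem magneticBracket_swap (hκ : κᵀ = -κ) (f g : Phase n → ℝ) (x : Phase n) :
    magneticBracket s κ f g x = -magneticBracket s κ g f x := by
  have h1 := twistedForm_hamVector (s := s) hκ f x (hamVector s κ g x)
  have h2 := twistedForm_hamVector (s := s) hκ g x (hamVector s κ f x)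
  rw [twistedForm_swap hκ] at h2
  rw [magneticBracket_eq, magneticBracket_eq]
  linarith

theorem magneticBracket_phi (x : Phase n) :
    magneticBracket s κ phi₁ phi₂ x = 2 * phi₁ x := by
  rw [magneticBracket_eq, fderiv_phi₁]
  congr 1
  simp only [phi₁, dotProduct]
  refine Finset.sum_congr rfl fun i _ => ?_
  simp [hamVector, dP, fderiv_phi₂]

/-- The Hamiltonian vector field of the restriction of `g` to `T*Sⁿ⁻¹`. -/
noncomputable def diracVector (s : ℝ) (κ : Matrix (Fin n) (Fin n) ℝ) (g : Phase n → ℝ) (x : Phase n) :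
    Phase n :=
  hamVector s κ g x
    - (magneticBracket s κ g phi₂ x / magneticBracket s κ phi₁ phi₂ x) • hamVector s κ phi₁ x
    + (magneticBracket s κ g phi₁ x / magneticBracket s κ phi₁ phi₂ x) • hamVector s κ phi₂ x

theorem diracBracket_eq_fderiv (f g : Phase n → ℝ) (x : Phase n) :
    diracBracket s κ f g x = fderiv ℝ f x (diracVector s κ g x) := by
  rw [diracVector, map_add, map_sub, map_smul, map_smul, ← magneticBracket_eq,
    ← magneticBracket_eq, ← magneticBracket_eq, diracBracket]
  simp only [smul_eq_mul]
  ring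

theorem diracVector_mem (hκ : κᵀ = -κ) (g : Phase n → ℝ) {x : Phase n}
    (hx : x ∈ cotangentSphere n) : diracVector s κ g x ∈ tangentAt x := by
  have hc : magneticBracket s κ phi₁ phi₂ x ≠ 0 := by
    rw [magneticBracket_phi, hx.1]; norm_num
  have hself : ∀ f : Phase n → ℝ, magneticBracket s κ f f x = 0 := fun f => by
    have := magneticBracket_swap (s := s) hκ f f x
    linarith
  rw [mem_tangentAt_iff_fderiv]
  constructor <;>
    rw [diracVector, map_add, map_sub, map_smul, map_smul, ← magneticBracket_eq,
      ← magneticBracket_eq, ← magneticBracket_eq, smul_eq_mul, smul_eq_mul, hself]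
  · rw [div_mul_cancel₀ _ hc, magneticBracket_swap hκ phi₁ g]
    ring
  · rw [magneticBracket_swap hκ phi₂ phi₁, mul_neg, div_mul_cancel₀ _ hc,
      magneticBracket_swap hκ phi₂ g]
    ring

theorem twistedForm_diracVector (hκ : κᵀ = -κ) (g : Phase n → ℝ) {x v : Phase n}
    (hv : v ∈ tangentAt x) :
    twistedForm s κ (diracVector s κ g x) v = -fderiv ℝ g x v := by
  obtain ⟨h1, h2⟩ := mem_tangentAt_iff_fderiv.1 hv
  have e1 := twistedForm_hamVector (s := s) hκ phi₁ x v
  have e2 := twistedForm_hamVector (s := s) hκ phi₂ x v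
  have e := twistedForm_hamVector (s := s) hκ g x v
  rw [h1] at e1
  rw [h2] at e2
  simp only [← twistedBilin_apply] at *
  rw [diracVector, map_add, map_sub, map_smul, map_smul]
  simp [e, e1, e2, -twistedBilin_apply]

/-- The bracket with `g`, computed from a tangent vector that represents `dg`. -/
theorem diracBracket_eq_of_twistedForm (hκ : κᵀ = -κ) (f : Phase n → ℝ) {g : Phase n → ℝ}
    {x X : Phase n} (hx : x ∈ cotangentSphere n) (hX : X ∈ tangentAt x)
    (hg : ∀ v ∈ tangentAt x, twistedForm s κ X v = -fderiv ℝ g x v) :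
    diracBracket s κ f g x = fderiv ℝ f x X := by
  have hf := diracVector_mem (s := s) hκ f hx
  have h1 := twistedForm_diracVector (s := s) hκ f (diracVector_mem (s := s) hκ g hx)
  have h2 := twistedForm_diracVector (s := s) hκ g hf
  have h3 := hg _ hf
  have h4 := twistedForm_diracVector (s := s) hκ f hX
  rw [twistedForm_swap hκ] at h4 h2
  rw [diracBracket_eq_fderiv]
  linarith

theorem diracBracket_swap (hκ : κᵀ = -κ) (f g : Phase n → ℝ) {x : Phase n}
    (hx : x ∈ cotangentSphere n) : diracBracket s κ f g x = -diracBracket s κ g f x := by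
  have h1 := twistedForm_diracVector (s := s) hκ f (diracVector_mem (s := s) hκ g hx)
  have h2 := twistedForm_diracVector (s := s) hκ g (diracVector_mem (s := s) hκ f hx)
  rw [twistedForm_swap hκ] at h2
  rw [diracBracket_eq_fderiv, diracBracket_eq_fderiv]
  linarith

theorem eq_zero_of_twistedForm (hκ : κᵀ = -κ) {x w : Phase n} (hx : x ∈ cotangentSphere n)
    (hw : w ∈ tangentAt x) (h : ∀ v ∈ tangentAt x, twistedForm s κ w v = 0) : w = 0 := by
  have hc : magneticBracket s κ phi₁ phi₂ x ≠ 0 := by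
    rw [magneticBracket_phi, hx.1]; norm_num
  set c := magneticBracket s κ phi₁ phi₂ x with hcdef
  have hself : ∀ f : Phase n → ℝ, magneticBracket s κ f f x = 0 := fun f => by
    have := magneticBracket_swap (s := s) hκ f f x
    linarith
  have key : ∀ v, twistedBilin s κ w v = 0 := by
    intro v
    set v' := v + (fderiv ℝ phi₂ x v / c) • hamVector s κ phi₁ x
      - (fderiv ℝ phi₁ x v / c) • hamVector s κ phi₂ x with hv'
    have hmem : v' ∈ tangentAt x := by
      rw [mem_tangentAt_iff_fderiv]
      constructor <;>
        rw [hv', map_sub, map_add, map_smul, map_smul, ← magneticBracket_eq,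
          ← magneticBracket_eq, smul_eq_mul, smul_eq_mul, hself]
      · rw [← hcdef, div_mul_cancel₀ _ hc]; ring
      · rw [magneticBracket_swap hκ phi₂ phi₁, ← hcdef, mul_neg, div_mul_cancel₀ _ hc]; ring
    have h1 := h v' hmem
    obtain ⟨hw1, hw2⟩ := mem_tangentAt_iff_fderiv.1 hw
    have e1 := twistedForm_hamVector (s := s) hκ phi₁ x w
    have e2 := twistedForm_hamVector (s := s) hκ phi₂ x w
    rw [hw1, twistedForm_swap hκ] at e1
    rw [hw2, twistedForm_swap hκ] at e2
    rw [neg_inj] at e1 e2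
    simp only [← twistedBilin_apply] at h1 e1 e2
    rw [hv', map_sub, map_add, map_smul, map_smul, e1, e2] at h1
    simpa [-twistedBilin_apply] using h1
  have h1 := key (0, w.1)
  have h1' : w.1 = 0 := by
    simp only [twistedBilin_apply, twistedForm, Matrix.mulVec_zero, dotProduct_zero] at h1
    exact dotProduct_self_eq_zero.1 (by linarith)
  have h2 := key (w.2, 0)
  have h2' : w.2 = 0 := by
    simp only [twistedBilin_apply, twistedForm, h1', zero_dotProduct, dotProduct_zero] at h2
    exact dotProduct_self_eq_zero.1 (by linarith)
  exact Prod.ext h1' h2'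

theorem finrank_tangentAt (hκ : κᵀ = -κ) {x : Phase n} (hx : x ∈ cotangentSphere n) :
    Module.finrank ℝ (tangentAt x) = 2 * (n - 1) := by
  have hc : magneticBracket (1 : ℝ) κ phi₁ phi₂ x ≠ 0 := by
    rw [magneticBracket_phi, hx.1]; norm_num
  set c := magneticBracket (1 : ℝ) κ phi₁ phi₂ x with hcdef
  have hself : ∀ f : Phase n → ℝ, magneticBracket (1 : ℝ) κ f f x = 0 := fun f => by
    have := magneticBracket_swap (s := (1 : ℝ)) hκ f f x
    linarith
  set L : Phase n →ₗ[ℝ] ℝ × ℝ :=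
    ((fderiv ℝ phi₁ x : Phase n →ₗ[ℝ] ℝ)).prod (fderiv ℝ phi₂ x : Phase n →ₗ[ℝ] ℝ) with hL
  have hsurj : LinearMap.range L = ⊤ := by
    rw [LinearMap.range_eq_top]
    rintro ⟨a, b⟩
    refine ⟨(a / c) • hamVector (1 : ℝ) κ phi₂ x - (b / c) • hamVector (1 : ℝ) κ phi₁ x, ?_⟩
    have hLv : ∀ v, L v = (fderiv ℝ phi₁ x v, fderiv ℝ phi₂ x v) := fun v => rfl
    simp only [map_sub, map_smul, hLv, ← magneticBracket_eq, hself]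
    rw [magneticBracket_swap hκ phi₂ phi₁, ← hcdef]
    ext
    · simp [hc]
    · simp [hc]
  have hker : LinearMap.ker L = tangentAt x := by
    ext v
    rw [LinearMap.mem_ker, mem_tangentAt_iff_fderiv, hL]
    simp [Prod.ext_iff]
  have := L.finrank_range_add_finrank_ker
  rw [hsurj, hker] at this
  simp at this
  omega

/-- If the common kernel `Z` of the differentials of the `fᵢ` is isotropic of dimension `d`, then
`ddim = 2(n-1) - d` and `dind = d`. -/
theorem ddimAt_dindAt_of_kernel {ι : Type} [Fintype ι] (hκ : κᵀ = -κ) (f : ι → Phase n → ℝ)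
    {x : Phase n} (hx : x ∈ cotangentSphere n) {d : ℕ} {Z : Fin d → Phase n}
    (hZt : ∀ a, Z a ∈ tangentAt x) (hZi : LinearIndependent ℝ Z)
    (hiso : ∀ a b, twistedForm s κ (Z a) (Z b) = 0) (hZf : ∀ i a, fderiv ℝ (f i) x (Z a) = 0)
    (hker : ∀ v ∈ tangentAt x, (∀ i, fderiv ℝ (f i) x v = 0) → v ∈ Submodule.span ℝ (range Z)) :
    ddimAt f x + dindAt s κ f x = 2 * (n - 1) ∧ dindAt s κ f x = d := by
  classical
  set T := tangentAt x with hT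
  set B : LinearMap.BilinForm ℝ T := (twistedBilin s κ).restrict T with hB
  have hBapp : ∀ v w : T, B v w = twistedForm s κ v w := fun v w => rfl
  have hBalt : B.IsAlt := fun v => by
    have := twistedForm_swap (s := s) hκ (v : Phase n) v
    rw [hBapp]
    linarith
  have hBnd : B.Nondegenerate := by
    have h1 : ∀ w : T, (∀ v, B w v = 0) → w = 0 := fun w hw =>
      Subtype.ext (eq_zero_of_twistedForm hκ hx w.2 fun v hv => hw ⟨v, hv⟩)
    refine ⟨h1, fun w hw => h1 w fun v => ?_⟩
    rw [← hBalt.neg_eq, hw, neg_zero]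
  set D : ι → T := fun i => ⟨diracVector s κ (f i) x, diracVector_mem hκ (f i) hx⟩ with hD
  have hBD : ∀ i (v : T), B (D i) v = -fderiv ℝ (f i) x v := fun i v =>
    twistedForm_diracVector hκ (f i) v.2
  set Z' : Fin d → T := fun a => ⟨Z a, hZt a⟩ with hZ'
  have hZ'i : LinearIndependent ℝ Z' := by
    refine LinearIndependent.of_comp T.subtype ?_
    exact hZi
  set ZS := Submodule.span ℝ (range Z') with hZS
  have hZSd : Module.finrank ℝ ZS = d := by
    rw [hZS, finrank_span_eq_card hZ'i, Fintype.card_fin]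
  have hmem : ∀ v : T, (∀ i, B (D i) v = 0) ↔ v ∈ ZS := by
    intro v
    constructor
    · intro h
      have h1 : (v : Phase n) ∈ Submodule.span ℝ (range Z) :=
        hker v v.2 fun i => by have := h i; rw [hBD] at this; linarith
      have h2 : range Z = T.subtype '' range Z' := by
        rw [← range_comp]; rfl
      rw [h2, ← Submodule.map_span] at h1
      obtain ⟨w, hw, hwv⟩ := h1
      rwa [← Subtype.ext hwv]
    · intro h i
      rw [hZS] at h
      induction h using Submodule.span_induction with
      | mem _ hx => obtain ⟨a, rfl⟩ := hx; rw [hBD, neg_eq_zero]; exact hZf i a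
      | zero => simp
      | add _ _ _ _ h1 h2 => rw [map_add, h1, h2, add_zero]
      | smul r _ _ h1 => rw [map_smul, h1, smul_zero]
  have hZiso : ∀ v ∈ ZS, ∀ w ∈ ZS, B v w = 0 := by
    intro v hv w hw
    rw [hZS] at hv hw
    induction hv using Submodule.span_induction with
    | mem _ hx =>
      obtain ⟨a, rfl⟩ := hx
      induction hw using Submodule.span_induction with
      | mem _ hx => obtain ⟨b, rfl⟩ := hx; exact hiso a b
      | zero => simp
      | add _ _ _ _ h1 h2 => rw [map_add, h1, h2, add_zero]
      | smul r _ _ h1 => rw [map_smul, h1, smul_zero]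
    | zero => simp
    | add _ _ _ _ h1 h2 => rw [map_add, LinearMap.add_apply, h1, h2, add_zero]
    | smul r _ _ h1 => rw [map_smul, LinearMap.smul_apply, h1, smul_zero]
  have h1 := finrank_span_add_of_orthogonal hBnd D hmem
  have h2 := rank_matrix_of_isotropic hBnd hBalt D hmem hZiso
  have hM : (Matrix.of fun i j => B (D i) (D j))
      = Matrix.of fun i j => diracBracket s κ (f j) (f i) x := by
    ext i j
    simp only [Matrix.of_apply]
    rw [diracBracket_swap hκ _ _ hx, diracBracket_eq_fderiv, hBD]
  have hrank : (Matrix.of fun i j => diracBracket s κ (f i) (f j) x).rank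
      = (Matrix.of fun i j => B (D i) (D j)).rank := by
    rw [hM, ← Matrix.rank_transpose]
    rfl
  have hddim : ddimAt f x = Module.finrank ℝ (Submodule.span ℝ (range D)) := by
    let Ψ : T →ₗ[ℝ] (T →L[ℝ] ℝ) :=
      ((LinearMap.toContinuousLinearMap : (T →ₗ[ℝ] ℝ) ≃ₗ[ℝ] (T →L[ℝ] ℝ)) : _ →ₗ[ℝ] _) ∘ₗ (-B)
    have hΨ : ∀ v w : T, Ψ v w = -B v w := fun v w => rfl
    have hinj : Function.Injective Ψ := by
      refine (injective_iff_map_eq_zero Ψ).2 fun v hv => hBnd.1 v fun w => ?_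
      have := hΨ v w
      rw [hv] at this
      simpa using this.symm
    have hr : (range fun i => (fderiv ℝ (f i) x).comp (tangentAt x).subtypeL)
        = Ψ '' range D := by
      rw [← range_comp]
      congr 1
      funext i
      ext v
      rw [Function.comp_apply, hΨ, hBD, neg_neg]
      rfl
    rw [ddimAt, hr, ← Submodule.map_span]
    exact (Submodule.equivMapOfInjective Ψ hinj _).finrank_eq.symm
  have hTd := finrank_tangentAt hκ hx
  rw [← hT] at hTd
  rw [hZSd] at h1 h2
  rw [dindAt, hrank, hddim]
  omega

end MagneticSphere

namespace MagneticSphere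

variable {n : ℕ}

theorem hasDerivAt_dotProduct {f g : ℝ → Fin n → ℝ} {f' g' : Fin n → ℝ} {t : ℝ}
    (hf : HasDerivAt f f' t) (hg : HasDerivAt g g' t) :
    HasDerivAt (fun t => f t ⬝ᵥ g t) (f' ⬝ᵥ g t + f t ⬝ᵥ g') t := by
  simp only [dotProduct, ← Finset.sum_add_distrib]
  exact HasDerivAt.fun_sum fun i _ => (hasDerivAt_pi.1 hf i).mul (hasDerivAt_pi.1 hg i)

@[fun_prop]
theorem contDiff_dotProduct {E : Type*} [NormedAddCommGroup E] [NormedSpace ℝ E] {k : WithTop ℕ∞}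
    {f g : E → Fin n → ℝ} (hf : ContDiff ℝ k f) (hg : ContDiff ℝ k g) :
    ContDiff ℝ k fun x => f x ⬝ᵥ g x := by
  simp only [dotProduct]
  exact ContDiff.sum fun i _ => (contDiff_pi.1 hf i).mul (contDiff_pi.1 hg i)

@[fun_prop]
theorem contDiff_mulVec {E : Type*} [NormedAddCommGroup E] [NormedSpace ℝ E] {k : WithTop ℕ∞}
    {Ω : Matrix (Fin n) (Fin n) ℝ} {f : E → Fin n → ℝ} (hf : ContDiff ℝ k f) :
    ContDiff ℝ k fun x => Ω *ᵥ f x :=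
  (Ω.mulVecLin.toContinuousLinearMap.contDiff).comp hf

theorem hasDerivAt_mulVec {Ω : Matrix (Fin n) (Fin n) ℝ} {f : ℝ → Fin n → ℝ} {f' : Fin n → ℝ}
    {t : ℝ} (hf : HasDerivAt f f' t) : HasDerivAt (fun t => Ω *ᵥ f t) (Ω *ᵥ f') t :=
  (Ω.mulVecLin.toContinuousLinearMap.hasFDerivAt).comp_hasDerivAt t hf

theorem fderiv_eq_of_curve {E F : Type*} [NormedAddCommGroup E] [NormedSpace ℝ E]
    [NormedAddCommGroup F] [NormedSpace ℝ F] {f : E → F} {x w : E} {v : F}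
    (hf : DifferentiableAt ℝ f x)
    (h : ∀ c : ℝ → E, HasDerivAt c w 0 → c 0 = x → HasDerivAt (fun t => f (c t)) v 0) :
    fderiv ℝ f x w = v := by
  have hc : HasDerivAt (fun t : ℝ => x + t • w) w 0 := by
    simpa using ((hasDerivAt_id (0 : ℝ)).smul_const w).const_add x
  have h1 := h _ hc (by simp)
  have h2 : HasDerivAt (fun t : ℝ => f (x + t • w)) (fderiv ℝ f x w) 0 := by
    have : HasFDerivAt f (fderiv ℝ f x) (x + (0 : ℝ) • w) := by simpa using hf.hasFDerivAt
    exact this.comp_hasDerivAt 0 hc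
  exact h2.unique h1

/-- The canonical symplectic form. -/
def canon (v w : Phase n) : ℝ := v.2 ⬝ᵥ w.1 - v.1 ⬝ᵥ w.2

/-- Twice the Hamiltonian of the Neumann system with the quadratic potential `diag a`. -/
def neumannE (a : Fin n → ℝ) (x : Phase n) : ℝ := x.2 ⬝ᵥ x.2 + x.1 ⬝ᵥ (a * x.1)

/-- The second integral of the Neumann system. -/
def neumannG (a : Fin n → ℝ) (x : Phase n) : ℝ :=
  x.1 ⬝ᵥ (a * (a * x.1)) + (x.2 ⬝ᵥ x.2) * (x.1 ⬝ᵥ (a * x.1)) + x.2 ⬝ᵥ (a * x.2)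

/-- The momentum of the linear flow of `Ω`. -/
def momentum (Ω : Matrix (Fin n) (Fin n) ℝ) (x : Phase n) : ℝ := x.2 ⬝ᵥ (Ω *ᵥ x.1)

/-- The field of the Neumann system, extended from `T*Sⁿ⁻¹` so that it preserves `φ₁`, `φ₂`. -/
def fieldE (a : Fin n → ℝ) (x : Phase n) : Phase n :=
  ((x.1 ⬝ᵥ x.1) • x.2 - (x.1 ⬝ᵥ x.2) • x.1,
    (x.1 ⬝ᵥ x.2) • x.2 - (x.2 ⬝ᵥ x.2) • x.1 - (x.1 ⬝ᵥ x.1) • (a * x.1)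
      + (x.1 ⬝ᵥ (a * x.1)) • x.1)

/-- The field of `neumannG / 2`, extended from `T*Sⁿ⁻¹` so that it preserves `φ₁`, `φ₂`. -/
def fieldG (a : Fin n → ℝ) (x : Phase n) : Phase n :=
  ((x.1 ⬝ᵥ (a * x.1)) • x.2 - (x.1 ⬝ᵥ (a * x.2)) • x.1 + (x.1 ⬝ᵥ x.1) • (a * x.2)
      - (x.1 ⬝ᵥ x.2) • (a * x.1),
    (x.1 ⬝ᵥ (a * x.2)) • x.2 - (x.2 ⬝ᵥ x.2) • (a * x.1) - (x.1 ⬝ᵥ x.1) • (a * (a * x.1))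
      + (x.1 ⬝ᵥ (a * (a * x.1))) • x.1 - (x.2 ⬝ᵥ (a * x.2)) • x.1 + (x.1 ⬝ᵥ x.2) • (a * x.2))

/-- The linear field of `Ω`. -/
def fieldRot (Ω : Matrix (Fin n) (Fin n) ℝ) (x : Phase n) : Phase n := (Ω *ᵥ x.1, Ω *ᵥ x.2)

/-- `Ω` is an infinitesimal rotation that commutes with `diag a`. -/
structure IsSymmetry (a : Fin n → ℝ) (Ω : Matrix (Fin n) (Fin n) ℝ) : Prop where
  skew : Ωᵀ = -Ω
  comm : ∀ x, Ω *ᵥ (a * x) = a * (Ω *ᵥ x)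

variable {a : Fin n → ℝ} {Ω Ω' : Matrix (Fin n) (Fin n) ℝ}

@[fun_prop]
theorem contDiff_neumannE {k : WithTop ℕ∞} : ContDiff ℝ k (neumannE a) := by
  unfold neumannE; fun_prop

@[fun_prop]
theorem contDiff_neumannG {k : WithTop ℕ∞} : ContDiff ℝ k (neumannG a) := by
  unfold neumannG; fun_prop

@[fun_prop]
theorem contDiff_momentum {k : WithTop ℕ∞} : ContDiff ℝ k (momentum Ω) := by
  unfold momentum; fun_prop

@[fun_prop]
theorem contDiff_fieldE {k : WithTop ℕ∞} : ContDiff ℝ k (fieldE a) := by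
  unfold fieldE; fun_prop

@[fun_prop]
theorem contDiff_fieldG {k : WithTop ℕ∞} : ContDiff ℝ k (fieldG a) := by
  unfold fieldG; fun_prop

@[fun_prop]
theorem contDiff_fieldRot {k : WithTop ℕ∞} : ContDiff ℝ k (fieldRot Ω) := by
  unfold fieldRot; fun_prop

@[fun_prop]
theorem contDiff_phi₁ {k : WithTop ℕ∞} : ContDiff ℝ k (phi₁ : Phase n → ℝ) := by
  unfold phi₁; fun_prop

@[fun_prop]
theorem contDiff_phi₂ {k : WithTop ℕ∞} : ContDiff ℝ k (phi₂ : Phase n → ℝ) := by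
  unfold phi₂; fun_prop

theorem hasDerivAt_fst {c : ℝ → Phase n} {w : Phase n} {t : ℝ} (hc : HasDerivAt c w t) :
    HasDerivAt (fun t => (c t).1) w.1 t :=
  (ContinuousLinearMap.fst ℝ (Fin n → ℝ) (Fin n → ℝ)).hasFDerivAt.comp_hasDerivAt t hc

theorem hasDerivAt_snd {c : ℝ → Phase n} {w : Phase n} {t : ℝ} (hc : HasDerivAt c w t) :
    HasDerivAt (fun t => (c t).2) w.2 t :=
  (ContinuousLinearMap.snd ℝ (Fin n → ℝ) (Fin n → ℝ)).hasFDerivAt.comp_hasDerivAt t hc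

/-! Moving diagonal factors to the right. -/

theorem mul_dot (a x y : Fin n → ℝ) : (a * x) ⬝ᵥ y = x ⬝ᵥ (a * y) := by
  simp only [dotProduct, Pi.mul_apply]
  exact Finset.sum_congr rfl fun i _ => by ring

theorem dot_mul_comm (a x y : Fin n → ℝ) : x ⬝ᵥ (a * y) = y ⬝ᵥ (a * x) := by
  rw [dotProduct_comm, mul_dot]

theorem fderiv_neumannE (x w : Phase n) :
    fderiv ℝ (neumannE a) x w = 2 * (x.2 ⬝ᵥ w.2) + 2 * (w.1 ⬝ᵥ (a * x.1)) := by
  refine fderiv_eq_of_curve (contDiff_neumannE.differentiable (n := 1) (by simp) x) ?_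
  rintro c hc rfl
  have h1 := hasDerivAt_fst hc
  have h2 := hasDerivAt_snd hc
  refine ((hasDerivAt_dotProduct h2 h2).add
    (hasDerivAt_dotProduct h1 (h1.const_mul a))).congr_deriv ?_
  rw [dot_mul_comm a (c 0).1, dotProduct_comm w.2]
  ring

theorem fderiv_neumannG (x w : Phase n) :
    fderiv ℝ (neumannG a) x w = 2 * (w.1 ⬝ᵥ (a * (a * x.1)))
      + 2 * (x.2 ⬝ᵥ w.2) * (x.1 ⬝ᵥ (a * x.1)) + 2 * (x.2 ⬝ᵥ x.2) * (w.1 ⬝ᵥ (a * x.1))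
      + 2 * (w.2 ⬝ᵥ (a * x.2)) := by
  refine fderiv_eq_of_curve (contDiff_neumannG.differentiable (n := 1) (by simp) x) ?_
  rintro c hc rfl
  have h1 := hasDerivAt_fst hc
  have h2 := hasDerivAt_snd hc
  refine (((hasDerivAt_dotProduct h1 ((h1.const_mul a).const_mul a)).add
    ((hasDerivAt_dotProduct h2 h2).mul (hasDerivAt_dotProduct h1 (h1.const_mul a)))).add
    (hasDerivAt_dotProduct h2 (h2.const_mul a))).congr_deriv ?_
  rw [dot_mul_comm a (c 0).1, dotProduct_comm w.2, dot_mul_comm a (c 0).2, dot_mul_comm a (c 0).1,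
    mul_dot, dot_mul_comm a (c 0).1 w.1]
  ring

theorem fderiv_momentum (x w : Phase n) :
    fderiv ℝ (momentum Ω) x w = w.2 ⬝ᵥ (Ω *ᵥ x.1) + x.2 ⬝ᵥ (Ω *ᵥ w.1) := by
  refine fderiv_eq_of_curve (contDiff_momentum.differentiable (n := 1) (by simp) x) ?_
  rintro c hc rfl
  exact hasDerivAt_dotProduct (hasDerivAt_snd hc) (hasDerivAt_mulVec (hasDerivAt_fst hc))

theorem fderiv_fieldRot (x w : Phase n) : fderiv ℝ (fieldRot Ω) x w = fieldRot Ω w := by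
  refine fderiv_eq_of_curve (contDiff_fieldRot.differentiable (n := 1) (by simp) x) ?_
  rintro c hc rfl
  exact (hasDerivAt_mulVec (hasDerivAt_fst hc)).prodMk (hasDerivAt_mulVec (hasDerivAt_snd hc))

theorem fderiv_fieldE (x w : Phase n) :
    fderiv ℝ (fieldE a) x w =
      ((2 * (x.1 ⬝ᵥ w.1)) • x.2 + (x.1 ⬝ᵥ x.1) • w.2
          - ((x.1 ⬝ᵥ w.2 + w.1 ⬝ᵥ x.2) • x.1 + (x.1 ⬝ᵥ x.2) • w.1),
        (x.1 ⬝ᵥ w.2 + w.1 ⬝ᵥ x.2) • x.2 + (x.1 ⬝ᵥ x.2) • w.2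
          - ((2 * (x.2 ⬝ᵥ w.2)) • x.1 + (x.2 ⬝ᵥ x.2) • w.1)
          - ((2 * (x.1 ⬝ᵥ w.1)) • (a * x.1) + (x.1 ⬝ᵥ x.1) • (a * w.1))
          + ((2 * (w.1 ⬝ᵥ (a * x.1))) • x.1 + (x.1 ⬝ᵥ (a * x.1)) • w.1)) := by
  refine fderiv_eq_of_curve (contDiff_fieldE.differentiable (n := 1) (by simp) x) ?_
  rintro c hc rfl
  have h1 := hasDerivAt_fst hc
  have h2 := hasDerivAt_snd hc
  have h11 := hasDerivAt_dotProduct h1 h1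
  have h12 := hasDerivAt_dotProduct h1 h2
  have h22 := hasDerivAt_dotProduct h2 h2
  have h1a := hasDerivAt_dotProduct h1 (h1.const_mul a)
  refine (((h11.smul h2).sub (h12.smul h1)).prodMk
    ((((h12.smul h2).sub (h22.smul h1)).sub (h11.smul (h1.const_mul a))).add
      (h1a.smul h1))).congr_deriv ?_
  rw [dot_mul_comm a (c 0).1 w.1, dotProduct_comm w.1 (c 0).1, dotProduct_comm w.2 (c 0).2]
  ext i <;> simp <;> ring

theorem fderiv_fieldG (x w : Phase n) :
    fderiv ℝ (fieldG a) x w =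
      ((2 * (w.1 ⬝ᵥ (a * x.1))) • x.2 + (x.1 ⬝ᵥ (a * x.1)) • w.2
          - ((w.1 ⬝ᵥ (a * x.2) + w.2 ⬝ᵥ (a * x.1)) • x.1 + (x.1 ⬝ᵥ (a * x.2)) • w.1)
          + ((2 * (x.1 ⬝ᵥ w.1)) • (a * x.2) + (x.1 ⬝ᵥ x.1) • (a * w.2))
          - ((x.1 ⬝ᵥ w.2 + w.1 ⬝ᵥ x.2) • (a * x.1) + (x.1 ⬝ᵥ x.2) • (a * w.1)),
        (w.1 ⬝ᵥ (a * x.2) + w.2 ⬝ᵥ (a * x.1)) • x.2 + (x.1 ⬝ᵥ (a * x.2)) • w.2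
          - ((2 * (x.2 ⬝ᵥ w.2)) • (a * x.1) + (x.2 ⬝ᵥ x.2) • (a * w.1))
          - ((2 * (x.1 ⬝ᵥ w.1)) • (a * (a * x.1)) + (x.1 ⬝ᵥ x.1) • (a * (a * w.1)))
          + ((2 * (w.1 ⬝ᵥ (a * (a * x.1)))) • x.1 + (x.1 ⬝ᵥ (a * (a * x.1))) • w.1)
          - ((2 * (w.2 ⬝ᵥ (a * x.2))) • x.1 + (x.2 ⬝ᵥ (a * x.2)) • w.1)
          + ((x.1 ⬝ᵥ w.2 + w.1 ⬝ᵥ x.2) • (a * x.2) + (x.1 ⬝ᵥ x.2) • (a * w.2))) := by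
  refine fderiv_eq_of_curve (contDiff_fieldG.differentiable (n := 1) (by simp) x) ?_
  rintro c hc rfl
  have h1 := hasDerivAt_fst hc
  have h2 := hasDerivAt_snd hc
  have a1 := h1.const_mul a
  have a2 := h2.const_mul a
  have h11 := hasDerivAt_dotProduct h1 h1
  have h12 := hasDerivAt_dotProduct h1 h2
  have h22 := hasDerivAt_dotProduct h2 h2
  have h1a1 := hasDerivAt_dotProduct h1 a1
  have h1a2 := hasDerivAt_dotProduct h1 a2
  have h2a2 := hasDerivAt_dotProduct h2 a2
  have h1aa1 := hasDerivAt_dotProduct h1 (a1.const_mul a)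
  refine (((((h1a1.smul h2).sub (h1a2.smul h1)).add (h11.smul a2)).sub (h12.smul a1)).prodMk
    ((((((h1a2.smul h2).sub (h22.smul a1)).sub (h11.smul (a1.const_mul a))).add
      (h1aa1.smul h1)).sub (h2a2.smul h1)).add (h12.smul a2))).congr_deriv ?_
  rw [dot_mul_comm a (c 0).1 w.1, dotProduct_comm w.1 (c 0).1, dotProduct_comm w.2 (c 0).2,
    dot_mul_comm a (c 0).1 w.2, dot_mul_comm a (c 0).2 w.2, dot_mul_comm a (c 0).1 (a * w.1),
    mul_dot]
  ext i <;> simp <;> ring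

end MagneticSphere

namespace MagneticSphere

variable {n : ℕ} {a : Fin n → ℝ} {Ω Ω' : Matrix (Fin n) (Fin n) ℝ}

theorem IsSymmetry.dot_self (h : IsSymmetry a Ω) (u : Fin n → ℝ) : u ⬝ᵥ (Ω *ᵥ u) = 0 := by
  have := dotProduct_mulVec_skew h.skew u u
  linarith

theorem IsSymmetry.dot_mul_self (h : IsSymmetry a Ω) (u : Fin n → ℝ) :
    u ⬝ᵥ (a * (Ω *ᵥ u)) = 0 := by
  have h1 := dotProduct_mulVec_skew h.skew u (a * u)
  rw [h.comm, mul_dot] at h1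
  linarith

theorem IsSymmetry.dot_mul_mul_self (h : IsSymmetry a Ω) (u : Fin n → ℝ) :
    u ⬝ᵥ (a * (a * (Ω *ᵥ u))) = 0 := by
  rw [← mul_dot, ← h.comm]
  exact h.dot_self _

theorem dot_mul_mul_comm (a x y : Fin n → ℝ) : x ⬝ᵥ (a * (a * y)) = y ⬝ᵥ (a * (a * x)) := by
  rw [dot_mul_comm, mul_dot]

theorem IsSymmetry.self_dot_mul (h : IsSymmetry a Ω) (u : Fin n → ℝ) :
    (Ω *ᵥ u) ⬝ᵥ (a * u) = 0 := by
  rw [dot_mul_comm, h.dot_mul_self]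

theorem IsSymmetry.self_dot_mul_mul (h : IsSymmetry a Ω) (u : Fin n → ℝ) :
    (Ω *ᵥ u) ⬝ᵥ (a * (a * u)) = 0 := by
  rw [dot_mul_mul_comm, h.dot_mul_mul_self]

theorem smul_dot (r : ℝ) (u v : Fin n → ℝ) : (r • u) ⬝ᵥ v = r * (u ⬝ᵥ v) := smul_dotProduct r u v

theorem dot_smul (r : ℝ) (u v : Fin n → ℝ) : u ⬝ᵥ (r • v) = r * (u ⬝ᵥ v) := dotProduct_smul r u v

section Algebra

variable {x v : Phase n}

theorem fieldE_phi₁ (x : Phase n) : fderiv ℝ phi₁ x (fieldE a x) = 0 := by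
  rw [fderiv_phi₁, fieldE]
  simp only [dotProduct_sub, dot_smul]
  ring

theorem fieldE_phi₂ (x : Phase n) : fderiv ℝ phi₂ x (fieldE a x) = 0 := by
  rw [fderiv_phi₂, fieldE]
  simp only [dotProduct_sub, dotProduct_add, dot_smul, dotProduct_comm x.2 x.1]
  ring

theorem fieldG_phi₁ (x : Phase n) : fderiv ℝ phi₁ x (fieldG a x) = 0 := by
  rw [fderiv_phi₁, fieldG]
  simp only [dotProduct_sub, dotProduct_add, dot_smul]
  ring

theorem fieldG_phi₂ (x : Phase n) : fderiv ℝ phi₂ x (fieldG a x) = 0 := by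
  rw [fderiv_phi₂, fieldG]
  simp only [dotProduct_sub, dotProduct_add, dot_smul, dotProduct_comm x.2 x.1,
    dot_mul_comm a x.2 x.1]
  ring

theorem fieldRot_phi₁ (h : Ωᵀ = -Ω) (x : Phase n) : fderiv ℝ phi₁ x (fieldRot Ω x) = 0 := by
  rw [fderiv_phi₁, fieldRot]
  have := dotProduct_mulVec_skew h x.1 x.1
  simp only
  linarith

theorem fieldRot_phi₂ (h : Ωᵀ = -Ω) (x : Phase n) : fderiv ℝ phi₂ x (fieldRot Ω x) = 0 := by
  rw [fderiv_phi₂, fieldRot, dotProduct_mulVec_skew h x.1 x.2]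
  simp

theorem fieldE_mem (x : Phase n) : fieldE a x ∈ tangentAt x :=
  mem_tangentAt_iff_fderiv.2 ⟨fieldE_phi₁ x, fieldE_phi₂ x⟩

theorem fieldG_mem (x : Phase n) : fieldG a x ∈ tangentAt x :=
  mem_tangentAt_iff_fderiv.2 ⟨fieldG_phi₁ x, fieldG_phi₂ x⟩

theorem fieldRot_mem (h : Ωᵀ = -Ω) (x : Phase n) : fieldRot Ω x ∈ tangentAt x :=
  mem_tangentAt_iff_fderiv.2 ⟨fieldRot_phi₁ h x, fieldRot_phi₂ h x⟩

theorem mem_cotangentSphere : x ∈ cotangentSphere n ↔ x.1 ⬝ᵥ x.1 = 1 ∧ x.1 ⬝ᵥ x.2 = 0 := by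
  rw [dotProduct_comm x.1 x.2]
  rfl

theorem canon_fieldE (hx : x ∈ cotangentSphere n) (hv : v ∈ tangentAt x) :
    2 * canon (fieldE a x) v = -fderiv ℝ (neumannE a) x v := by
  obtain ⟨h1, h2⟩ := mem_cotangentSphere.1 hx
  obtain ⟨h3, h4⟩ := mem_tangentAt.1 hv
  rw [fderiv_neumannE, canon, fieldE]
  simp only [sub_dotProduct, add_dotProduct, smul_dot, mul_dot, h1, h2, dot_mul_comm a x.1 v.1]
  linear_combination (2 * (x.1 ⬝ᵥ (a * x.1)) - 2 * (x.2 ⬝ᵥ x.2)) * h3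

theorem canon_fieldG (hx : x ∈ cotangentSphere n) (hv : v ∈ tangentAt x) :
    2 * canon (fieldG a x) v = -fderiv ℝ (neumannG a) x v := by
  obtain ⟨h1, h2⟩ := mem_cotangentSphere.1 hx
  obtain ⟨h3, h4⟩ := mem_tangentAt.1 hv
  rw [fderiv_neumannG, canon, fieldG]
  simp only [sub_dotProduct, add_dotProduct, smul_dot, mul_dot, h1, h2, dot_mul_comm a x.1 v.1,
    dot_mul_comm a x.2 v.1, dot_mul_comm a x.1 v.2, dot_mul_comm a x.2 v.2,
    dot_mul_comm a x.1 (a * v.1)]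
  linear_combination (2 * (x.1 ⬝ᵥ (a * (a * x.1))) - 2 * (x.2 ⬝ᵥ (a * x.2))) * h3
    + 2 * (x.1 ⬝ᵥ (a * x.2)) * h4

theorem canon_fieldRot (h : Ωᵀ = -Ω) (x v : Phase n) :
    canon (fieldRot Ω x) v = -fderiv ℝ (momentum Ω) x v := by
  rw [fderiv_momentum, canon, fieldRot, dotProduct_comm (Ω *ᵥ x.1), dotProduct_comm (Ω *ᵥ x.2),
    dotProduct_mulVec_skew h v.1]
  ring

theorem canon_self (v : Phase n) : canon v v = 0 := by
  rw [canon, dotProduct_comm, sub_self]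

theorem canon_swap (v w : Phase n) : canon v w = -canon w v := by
  rw [canon, canon, dotProduct_comm v.2, dotProduct_comm v.1]
  ring

theorem fderiv_neumannE_fieldRot (h : IsSymmetry a Ω) (x : Phase n) :
    fderiv ℝ (neumannE a) x (fieldRot Ω x) = 0 := by
  rw [fderiv_neumannE, fieldRot, h.dot_self, dot_mul_comm, h.dot_mul_self]
  simp

theorem fderiv_neumannG_fieldRot (h : IsSymmetry a Ω) (x : Phase n) :
    fderiv ℝ (neumannG a) x (fieldRot Ω x) = 0 := by
  rw [fderiv_neumannG]
  simp [fieldRot, h.dot_self, h.self_dot_mul, h.self_dot_mul_mul]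

theorem fderiv_momentum_fieldRot (h : Ωᵀ = -Ω) (x : Phase n) :
    fderiv ℝ (momentum Ω') x (fieldRot Ω x) = momentum (Ω' * Ω - Ω * Ω') x := by
  rw [fderiv_momentum, fieldRot, momentum, Matrix.sub_mulVec, dotProduct_sub,
    ← Matrix.mulVec_mulVec, ← Matrix.mulVec_mulVec, dotProduct_mulVec_skew h x.2]
  simp only
  rw [dotProduct_comm (Ω *ᵥ x.2)]
  ring

theorem canon_fieldE_fieldG (hx : x ∈ cotangentSphere n) :
    canon (fieldE a x) (fieldG a x) = 0 := by
  obtain ⟨h1, h2⟩ := mem_cotangentSphere.1 hx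
  rw [canon, fieldE, fieldG]
  simp only [sub_dotProduct, add_dotProduct, dotProduct_sub, dotProduct_add, smul_dot, dot_smul,
    mul_dot, h1, h2, dotProduct_comm x.2 x.1, dot_mul_comm a x.2 x.1, dot_mul_mul_comm a x.2 x.1]
  ring

theorem fderiv_neumannE_fieldE (hx : x ∈ cotangentSphere n) :
    fderiv ℝ (neumannE a) x (fieldE a x) = 0 := by
  have := canon_fieldE (a := a) hx (fieldE_mem (a := a) x)
  rw [canon_self] at this
  linarith

theorem fderiv_neumannG_fieldG (hx : x ∈ cotangentSphere n) :
    fderiv ℝ (neumannG a) x (fieldG a x) = 0 := by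
  have := canon_fieldG (a := a) hx (fieldG_mem (a := a) x)
  rw [canon_self] at this
  linarith

theorem fderiv_neumannE_fieldG (hx : x ∈ cotangentSphere n) :
    fderiv ℝ (neumannE a) x (fieldG a x) = 0 := by
  have := canon_fieldE (a := a) hx (fieldG_mem (a := a) x)
  rw [canon_fieldE_fieldG hx] at this
  linarith

theorem fderiv_neumannG_fieldE (hx : x ∈ cotangentSphere n) :
    fderiv ℝ (neumannG a) x (fieldE a x) = 0 := by
  have := canon_fieldG (a := a) hx (fieldE_mem (a := a) x)
  rw [canon_swap, canon_fieldE_fieldG hx] at this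
  linarith

theorem canon_fieldE_fieldRot (h : IsSymmetry a Ω) (hx : x ∈ cotangentSphere n) :
    canon (fieldE a x) (fieldRot Ω x) = 0 := by
  have := canon_fieldE (a := a) hx (fieldRot_mem h.skew x)
  rw [fderiv_neumannE_fieldRot h] at this
  linarith

theorem canon_fieldG_fieldRot (h : IsSymmetry a Ω) (hx : x ∈ cotangentSphere n) :
    canon (fieldG a x) (fieldRot Ω x) = 0 := by
  have := canon_fieldG (a := a) hx (fieldRot_mem h.skew x)
  rw [fderiv_neumannG_fieldRot h] at this
  linarith

theorem fderiv_momentum_fieldE (h : IsSymmetry a Ω) (hx : x ∈ cotangentSphere n) :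
    fderiv ℝ (momentum Ω) x (fieldE a x) = 0 := by
  have := canon_fieldRot h.skew x (fieldE a x)
  rw [canon_swap, canon_fieldE_fieldRot h hx] at this
  linarith

theorem fderiv_momentum_fieldG (h : IsSymmetry a Ω) (hx : x ∈ cotangentSphere n) :
    fderiv ℝ (momentum Ω) x (fieldG a x) = 0 := by
  have := canon_fieldRot h.skew x (fieldG a x)
  rw [canon_swap, canon_fieldG_fieldRot h hx] at this
  linarith

/-! Commutation of the fields along `T*Sⁿ⁻¹`. -/

theorem fieldE_comm_fieldG (hx : x ∈ cotangentSphere n) :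
    fderiv ℝ (fieldE a) x (fieldG a x) = fderiv ℝ (fieldG a) x (fieldE a x) := by
  obtain ⟨h1, h2⟩ := mem_cotangentSphere.1 hx
  rw [fderiv_fieldE, fderiv_fieldG]
  simp only [fieldE, fieldG, sub_dotProduct, add_dotProduct, dotProduct_sub, dotProduct_add,
    smul_dot, dot_smul, mul_dot, h1, h2, dotProduct_comm x.2 x.1, dot_mul_comm a x.2 x.1,
    dot_mul_mul_comm a x.2 x.1]
  ext i
  · simp
    ring
  · simp
    ring

theorem fieldE_comm_fieldRot (h : IsSymmetry a Ω) (x : Phase n) :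
    fderiv ℝ (fieldE a) x (fieldRot Ω x) = fieldRot Ω (fieldE a x) := by
  have e1 := h.dot_self x.1
  have e2 := h.dot_self x.2
  have e3 := h.self_dot_mul x.1
  have e4 : (Ω *ᵥ x.1) ⬝ᵥ x.2 = -(x.1 ⬝ᵥ (Ω *ᵥ x.2)) := by
    rw [dotProduct_comm, dotProduct_mulVec_skew h.skew]
  rw [fderiv_fieldE]
  simp only [fieldE, fieldRot, e1, e2, e3, e4, Matrix.mulVec_sub, Matrix.mulVec_add,
    Matrix.mulVec_smul, h.comm]
  ext i
  · simp
  · simp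

theorem fieldG_comm_fieldRot (h : IsSymmetry a Ω) (x : Phase n) :
    fderiv ℝ (fieldG a) x (fieldRot Ω x) = fieldRot Ω (fieldG a x) := by
  have e1 := h.dot_self x.1
  have e2 := h.dot_self x.2
  have e3 := h.self_dot_mul x.1
  have e4 : (Ω *ᵥ x.1) ⬝ᵥ x.2 = -(x.1 ⬝ᵥ (Ω *ᵥ x.2)) := by
    rw [dotProduct_comm, dotProduct_mulVec_skew h.skew]
  have e5 := h.self_dot_mul x.2
  have e6 := h.self_dot_mul_mul x.1
  have e7 : (Ω *ᵥ x.2) ⬝ᵥ (a * x.1) = -((Ω *ᵥ x.1) ⬝ᵥ (a * x.2)) := by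
    rw [dotProduct_comm, dotProduct_comm _ (a * x.2), dotProduct_mulVec_skew h.skew, h.comm,
      mul_dot]
  rw [fderiv_fieldG]
  simp only [fieldG, fieldRot, e1, e2, e3, e4, e5, e6, e7, Matrix.mulVec_sub, Matrix.mulVec_add,
    Matrix.mulVec_smul, h.comm]
  ext i
  · simp
  · simp

end Algebra

end MagneticSphere

namespace MagneticSphere

variable {n : ℕ} {a : Fin n → ℝ} {m s : ℝ} {κ Ω : Matrix (Fin n) (Fin n) ℝ}

/-- The passage from the canonical momenta `P` to the magnetic ones, `p = P + (s/2) κγ`. -/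
noncomputable def shift (s : ℝ) (κ : Matrix (Fin n) (Fin n) ℝ) : Phase n ≃L[ℝ] Phase n :=
  LinearEquiv.toContinuousLinearEquiv
    { toFun := fun x => (x.1, x.2 + (s / 2) • (κ *ᵥ x.1))
      invFun := fun x => (x.1, x.2 - (s / 2) • (κ *ᵥ x.1))
      map_add' := fun x y => by
        ext i
        · simp
        · simp [Matrix.mulVec_add]; ring
      map_smul' := fun r x => by
        ext i
        · simp
        · simp [Matrix.mulVec_smul]; ring
      left_inv := fun x => by simp
      right_inv := fun x => by simp }

theorem shift_apply (x : Phase n) : shift s κ x = (x.1, x.2 + (s / 2) • (κ *ᵥ x.1)) := rfl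

theorem shift_mem_cotangentSphere (hκ : κᵀ = -κ) (x : Phase n) :
    shift s κ x ∈ cotangentSphere n ↔ x ∈ cotangentSphere n := by
  have h := dotProduct_mulVec_skew hκ x.1 x.1
  have h0 : x.1 ⬝ᵥ (κ *ᵥ x.1) = 0 := by linarith
  rw [mem_cotangentSphere, mem_cotangentSphere, shift_apply]
  simp only [dotProduct_add, dot_smul, h0, mul_zero, add_zero]

theorem shift_mem_tangentAt (hκ : κᵀ = -κ) (x v : Phase n) :
    shift s κ v ∈ tangentAt (shift s κ x) ↔ v ∈ tangentAt x := by
  have h := dotProduct_mulVec_skew hκ x.1 v.1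
  rw [mem_tangentAt, mem_tangentAt, shift_apply, shift_apply]
  simp only [dotProduct_add, dot_smul, add_dotProduct, smul_dot, h, dotProduct_comm (κ *ᵥ x.1)]
  ring_nf

theorem twistedForm_shift (hκ : κᵀ = -κ) (v w : Phase n) :
    twistedForm s κ (shift s κ v) (shift s κ w) = canon v w := by
  have h := dotProduct_mulVec_skew hκ v.1 w.1
  rw [twistedForm, canon, shift_apply, shift_apply]
  simp only [dotProduct_add, dot_smul, add_dotProduct, smul_dot, h, dotProduct_comm (κ *ᵥ v.1)]
  ring

/-- `diag a = -(s²/4) κ²`. -/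
def IsHalfSquare (a : Fin n → ℝ) (s : ℝ) (κ : Matrix (Fin n) (Fin n) ℝ) : Prop :=
  ∀ u, (s ^ 2 / 4) • (κ *ᵥ (κ *ᵥ u)) = -(a * u)

theorem IsHalfSquare.comm (ha : IsHalfSquare a s κ) (u : Fin n → ℝ) :
    κ *ᵥ (a * u) = a * (κ *ᵥ u) := by
  have h1 := ha (κ *ᵥ u)
  have h2 := congrArg (fun v => κ *ᵥ v) (ha u)
  simp only [Matrix.mulVec_smul, Matrix.mulVec_neg] at h2
  rw [h1, neg_inj] at h2
  exact h2.symm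

theorem IsHalfSquare.isSymmetry (ha : IsHalfSquare a s κ) (hκ : κᵀ = -κ) : IsSymmetry a κ :=
  ⟨hκ, ha.comm⟩

theorem IsHalfSquare.isSymmetry_cube (ha : IsHalfSquare a s κ) (hκ : κᵀ = -κ) :
    IsSymmetry a (κ * κ * κ) := by
  refine ⟨by simp [Matrix.transpose_mul, hκ, mul_assoc], fun u => ?_⟩
  simp only [← Matrix.mulVec_mulVec, ha.comm]

theorem IsHalfSquare.mulVec_dot (ha : IsHalfSquare a s κ) (hκ : κᵀ = -κ) (u v : Fin n → ℝ) :
    s ^ 2 * ((κ *ᵥ u) ⬝ᵥ (κ *ᵥ v)) = 4 * (u ⬝ᵥ (a * v)) := by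
  have h1 := congrArg (fun w => u ⬝ᵥ w) (ha v)
  simp only [dot_smul, dotProduct_neg] at h1
  have h2 := dotProduct_mulVec_skew hκ (κ *ᵥ v) u
  have h3 := dotProduct_comm (κ *ᵥ u) (κ *ᵥ v)
  rw [h3, h2]
  linarith

theorem energy_shift (ha : IsHalfSquare a s κ) (hκ : κᵀ = -κ) (x : Phase n) :
    energy m (shift s κ x) = (neumannE a x + s * momentum κ x) / (2 * m) := by
  have h := ha.mulVec_dot hκ x.1 x.1
  rw [energy, shift_apply, neumannE, momentum]
  simp only [dotProduct_add, dot_smul, add_dotProduct, smul_dot, dotProduct_comm (κ *ᵥ x.1) x.2]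
  congr 1
  linear_combination h / 4

theorem multiplier_shift (ha : IsHalfSquare a s κ) (hκ : κᵀ = -κ) (x : Phase n) :
    multiplier m s κ (shift s κ x) = (x.1 ⬝ᵥ (a * x.1) - x.2 ⬝ᵥ x.2) / m := by
  have h := ha.mulVec_dot hκ x.1 x.1
  rw [multiplier, shift_apply]
  simp only [dotProduct_add, dot_smul, add_dotProduct, smul_dot, dotProduct_comm (κ *ᵥ x.1) x.2]
  congr 1
  linear_combination h / 4

theorem integralJ_shift (ha : IsHalfSquare a s κ) (hκ : κᵀ = -κ) (x : Phase n) :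
    integralJ m s κ (shift s κ x) =
      (4 * neumannG a x - neumannE a x ^ 2 - s ^ 3 * momentum (κ * κ * κ) x) / m ^ 2 := by
  have h1 := ha.mulVec_dot hκ x.2 x.2
  have h2 := ha.mulVec_dot hκ (κ *ᵥ x.1) (κ *ᵥ x.1)
  have h3 := ha.mulVec_dot hκ x.1 (a * x.1)
  have h5 : (κ *ᵥ x.2) ⬝ᵥ (κ *ᵥ (κ *ᵥ x.1)) = -(x.2 ⬝ᵥ ((κ * κ * κ) *ᵥ x.1)) := by
    rw [dotProduct_comm, dotProduct_mulVec_skew hκ, ← Matrix.mulVec_mulVec, ← Matrix.mulVec_mulVec]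
  have h4 : (κ *ᵥ x.1) ⬝ᵥ (a * (κ *ᵥ x.1)) = (κ *ᵥ x.1) ⬝ᵥ (κ *ᵥ (a * x.1)) := by
    rw [ha.comm]
  rw [integralJ, multiplier_shift ha hκ, shift_apply, neumannE, neumannG, momentum]
  simp only [Matrix.mulVec_add, Matrix.mulVec_smul, dotProduct_add, dot_smul, add_dotProduct,
    smul_dot, dotProduct_comm (κ *ᵥ (κ *ᵥ x.1)) (κ *ᵥ x.2), h5]
  rw [h4] at h2
  rw [div_pow, div_mul_eq_mul_div, ← sub_div]
  congr 1
  linear_combination h1 + s ^ 2 / 4 * h2 + h3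

theorem magneticField_shift (ha : IsHalfSquare a s κ) (hκ : κᵀ = -κ) {x : Phase n}
    (hx : x ∈ cotangentSphere n) :
    magneticField m s κ (shift s κ x)
      = shift s κ (m⁻¹ • (fieldE a x + (s / 2) • fieldRot κ x)) := by
  obtain ⟨h1, h2⟩ := mem_cotangentSphere.1 hx
  have h := ha x.1
  rw [magneticField, multiplier_shift ha hκ, shift_apply, shift_apply, fieldE, fieldRot]
  ext i
  · simp [h1, h2]; ring
  · have hi := congrFun h i
    simp only [Pi.smul_apply, smul_eq_mul, Pi.neg_apply, Pi.mul_apply] at hi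
    simp only [h1, h2, Matrix.mulVec_add, Matrix.mulVec_smul, Pi.add_apply,
      Pi.smul_apply, Pi.sub_apply, Pi.mul_apply, smul_eq_mul, Prod.smul_fst, Prod.smul_snd,
      Prod.fst_add, Prod.snd_add, zero_smul, one_smul, sub_zero, zero_sub, Pi.neg_apply]
    linear_combination m⁻¹ * hi

theorem fderiv_comp_shift {f : Phase n → ℝ} (x v : Phase n) :
    fderiv ℝ (fun y => f (shift s κ y)) x v = fderiv ℝ f (shift s κ x) (shift s κ v) := by
  have : (fun y => f (shift s κ y)) = f ∘ shift s κ := rfl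
  rw [this, (shift s κ).comp_right_fderiv]
  rfl

section Frame

variable {ι : Type}

theorem isCompact_level {f : ι → Phase n → ℝ} (hf : ∀ i, ContDiff ℝ ∞ (f i)) (hm : 0 < m)
    {i₀ : ι} (hi₀ : f i₀ = energy m) (x : Phase n) :
    IsCompact {y | y ∈ cotangentSphere n ∧ ∀ i, f i y = f i x} := by
  refine Metric.isCompact_of_isClosed_isBounded ?_ ?_
  · have h1 : IsClosed (cotangentSphere n) :=
      (isClosed_eq (contDiff_phi₁ (k := 0)).continuous continuous_const).inter
        (isClosed_eq (contDiff_phi₂ (k := 0)).continuous continuous_const)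
    have h2 : IsClosed {y | ∀ i, f i y = f i x} := by
      simp only [Set.ofPred_forall]
      exact isClosed_iInter fun i => isClosed_eq (hf i).continuous continuous_const
    exact h1.inter h2
  · rw [Metric.isBounded_iff_subset_closedBall 0]
    have hsq : ∀ (u : Fin n → ℝ) (i : Fin n), u i ^ 2 ≤ u ⬝ᵥ u := fun u i => by
      rw [dotProduct, sq]
      exact Finset.single_le_sum (f := fun i => u i * u i) (fun i _ => mul_self_nonneg _)
        (Finset.mem_univ i)
    have hn : ∀ (u : Fin n → ℝ) (r : ℝ), u ⬝ᵥ u ≤ r → ‖u‖ ≤ r + 1 := by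
      intro u r hr
      have h0 : 0 ≤ u ⬝ᵥ u := by
        rw [dotProduct]; exact Finset.sum_nonneg fun i _ => mul_self_nonneg _
      refine (pi_norm_le_iff_of_nonneg (by linarith)).2 fun i => ?_
      rw [Real.norm_eq_abs]
      have h1 := hsq u i
      rw [← sq_abs] at h1
      nlinarith [sq_nonneg (|u i| - 1), abs_nonneg (u i)]
    refine ⟨max 1 (x.2 ⬝ᵥ x.2) + 1, fun y hy => ?_⟩
    have h1 : y.1 ⬝ᵥ y.1 = 1 := hy.1.1
    have h2 := hy.2 i₀
    rw [hi₀, energy, energy, div_left_inj' (by positivity)] at h2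
    rw [mem_closedBall_zero_iff, Prod.norm_def, max_le_iff]
    exact ⟨hn _ _ (h1 ▸ le_max_left _ _), hn _ _ (h2 ▸ le_max_right _ _)⟩

theorem isConst_of_hasDerivAt {f : Phase n → ℝ} (hf : Differentiable ℝ f) {c : ℝ → Phase n}
    {c' : ℝ → Phase n} (hc : ∀ t, HasDerivAt c (c' t) t) (h : ∀ t, fderiv ℝ f (c t) (c' t) = 0)
    (t : ℝ) : f (c t) = f (c 0) := by
  have hd : ∀ t, HasDerivAt (fun t => f (c t)) 0 t := fun t => by
    rw [← h t]
    exact (hf (c t)).hasFDerivAt.comp_hasDerivAt t (hc t)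
  exact is_const_of_deriv_eq_zero (fun t => (hd t).differentiableAt) (fun t => (hd t).deriv) t 0

/-- The level set through `shift s κ x`, in the canonical momenta. -/
def canonicalLevel (s : ℝ) (κ : Matrix (Fin n) (Fin n) ℝ) (f : ι → Phase n → ℝ) (x : Phase n) :
    Set (Phase n) :=
  {y | y ∈ cotangentSphere n ∧ ∀ i, f i (shift s κ y) = f i (shift s κ x)}

/-- A criterion for the generic part of noncommutative integrability at `shift s κ x`: a frame of
commuting fields that spans the common kernel of the differentials along the level set. -/
theorem generic_of_frame [Fintype ι] (hm : 0 < m) (hκ : κᵀ = -κ) (ha : IsHalfSquare a s κ)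
    {f : ι → Phase n → ℝ} (hf : ∀ i, ContDiff ℝ ∞ (f i)) {i₀ : ι} (hi₀ : f i₀ = energy m)
    {x : Phase n} (hx : x ∈ cotangentSphere n) {d : ℕ} (X : Fin d → Phase n → Phase n)
    (hX : ∀ j, ContDiff ℝ ∞ (X j)) (hX₁ : ∀ j y, fderiv ℝ phi₁ y (X j y) = 0)
    (hX₂ : ∀ j y, fderiv ℝ phi₂ y (X j y) = 0)
    (hXf : ∀ i j, ∀ y ∈ cotangentSphere n, fderiv ℝ (f i) (shift s κ y) (shift s κ (X j y)) = 0)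
    (hcomm : ∀ i j, ∀ y ∈ cotangentSphere n,
      fderiv ℝ (X i) y (X j y) = fderiv ℝ (X j) y (X i y))
    (hind : ∀ y ∈ canonicalLevel s κ f x, LinearIndependent ℝ fun j => X j y)
    (hiso : ∀ i j, ∀ y ∈ cotangentSphere n, canon (X i y) (X j y) = 0)
    (hspan : ∀ y ∈ canonicalLevel s κ f x, ∀ v ∈ tangentAt y,
      (∀ i, fderiv ℝ (f i) (shift s κ y) (shift s κ v) = 0) →
        v ∈ Submodule.span ℝ (range fun j => X j y))
    {ν : Fin d → ℝ} (hν : ∀ y ∈ canonicalLevel s κ f x,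
      fieldE a y + (s / 2) • fieldRot κ y = ∑ j, ν j • X j y) :
    ddimAt f (shift s κ x) + dindAt s κ f (shift s κ x) = 2 * (n - 1) ∧
      dindAt s κ f (shift s κ x) = d ∧
      IsIsotropicInvariantTorus m s κ d (levelComponent f (shift s κ x)) := by
  set σ := shift s κ with hσ
  set K := canonicalLevel s κ f x with hK
  have hxK : x ∈ K := ⟨hx, fun i => rfl⟩
  have hKS : K = σ ⁻¹' {z | z ∈ cotangentSphere n ∧ ∀ i, f i z = f i (σ x)} := by
    ext y
    simp only [hK, canonicalLevel, Set.mem_ofPred_eq, mem_preimage, hσ, shift_mem_cotangentSphere hκ]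
  have hKc : IsCompact K := by
    rw [hKS]
    exact σ.toHomeomorph.isCompact_preimage.2 (isCompact_level hf hm hi₀ _)
  obtain ⟨hd1, hd2⟩ := ddimAt_dindAt_of_kernel (Z := fun j => σ (X j x)) hκ f
    ((shift_mem_cotangentSphere hκ x).2 hx)
    (fun j => (shift_mem_tangentAt hκ x _).2
      (mem_tangentAt_iff_fderiv.2 ⟨hX₁ j x, hX₂ j x⟩))
    ((hind x hxK).map' (σ : Phase n →ₗ[ℝ] Phase n) (LinearMap.ker_eq_bot.2 σ.injective))
    (fun i j => by rw [hσ, twistedForm_shift hκ]; exact hiso i j x hx)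
    (fun i j => hXf i j x hx)
    (fun v hv h0 => by
      obtain ⟨w, rfl⟩ := σ.surjective v
      have h1 := hspan x hxK w ((shift_mem_tangentAt hκ x w).1 hv) h0
      have h2 := Submodule.mem_map_of_mem (f := (σ : Phase n →ₗ[ℝ] Phase n)) h1
      rw [Submodule.map_span, ← range_comp] at h2
      exact h2)
  refine ⟨hd1, hd2, ?_⟩
  set 𝕏 : Phase n → (Fin d → ℝ) →L[ℝ] Phase n := fun y =>
    ∑ j, (ContinuousLinearMap.proj j : (Fin d → ℝ) →L[ℝ] ℝ).smulRight (X j y) with h𝕏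
  have h𝕏u : ∀ y u, 𝕏 y u = ∑ j, u j • X j y := fun y u => by
    simp [h𝕏]
  have h𝕏s : ContDiff ℝ ∞ 𝕏 := by
    refine ContDiff.sum fun j _ => ?_
    exact contDiff_const.smulRight (hX j)
  have h𝕏d : ∀ y w u, fderiv ℝ 𝕏 y w u = ∑ j, u j • fderiv ℝ (X j) y w := by
    intro y w u
    have h1 : HasFDerivAt (fun y => 𝕏 y u) ((fderiv ℝ 𝕏 y).flip u) y := by
      have := ((h𝕏s.differentiable (by simp) y).hasFDerivAt).clm_apply (hasFDerivAt_const u y)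
      simpa using this
    have h2 : HasFDerivAt (fun y => 𝕏 y u) (∑ j, u j • fderiv ℝ (X j) y) y := by
      simp only [h𝕏u]
      exact HasFDerivAt.fun_sum fun j _ =>
        (((hX j).differentiable (by simp) y).hasFDerivAt).const_smul (u j)
    have h3 := congrArg (fun L : Phase n →L[ℝ] Phase n => L w) (h1.unique h2)
    simpa using h3
  let G : Phase n → ℝ × ℝ × (ι → ℝ) := fun y => (phi₁ y, phi₂ y, fun i => f i (σ y))
  have hfσ : ∀ i, ContDiff ℝ ∞ fun y => f i (σ y) := fun i => (hf i).comp σ.contDiff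
  have hGs : ContDiff ℝ ∞ G :=
    contDiff_phi₁.prodMk (contDiff_phi₂.prodMk (contDiff_pi.2 hfσ))
  have hGd : ∀ y v, fderiv ℝ G y v = (fderiv ℝ phi₁ y v, fderiv ℝ phi₂ y v,
      fun i => fderiv ℝ (f i) (σ y) (σ v)) := by
    intro y v
    have h1 := (contDiff_phi₁ (n := n) (k := 1)).differentiable (by simp) y
    have h2 := (contDiff_phi₂ (n := n) (k := 1)).differentiable (by simp) y
    have h3 : ∀ i, DifferentiableAt ℝ (fun y => f i (σ y)) y := fun i =>
      (hfσ i).differentiable (by simp) y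
    have h := h1.hasFDerivAt.prodMk (h2.hasFDerivAt.prodMk
      (hasFDerivAt_pi.2 fun i => (h3 i).hasFDerivAt))
    have h' : HasFDerivAt G _ y := h
    rw [h'.fderiv]
    ext i
    · rfl
    · rfl
    · exact fderiv_comp_shift y v
  obtain ⟨Θ, L, hΘs, hΘr, hΘp, hΘd, hΘK⟩ := exists_torus_of_commuting (G := G) (X := 𝕏) hKc h𝕏s
    (fun y hy u v => by
      rw [h𝕏d, h𝕏d]
      simp only [h𝕏u, map_sum, map_smul, Finset.smul_sum]
      rw [Finset.sum_comm]
      refine Finset.sum_congr rfl fun i _ => Finset.sum_congr rfl fun j _ => ?_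
      rw [hcomm j i y hy.1, smul_comm])
    (fun c ψ u hc h0 => by
      have e1 : ∀ t, phi₁ (c t) = 1 := fun t => by
        rw [isConst_of_hasDerivAt ((contDiff_phi₁ (k := 1)).differentiable (by simp)) hc
          (fun t => by simp [h𝕏u, hX₁]) t]
        exact h0.1.1
      have e2 : ∀ t, phi₂ (c t) = 0 := fun t => by
        rw [isConst_of_hasDerivAt ((contDiff_phi₂ (k := 1)).differentiable (by simp)) hc
          (fun t => by simp [h𝕏u, hX₂]) t]
        exact h0.1.2
      intro t
      refine ⟨⟨e1 t, e2 t⟩, fun i => ?_⟩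
      rw [← h0.2 i]
      refine isConst_of_hasDerivAt (f := fun y => f i (σ y)) ((hfσ i).differentiable (by simp)) hc
        (fun t => ?_) t
      rw [fderiv_comp_shift]
      simp only [h𝕏u, map_smul, map_sum]
      rw [Finset.sum_eq_zero, smul_zero]
      intro j _
      rw [hXf i j _ ⟨e1 t, e2 t⟩, smul_zero])
    (fun y hy => by
      have := linearIndependent_iff_injective_fintypeLinearCombination.1 (hind y hy)
      intro u v huv
      apply this
      simpa [Fintype.linearCombination_apply, h𝕏u] using huv)
    (hGs.of_le (by simp))
    (fun y hy z hz => by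
      simp only [G]
      rw [hy.1.1, hy.1.2, hz.1.1, hz.1.2]
      simp only [Prod.mk.injEq, true_and]
      funext i
      rw [hy.2 i, hz.2 i])
    (fun y hy v hv => by
      rw [hGd] at hv
      simp only [Prod.mk_eq_zero, funext_iff, Pi.zero_apply] at hv
      have h1 := hspan y hy v (mem_tangentAt_iff_fderiv.2 ⟨hv.1, hv.2.1⟩) hv.2.2
      rw [Submodule.mem_span_range_iff_exists_fun] at h1
      obtain ⟨u, hu⟩ := h1
      exact ⟨u, by rw [h𝕏u, hu]⟩)
    hxK
  have hΘ'd : ∀ θ, HasFDerivAt (fun θ => σ (Θ θ))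
      ((σ : Phase n →L[ℝ] Phase n).comp ((𝕏 (Θ θ)).comp (L : (Fin d → ℝ) →L[ℝ] _))) θ :=
    fun θ => σ.hasFDerivAt.comp θ (hΘd θ)
  have hΘ'e : ∀ θ u, fderiv ℝ (fun θ => σ (Θ θ)) θ u = σ (𝕏 (Θ θ) (L u)) := fun θ u => by
    rw [(hΘ'd θ).fderiv]
    rfl
  refine ⟨fun θ => σ (Θ θ), L.symm (m⁻¹ • ν), σ.contDiff.comp hΘs, ?_, ?_, ?_, ?_, ?_⟩
  · have h1 : range (fun θ => σ (Θ θ)) = σ '' range Θ := by rw [← range_comp]; rfl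
    rw [h1, hΘr, levelComponent]
    have h2 := σ.toHomeomorph.image_connectedComponentIn hxK
    rw [ContinuousLinearEquiv.coe_toHomeomorph] at h2
    rw [h2]
    congr 1
    rw [hKS, image_preimage_eq _ σ.surjective]
  · intro θ θ'
    rw [← hΘp θ θ']
    exact σ.injective.eq_iff
  · intro θ u v huv
    rw [hΘ'e, hΘ'e] at huv
    have h1 := σ.injective huv
    rw [h𝕏u, h𝕏u] at h1
    have := linearIndependent_iff_injective_fintypeLinearCombination.1 (hind _ (hΘK θ))
    exact L.injective (this (by simpa [Fintype.linearCombination_apply] using h1))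
  · intro θ u v
    rw [hΘ'e, hΘ'e, hσ, twistedForm_shift hκ, h𝕏u, h𝕏u]
    have hb : ∀ y z : Phase n, canon y z = twistedBilin 0 (0 : Matrix (Fin n) (Fin n) ℝ) y z := by
      intro y z
      simp [canon, twistedForm]
    rw [hb]
    simp only [map_sum, LinearMap.sum_apply, map_smul, LinearMap.smul_apply, ← hb,
      hiso _ _ _ (hΘK θ).1, smul_zero, Finset.sum_const_zero]
  · intro θ
    rw [hΘ'e, L.apply_symm_apply, hσ, magneticField_shift ha hκ (hΘK θ).1, hν _ (hΘK θ), h𝕏u]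
    simp only [Pi.smul_apply, Finset.smul_sum, smul_eq_mul, mul_smul]

end Frame

end MagneticSphere

namespace MagneticSphere

variable {n : ℕ} {s : ℝ} {κ : Matrix (Fin n) (Fin n) ℝ}

/-- The retraction of `{γ ≠ 0}` onto `T*Sⁿ⁻¹`. -/
noncomputable def retraction (x : Phase n) : Phase n :=
  ((√(x.1 ⬝ᵥ x.1))⁻¹ • x.1, x.2 - ((x.1 ⬝ᵥ x.2) / (x.1 ⬝ᵥ x.1)) • x.1)

theorem retraction_of_mem {x : Phase n} (hx : x ∈ cotangentSphere n) : retraction x = x := by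
  obtain ⟨h1, h2⟩ := mem_cotangentSphere.1 hx
  simp [retraction, h1, h2]

theorem dotProduct_self_ne_zero {u : Fin n → ℝ} (hu : u ≠ 0) : u ⬝ᵥ u ≠ 0 :=
  fun h => hu (dotProduct_self_eq_zero.1 h)

theorem dotProduct_self_nonneg (u : Fin n → ℝ) : 0 ≤ u ⬝ᵥ u :=
  Finset.sum_nonneg fun _ _ => mul_self_nonneg _

theorem retraction_mem {x : Phase n} (hx : x.1 ≠ 0) : retraction x ∈ cotangentSphere n := by
  have h := dotProduct_self_ne_zero hx
  have h' := Real.mul_self_sqrt (dotProduct_self_nonneg x.1)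
  have h0 : √(x.1 ⬝ᵥ x.1) ≠ 0 := fun h0 => h (by rw [← h', h0, mul_zero])
  rw [mem_cotangentSphere, retraction]
  simp only [smul_dot, dot_smul, dotProduct_sub]
  constructor
  · field_simp
    linarith [sq √(x.1 ⬝ᵥ x.1)]
  · field_simp
    ring

theorem contDiffAt_retraction {x : Phase n} (hx : x.1 ≠ 0) : ContDiffAt ℝ ω retraction x := by
  have h := dotProduct_self_ne_zero hx
  have h' := Real.mul_self_sqrt (dotProduct_self_nonneg x.1)
  have h0 : √(x.1 ⬝ᵥ x.1) ≠ 0 := fun h0 => h (by rw [← h', h0, mul_zero])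
  have h1 : ContDiffAt ℝ ω (fun x : Phase n => x.1 ⬝ᵥ x.1) x := by fun_prop
  have h2 : ContDiffAt ℝ ω (fun x : Phase n => x.1 ⬝ᵥ x.2) x := by fun_prop
  exact (((h1.sqrt h).inv h0).smul contDiffAt_fst).prodMk
    (contDiffAt_snd.sub ((h2.div h1 h).smul contDiffAt_fst))

theorem isPreconnected_fst_ne_zero (hn : 2 ≤ n) :
    IsPreconnected {x : Phase n | x.1 ≠ 0} := by
  have h1 : IsPreconnected ({0}ᶜ : Set (Fin n → ℝ)) :=
    (isConnected_compl_singleton_of_one_lt_rank (by simp; omega) 0).isPreconnected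
  have h2 := h1.prod (isPreconnected_univ (α := Fin n → ℝ))
  convert h2 using 1
  ext x
  simp

/-- The zero set of an analytic function that does not vanish identically on `T*Sⁿ⁻¹` is nowhere
dense. -/
theorem dense_ne_zero (hn : 2 ≤ n) {g : Phase n → ℝ} (hg : ContDiff ℝ ω g) {z : Phase n}
    (hz : z ∈ cotangentSphere n) (hgz : g z ≠ 0) :
    cotangentSphere n ⊆ closure ({x | g x ≠ 0} ∩ cotangentSphere n) := by
  have hne : ∀ x ∈ cotangentSphere n, x.1 ≠ 0 := fun x hx h => by
    have := (mem_cotangentSphere.1 hx).1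
    simp [h] at this
  intro x hx
  by_contra hcl
  have hev : ∀ᶠ y in 𝓝 x, y ∉ {x | g x ≠ 0} ∩ cotangentSphere n := by
    rw [mem_closure_iff_frequently] at hcl
    exact not_frequently.1 hcl
  have hcont : Tendsto retraction (𝓝 x) (𝓝 x) := by
    have := (contDiffAt_retraction (hne x hx)).continuousAt.tendsto
    rwa [retraction_of_mem hx] at this
  have hopen : IsOpen {x : Phase n | x.1 ≠ 0} := isOpen_compl_singleton.preimage continuous_fst
  have han : AnalyticOnNhd ℝ (fun y => g (retraction y)) {x : Phase n | x.1 ≠ 0} := fun y hy =>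
    (hg.contDiffAt.comp y (contDiffAt_retraction hy)).analyticAt
  have h0 := han.eqOn_zero_of_preconnected_of_eventuallyEq_zero (isPreconnected_fst_ne_zero hn)
    (hne x hx) (by
      filter_upwards [hcont.eventually hev, hopen.mem_nhds (hne x hx)] with y hy hy'
      by_contra h
      exact hy ⟨h, retraction_mem hy'⟩)
  have := h0 (hne z hz)
  simp only [retraction_of_mem hz] at this
  exact hgz this

theorem Generically.and {P Q : Phase n → Prop} (hP : Generically P) (hQ : Generically Q) :
    Generically fun x => P x ∧ Q x := by
  obtain ⟨U, hU, hUd, hUP⟩ := hP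
  obtain ⟨V, hV, hVd, hVQ⟩ := hQ
  refine ⟨U ∩ V, hU.inter hV, fun x hx => ?_, fun x hx => ⟨hUP x ⟨hx.1.1, hx.2⟩, hVQ x ⟨hx.1.2, hx.2⟩⟩⟩
  have h1 : U ∩ cotangentSphere n ⊆ closure (U ∩ V ∩ cotangentSphere n) := by
    rw [inter_assoc]
    exact (inter_subset_inter_right U hVd).trans hU.inter_closure
  exact closure_minimal h1 isClosed_closure (hUd hx)

theorem Generically.mono {P Q : Phase n → Prop} (hP : Generically P)
    (h : ∀ x ∈ cotangentSphere n, P x → Q x) : Generically Q := by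
  obtain ⟨U, hU, hUd, hUP⟩ := hP
  exact ⟨U, hU, hUd, fun x hx => h x hx.2 (hUP x hx)⟩

/-- A property that holds, in the canonical momenta, wherever an analytic function does not
vanish. -/
theorem generically_of_ne_zero (hn : 2 ≤ n) (hκ : κᵀ = -κ) {g : Phase n → ℝ}
    (hg : ContDiff ℝ ω g) {z : Phase n} (hz : z ∈ cotangentSphere n) (hgz : g z ≠ 0)
    {P : Phase n → Prop} (h : ∀ x ∈ cotangentSphere n, g x ≠ 0 → P (shift s κ x)) :
    Generically P := by
  have hg' : ContDiff ℝ ω (fun x => g ((shift s κ).symm x)) :=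
    hg.comp (shift s κ).symm.contDiff
  have hm : ∀ x, (shift s κ).symm x ∈ cotangentSphere n ↔ x ∈ cotangentSphere n := fun x => by
    rw [← shift_mem_cotangentSphere hκ (s := s), ContinuousLinearEquiv.apply_symm_apply]
  refine ⟨{x | g ((shift s κ).symm x) ≠ 0}, isOpen_compl_singleton.preimage hg'.continuous,
    dense_ne_zero hn hg' ((shift_mem_cotangentSphere (s := s) hκ z).2 hz) (by simpa [ContinuousLinearEquiv.symm_apply_apply (shift s κ)] using hgz),
    fun x hx => ?_⟩
  have := h _ ((hm x).2 hx.2) hx.1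
  rwa [ContinuousLinearEquiv.apply_symm_apply] at this

end MagneticSphere

namespace MagneticSphere

variable {n : ℕ} {a : Fin n → ℝ} {S S' : Finset (Fin n)} {x w w' : Phase n}

/-- The scalar product of the components in the coordinate subspace of a block `S`. -/
def blockDot (S : Finset (Fin n)) (u v : Fin n → ℝ) : ℝ := ∑ i ∈ S, u i * v i

theorem blockDot_comm (u v : Fin n → ℝ) : blockDot S u v = blockDot S v u :=
  Finset.sum_congr rfl fun _ _ => mul_comm _ _

theorem blockDot_self_nonneg (u : Fin n → ℝ) : 0 ≤ blockDot S u u :=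
  Finset.sum_nonneg fun _ _ => mul_self_nonneg _

theorem blockDot_lin {u v v₁ v₂ : Fin n → ℝ} {p q : ℝ} (h : ∀ i ∈ S, v i = p * v₁ i + q * v₂ i) :
    blockDot S u v = p * blockDot S u v₁ + q * blockDot S u v₂ := by
  rw [blockDot, blockDot, blockDot, Finset.mul_sum, Finset.mul_sum, ← Finset.sum_add_distrib]
  exact Finset.sum_congr rfl fun i hi => by rw [h i hi]; ring

theorem contDiff_blockDot {E : Type*} [NormedAddCommGroup E] [NormedSpace ℝ E] {k : WithTop ℕ∞}
    {f g : E → Fin n → ℝ} (hf : ContDiff ℝ k f) (hg : ContDiff ℝ k g) :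
    ContDiff ℝ k fun x => blockDot S (f x) (g x) := by
  simp only [blockDot]
  exact ContDiff.sum fun i _ => (contDiff_pi.1 hf i).mul (contDiff_pi.1 hg i)

/-- The angular momentum `γᵢPⱼ - γⱼPᵢ`. -/
def ang (i j : Fin n) (x : Phase n) : ℝ := x.1 i * x.2 j - x.1 j * x.2 i

@[fun_prop]
theorem contDiff_ang {k : WithTop ℕ∞} (i j : Fin n) : ContDiff ℝ k (ang i j) := by
  unfold ang
  fun_prop

theorem ang_swap (i j : Fin n) (x : Phase n) : ang j i x = -ang i j x := by
  rw [ang, ang]; ring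

theorem fderiv_ang (i j : Fin n) (x w : Phase n) :
    fderiv ℝ (ang i j) x w = w.1 i * x.2 j + x.1 i * w.2 j - (w.1 j * x.2 i + x.1 j * w.2 i) := by
  refine fderiv_eq_of_curve ((contDiff_ang i j).differentiable (n := 1) (by simp) x) ?_
  rintro c hc rfl
  have h1 := hasDerivAt_pi.1 (hasDerivAt_fst hc)
  have h2 := hasDerivAt_pi.1 (hasDerivAt_snd hc)
  exact ((h1 i).mul (h2 j)).sub ((h1 j).mul (h2 i))

/-- The variation `w` at `x` preserves the angular momenta of the block `S`. -/
def KillsAng (S : Finset (Fin n)) (x w : Phase n) : Prop :=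
  ∀ i ∈ S, ∀ j ∈ S, fderiv ℝ (ang i j) x w = 0

/-- On the block `S`, `w` is the value at `x` of an infinitesimal transformation from `sl₂`, which
acts on the pairs `(γ, P)`. -/
def IsSl₂On (S : Finset (Fin n)) (x w : Phase n) (p q r : ℝ) : Prop :=
  ∀ i ∈ S, w.1 i = p * x.1 i + q * x.2 i ∧ w.2 i = r * x.1 i - p * x.2 i

namespace IsSl₂On

variable {p q r p' q' r' : ℝ}

theorem killsAng (h : IsSl₂On S x w p q r) : KillsAng S x w := fun i hi j hj => by
  rw [fderiv_ang, (h i hi).1, (h i hi).2, (h j hj).1, (h j hj).2]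
  ring

theorem add (h : IsSl₂On S x w p q r) (h' : IsSl₂On S x w' p' q' r') :
    IsSl₂On S x (w + w') (p + p') (q + q') (r + r') := fun i hi => by
  simp only [Prod.fst_add, Prod.snd_add, Pi.add_apply, (h i hi).1, (h i hi).2, (h' i hi).1,
    (h' i hi).2]
  constructor <;> ring

theorem smul (c : ℝ) (h : IsSl₂On S x w p q r) : IsSl₂On S x (c • w) (c * p) (c * q) (c * r) :=
  fun i hi => by
  simp only [Prod.smul_fst, Prod.smul_snd, Pi.smul_apply, smul_eq_mul, (h i hi).1, (h i hi).2]
  constructor <;> ring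

theorem dot₁ (h : IsSl₂On S x w p q r) (u : Fin n → ℝ) :
    blockDot S u w.1 = p * blockDot S u x.1 + q * blockDot S u x.2 :=
  blockDot_lin fun i hi => (h i hi).1

theorem dot₂ (h : IsSl₂On S x w p q r) (u : Fin n → ℝ) :
    blockDot S u w.2 = r * blockDot S u x.1 - p * blockDot S u x.2 := by
  rw [blockDot_lin (p := r) (q := -p) (v₁ := x.1) (v₂ := x.2) fun i hi => by rw [(h i hi).2]; ring]
  ring

/-- A nondegenerate block is moved by every nontrivial transformation. -/
theorem eq_zero (h : IsSl₂On S x w p q r) (h₁ : ∀ i ∈ S, w.1 i = 0)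
    (hD : blockDot S x.1 x.1 * blockDot S x.2 x.2 - blockDot S x.1 x.2 ^ 2 ≠ 0) :
    p = 0 ∧ q = 0 := by
  have e1 := h.dot₁ x.1
  have e2 := h.dot₁ x.2
  have h0 : ∀ u, blockDot S u w.1 = 0 := fun u =>
    Finset.sum_eq_zero fun i hi => by rw [h₁ i hi, mul_zero]
  rw [h0] at e1 e2
  rw [blockDot_comm x.2 x.1] at e2
  constructor
  · refine (mul_eq_zero.1 ?_).resolve_right hD
    linear_combination blockDot S x.1 x.2 * e2 - blockDot S x.2 x.2 * e1
  · refine (mul_eq_zero.1 ?_).resolve_right hD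
    linear_combination blockDot S x.1 x.2 * e1 - blockDot S x.1 x.1 * e2

end IsSl₂On

theorem KillsAng.sub (h : KillsAng S x w) (h' : KillsAng S x w') : KillsAng S x (w - w') :=
  fun i hi j hj => by rw [map_sub, h i hi j hj, h' i hi j hj, sub_zero]

theorem KillsAng.smul (c : ℝ) (h : KillsAng S x w) : KillsAng S x (c • w) :=
  fun i hi j hj => by rw [map_smul, h i hi j hj, smul_zero]

theorem KillsAng.contract (h : KillsAng S x w) {i : Fin n} (hi : i ∈ S) (u : Fin n → ℝ) :
    w.1 i * blockDot S u x.2 + x.1 i * blockDot S u w.2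
      - (x.2 i * blockDot S u w.1 + w.2 i * blockDot S u x.1) = 0 := by
  simp only [blockDot, Finset.mul_sum, ← Finset.sum_add_distrib, ← Finset.sum_sub_distrib]
  refine Finset.sum_eq_zero fun j hj => ?_
  have := h i hi j hj
  rw [fderiv_ang] at this
  linear_combination u j * this

/-- The Casimir function `uV - v²` of a block is preserved with the angular momenta. -/
theorem KillsAng.casimir_variation (h : KillsAng S x w) :
    blockDot S x.2 x.2 * (2 * blockDot S x.1 w.1) + blockDot S x.1 x.1 * (2 * blockDot S x.2 w.2)
      - 2 * blockDot S x.1 x.2 * (blockDot S x.1 w.2 + blockDot S x.2 w.1) = 0 := by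
  have key : ∑ i ∈ S, x.1 i * (w.1 i * blockDot S x.2 x.2 + x.1 i * blockDot S x.2 w.2
      - (x.2 i * blockDot S x.2 w.1 + w.2 i * blockDot S x.2 x.1)) = 0 :=
    Finset.sum_eq_zero fun i hi => by rw [h.contract hi, mul_zero]
  have e : ∀ A B C D : ℝ, ∑ i ∈ S, x.1 i * (w.1 i * A + x.1 i * B - (x.2 i * C + w.2 i * D)) =
      A * blockDot S x.1 w.1 + B * blockDot S x.1 x.1
      - (C * blockDot S x.1 x.2 + D * blockDot S x.1 w.2) := fun A B C D => by
    simp only [blockDot, Finset.mul_sum, ← Finset.sum_add_distrib, ← Finset.sum_sub_distrib]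
    exact Finset.sum_congr rfl fun i _ => by ring
  rw [e, blockDot_comm x.2 x.1] at key
  linear_combination 2 * key

/-- A variation that preserves the angular momenta and the Gram matrix of a nondegenerate block
is a rotation in the plane of `γ` and `P`. -/
theorem KillsAng.isSl₂On (h : KillsAng S x w)
    (hD : blockDot S x.1 x.1 * blockDot S x.2 x.2 - blockDot S x.1 x.2 ^ 2 ≠ 0)
    (h₁ : blockDot S x.1 w.1 = 0) (h₂ : blockDot S x.1 w.2 + blockDot S x.2 w.1 = 0)
    (h₃ : blockDot S x.2 w.2 = 0) :
    ∃ c : ℝ, IsSl₂On S x w (c * -blockDot S x.1 x.2) (c * blockDot S x.1 x.1)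
      (c * -blockDot S x.2 x.2) := by
  refine ⟨-blockDot S x.1 w.2 / (blockDot S x.1 x.1 * blockDot S x.2 x.2 - blockDot S x.1 x.2 ^ 2),
    fun i hi => ?_⟩
  have e1 := h.contract hi x.1
  have e2 := h.contract hi x.2
  have h₂' : blockDot S x.2 w.1 = -blockDot S x.1 w.2 := by linarith
  rw [h₁] at e1
  rw [h₂', h₃, blockDot_comm x.2 x.1] at e2
  constructor <;> refine mul_left_cancel₀ hD ?_ <;> field_simp
  · linear_combination blockDot S x.1 x.1 * e2 - blockDot S x.1 x.2 * e1
  · linear_combination blockDot S x.1 x.2 * e2 - blockDot S x.2 x.2 * e1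

/-- The matrix of the angular momenta of a block. -/
def blockRot (S : Finset (Fin n)) (x : Phase n) : Matrix (Fin n) (Fin n) ℝ :=
  Matrix.of fun i j => if i ∈ S ∧ j ∈ S then ang j i x else 0

/-- Half the field of the Casimir function of a block: the rotation in the plane of `γ` and `P`. -/
def fieldBlock (S : Finset (Fin n)) (x : Phase n) : Phase n := fieldRot (blockRot S x) x

theorem blockRot_skew (S : Finset (Fin n)) (x : Phase n) : (blockRot S x)ᵀ = -blockRot S x := by
  ext i j
  simp only [blockRot, Matrix.transpose_apply, Matrix.of_apply, Matrix.neg_apply, and_comm (a := j ∈ S)]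
  split_ifs
  · exact ang_swap _ _ _
  · simp

theorem blockRot_mulVec_of_mem (u : Fin n → ℝ) {i : Fin n} (hi : i ∈ S) :
    (blockRot S x *ᵥ u) i = blockDot S u x.1 * x.2 i - blockDot S u x.2 * x.1 i := by
  simp only [blockRot, Matrix.mulVec, dotProduct, Matrix.of_apply, hi, true_and, ite_mul, zero_mul,
    blockDot, Finset.sum_mul]
  rw [← Finset.sum_filter, ← Finset.sum_sub_distrib]
  simp only [Finset.filter_mem_eq_inter, Finset.univ_inter, ang]
  exact Finset.sum_congr rfl fun j _ => by ring

theorem blockRot_mulVec_of_notMem (u : Fin n → ℝ) {i : Fin n} (hi : i ∉ S) :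
    (blockRot S x *ᵥ u) i = 0 := by
  simp [blockRot, Matrix.mulVec, dotProduct, hi]

theorem fieldBlock_isSl₂On : IsSl₂On S x (fieldBlock S x) (-blockDot S x.1 x.2)
    (blockDot S x.1 x.1) (-blockDot S x.2 x.2) := fun i hi => by
  simp only [fieldBlock, fieldRot, blockRot_mulVec_of_mem _ hi, blockDot_comm x.2 x.1]
  constructor <;> ring

theorem fieldBlock_of_notMem {i : Fin n} (hi : i ∉ S) :
    (fieldBlock S x).1 i = 0 ∧ (fieldBlock S x).2 i = 0 :=
  ⟨blockRot_mulVec_of_notMem _ hi, blockRot_mulVec_of_notMem _ hi⟩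

theorem fieldBlock_isSl₂On_of_disjoint (h : Disjoint S S') :
    IsSl₂On S x (fieldBlock S' x) 0 0 0 := fun i hi => by
  obtain ⟨h1, h2⟩ := fieldBlock_of_notMem (x := x) (Finset.disjoint_left.1 h hi)
  simp [h1, h2]

theorem blockRot_isSymmetry {c : ℝ} (ha : ∀ i ∈ S, a i = c) : IsSymmetry a (blockRot S x) := by
  refine ⟨blockRot_skew S x, fun u => ?_⟩
  ext i
  by_cases hi : i ∈ S
  · rw [Pi.mul_apply, blockRot_mulVec_of_mem _ hi, blockRot_mulVec_of_mem _ hi, ha i hi]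
    have : ∀ v, blockDot S (a * u) v = c * blockDot S u v := fun v => by
      rw [blockDot, blockDot, Finset.mul_sum]
      exact Finset.sum_congr rfl fun j hj => by rw [Pi.mul_apply, ha j hj, mul_assoc]
    rw [this, this]
    ring
  · rw [Pi.mul_apply, blockRot_mulVec_of_notMem _ hi, blockRot_mulVec_of_notMem _ hi, mul_zero]

@[fun_prop]
theorem contDiff_fieldBlock {k : WithTop ℕ∞} : ContDiff ℝ k (fieldBlock (n := n) S) := by
  have h : ∀ i j, ContDiff ℝ k fun x : Phase n => blockRot S x i j := fun i j => by
    simp only [blockRot, Matrix.of_apply]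
    split_ifs
    · exact contDiff_ang _ _
    · exact contDiff_const
  refine ContDiff.prodMk (contDiff_pi.2 fun i => ?_) (contDiff_pi.2 fun i => ?_)
  · simp only [Matrix.mulVec, dotProduct]
    exact ContDiff.sum fun j _ => (h i j).mul (contDiff_pi.1 contDiff_fst j)
  · simp only [Matrix.mulVec, dotProduct]
    exact ContDiff.sum fun j _ => (h i j).mul (contDiff_pi.1 contDiff_snd j)

/-- Along variations that preserve the angular momenta, the field of a block is linear. -/
theorem fderiv_fieldBlock (h : KillsAng S x w) :
    fderiv ℝ (fieldBlock S) x w = fieldRot (blockRot S x) w := by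
  refine fderiv_eq_of_curve (contDiff_fieldBlock.differentiable (n := 1) (by simp) x) ?_
  rintro c hc rfl
  have h1 := hasDerivAt_pi.1 (hasDerivAt_fst hc)
  have h2 := hasDerivAt_pi.1 (hasDerivAt_snd hc)
  have hΩ : ∀ i j, HasDerivAt (fun t => blockRot S (c t) i j) 0 0 := fun i j => by
    simp only [blockRot, Matrix.of_apply]
    split_ifs with hij
    · exact (((contDiff_ang j i).differentiable (n := 1) (by simp)
        _).hasFDerivAt.comp_hasDerivAt 0 hc).congr_deriv (h j hij.2 i hij.1)
    · exact hasDerivAt_const _ _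
  refine HasDerivAt.prodMk (hasDerivAt_pi.2 fun i => ?_) (hasDerivAt_pi.2 fun i => ?_)
  · simp only [Matrix.mulVec, dotProduct]
    exact (HasDerivAt.fun_sum fun j _ => (hΩ i j).mul (h1 j)).congr_deriv
      (Finset.sum_congr rfl fun j _ => by rw [zero_mul, zero_add])
  · simp only [Matrix.mulVec, dotProduct]
    exact (HasDerivAt.fun_sum fun j _ => (hΩ i j).mul (h2 j)).congr_deriv
      (Finset.sum_congr rfl fun j _ => by rw [zero_mul, zero_add])

theorem fieldBlock_phi₁ (x : Phase n) : fderiv ℝ phi₁ x (fieldBlock S x) = 0 :=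
  fieldRot_phi₁ (blockRot_skew S x) x

theorem fieldBlock_phi₂ (x : Phase n) : fderiv ℝ phi₂ x (fieldBlock S x) = 0 :=
  fieldRot_phi₂ (blockRot_skew S x) x

section Fields

variable {c : ℝ}

theorem fieldE_isSl₂On (hx : x ∈ cotangentSphere n) (ha : ∀ i ∈ S, a i = c) :
    IsSl₂On S x (fieldE a x) 0 1 (x.1 ⬝ᵥ (a * x.1) - x.2 ⬝ᵥ x.2 - c) := fun i hi => by
  obtain ⟨h1, h2⟩ := mem_cotangentSphere.1 hx
  simp only [fieldE, h1, h2, Pi.sub_apply, Pi.add_apply, Pi.smul_apply, Pi.mul_apply, smul_eq_mul,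
    ha i hi]
  constructor <;> ring

theorem fieldG_isSl₂On (hx : x ∈ cotangentSphere n) (ha : ∀ i ∈ S, a i = c) :
    IsSl₂On S x (fieldG a x) (-(x.1 ⬝ᵥ (a * x.2))) (x.1 ⬝ᵥ (a * x.1) + c)
      (x.1 ⬝ᵥ (a * (a * x.1)) - x.2 ⬝ᵥ (a * x.2) - c ^ 2 - (x.2 ⬝ᵥ x.2) * c) := fun i hi => by
  obtain ⟨h1, h2⟩ := mem_cotangentSphere.1 hx
  simp only [fieldG, h1, h2, Pi.sub_apply, Pi.add_apply, Pi.smul_apply, Pi.mul_apply, smul_eq_mul,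
    ha i hi]
  constructor <;> ring

theorem fieldE_comm_fieldBlock (hx : x ∈ cotangentSphere n) (ha : ∀ i ∈ S, a i = c) :
    fderiv ℝ (fieldE a) x (fieldBlock S x) = fderiv ℝ (fieldBlock S) x (fieldE a x) := by
  rw [fderiv_fieldBlock (fieldE_isSl₂On hx ha).killsAng]
  exact fieldE_comm_fieldRot (blockRot_isSymmetry ha) x

theorem fieldG_comm_fieldBlock (hx : x ∈ cotangentSphere n) (ha : ∀ i ∈ S, a i = c) :
    fderiv ℝ (fieldG a) x (fieldBlock S x) = fderiv ℝ (fieldBlock S) x (fieldG a x) := by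
  rw [fderiv_fieldBlock (fieldG_isSl₂On hx ha).killsAng]
  exact fieldG_comm_fieldRot (blockRot_isSymmetry ha) x

theorem blockRot_mulVec_eq_zero {u : Fin n → ℝ} (hu : ∀ i ∈ S, u i = 0) :
    blockRot S x *ᵥ u = 0 := by
  ext i
  by_cases hi : i ∈ S
  · have : ∀ v, blockDot S u v = 0 := fun v =>
      Finset.sum_eq_zero fun j hj => by rw [hu j hj, zero_mul]
    rw [blockRot_mulVec_of_mem _ hi, this, this]
    simp
  · exact blockRot_mulVec_of_notMem _ hi

theorem fieldRot_blockRot_of_disjoint (h : Disjoint S S') :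
    fieldRot (blockRot S x) (fieldBlock S' x) = 0 := by
  have h0 := fun i (hi : i ∈ S) => fieldBlock_of_notMem (x := x) (Finset.disjoint_left.1 h hi)
  rw [fieldRot, blockRot_mulVec_eq_zero fun i hi => (h0 i hi).1,
    blockRot_mulVec_eq_zero fun i hi => (h0 i hi).2]
  rfl

theorem fieldBlock_comm_fieldBlock (h : Disjoint S S') :
    fderiv ℝ (fieldBlock S) x (fieldBlock S' x) = fderiv ℝ (fieldBlock S') x (fieldBlock S x) := by
  rw [fderiv_fieldBlock (fieldBlock_isSl₂On_of_disjoint h).killsAng,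
    fderiv_fieldBlock (fieldBlock_isSl₂On_of_disjoint h.symm).killsAng,
    fieldRot_blockRot_of_disjoint h, fieldRot_blockRot_of_disjoint h.symm]

theorem canon_fieldE_fieldBlock (hx : x ∈ cotangentSphere n) (ha : ∀ i ∈ S, a i = c) :
    canon (fieldE a x) (fieldBlock S x) = 0 :=
  canon_fieldE_fieldRot (blockRot_isSymmetry ha) hx

theorem canon_fieldG_fieldBlock (hx : x ∈ cotangentSphere n) (ha : ∀ i ∈ S, a i = c) :
    canon (fieldG a x) (fieldBlock S x) = 0 :=
  canon_fieldG_fieldRot (blockRot_isSymmetry ha) hx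

theorem canon_fieldBlock_fieldBlock (h : Disjoint S S') :
    canon (fieldBlock S x) (fieldBlock S' x) = 0 := by
  have h0 : ∀ u v : Fin n → ℝ, (∀ i ∈ S, v i = 0) → (∀ i ∉ S, u i = 0) → u ⬝ᵥ v = 0 :=
    fun u v hv hu => Finset.sum_eq_zero fun i _ => by
      by_cases hi : i ∈ S
      · rw [hv i hi, mul_zero]
      · rw [hu i hi, zero_mul]
  have h1 := fun i (hi : i ∈ S) => fieldBlock_of_notMem (x := x) (Finset.disjoint_left.1 h hi)
  have h2 := fun i (hi : i ∉ S) => fieldBlock_of_notMem (x := x) hi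
  rw [canon, h0 _ _ (fun i hi => (h1 i hi).1) fun i hi => (h2 i hi).2,
    h0 _ _ (fun i hi => (h1 i hi).2) fun i hi => (h2 i hi).1, sub_zero]

theorem fderiv_neumannE_fieldBlock (ha : ∀ i ∈ S, a i = c) (x : Phase n) :
    fderiv ℝ (neumannE a) x (fieldBlock S x) = 0 :=
  fderiv_neumannE_fieldRot (blockRot_isSymmetry ha) x

theorem fderiv_neumannG_fieldBlock (ha : ∀ i ∈ S, a i = c) (x : Phase n) :
    fderiv ℝ (neumannG a) x (fieldBlock S x) = 0 :=
  fderiv_neumannG_fieldRot (blockRot_isSymmetry ha) x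

end Fields

end MagneticSphere

namespace MagneticSphere

theorem exists_smul_of_mul_eq_mul {p q r t : ℝ} (h : p * t = q * r) (h0 : ¬(p = 0 ∧ q = 0)) :
    ∃ c, r = c * p ∧ t = c * q := by
  have hne : p ^ 2 + q ^ 2 ≠ 0 := fun h => h0
    ⟨by nlinarith [sq_nonneg p, sq_nonneg q], by nlinarith [sq_nonneg p, sq_nonneg q]⟩
  refine ⟨(p * r + q * t) / (p ^ 2 + q ^ 2), ?_, ?_⟩
  · rw [div_mul_eq_mul_div, eq_div_iff hne]
    linear_combination -q * h
  · rw [div_mul_eq_mul_div, eq_div_iff hne]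
    linear_combination p * h

section GenusOne

variable {a u v z u' v' z' : ℝ}

/-- Above the minimum of the reduced energy, a state with two blocks is not stationary. -/
theorem not_stationary (hu : u + u' = 1) (hu₀ : 0 < u) (hu₀' : 0 < u') (hz : 0 ≤ z) (hz' : 0 ≤ z')
    {t : ℝ} (ht : 0 < t) (ht' : t < 1)
    (hE : (u * z - v ^ 2) / t + (u' * z' - v' ^ 2) / (1 - t) + a * t < z + z' + a * u)
    (hv : v + v' = 0) : ¬(v = 0 ∧ z + (a * u - z - z' - a) * u = 0) := by
  rintro ⟨rfl, h⟩
  obtain rfl : v' = 0 := by linarith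
  obtain rfl : u' = 1 - u := by linarith
  have ht'' : 0 < 1 - t := by linarith
  have ha : a = z / u - z' / (1 - u) := by
    field_simp
    linear_combination -h
  have key : (u * z - 0 ^ 2) / t + ((1 - u) * z' - 0 ^ 2) / (1 - t) + a * t - (z + z' + a * u)
      = (t - u) ^ 2 * (z / (t * u) + z' / ((1 - t) * (1 - u))) := by
    rw [ha]
    field_simp
    ring
  have : 0 ≤ (t - u) ^ 2 * (z / (t * u) + z' / ((1 - t) * (1 - u))) := by positivity
  linarith

/-- The variations of a nonstationary state with two blocks that preserve all integrals. -/
theorem exists_variation_two_blocks (hu : u + u' = 1) (hv : v + v' = 0) (hu₀ : 0 < u)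
    (hu₀' : 0 < u') (hns : ¬(v = 0 ∧ z + (a * u - z - z' - a) * u = 0)) {du dv dz du' dv' dz' : ℝ}
    (hdu : du + du' = 0) (hdv : dv + dv' = 0) (hdE : dz + dz' + a * du = 0)
    (hD : z * du + u * dz - 2 * v * dv = 0) (hD' : z' * du' + u' * dz' - 2 * v' * dv' = 0) :
    ∃ c, du = c * (2 * v) ∧ dv = c * (z + (a * u - z - z' - a) * u) ∧
      dz = c * (2 * (a * u - z - z' - a) * v) ∧ du' = c * (2 * v') ∧
      dv' = c * (z' + (a * u - z - z') * u') ∧ dz' = c * (2 * (a * u - z - z') * v') := by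
  obtain rfl : v' = -v := by linarith
  obtain rfl : u' = 1 - u := by linarith
  obtain rfl : dv' = -dv := by linarith
  obtain rfl : du' = -du := by linarith
  obtain ⟨q, hq⟩ : ∃ q, q = z + (a * u - z - z' - a) * u := ⟨_, rfl⟩
  rw [← hq] at hns ⊢
  have h1 : 2 * v * dv = q * du := by
    rw [hq]
    linear_combination u * (1 - u) * hdE - (1 - u) * hD - u * hD'
  obtain ⟨c, e1, e2⟩ := exists_smul_of_mul_eq_mul h1 fun h => hns ⟨by linarith [h.1], h.2⟩
  refine ⟨c, e1, e2, ?_, ?_, ?_, ?_⟩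
  · refine mul_left_cancel₀ hu₀.ne' ?_
    rw [hq] at e2
    linear_combination hD - z * e1 + 2 * v * e2
  · linear_combination -e1
  · rw [hq] at e2
    linear_combination -e2
  · refine mul_left_cancel₀ hu₀'.ne' ?_
    rw [hq] at e2
    linear_combination hD' + z' * e1 + 2 * v * e2

end GenusOne

section GenusTwo

/-- Interpolation by a quadratic polynomial with the nodes `a`, `b`, `0`. -/
def interp (a b u₁ u₂ u₃ l : ℝ) : ℝ :=
  u₁ * ((b - l) * -l) + u₂ * ((a - l) * -l) + u₃ * ((a - l) * (b - l))

/-- The spectral polynomial of the reduced system with three blocks. -/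
def spectral (a b E G D₁ D₂ D₃ l : ℝ) : ℝ :=
  -(D₁ * ((b - l) * l) ^ 2 + D₂ * ((a - l) * l) ^ 2 + D₃ * ((a - l) * (b - l)) ^ 2)
    + (a - l) * (b - l) * -l * (l ^ 2 - (a + b - (E - D₁ - D₂ - D₃)) * l
      + (a * b - (a + b) * (E - D₁ - D₂ - D₃) + (G - 2 * (a * D₁ + b * D₂))))

variable {a b u₁ u₂ u₃ v₁ v₂ v₃ z₁ z₂ z₃ : ℝ}

theorem spectral_eq (hu : u₁ + u₂ + u₃ = 1) (hv : v₁ + v₂ + v₃ = 0) (l : ℝ) :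
    interp a b v₁ v₂ v₃ l ^ 2
        - interp a b u₁ u₂ u₃ l * (interp a b z₁ z₂ z₃ l - (a - l) * (b - l) * -l)
      = spectral a b (z₁ + z₂ + z₃ + (a * u₁ + b * u₂))
        (a ^ 2 * u₁ + b ^ 2 * u₂ + (z₁ + z₂ + z₃) * (a * u₁ + b * u₂) + (a * z₁ + b * z₂))
        (u₁ * z₁ - v₁ ^ 2) (u₂ * z₂ - v₂ ^ 2) (u₃ * z₃ - v₃ ^ 2) l := by
  obtain rfl : u₃ = 1 - u₁ - u₂ := by linarith
  obtain rfl : v₃ = -v₁ - v₂ := by linarith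
  simp only [interp, spectral]
  ring

/-- A cubic polynomial cannot have three sign changes against its leading coefficient. -/
theorem cubic_signs {A B C x₁ x₂ x₃ : ℝ} (h1 : 0 < x₁) (h2 : x₁ < x₂) (h3 : x₂ < x₃)
    (s₀ : C < 0) (s₁ : 0 < -x₁ ^ 3 + A * x₁ ^ 2 + B * x₁ + C)
    (s₂ : -x₂ ^ 3 + A * x₂ ^ 2 + B * x₂ + C < 0)
    (s₃ : 0 < -x₃ ^ 3 + A * x₃ ^ 2 + B * x₃ + C) : False := by
  have d1 : 0 < x₂ - x₁ := by linarith
  have d2 : 0 < x₃ - x₂ := by linarith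
  have d3 : 0 < x₃ - x₁ := by linarith
  have p2 : 0 < x₂ := by linarith
  have p3 : 0 < x₃ := by linarith
  have key : -C / (x₁ * x₂ * x₃)
      + (-x₁ ^ 3 + A * x₁ ^ 2 + B * x₁ + C) / (x₁ * (x₂ - x₁) * (x₃ - x₁))
      + -(-x₂ ^ 3 + A * x₂ ^ 2 + B * x₂ + C) / (x₂ * (x₂ - x₁) * (x₃ - x₂))
      + (-x₃ ^ 3 + A * x₃ ^ 2 + B * x₃ + C) / (x₃ * (x₃ - x₁) * (x₃ - x₂)) = -1 := by
    field_simp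
    ring
  have t0 : 0 < -C / (x₁ * x₂ * x₃) := div_pos (by linarith) (by positivity)
  have t1 := div_pos s₁ (show 0 < x₁ * (x₂ - x₁) * (x₃ - x₁) by positivity)
  have t2 := div_pos (neg_pos.2 s₂) (show 0 < x₂ * (x₂ - x₁) * (x₃ - x₂) by positivity)
  have t3 := div_pos s₃ (show 0 < x₃ * (x₃ - x₁) * (x₃ - x₂) by positivity)
  linarith

variable {D₁ D₂ D₃ E G : ℝ}

theorem not_common_zero (hu : u₁ + u₂ + u₃ = 1) (hv : v₁ + v₂ + v₃ = 0) (ha : 0 < a) (hab : a < b)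
    (hD₁ : u₁ * z₁ - v₁ ^ 2 = D₁) (hD₂ : u₂ * z₂ - v₂ ^ 2 = D₂) (hD₃ : u₃ * z₃ - v₃ ^ 2 = D₃)
    (hE : z₁ + z₂ + z₃ + (a * u₁ + b * u₂) = E)
    (hG : a ^ 2 * u₁ + b ^ 2 * u₂ + (z₁ + z₂ + z₃) * (a * u₁ + b * u₂) + (a * z₁ + b * z₂) = G)
    (hp₁ : 0 < D₁) (hp₃ : 0 < D₃) {p q : ℝ} (hp : 0 < p) (hpa : p < a)
    (haq : a < q) (hRp : 0 < spectral a b E G D₁ D₂ D₃ p)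
    (hRq : 0 < spectral a b E G D₁ D₂ D₃ q) {l : ℝ} (hU : interp a b u₁ u₂ u₃ l = 0)
    (hV : interp a b v₁ v₂ v₃ l = 0)
    (hW : interp a b z₁ z₂ z₃ l - (a - l) * (b - l) * -l = 0) : False := by
  have hR : ∃ A B C, ∀ x, spectral a b E G D₁ D₂ D₃ x
      = (x - l) ^ 2 * (-x ^ 3 + A * x ^ 2 + B * x + C) := by
    set c₁ := -(b * v₁ + a * v₂ + (a + b) * v₃) with hc₁
    set k := -(b * u₁ + a * u₂ + (a + b) * u₃) with hk
    set w₂ := z₁ + z₂ + z₃ - (a + b) with hw₂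
    set w₁ := a * b - (b * z₁ + a * z₂ + (a + b) * z₃) with hw₁
    have eU : ∀ x, interp a b u₁ u₂ u₃ x = (x - l) * (x + (l + k)) := fun x => by
      obtain rfl : u₃ = 1 - u₁ - u₂ := by linarith
      rw [← sub_zero (interp a b u₁ u₂ _ x), ← hU]
      simp only [interp, hk]
      ring
    have eV : ∀ x, interp a b v₁ v₂ v₃ x = (x - l) * c₁ := fun x => by
      obtain rfl : v₃ = -v₁ - v₂ := by linarith
      rw [← sub_zero (interp a b v₁ v₂ _ x), ← hV]
      simp only [interp, hc₁]
      ring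
    have eW : ∀ x, interp a b z₁ z₂ z₃ x - (a - x) * (b - x) * -x
        = (x - l) * (x ^ 2 + (l + w₂) * x + (l ^ 2 + w₂ * l + w₁)) := fun x => by
      rw [← sub_zero (interp a b z₁ z₂ z₃ x - _), ← hW]
      simp only [interp, hw₁, hw₂]
      ring
    refine ⟨-(l + w₂) - (l + k), -(l ^ 2 + w₂ * l + w₁) - (l + k) * (l + w₂),
      c₁ ^ 2 - (l + k) * (l ^ 2 + w₂ * l + w₁), fun x => ?_⟩
    rw [← hE, ← hG, ← hD₁, ← hD₂, ← hD₃, ← spectral_eq hu hv, eU, eV, eW]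
    ring
  obtain ⟨A, B, C, hR⟩ := hR
  have hR₀ : spectral a b E G D₁ D₂ D₃ 0 < 0 := by
    have : spectral a b E G D₁ D₂ D₃ 0 = -(D₃ * (a * b) ^ 2) := by
      simp only [spectral]
      ring
    have hb : 0 < b := ha.trans hab
    have : 0 < D₃ * (a * b) ^ 2 := by positivity
    linarith
  have hRa : spectral a b E G D₁ D₂ D₃ a < 0 := by
    have : spectral a b E G D₁ D₂ D₃ a = -(D₁ * ((b - a) * a) ^ 2) := by
      simp only [spectral]
      ring
    have hb : 0 < b - a := by linarith
    have : 0 < D₁ * ((b - a) * a) ^ 2 := by positivity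
    linarith
  have hpos : ∀ x, 0 < spectral a b E G D₁ D₂ D₃ x → 0 < -x ^ 3 + A * x ^ 2 + B * x + C :=
    fun x hx => by
      rw [hR] at hx
      exact (pos_iff_pos_of_mul_pos hx).1
        (lt_of_le_of_ne (sq_nonneg _) fun h => by rw [← h, zero_mul] at hx; exact hx.false)
  have hneg : ∀ x, spectral a b E G D₁ D₂ D₃ x < 0 → -x ^ 3 + A * x ^ 2 + B * x + C < 0 :=
    fun x hx => by
      rw [hR] at hx
      by_contra h
      nlinarith [mul_nonneg (sq_nonneg (x - l)) (not_lt.1 h)]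
  have s₀ := hneg 0 hR₀
  refine cubic_signs hp hpa haq (by simpa using s₀) (hpos p hRp) (hneg a hRa) (hpos q hRq)

theorem exists_roots (hu₁ : 0 < u₁) (hu₂ : 0 < u₂) (hu₃ : 0 < u₃) (ha : 0 < a) (hab : a < b) :
    ∃ l₁ l₂, l₁ ≠ l₂ ∧ interp a b u₁ u₂ u₃ l₁ = 0 ∧ interp a b u₁ u₂ u₃ l₂ = 0 := by
  have hc : Continuous (interp a b u₁ u₂ u₃) := by
    unfold interp
    fun_prop
  have hb : 0 < b := ha.trans hab
  have hba : 0 < b - a := by linarith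
  have h0 : 0 < interp a b u₁ u₂ u₃ 0 := by
    have : interp a b u₁ u₂ u₃ 0 = u₃ * (a * b) := by simp only [interp]; ring
    rw [this]; positivity
  have h1 : interp a b u₁ u₂ u₃ a < 0 := by
    have : interp a b u₁ u₂ u₃ a = -(u₁ * ((b - a) * a)) := by simp only [interp]; ring
    rw [this, neg_lt_zero]; positivity
  have h2 : 0 < interp a b u₁ u₂ u₃ b := by
    have : interp a b u₁ u₂ u₃ b = u₂ * ((b - a) * b) := by simp only [interp]; ring
    rw [this]; positivity
  obtain ⟨l₁, hl₁, e₁⟩ := intermediate_value_Ioo' ha.le hc.continuousOn ⟨h1, h0⟩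
  obtain ⟨l₂, hl₂, e₂⟩ := intermediate_value_Ioo hab.le hc.continuousOn ⟨h1, h2⟩
  exact ⟨l₁, l₂, (hl₁.2.trans hl₂.1).ne, e₁, e₂⟩

theorem eq_zero_of_interp {e₁ e₂ e₃ l₁ l₂ : ℝ} (ha : 0 < a) (hab : a < b) (hl : l₁ ≠ l₂)
    (he : e₁ + e₂ + e₃ = 0) (h₁ : interp a b e₁ e₂ e₃ l₁ = 0) (h₂ : interp a b e₁ e₂ e₃ l₂ = 0) :
    e₁ = 0 ∧ e₂ = 0 ∧ e₃ = 0 := by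
  obtain rfl : e₂ = -e₁ - e₃ := by linarith
  simp only [interp] at h₁ h₂
  have hl' : l₁ - l₂ ≠ 0 := sub_ne_zero.2 hl
  have hba : b - a ≠ 0 := by linarith
  have h3 : (b - a) * e₁ + b * e₃ = 0 := by
    refine (mul_eq_zero.1 ?_).resolve_left hl'
    linear_combination h₂ - h₁
  have h4 : e₃ = 0 := by
    refine (mul_eq_zero.1 ?_).resolve_left (mul_pos ha (ha.trans hab)).ne'
    linear_combination h₁ + l₁ * h3
  subst h4
  have h5 : e₁ = 0 := by
    refine (mul_eq_zero.1 ?_).resolve_left hba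
    linear_combination h3
  subst h5
  simp

/-- The roots of the interpolation polynomial of the `uⱼ` separate the variables: along
`x • E + y • G` the variations are proportional with the factors `x + y (α + lᵢ)`. -/
theorem interp_fieldG_u (hu : u₁ + u₂ + u₃ = 1) (hv : v₁ + v₂ + v₃ = 0) (x y l : ℝ)
    (hU : interp a b u₁ u₂ u₃ l = 0) :
    interp a b
      (x * (2 * v₁) + y * (2 * ((a * u₁ + b * u₂ + a) * v₁ - (a * v₁ + b * v₂) * u₁)))
      (x * (2 * v₂) + y * (2 * ((a * u₁ + b * u₂ + b) * v₂ - (a * v₁ + b * v₂) * u₂)))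
      (x * (2 * v₃) + y * (2 * ((a * u₁ + b * u₂) * v₃ - (a * v₁ + b * v₂) * u₃))) l
      = 2 * (x + y * (a * u₁ + b * u₂ + l)) * interp a b v₁ v₂ v₃ l := by
  have e : ∀ β : ℝ, β * interp a b u₁ u₂ u₃ l = 0 := fun β => by rw [hU, mul_zero]
  obtain rfl : u₃ = 1 - u₁ - u₂ := by linarith
  obtain rfl : v₃ = -v₁ - v₂ := by linarith
  have := e (-2 * y * (a * v₁ + b * v₂))
  simp only [interp] at this ⊢
  linear_combination this

theorem interp_fieldG_v (hu : u₁ + u₂ + u₃ = 1) (x y l e : ℝ)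
    (hU : interp a b u₁ u₂ u₃ l = 0) :
    interp a b
      (x * (z₁ + (a * u₁ + b * u₂ - (z₁ + z₂ + z₃) - a) * u₁)
        + y * ((a * u₁ + b * u₂ + a) * z₁ + (e - a ^ 2 - (z₁ + z₂ + z₃) * a) * u₁))
      (x * (z₂ + (a * u₁ + b * u₂ - (z₁ + z₂ + z₃) - b) * u₂)
        + y * ((a * u₁ + b * u₂ + b) * z₂ + (e - b ^ 2 - (z₁ + z₂ + z₃) * b) * u₂))
      (x * (z₃ + (a * u₁ + b * u₂ - (z₁ + z₂ + z₃)) * u₃)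
        + y * ((a * u₁ + b * u₂) * z₃ + e * u₃)) l
      = (x + y * (a * u₁ + b * u₂ + l))
        * (interp a b z₁ z₂ z₃ l - (a - l) * (b - l) * -l) := by
  have e' : ∀ β : ℝ, β * interp a b u₁ u₂ u₃ l = 0 := fun β => by rw [hU, mul_zero]
  obtain rfl : u₃ = 1 - u₁ - u₂ := by linarith
  have := e' (x * (a * u₁ + b * u₂ - (z₁ + z₂ + z₃) - l) + y * (e - l ^ 2 - (z₁ + z₂ + z₃) * l))
  simp only [interp] at this ⊢
  linear_combination this

theorem spectral_variation (hu : u₁ + u₂ + u₃ = 1) (hv : v₁ + v₂ + v₃ = 0)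
    {du₁ du₂ du₃ dv₁ dv₂ dv₃ dz₁ dz₂ dz₃ : ℝ} (hdu : du₁ + du₂ + du₃ = 0)
    (hdv : dv₁ + dv₂ + dv₃ = 0) (hdE : dz₁ + dz₂ + dz₃ + (a * du₁ + b * du₂) = 0)
    (hdG : a ^ 2 * du₁ + b ^ 2 * du₂ + (dz₁ + dz₂ + dz₃) * (a * u₁ + b * u₂)
      + (z₁ + z₂ + z₃) * (a * du₁ + b * du₂) + (a * dz₁ + b * dz₂) = 0)
    (hD₁ : z₁ * du₁ + u₁ * dz₁ - 2 * v₁ * dv₁ = 0)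
    (hD₂ : z₂ * du₂ + u₂ * dz₂ - 2 * v₂ * dv₂ = 0)
    (hD₃ : z₃ * du₃ + u₃ * dz₃ - 2 * v₃ * dv₃ = 0) (l : ℝ) :
    2 * interp a b v₁ v₂ v₃ l * interp a b dv₁ dv₂ dv₃ l
      - interp a b du₁ du₂ du₃ l * (interp a b z₁ z₂ z₃ l - (a - l) * (b - l) * -l)
      - interp a b u₁ u₂ u₃ l * interp a b dz₁ dz₂ dz₃ l = 0 := by
  obtain rfl : u₃ = 1 - u₁ - u₂ := by linarith
  obtain rfl : v₃ = -v₁ - v₂ := by linarith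
  obtain rfl : du₃ = -du₁ - du₂ := by linarith
  obtain rfl : dv₃ = -dv₁ - dv₂ := by linarith
  simp only [interp]
  linear_combination -(((b - l) * l) ^ 2 * hD₁ + ((a - l) * l) ^ 2 * hD₂
    + ((a - l) * (b - l)) ^ 2 * hD₃) + (a - l) * (b - l) * -l * (l * (hdE - hD₁ - hD₂ - hD₃)
    - (a + b) * (hdE - hD₁ - hD₂ - hD₃) + (hdG - 2 * (a * hD₁ + b * hD₂)))

/-- The variations of a state with three blocks that preserve all integrals. -/
theorem exists_variation_three_blocks (hu : u₁ + u₂ + u₃ = 1) (hv : v₁ + v₂ + v₃ = 0)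
    (hu₁ : 0 < u₁) (hu₂ : 0 < u₂) (hu₃ : 0 < u₃) (ha : 0 < a) (hab : a < b)
    (hncz : ∀ l, interp a b u₁ u₂ u₃ l = 0 → interp a b v₁ v₂ v₃ l = 0 →
      interp a b z₁ z₂ z₃ l - (a - l) * (b - l) * -l = 0 → False)
    {du₁ du₂ du₃ dv₁ dv₂ dv₃ dz₁ dz₂ dz₃ : ℝ} (hdu : du₁ + du₂ + du₃ = 0)
    (hdv : dv₁ + dv₂ + dv₃ = 0) (hdE : dz₁ + dz₂ + dz₃ + (a * du₁ + b * du₂) = 0)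
    (hdG : a ^ 2 * du₁ + b ^ 2 * du₂ + (dz₁ + dz₂ + dz₃) * (a * u₁ + b * u₂)
      + (z₁ + z₂ + z₃) * (a * du₁ + b * du₂) + (a * dz₁ + b * dz₂) = 0)
    (hD₁ : z₁ * du₁ + u₁ * dz₁ - 2 * v₁ * dv₁ = 0)
    (hD₂ : z₂ * du₂ + u₂ * dz₂ - 2 * v₂ * dv₂ = 0)
    (hD₃ : z₃ * du₃ + u₃ * dz₃ - 2 * v₃ * dv₃ = 0) {e : ℝ}
    (he : e = a ^ 2 * u₁ + b ^ 2 * u₂ - (a * z₁ + b * z₂)) :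
    ∃ x y,
      du₁ = x * (2 * v₁) + y * (2 * ((a * u₁ + b * u₂ + a) * v₁ - (a * v₁ + b * v₂) * u₁)) ∧
      du₂ = x * (2 * v₂) + y * (2 * ((a * u₁ + b * u₂ + b) * v₂ - (a * v₁ + b * v₂) * u₂)) ∧
      du₃ = x * (2 * v₃) + y * (2 * ((a * u₁ + b * u₂) * v₃ - (a * v₁ + b * v₂) * u₃)) ∧
      dv₁ = x * (z₁ + (a * u₁ + b * u₂ - (z₁ + z₂ + z₃) - a) * u₁)
        + y * ((a * u₁ + b * u₂ + a) * z₁ + (e - a ^ 2 - (z₁ + z₂ + z₃) * a) * u₁) ∧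
      dv₂ = x * (z₂ + (a * u₁ + b * u₂ - (z₁ + z₂ + z₃) - b) * u₂)
        + y * ((a * u₁ + b * u₂ + b) * z₂ + (e - b ^ 2 - (z₁ + z₂ + z₃) * b) * u₂) ∧
      dv₃ = x * (z₃ + (a * u₁ + b * u₂ - (z₁ + z₂ + z₃)) * u₃)
        + y * ((a * u₁ + b * u₂) * z₃ + e * u₃) := by
  obtain ⟨l₁, l₂, hl, hU₁, hU₂⟩ := exists_roots hu₁ hu₂ hu₃ ha hab
  have key : ∀ l, interp a b u₁ u₂ u₃ l = 0 → ∃ t,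
      interp a b du₁ du₂ du₃ l = t * (2 * interp a b v₁ v₂ v₃ l) ∧ interp a b dv₁ dv₂ dv₃ l
        = t * (interp a b z₁ z₂ z₃ l - (a - l) * (b - l) * -l) := fun l hU => by
    have h := spectral_variation hu hv hdu hdv hdE hdG hD₁ hD₂ hD₃ l
    rw [hU] at h
    exact exists_smul_of_mul_eq_mul (by linarith) fun h => hncz l hU (by linarith [h.1]) h.2
  obtain ⟨t₁, e₁, f₁⟩ := key l₁ hU₁
  obtain ⟨t₂, e₂, f₂⟩ := key l₂ hU₂
  have hl' : l₁ - l₂ ≠ 0 := sub_ne_zero.2 hl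
  obtain ⟨y, hy⟩ : ∃ y, y = (t₁ - t₂) / (l₁ - l₂) := ⟨_, rfl⟩
  obtain ⟨x, hx⟩ : ∃ x, x = t₁ - y * (a * u₁ + b * u₂ + l₁) := ⟨_, rfl⟩
  have g₁ : x + y * (a * u₁ + b * u₂ + l₁) = t₁ := by rw [hx]; ring
  have g₂ : x + y * (a * u₁ + b * u₂ + l₂) = t₂ := by
    have : y * (l₁ - l₂) = t₁ - t₂ := by rw [hy, div_mul_cancel₀ _ hl']
    linear_combination g₁ - this
  have sub : ∀ p₁ p₂ p₃ q₁ q₂ q₃ l, interp a b (p₁ - q₁) (p₂ - q₂) (p₃ - q₃) l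
      = interp a b p₁ p₂ p₃ l - interp a b q₁ q₂ q₃ l := fun p₁ p₂ p₃ q₁ q₂ q₃ l => by
    simp only [interp]
    ring
  obtain ⟨r₁, r₂, r₃⟩ := eq_zero_of_interp ha hab hl (l₁ := l₁) (l₂ := l₂)
    (e₁ := du₁ - (x * (2 * v₁) + y * (2 * ((a * u₁ + b * u₂ + a) * v₁ - (a * v₁ + b * v₂) * u₁))))
    (e₂ := du₂ - (x * (2 * v₂) + y * (2 * ((a * u₁ + b * u₂ + b) * v₂ - (a * v₁ + b * v₂) * u₂))))
    (e₃ := du₃ - (x * (2 * v₃) + y * (2 * ((a * u₁ + b * u₂) * v₃ - (a * v₁ + b * v₂) * u₃))))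
    (by linear_combination hdu - (2 * x + 2 * y * (a * u₁ + b * u₂)) * hv
          + 2 * y * (a * v₁ + b * v₂) * hu)
    (by rw [sub, interp_fieldG_u hu hv x y _ hU₁, e₁, g₁]; ring)
    (by rw [sub, interp_fieldG_u hu hv x y _ hU₂, e₂, g₂]; ring)
  obtain ⟨s₁, s₂, s₃⟩ := eq_zero_of_interp ha hab hl (l₁ := l₁) (l₂ := l₂)
    (e₁ := dv₁ - (x * (z₁ + (a * u₁ + b * u₂ - (z₁ + z₂ + z₃) - a) * u₁)
        + y * ((a * u₁ + b * u₂ + a) * z₁ + (e - a ^ 2 - (z₁ + z₂ + z₃) * a) * u₁)))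
    (e₂ := dv₂ - (x * (z₂ + (a * u₁ + b * u₂ - (z₁ + z₂ + z₃) - b) * u₂)
        + y * ((a * u₁ + b * u₂ + b) * z₂ + (e - b ^ 2 - (z₁ + z₂ + z₃) * b) * u₂)))
    (e₃ := dv₃ - (x * (z₃ + (a * u₁ + b * u₂ - (z₁ + z₂ + z₃)) * u₃)
        + y * ((a * u₁ + b * u₂) * z₃ + e * u₃)))
    (by linear_combination hdv - (x * (a * u₁ + b * u₂ - (z₁ + z₂ + z₃)) + y * e) * hu
          - y * he)
    (by rw [sub, interp_fieldG_v hu x y _ e hU₁, f₁, g₁]; ring)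
    (by rw [sub, interp_fieldG_v hu x y _ e hU₂, f₂, g₂]; ring)
  exact ⟨x, y, by linarith, by linarith, by linarith, by linarith, by linarith, by linarith⟩

/-- The two flows of a state with three blocks are independent. -/
theorem eq_zero_of_three_blocks (hu : u₁ + u₂ + u₃ = 1) (hv : v₁ + v₂ + v₃ = 0)
    (hu₁ : 0 < u₁) (hu₂ : 0 < u₂) (hu₃ : 0 < u₃) (ha : 0 < a) (hab : a < b)
    (hncz : ∀ l, interp a b u₁ u₂ u₃ l = 0 → interp a b v₁ v₂ v₃ l = 0 →
      interp a b z₁ z₂ z₃ l - (a - l) * (b - l) * -l = 0 → False) {x y e : ℝ}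
    (r₁ : x * (2 * v₁) + y * (2 * ((a * u₁ + b * u₂ + a) * v₁ - (a * v₁ + b * v₂) * u₁)) = 0)
    (r₂ : x * (2 * v₂) + y * (2 * ((a * u₁ + b * u₂ + b) * v₂ - (a * v₁ + b * v₂) * u₂)) = 0)
    (r₃ : x * (2 * v₃) + y * (2 * ((a * u₁ + b * u₂) * v₃ - (a * v₁ + b * v₂) * u₃)) = 0)
    (s₁ : x * (z₁ + (a * u₁ + b * u₂ - (z₁ + z₂ + z₃) - a) * u₁)
        + y * ((a * u₁ + b * u₂ + a) * z₁ + (e - a ^ 2 - (z₁ + z₂ + z₃) * a) * u₁) = 0)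
    (s₂ : x * (z₂ + (a * u₁ + b * u₂ - (z₁ + z₂ + z₃) - b) * u₂)
        + y * ((a * u₁ + b * u₂ + b) * z₂ + (e - b ^ 2 - (z₁ + z₂ + z₃) * b) * u₂) = 0)
    (s₃ : x * (z₃ + (a * u₁ + b * u₂ - (z₁ + z₂ + z₃)) * u₃)
        + y * ((a * u₁ + b * u₂) * z₃ + e * u₃) = 0) : x = 0 ∧ y = 0 := by
  obtain ⟨l₁, l₂, hl, hU₁, hU₂⟩ := exists_roots hu₁ hu₂ hu₃ ha hab
  have h0 : ∀ l, interp a b 0 0 0 l = 0 := fun l => by simp [interp]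
  have key : ∀ l, interp a b u₁ u₂ u₃ l = 0 → x + y * (a * u₁ + b * u₂ + l) = 0 := fun l hU => by
    have h1 := interp_fieldG_u hu hv x y l hU
    have h2 := interp_fieldG_v (z₁ := z₁) (z₂ := z₂) (z₃ := z₃) hu x y l e hU
    rw [r₁, r₂, r₃, h0] at h1
    rw [s₁, s₂, s₃, h0] at h2
    by_contra h
    exact hncz l hU (by simpa [h] using h1.symm) (by simpa [h] using h2.symm)
  have k₁ := key l₁ hU₁
  have k₂ := key l₂ hU₂
  have hy : y = 0 := by
    refine (mul_eq_zero.1 ?_).resolve_right (sub_ne_zero.2 hl)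
    linear_combination k₁ - k₂
  subst hy
  exact ⟨by linarith, rfl⟩

end GenusTwo

end MagneticSphere

namespace MagneticSphere

variable {n : ℕ} {a : Fin n → ℝ} {S S' S₁ S₂ S₃ : Finset (Fin n)} {x y w : Phase n} {c c₁ c₂ : ℝ}

/-- The Casimir function of the rotations of a block. -/
def casimir (S : Finset (Fin n)) (x : Phase n) : ℝ :=
  blockDot S x.1 x.1 * blockDot S x.2 x.2 - blockDot S x.1 x.2 ^ 2

theorem casimir_eq_sum (S : Finset (Fin n)) (x : Phase n) :
    2 * casimir S x = ∑ i ∈ S, ∑ j ∈ S, ang i j x ^ 2 := by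
  have h : ∀ i j, ang i j x ^ 2 = x.1 i * x.1 i * (x.2 j * x.2 j)
      - 2 * (x.1 i * x.2 i) * (x.1 j * x.2 j) + x.2 i * x.2 i * (x.1 j * x.1 j) := fun i j => by
    rw [ang]; ring
  simp only [h, Finset.sum_add_distrib, Finset.sum_sub_distrib, ← Finset.mul_sum,
    ← Finset.sum_mul, casimir, blockDot]
  ring

theorem casimir_nonneg (S : Finset (Fin n)) (x : Phase n) : 0 ≤ casimir S x := by
  have : 0 ≤ 2 * casimir S x := by
    rw [casimir_eq_sum]
    exact Finset.sum_nonneg fun _ _ => Finset.sum_nonneg fun _ _ => sq_nonneg _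
  linarith

theorem casimir_congr (h : ∀ i ∈ S, ∀ j ∈ S, ang i j x = ang i j y) : casimir S x = casimir S y := by
  have : 2 * casimir S x = 2 * casimir S y := by
    rw [casimir_eq_sum, casimir_eq_sum]
    exact Finset.sum_congr rfl fun i hi => Finset.sum_congr rfl fun j hj => by rw [h i hi j hj]
  linarith

theorem blockDot_pos_of_casimir (h : 0 < casimir S x) : 0 < blockDot S x.1 x.1 := by
  refine lt_of_le_of_ne (blockDot_self_nonneg _) fun h0 => ?_
  rw [casimir, ← h0] at h
  nlinarith [sq_nonneg (blockDot S x.1 x.2)]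

/-- The coordinates are divided into two blocks; `diag a` is equal to `c` on the first of them and
to zero on the second. -/
structure TwoBlocks (S S' : Finset (Fin n)) (a : Fin n → ℝ) (c : ℝ) : Prop where
  disj : Disjoint S S'
  cover : ∀ i, i ∈ S ∨ i ∈ S'
  h₁ : ∀ i ∈ S, a i = c
  h₂ : ∀ i ∈ S', a i = 0

/-- The coordinates are divided into three blocks; `diag a` is equal to `c₁`, `c₂` and zero on
them. -/
structure ThreeBlocks (S₁ S₂ S₃ : Finset (Fin n)) (a : Fin n → ℝ) (c₁ c₂ : ℝ) : Prop where
  disj₁₂ : Disjoint S₁ S₂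
  disj₁₃ : Disjoint S₁ S₃
  disj₂₃ : Disjoint S₂ S₃
  cover : ∀ i, i ∈ S₁ ∨ i ∈ S₂ ∨ i ∈ S₃
  h₁ : ∀ i ∈ S₁, a i = c₁
  h₂ : ∀ i ∈ S₂, a i = c₂
  h₃ : ∀ i ∈ S₃, a i = 0

theorem blockDot_mul (h : ∀ i ∈ S, a i = c) (u v : Fin n → ℝ) :
    blockDot S u (a * v) = c * blockDot S u v := by
  rw [blockDot, blockDot, Finset.mul_sum]
  exact Finset.sum_congr rfl fun j hj => by rw [Pi.mul_apply, h j hj]; ring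

namespace TwoBlocks

theorem dot (h : TwoBlocks S S' a c) (u v : Fin n → ℝ) :
    u ⬝ᵥ v = blockDot S u v + blockDot S' u v := by
  rw [blockDot, blockDot, ← Finset.sum_union h.disj]
  exact Finset.sum_congr (by ext i; simpa using h.cover i) fun _ _ => rfl

theorem dot_mul (h : TwoBlocks S S' a c) (u v : Fin n → ℝ) : u ⬝ᵥ (a * v) = c * blockDot S u v := by
  rw [h.dot, blockDot_mul h.h₁, blockDot_mul h.h₂, zero_mul, add_zero]

end TwoBlocks

namespace ThreeBlocks

theorem dot (h : ThreeBlocks S₁ S₂ S₃ a c₁ c₂) (u v : Fin n → ℝ) :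
    u ⬝ᵥ v = blockDot S₁ u v + blockDot S₂ u v + blockDot S₃ u v := by
  rw [blockDot, blockDot, blockDot, ← Finset.sum_union h.disj₁₂,
    ← Finset.sum_union (Finset.disjoint_union_left.2 ⟨h.disj₁₃, h.disj₂₃⟩)]
  exact Finset.sum_congr (by ext i; simpa [or_assoc] using h.cover i) fun _ _ => rfl

theorem dot_mul (h : ThreeBlocks S₁ S₂ S₃ a c₁ c₂) (u v : Fin n → ℝ) :
    u ⬝ᵥ (a * v) = c₁ * blockDot S₁ u v + c₂ * blockDot S₂ u v := by
  rw [h.dot, blockDot_mul h.h₁, blockDot_mul h.h₂, blockDot_mul h.h₃, zero_mul, add_zero]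

theorem dot_mul_mul (h : ThreeBlocks S₁ S₂ S₃ a c₁ c₂) (u v : Fin n → ℝ) :
    u ⬝ᵥ (a * (a * v)) = c₁ ^ 2 * blockDot S₁ u v + c₂ ^ 2 * blockDot S₂ u v := by
  rw [h.dot_mul, blockDot_mul h.h₁, blockDot_mul h.h₂]
  ring

theorem symm (h : ThreeBlocks S₁ S₂ S₃ a c₁ c₂) : ThreeBlocks S₂ S₁ S₃ a c₂ c₁ :=
  ⟨h.disj₁₂.symm, h.disj₂₃, h.disj₁₃, fun i => by have := h.cover i; tauto, h.h₂, h.h₁, h.h₃⟩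

theorem twoBlocks (h : ThreeBlocks S₁ S₂ S₃ a c c) : TwoBlocks (S₁ ∪ S₂) S₃ a c :=
  ⟨Finset.disjoint_union_left.2 ⟨h.disj₁₃, h.disj₂₃⟩,
    fun i => by have := h.cover i; simpa [or_assoc] using this,
    fun i hi => (Finset.mem_union.1 hi).elim (h.h₁ i) (h.h₂ i), h.h₃⟩

end ThreeBlocks

/-- The state can be continued between the zeros of the spectral polynomial; a condition on the
values of the integrals only. -/
def HasGaps (S₁ S₂ S₃ : Finset (Fin n)) (a : Fin n → ℝ) (c₁ c₂ : ℝ) (x : Phase n) : Prop :=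
  ∃ p q, 0 < p ∧ p < min c₁ c₂ ∧ min c₁ c₂ < q ∧
    0 < spectral c₁ c₂ (neumannE a x) (neumannG a x) (casimir S₁ x) (casimir S₂ x) (casimir S₃ x) p ∧
    0 < spectral c₁ c₂ (neumannE a x) (neumannG a x) (casimir S₁ x) (casimir S₂ x) (casimir S₃ x) q

theorem HasGaps.symm (h : HasGaps S₁ S₂ S₃ a c₁ c₂ x) : HasGaps S₂ S₁ S₃ a c₂ c₁ x := by
  have e : ∀ E G D₁ D₂ D₃ l, spectral c₁ c₂ E G D₁ D₂ D₃ l = spectral c₂ c₁ E G D₂ D₁ D₃ l :=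
    fun E G D₁ D₂ D₃ l => by simp only [spectral]; ring
  obtain ⟨p, q, h⟩ := h
  exact ⟨p, q, by rw [min_comm, ← e, ← e]; exact h⟩

theorem IsSl₂On.gram {p q r : ℝ} (h : IsSl₂On S x w p q r) :
    2 * blockDot S x.1 w.1 = 2 * (p * blockDot S x.1 x.1 + q * blockDot S x.1 x.2) ∧
    blockDot S x.1 w.2 + blockDot S x.2 w.1 = r * blockDot S x.1 x.1 + q * blockDot S x.2 x.2 ∧
    2 * blockDot S x.2 w.2 = 2 * (r * blockDot S x.1 x.2 - p * blockDot S x.2 x.2) := by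
  rw [h.dot₁, h.dot₂, h.dot₁, h.dot₂, blockDot_comm x.2 x.1]
  refine ⟨rfl, by ring, rfl⟩

theorem KillsAng.gram_of_casimir (h : KillsAng S x w) (hD : 0 < casimir S x)
    (h₁ : 2 * blockDot S x.1 w.1 = 0) (h₂ : blockDot S x.1 w.2 + blockDot S x.2 w.1 = 0) :
    ∃ r : ℝ, IsSl₂On S x w (r * -blockDot S x.1 x.2) (r * blockDot S x.1 x.1)
      (r * -blockDot S x.2 x.2) := by
  refine h.isSl₂On hD.ne' (by linarith) h₂ ?_
  have := h.casimir_variation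
  rw [h₁, h₂] at this
  refine (mul_eq_zero.1 ?_).resolve_left (blockDot_pos_of_casimir hD).ne'
  linarith

theorem IsSl₂On.eq_of (h : IsSl₂On S x w (c * -blockDot S x.1 x.2) (c * blockDot S x.1 x.1)
    (c * -blockDot S x.2 x.2)) {i : Fin n} (hi : i ∈ S) :
    w.1 i = c * (fieldBlock S x).1 i ∧ w.2 i = c * (fieldBlock S x).2 i := by
  obtain ⟨h1, h2⟩ := h i hi
  obtain ⟨h3, h4⟩ := fieldBlock_isSl₂On (S := S) (x := x) i hi
  rw [h1, h2, h3, h4]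
  constructor <;> ring

theorem eq_zero_of_fieldBlock (hD : 0 < casimir S x) (hw : ∀ i ∈ S, w.1 i = 0)
    (h : ∀ i ∈ S, w.1 i = c * (fieldBlock S x).1 i) : c = 0 := by
  have h1 := (fieldBlock_isSl₂On (S := S) (x := x)).smul c
  have := (h1.eq_zero (fun i hi => by
    rw [Prod.smul_fst, Pi.smul_apply, smul_eq_mul, ← h i hi, hw i hi]) hD.ne').2
  exact (mul_eq_zero.1 this).resolve_right (blockDot_pos_of_casimir hD).ne'

theorem ThreeBlocks.fderiv_neumannE (h : ThreeBlocks S₁ S₂ S₃ a c₁ c₂) (x w : Phase n) :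
    fderiv ℝ (neumannE a) x w = 2 * blockDot S₁ x.2 w.2 + 2 * blockDot S₂ x.2 w.2
      + 2 * blockDot S₃ x.2 w.2
      + (c₁ * (2 * blockDot S₁ x.1 w.1) + c₂ * (2 * blockDot S₂ x.1 w.1)) := by
  rw [MagneticSphere.fderiv_neumannE, h.dot, dot_mul_comm, h.dot_mul]
  ring

theorem ThreeBlocks.fderiv_neumannG (h : ThreeBlocks S₁ S₂ S₃ a c₁ c₂) (x w : Phase n) :
    fderiv ℝ (neumannG a) x w =
      c₁ ^ 2 * (2 * blockDot S₁ x.1 w.1) + c₂ ^ 2 * (2 * blockDot S₂ x.1 w.1)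
      + (2 * blockDot S₁ x.2 w.2 + 2 * blockDot S₂ x.2 w.2 + 2 * blockDot S₃ x.2 w.2)
        * (c₁ * blockDot S₁ x.1 x.1 + c₂ * blockDot S₂ x.1 x.1)
      + (blockDot S₁ x.2 x.2 + blockDot S₂ x.2 x.2 + blockDot S₃ x.2 x.2)
        * (c₁ * (2 * blockDot S₁ x.1 w.1) + c₂ * (2 * blockDot S₂ x.1 w.1))
      + (c₁ * (2 * blockDot S₁ x.2 w.2) + c₂ * (2 * blockDot S₂ x.2 w.2)) := by
  rw [MagneticSphere.fderiv_neumannG, dot_mul_comm a w.2, dot_mul_comm a w.1 x.1,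
    dot_mul_mul_comm a w.1, h.dot_mul_mul, h.dot x.2 w.2, h.dot x.2 x.2, h.dot_mul, h.dot_mul,
    h.dot_mul]
  ring

theorem ThreeBlocks.neumannE_eq (h : ThreeBlocks S₁ S₂ S₃ a c₁ c₂) (x : Phase n) :
    blockDot S₁ x.2 x.2 + blockDot S₂ x.2 x.2 + blockDot S₃ x.2 x.2
      + (c₁ * blockDot S₁ x.1 x.1 + c₂ * blockDot S₂ x.1 x.1) = neumannE a x := by
  rw [neumannE, h.dot, h.dot_mul]

theorem ThreeBlocks.neumannG_eq (h : ThreeBlocks S₁ S₂ S₃ a c₁ c₂) (x : Phase n) :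
    c₁ ^ 2 * blockDot S₁ x.1 x.1 + c₂ ^ 2 * blockDot S₂ x.1 x.1
      + (blockDot S₁ x.2 x.2 + blockDot S₂ x.2 x.2 + blockDot S₃ x.2 x.2)
        * (c₁ * blockDot S₁ x.1 x.1 + c₂ * blockDot S₂ x.1 x.1)
      + (c₁ * blockDot S₁ x.2 x.2 + c₂ * blockDot S₂ x.2 x.2) = neumannG a x := by
  rw [neumannG, h.dot_mul_mul, h.dot, h.dot_mul, h.dot_mul]

theorem ThreeBlocks.not_common_zero (h : ThreeBlocks S₁ S₂ S₃ a c₁ c₂) (hc₁ : 0 < c₁)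
    (hc : c₁ < c₂) (hx : x ∈ cotangentSphere n) (hD₁ : 0 < casimir S₁ x)
    (hD₃ : 0 < casimir S₃ x) (hgap : HasGaps S₁ S₂ S₃ a c₁ c₂ x) (l : ℝ)
    (hU : interp c₁ c₂ (blockDot S₁ x.1 x.1) (blockDot S₂ x.1 x.1) (blockDot S₃ x.1 x.1) l = 0)
    (hV : interp c₁ c₂ (blockDot S₁ x.1 x.2) (blockDot S₂ x.1 x.2) (blockDot S₃ x.1 x.2) l = 0)
    (hW : interp c₁ c₂ (blockDot S₁ x.2 x.2) (blockDot S₂ x.2 x.2) (blockDot S₃ x.2 x.2) l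
      - (c₁ - l) * (c₂ - l) * -l = 0) : False := by
  obtain ⟨p, q, hp, hpa, haq, hRp, hRq⟩ := hgap
  rw [min_eq_left hc.le] at hpa haq
  obtain ⟨hx₁, hx₂⟩ := mem_cotangentSphere.1 hx
  rw [h.dot] at hx₁ hx₂
  exact MagneticSphere.not_common_zero hx₁ hx₂ hc₁ hc rfl rfl rfl (h.neumannE_eq x) (h.neumannG_eq x)
    hD₁ hD₃ hp hpa haq hRp hRq hU hV hW

theorem ThreeBlocks.span_of_lt (h : ThreeBlocks S₁ S₂ S₃ a c₁ c₂) (hc₁ : 0 < c₁)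
    (hc : c₁ < c₂) (hx : x ∈ cotangentSphere n) (hD₁ : 0 < casimir S₁ x) (hD₂ : 0 < casimir S₂ x)
    (hD₃ : 0 < casimir S₃ x) (hgap : HasGaps S₁ S₂ S₃ a c₁ c₂ x) (hw : w ∈ tangentAt x)
    (hE : fderiv ℝ (neumannE a) x w = 0) (hG : fderiv ℝ (neumannG a) x w = 0)
    (h₁ : KillsAng S₁ x w) (h₂ : KillsAng S₂ x w) (h₃ : KillsAng S₃ x w) :
    ∃ r s t₁ t₂ t₃ : ℝ, w = r • fieldE a x + s • fieldG a x + t₁ • fieldBlock S₁ x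
      + t₂ • fieldBlock S₂ x + t₃ • fieldBlock S₃ x := by
  have hncz := h.not_common_zero hc₁ hc hx hD₁ hD₃ hgap
  obtain ⟨hw₁, hw₂⟩ := mem_tangentAt.1 hw
  obtain ⟨hx₁, hx₂⟩ := mem_cotangentSphere.1 hx
  rw [h.dot] at hx₁ hx₂ hw₁
  rw [h.dot, h.dot] at hw₂
  rw [h.fderiv_neumannE] at hE
  rw [h.fderiv_neumannG] at hG
  have e₁ := h₁.casimir_variation
  have e₂ := h₂.casimir_variation
  have e₃ := h₃.casimir_variation
  obtain ⟨r, s, f₁, f₂, f₃, g₁, g₂, g₃⟩ := exists_variation_three_blocks hx₁ hx₂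
    (blockDot_pos_of_casimir hD₁) (blockDot_pos_of_casimir hD₂) (blockDot_pos_of_casimir hD₃)
    hc₁ hc hncz (by linarith) (by linarith) hE hG e₁ e₂ e₃ rfl
  have hX : ∀ S c, (∀ i ∈ S, a i = c) → KillsAng S x w → 0 < casimir S x →
      2 * blockDot S x.1 w.1 = r * (2 * blockDot S x.1 x.2)
        + s * (2 * ((x.1 ⬝ᵥ (a * x.1) + c) * blockDot S x.1 x.2
          - x.1 ⬝ᵥ (a * x.2) * blockDot S x.1 x.1)) →
      blockDot S x.1 w.2 + blockDot S x.2 w.1 =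
        r * (blockDot S x.2 x.2 + (x.1 ⬝ᵥ (a * x.1) - x.2 ⬝ᵥ x.2 - c) * blockDot S x.1 x.1)
        + s * ((x.1 ⬝ᵥ (a * x.1) + c) * blockDot S x.2 x.2 + (x.1 ⬝ᵥ (a * (a * x.1))
          - x.2 ⬝ᵥ (a * x.2) - c ^ 2 - (x.2 ⬝ᵥ x.2) * c) * blockDot S x.1 x.1) →
      ∃ t : ℝ, ∀ i ∈ S, (w - (r • fieldE a x + s • fieldG a x)).1 i = t * (fieldBlock S x).1 i
        ∧ (w - (r • fieldE a x + s • fieldG a x)).2 i = t * (fieldBlock S x).2 i := by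
    intro S c ha hk hD hu hv
    have hs := ((fieldE_isSl₂On hx ha).smul r).add ((fieldG_isSl₂On hx ha).smul s)
    obtain ⟨i₁, i₂, -⟩ := hs.gram
    have hk' := hk.sub hs.killsAng
    have sub : ∀ u v w : Fin n → ℝ, blockDot S u (v - w) = blockDot S u v - blockDot S u w :=
      fun u v w => by simp [blockDot, mul_sub]
    obtain ⟨t, ht⟩ := hk'.gram_of_casimir hD
      (by rw [Prod.fst_sub, sub, mul_sub, hu, i₁]; ring)
      (by rw [Prod.fst_sub, Prod.snd_sub, sub, sub]; linear_combination hv - i₂)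
    exact ⟨t, fun i hi => ht.eq_of hi⟩
  obtain ⟨t₁, k₁⟩ := hX S₁ c₁ h.h₁ h₁ hD₁ (by rw [f₁, h.dot_mul, h.dot_mul])
    (by rw [g₁, h.dot_mul, h.dot_mul_mul, h.dot_mul, h.dot])
  obtain ⟨t₂, k₂⟩ := hX S₂ c₂ h.h₂ h₂ hD₂ (by rw [f₂, h.dot_mul, h.dot_mul])
    (by rw [g₂, h.dot_mul, h.dot_mul_mul, h.dot_mul, h.dot])
  obtain ⟨t₃, k₃⟩ := hX S₃ 0 h.h₃ h₃ hD₃ (by rw [f₃, h.dot_mul, h.dot_mul]; ring)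
    (by rw [g₃, h.dot_mul, h.dot_mul_mul, h.dot_mul, h.dot]; ring)
  have hsum : w - (r • fieldE a x + s • fieldG a x)
      = t₁ • fieldBlock S₁ x + t₂ • fieldBlock S₂ x + t₃ • fieldBlock S₃ x := by
    refine Prod.ext (funext fun i => ?_) (funext fun i => ?_)
    all_goals
      rcases h.cover i with hi | hi | hi
      · have m₂ := fieldBlock_of_notMem (x := x) (Finset.disjoint_left.1 h.disj₁₂ hi)
        have m₃ := fieldBlock_of_notMem (x := x) (Finset.disjoint_left.1 h.disj₁₃ hi)
        simp [-Prod.fst_sub, -Prod.snd_sub, k₁ i hi, m₂, m₃]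
      · have m₁ := fieldBlock_of_notMem (x := x) (Finset.disjoint_right.1 h.disj₁₂ hi)
        have m₃ := fieldBlock_of_notMem (x := x) (Finset.disjoint_left.1 h.disj₂₃ hi)
        simp [-Prod.fst_sub, -Prod.snd_sub, k₂ i hi, m₁, m₃]
      · have m₁ := fieldBlock_of_notMem (x := x) (Finset.disjoint_right.1 h.disj₁₃ hi)
        have m₂ := fieldBlock_of_notMem (x := x) (Finset.disjoint_right.1 h.disj₂₃ hi)
        simp [-Prod.fst_sub, -Prod.snd_sub, k₃ i hi, m₁, m₂]
  refine ⟨r, s, t₁, t₂, t₃, ?_⟩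
  rw [sub_eq_iff_eq_add] at hsum
  rw [hsum]
  abel

theorem ThreeBlocks.span (h : ThreeBlocks S₁ S₂ S₃ a c₁ c₂) (hc₁ : 0 < c₁) (hc₂ : 0 < c₂)
    (hc : c₁ ≠ c₂) (hx : x ∈ cotangentSphere n) (hD₁ : 0 < casimir S₁ x) (hD₂ : 0 < casimir S₂ x)
    (hD₃ : 0 < casimir S₃ x) (hgap : HasGaps S₁ S₂ S₃ a c₁ c₂ x) (hw : w ∈ tangentAt x)
    (hE : fderiv ℝ (neumannE a) x w = 0) (hG : fderiv ℝ (neumannG a) x w = 0)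
    (h₁ : KillsAng S₁ x w) (h₂ : KillsAng S₂ x w) (h₃ : KillsAng S₃ x w) :
    ∃ r s t₁ t₂ t₃ : ℝ, w = r • fieldE a x + s • fieldG a x + t₁ • fieldBlock S₁ x
      + t₂ • fieldBlock S₂ x + t₃ • fieldBlock S₃ x := by
  rcases lt_or_gt_of_ne hc with hlt | hlt
  · exact h.span_of_lt hc₁ hlt hx hD₁ hD₂ hD₃ hgap hw hE hG h₁ h₂ h₃
  · obtain ⟨r, s, t₂, t₁, t₃, e⟩ :=
      h.symm.span_of_lt hc₂ hlt hx hD₂ hD₁ hD₃ hgap.symm hw hE hG h₂ h₁ h₃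
    exact ⟨r, s, t₁, t₂, t₃, by rw [e]; abel⟩

theorem IsSl₂On.gram_add_block {p q r t : ℝ}
    (h : IsSl₂On S x w (p + t * -blockDot S x.1 x.2) (q + t * blockDot S x.1 x.1)
      (r + t * -blockDot S x.2 x.2)) (hw : ∀ i ∈ S, w.1 i = 0 ∧ w.2 i = 0) :
    p * blockDot S x.1 x.1 + q * blockDot S x.1 x.2 = 0 ∧
    r * blockDot S x.1 x.1 + q * blockDot S x.2 x.2 = 0 := by
  obtain ⟨h1, h2, -⟩ := h.gram
  have e1 : ∀ u, blockDot S u w.1 = 0 := fun u =>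
    Finset.sum_eq_zero fun i hi => by rw [(hw i hi).1, mul_zero]
  have e2 : ∀ u, blockDot S u w.2 = 0 := fun u =>
    Finset.sum_eq_zero fun i hi => by rw [(hw i hi).2, mul_zero]
  rw [e1] at h1
  rw [e1, e2] at h2
  constructor <;> linarith

theorem eq_zero_of_smul_fieldBlock (hD : 0 < casimir S x) (h : c • fieldBlock S x = 0) : c = 0 :=
  eq_zero_of_fieldBlock (S := S) (w := 0) hD (fun _ _ => rfl) fun i _ => by
    have := congrFun (congrArg Prod.fst h) i
    simpa using this.symm

theorem ThreeBlocks.eq_zero_of_lt (h : ThreeBlocks S₁ S₂ S₃ a c₁ c₂) (hc₁ : 0 < c₁)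
    (hc : c₁ < c₂) (hx : x ∈ cotangentSphere n) (hD₁ : 0 < casimir S₁ x) (hD₂ : 0 < casimir S₂ x)
    (hD₃ : 0 < casimir S₃ x) (hgap : HasGaps S₁ S₂ S₃ a c₁ c₂ x) {r s t₁ t₂ t₃ : ℝ}
    (h0 : r • fieldE a x + s • fieldG a x + t₁ • fieldBlock S₁ x + t₂ • fieldBlock S₂ x
      + t₃ • fieldBlock S₃ x = 0) : r = 0 ∧ s = 0 := by
  have hncz := h.not_common_zero hc₁ hc hx hD₁ hD₃ hgap
  obtain ⟨hx₁, hx₂⟩ := mem_cotangentSphere.1 hx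
  rw [h.dot] at hx₁ hx₂
  have k₁ := ((((fieldE_isSl₂On hx h.h₁).smul r).add ((fieldG_isSl₂On hx h.h₁).smul s)).add
    (fieldBlock_isSl₂On.smul t₁)).add ((fieldBlock_isSl₂On_of_disjoint h.disj₁₂).smul t₂)
      |>.add ((fieldBlock_isSl₂On_of_disjoint h.disj₁₃).smul t₃)
  have k₂ := ((((fieldE_isSl₂On hx h.h₂).smul r).add ((fieldG_isSl₂On hx h.h₂).smul s)).add
    ((fieldBlock_isSl₂On_of_disjoint h.disj₁₂.symm).smul t₁)).add (fieldBlock_isSl₂On.smul t₂)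
      |>.add ((fieldBlock_isSl₂On_of_disjoint h.disj₂₃).smul t₃)
  have k₃ := ((((fieldE_isSl₂On hx h.h₃).smul r).add ((fieldG_isSl₂On hx h.h₃).smul s)).add
    ((fieldBlock_isSl₂On_of_disjoint h.disj₁₃.symm).smul t₁)).add
      ((fieldBlock_isSl₂On_of_disjoint h.disj₂₃.symm).smul t₂) |>.add (fieldBlock_isSl₂On.smul t₃)
  simp only [mul_zero, add_zero, h0] at k₁ k₂ k₃
  obtain ⟨r₁, s₁⟩ := k₁.gram_add_block fun _ _ => ⟨rfl, rfl⟩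
  obtain ⟨r₂, s₂⟩ := k₂.gram_add_block fun _ _ => ⟨rfl, rfl⟩
  obtain ⟨r₃, s₃⟩ := k₃.gram_add_block fun _ _ => ⟨rfl, rfl⟩
  rw [h.dot_mul, h.dot_mul] at r₁ r₂ r₃
  rw [h.dot_mul_mul, h.dot_mul, h.dot_mul, h.dot] at s₁ s₂ s₃
  refine eq_zero_of_three_blocks hx₁ hx₂ (blockDot_pos_of_casimir hD₁)
    (blockDot_pos_of_casimir hD₂) (blockDot_pos_of_casimir hD₃) hc₁ hc hncz
    (e := c₁ ^ 2 * blockDot S₁ x.1 x.1 + c₂ ^ 2 * blockDot S₂ x.1 x.1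
      - (c₁ * blockDot S₁ x.2 x.2 + c₂ * blockDot S₂ x.2 x.2)) ?_ ?_ ?_ ?_ ?_ ?_
  · linear_combination 2 * r₁
  · linear_combination 2 * r₂
  · linear_combination 2 * r₃
  · linear_combination s₁
  · linear_combination s₂
  · linear_combination s₃

theorem eq_zero_of_blocks (h₁₂ : Disjoint S₁ S₂) (h₁₃ : Disjoint S₁ S₃) (h₂₃ : Disjoint S₂ S₃)
    (hD₁ : 0 < casimir S₁ x) (hD₂ : 0 < casimir S₂ x) (hD₃ : 0 < casimir S₃ x) {t₁ t₂ t₃ : ℝ}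
    (h0 : t₁ • fieldBlock S₁ x + t₂ • fieldBlock S₂ x + t₃ • fieldBlock S₃ x = 0) :
    t₁ = 0 ∧ t₂ = 0 ∧ t₃ = 0 := by
  have hi : ∀ i, t₁ * (fieldBlock S₁ x).1 i + t₂ * (fieldBlock S₂ x).1 i
      + t₃ * (fieldBlock S₃ x).1 i = 0 := fun i => by
    have := congrFun (congrArg Prod.fst h0) i
    simpa using this
  refine ⟨eq_zero_of_fieldBlock (w := 0) hD₁ (fun _ _ => rfl) fun i hS => ?_,
    eq_zero_of_fieldBlock (w := 0) hD₂ (fun _ _ => rfl) fun i hS => ?_,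
    eq_zero_of_fieldBlock (w := 0) hD₃ (fun _ _ => rfl) fun i hS => ?_⟩
  · have := hi i
    rw [(fieldBlock_of_notMem (Finset.disjoint_left.1 h₁₂ hS)).1,
      (fieldBlock_of_notMem (Finset.disjoint_left.1 h₁₃ hS)).1] at this
    change 0 = _
    linarith
  · have := hi i
    rw [(fieldBlock_of_notMem (Finset.disjoint_right.1 h₁₂ hS)).1,
      (fieldBlock_of_notMem (Finset.disjoint_left.1 h₂₃ hS)).1] at this
    change 0 = _
    linarith
  · have := hi i
    rw [(fieldBlock_of_notMem (Finset.disjoint_right.1 h₁₃ hS)).1,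
      (fieldBlock_of_notMem (Finset.disjoint_right.1 h₂₃ hS)).1] at this
    change 0 = _
    linarith

theorem ThreeBlocks.eq_zero (h : ThreeBlocks S₁ S₂ S₃ a c₁ c₂) (hc₁ : 0 < c₁) (hc₂ : 0 < c₂)
    (hc : c₁ ≠ c₂) (hx : x ∈ cotangentSphere n) (hD₁ : 0 < casimir S₁ x) (hD₂ : 0 < casimir S₂ x)
    (hD₃ : 0 < casimir S₃ x) (hgap : HasGaps S₁ S₂ S₃ a c₁ c₂ x) {r s t₁ t₂ t₃ : ℝ}
    (h0 : r • fieldE a x + s • fieldG a x + t₁ • fieldBlock S₁ x + t₂ • fieldBlock S₂ x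
      + t₃ • fieldBlock S₃ x = 0) : r = 0 ∧ s = 0 ∧ t₁ = 0 ∧ t₂ = 0 ∧ t₃ = 0 := by
  have hrs : r = 0 ∧ s = 0 := by
    rcases lt_or_gt_of_ne hc with hlt | hlt
    · exact h.eq_zero_of_lt hc₁ hlt hx hD₁ hD₂ hD₃ hgap h0
    · exact h.symm.eq_zero_of_lt hc₂ hlt hx hD₂ hD₁ hD₃ hgap.symm
        (t₁ := t₂) (t₂ := t₁) (t₃ := t₃) (by rw [← h0]; abel)
  obtain ⟨rfl, rfl⟩ := hrs
  refine ⟨rfl, rfl, eq_zero_of_blocks h.disj₁₂ h.disj₁₃ h.disj₂₃ hD₁ hD₂ hD₃ ?_⟩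
  simpa using h0

/-! Two blocks. -/

/-- The reduced energy of a state with two blocks lies above its minimum; a condition on the values
of the integrals only. -/
def AboveMin (S S' : Finset (Fin n)) (a : Fin n → ℝ) (c : ℝ) (x : Phase n) : Prop :=
  ∃ t, 0 < t ∧ t < 1 ∧ casimir S x / t + casimir S' x / (1 - t) + c * t < neumannE a x

theorem blockDot_sub (S : Finset (Fin n)) (u v w : Fin n → ℝ) :
    blockDot S u (v - w) = blockDot S u v - blockDot S u w := by
  simp [blockDot, mul_sub]

/-- The variation `w` does not change the Gram matrix of `γ` and `P` on the block `S`. -/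
structure KillsGram (S : Finset (Fin n)) (x w : Phase n) : Prop where
  h₁ : 2 * blockDot S x.1 w.1 = 0
  h₂ : blockDot S x.1 w.2 + blockDot S x.2 w.1 = 0
  h₃ : 2 * blockDot S x.2 w.2 = 0

theorem KillsGram.rotation (h : KillsGram S x w) (hk : KillsAng S x w)
    (hD : 0 < casimir S x) : ∃ t : ℝ, ∀ i ∈ S,
      w.1 i = t * (fieldBlock S x).1 i ∧ w.2 i = t * (fieldBlock S x).2 i := by
  obtain ⟨t, ht⟩ := hk.gram_of_casimir hD h.h₁ h.h₂
  exact ⟨t, fun i hi => ht.eq_of hi⟩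

namespace TwoBlocks

theorem fderiv_neumannE (h : TwoBlocks S S' a c) (x w : Phase n) :
    fderiv ℝ (neumannE a) x w = 2 * blockDot S x.2 w.2 + 2 * blockDot S' x.2 w.2
      + c * (2 * blockDot S x.1 w.1) := by
  rw [MagneticSphere.fderiv_neumannE, h.dot, dot_mul_comm, h.dot_mul]
  ring

theorem neumannE_eq (h : TwoBlocks S S' a c) (x : Phase n) :
    neumannE a x = blockDot S x.2 x.2 + blockDot S' x.2 x.2 + c * blockDot S x.1 x.1 := by
  rw [neumannE, h.dot, h.dot_mul]

theorem not_stationary (h : TwoBlocks S S' a c) (hx : x ∈ cotangentSphere n)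
    (hD : 0 < casimir S x) (hD' : 0 < casimir S' x) (hmin : AboveMin S S' a c x) :
    ¬(blockDot S x.1 x.2 = 0 ∧ blockDot S x.2 x.2 + (c * blockDot S x.1 x.1 - blockDot S x.2 x.2
      - blockDot S' x.2 x.2 - c) * blockDot S x.1 x.1 = 0) := by
  obtain ⟨t, ht, ht', hE⟩ := hmin
  obtain ⟨hx₁, hx₂⟩ := mem_cotangentSphere.1 hx
  rw [h.dot] at hx₁ hx₂
  rw [h.neumannE_eq] at hE
  exact MagneticSphere.not_stationary hx₁ (blockDot_pos_of_casimir hD) (blockDot_pos_of_casimir hD')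
    (blockDot_self_nonneg _) (blockDot_self_nonneg _) ht ht' hE hx₂

theorem fieldE_isSl₂On₁ (h : TwoBlocks S S' a c) (hx : x ∈ cotangentSphere n) :
    IsSl₂On S x (fieldE a x) 0 1
      (c * blockDot S x.1 x.1 - blockDot S x.2 x.2 - blockDot S' x.2 x.2 - c) := by
  have := fieldE_isSl₂On hx h.h₁
  rw [h.dot_mul, h.dot] at this
  rwa [← sub_sub] at this

theorem fieldE_isSl₂On₂ (h : TwoBlocks S S' a c) (hx : x ∈ cotangentSphere n) :
    IsSl₂On S' x (fieldE a x) 0 1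
      (c * blockDot S x.1 x.1 - blockDot S x.2 x.2 - blockDot S' x.2 x.2) := by
  have := fieldE_isSl₂On hx h.h₂
  rw [h.dot_mul, h.dot, sub_zero] at this
  rwa [← sub_sub] at this

/-- Variations that preserve the energy and the Casimir functions of two blocks. -/
theorem exists_killsGram (h : TwoBlocks S S' a c) (hx : x ∈ cotangentSphere n)
    (hD : 0 < casimir S x) (hD' : 0 < casimir S' x) (hmin : AboveMin S S' a c x)
    (hw : w ∈ tangentAt x) (hE : fderiv ℝ (neumannE a) x w = 0)
    (hC : blockDot S x.2 x.2 * (2 * blockDot S x.1 w.1)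
      + blockDot S x.1 x.1 * (2 * blockDot S x.2 w.2)
      - 2 * blockDot S x.1 x.2 * (blockDot S x.1 w.2 + blockDot S x.2 w.1) = 0)
    (h' : KillsAng S' x w) :
    ∃ r : ℝ, KillsGram S x (w - r • fieldE a x) ∧ KillsGram S' x (w - r • fieldE a x) := by
  have hns := h.not_stationary hx hD hD' hmin
  obtain ⟨hw₁, hw₂⟩ := mem_tangentAt.1 hw
  obtain ⟨hx₁, hx₂⟩ := mem_cotangentSphere.1 hx
  rw [h.dot] at hx₁ hx₂ hw₁
  rw [h.dot, h.dot] at hw₂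
  rw [h.fderiv_neumannE] at hE
  obtain ⟨r, e₁, e₂, e₃, f₁, f₂, f₃⟩ := exists_variation_two_blocks hx₁ hx₂
    (blockDot_pos_of_casimir hD) (blockDot_pos_of_casimir hD') hns (by linarith) (by linarith) hE hC
    h'.casimir_variation
  obtain ⟨g₁, g₂, g₃⟩ := ((h.fieldE_isSl₂On₁ hx).smul r).gram
  obtain ⟨g₁', g₂', g₃'⟩ := ((h.fieldE_isSl₂On₂ hx).smul r).gram
  refine ⟨r, ⟨?_, ?_, ?_⟩, ⟨?_, ?_, ?_⟩⟩ <;>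
    simp only [Prod.fst_sub, Prod.snd_sub, blockDot_sub]
  · linear_combination e₁ - g₁
  · linear_combination e₂ - g₂
  · linear_combination e₃ - g₃
  · linear_combination f₁ - g₁'
  · linear_combination f₂ - g₂'
  · linear_combination f₃ - g₃'

theorem eq_of_blocks (h : TwoBlocks S S' a c) {v : Phase n}
    (h₁ : ∀ i ∈ S, w.1 i = v.1 i ∧ w.2 i = v.2 i) (h₂ : ∀ i ∈ S', w.1 i = v.1 i ∧ w.2 i = v.2 i) :
    w = v := by
  refine Prod.ext (funext fun i => ?_) (funext fun i => ?_) <;> rcases h.cover i with hi | hi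
  exacts [(h₁ i hi).1, (h₂ i hi).1, (h₁ i hi).2, (h₂ i hi).2]

theorem span (h : TwoBlocks S S' a c) (hx : x ∈ cotangentSphere n)
    (hD : 0 < casimir S x) (hD' : 0 < casimir S' x) (hmin : AboveMin S S' a c x)
    (hw : w ∈ tangentAt x) (hE : fderiv ℝ (neumannE a) x w = 0) (hk : KillsAng S x w)
    (hk' : KillsAng S' x w) :
    ∃ r t t' : ℝ, w = r • fieldE a x + t • fieldBlock S x + t' • fieldBlock S' x := by
  obtain ⟨r, h₁, h₂⟩ := h.exists_killsGram hx hD hD' hmin hw hE hk.casimir_variation hk'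
  obtain ⟨t, e₁⟩ := h₁.rotation (hk.sub ((h.fieldE_isSl₂On₁ hx).killsAng.smul r)) hD
  obtain ⟨t', e₂⟩ := h₂.rotation (hk'.sub ((h.fieldE_isSl₂On₂ hx).killsAng.smul r)) hD'
  refine ⟨r, t, t', ?_⟩
  have : w - r • fieldE a x = t • fieldBlock S x + t' • fieldBlock S' x := by
    refine h.eq_of_blocks (fun i hi => ?_) fun i hi => ?_
    · rw [(e₁ i hi).1, (e₁ i hi).2]
      simp [fieldBlock_of_notMem (x := x) (Finset.disjoint_left.1 h.disj hi)]
    · rw [(e₂ i hi).1, (e₂ i hi).2]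
      simp [fieldBlock_of_notMem (x := x) (Finset.disjoint_right.1 h.disj hi)]
  rw [add_assoc, ← this]
  abel

/-- A multiple of the energy field that is a rotation on the second block vanishes. -/
theorem eq_zero_of_fieldE (h : TwoBlocks S S' a c) (hx : x ∈ cotangentSphere n)
    (hD : 0 < casimir S x) (hD' : 0 < casimir S' x) (hmin : AboveMin S S' a c x) {r t : ℝ}
    (h0 : ∀ i ∈ S', (r • fieldE a x + t • fieldBlock S' x).1 i = 0
      ∧ (r • fieldE a x + t • fieldBlock S' x).2 i = 0) : r = 0 := by
  have hns := h.not_stationary hx hD hD' hmin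
  obtain ⟨hx₁, hx₂⟩ := mem_cotangentSphere.1 hx
  rw [h.dot] at hx₁ hx₂
  obtain ⟨e₁, e₂⟩ := (((h.fieldE_isSl₂On₂ hx).smul r).add
    (fieldBlock_isSl₂On.smul t)).gram_add_block h0
  by_contra hr
  refine hns ⟨mul_left_cancel₀ hr ?_, mul_left_cancel₀ hr ?_⟩
  · linear_combination r * hx₂ - e₁
  · linear_combination -e₂ + r * (c * blockDot S x.1 x.1 - blockDot S x.2 x.2
      - blockDot S' x.2 x.2) * hx₁

theorem eq_zero (h : TwoBlocks S S' a c) (hx : x ∈ cotangentSphere n)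
    (hD : 0 < casimir S x) (hD' : 0 < casimir S' x) (hmin : AboveMin S S' a c x) {r t t' : ℝ}
    (h0 : r • fieldE a x + t • fieldBlock S x + t' • fieldBlock S' x = 0) :
    r = 0 ∧ t = 0 ∧ t' = 0 := by
  have hr : r = 0 := by
    refine h.eq_zero_of_fieldE hx hD hD' hmin (t := t') fun i hi => ?_
    have m := fieldBlock_of_notMem (x := x) (Finset.disjoint_right.1 h.disj hi)
    have e1 := congrFun (congrArg Prod.fst h0) i
    have e2 := congrFun (congrArg Prod.snd h0) i
    simp only [Prod.fst_add, Prod.snd_add, Prod.smul_fst, Prod.smul_snd, Pi.add_apply,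
      Pi.smul_apply, m.1, m.2, smul_zero, add_zero, Prod.fst_zero, Prod.snd_zero,
      Pi.zero_apply] at e1 e2 ⊢
    exact ⟨e1, e2⟩
  subst hr
  rw [zero_smul, zero_add] at h0
  have hi := fun i => congrFun (congrArg Prod.fst h0) i
  simp only [Prod.fst_add, Prod.smul_fst, Pi.add_apply, Pi.smul_apply, smul_eq_mul, Prod.fst_zero,
    Pi.zero_apply] at hi
  refine ⟨rfl, eq_zero_of_fieldBlock (w := 0) hD (fun _ _ => rfl) fun i hS => ?_,
    eq_zero_of_fieldBlock (w := 0) hD' (fun _ _ => rfl) fun i hS => ?_⟩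
  · have := hi i
    rw [(fieldBlock_of_notMem (Finset.disjoint_left.1 h.disj hS)).1, mul_zero, add_zero] at this
    exact this.symm
  · have := hi i
    rw [(fieldBlock_of_notMem (Finset.disjoint_right.1 h.disj hS)).1, mul_zero, zero_add] at this
    exact this.symm

end TwoBlocks

theorem IsSl₂On.congr {v : Phase n} {p q r p' q' r' : ℝ} (h : IsSl₂On S x w p q r)
    (h' : IsSl₂On S x v p' q' r') (hp : p = p') (hq : q = q') (hr : r = r') :
    ∀ i ∈ S, w.1 i = v.1 i ∧ w.2 i = v.2 i := fun i hi => by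
  rw [(h i hi).1, (h i hi).2, (h' i hi).1, (h' i hi).2, hp, hq, hr]
  exact ⟨rfl, rfl⟩

theorem blockDot_union (h : Disjoint S₁ S₂) (u v : Fin n → ℝ) :
    blockDot (S₁ ∪ S₂) u v = blockDot S₁ u v + blockDot S₂ u v :=
  Finset.sum_union h

namespace TwoBlocks

theorem fieldG_isSl₂On₁ (h : TwoBlocks S S' a c) (hx : x ∈ cotangentSphere n) :
    IsSl₂On S x (fieldG a x) (-(c * blockDot S x.1 x.2)) (c * blockDot S x.1 x.1 + c)
      (c * (c * blockDot S x.1 x.1) - c * blockDot S x.2 x.2 - c ^ 2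
        - (blockDot S x.2 x.2 + blockDot S' x.2 x.2) * c) := by
  have := fieldG_isSl₂On hx h.h₁
  rwa [h.dot_mul, h.dot_mul, h.dot_mul, blockDot_mul h.h₁, h.dot_mul, h.dot] at this

theorem fieldG_isSl₂On₂ (h : TwoBlocks S S' a c) (hx : x ∈ cotangentSphere n) :
    IsSl₂On S' x (fieldG a x) (-(c * blockDot S x.1 x.2)) (c * blockDot S x.1 x.1)
      (c * (c * blockDot S x.1 x.1) - c * blockDot S x.2 x.2) := by
  have := fieldG_isSl₂On hx h.h₂
  rw [h.dot_mul, h.dot_mul, h.dot_mul, blockDot_mul h.h₁, h.dot_mul] at this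
  simpa using this

/-- With two blocks the second field reduces to the first one and to rotations. -/
theorem fieldG_eq (h : TwoBlocks S S' a c) (hx : x ∈ cotangentSphere n) :
    fieldG a x = c • fieldE a x + c • fieldBlock S x + (-c) • fieldBlock S' x := by
  obtain ⟨hx₁, hx₂⟩ := mem_cotangentSphere.1 hx
  rw [h.dot] at hx₁ hx₂
  refine h.eq_of_blocks ?_ ?_
  · refine (h.fieldG_isSl₂On₁ hx).congr ((((h.fieldE_isSl₂On₁ hx).smul c).add
      (fieldBlock_isSl₂On.smul c)).add ((fieldBlock_isSl₂On_of_disjoint h.disj).smul (-c))) ?_ ?_ ?_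
    all_goals ring
  · refine (h.fieldG_isSl₂On₂ hx).congr ((((h.fieldE_isSl₂On₂ hx).smul c).add
      ((fieldBlock_isSl₂On_of_disjoint h.disj.symm).smul c)).add
      (fieldBlock_isSl₂On.smul (-c))) ?_ ?_ ?_
    · linear_combination -c * hx₂
    · linear_combination c * hx₁
    · ring

theorem fderiv_neumannG (h : TwoBlocks S S' a c) (x w : Phase n) :
    fderiv ℝ (neumannG a) x w = c ^ 2 * (2 * blockDot S x.1 w.1)
      + (2 * blockDot S x.2 w.2 + 2 * blockDot S' x.2 w.2) * (c * blockDot S x.1 x.1)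
      + (blockDot S x.2 x.2 + blockDot S' x.2 x.2) * (c * (2 * blockDot S x.1 w.1))
      + c * (2 * blockDot S x.2 w.2) := by
  rw [MagneticSphere.fderiv_neumannG, dot_mul_comm a w.2, dot_mul_comm a w.1 x.1,
    dot_mul_mul_comm a w.1, h.dot_mul x.1 (a * w.1), blockDot_mul h.h₁, h.dot x.2 w.2,
    h.dot x.2 x.2, h.dot_mul, h.dot_mul, h.dot_mul]
  ring

theorem neumannG_eq (h : TwoBlocks S S' a c) (hx : x ∈ cotangentSphere n) :
    neumannG a x = c * neumannE a x + c * (casimir S x - casimir S' x) := by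
  obtain ⟨hx₁, hx₂⟩ := mem_cotangentSphere.1 hx
  rw [h.dot] at hx₁ hx₂
  rw [h.neumannE_eq, neumannG, h.dot_mul x.1 (a * x.1), blockDot_mul h.h₁, h.dot x.2 x.2, h.dot_mul,
    h.dot_mul, casimir, casimir]
  linear_combination c * blockDot S' x.2 x.2 * hx₁
    + c * (blockDot S x.1 x.2 - blockDot S' x.1 x.2) * hx₂

/-- The differential of `neumannG` on the phase space, for two blocks. -/
theorem fderiv_neumannG_eq (h : TwoBlocks S S' a c) (hx : x ∈ cotangentSphere n)
    (hw : w ∈ tangentAt x) :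
    fderiv ℝ (neumannG a) x w = c * fderiv ℝ (neumannE a) x w
      + c * ((blockDot S x.2 x.2 * (2 * blockDot S x.1 w.1)
          + blockDot S x.1 x.1 * (2 * blockDot S x.2 w.2)
          - 2 * blockDot S x.1 x.2 * (blockDot S x.1 w.2 + blockDot S x.2 w.1))
        - (blockDot S' x.2 x.2 * (2 * blockDot S' x.1 w.1)
          + blockDot S' x.1 x.1 * (2 * blockDot S' x.2 w.2)
          - 2 * blockDot S' x.1 x.2 * (blockDot S' x.1 w.2 + blockDot S' x.2 w.1))) := by
  obtain ⟨hx₁, hx₂⟩ := mem_cotangentSphere.1 hx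
  obtain ⟨hw₁, hw₂⟩ := mem_tangentAt.1 hw
  rw [h.dot] at hx₁ hx₂ hw₁
  rw [h.dot, h.dot] at hw₂
  rw [h.fderiv_neumannE, h.fderiv_neumannG]
  linear_combination 2 * c * blockDot S' x.2 x.2 * hw₁ + 2 * c * blockDot S' x.2 w.2 * hx₁
    + 2 * c * blockDot S x.1 x.2 * hw₂
    - 2 * c * (blockDot S' x.1 w.2 + blockDot S' x.2 w.1) * hx₂

theorem casimir_variation (h : TwoBlocks S S' a c) (hc : 0 < c) (hx : x ∈ cotangentSphere n)
    (hw : w ∈ tangentAt x) (hE : fderiv ℝ (neumannE a) x w = 0)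
    (hG : fderiv ℝ (neumannG a) x w = 0) (hk : KillsAng S' x w) :
    blockDot S x.2 x.2 * (2 * blockDot S x.1 w.1)
      + blockDot S x.1 x.1 * (2 * blockDot S x.2 w.2)
      - 2 * blockDot S x.1 x.2 * (blockDot S x.1 w.2 + blockDot S x.2 w.1) = 0 := by
  rw [h.fderiv_neumannG_eq hx hw, hE, hk.casimir_variation, mul_zero, zero_add, sub_zero] at hG
  exact (mul_eq_zero.1 hG).resolve_left hc.ne'

end TwoBlocks

theorem casimir_union (h : Disjoint S₁ S₂) (x : Phase n) :
    casimir (S₁ ∪ S₂) x = casimir S₁ x + casimir S₂ x + (blockDot S₁ x.1 x.1 * blockDot S₂ x.2 x.2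
      + blockDot S₂ x.1 x.1 * blockDot S₁ x.2 x.2
      - 2 * blockDot S₁ x.1 x.2 * blockDot S₂ x.1 x.2) := by
  rw [casimir, blockDot_union h, blockDot_union h, blockDot_union h, casimir, casimir]
  ring

/-- The Gram matrices of two blocks are not proportional. -/
theorem not_proportional {u₁ v₁ z₁ u₂ v₂ z₂ D₁ D₂ : ℝ} (hu₁ : 0 < u₁)
    (hD₁ : u₁ * z₁ - v₁ ^ 2 = D₁) (hD₂ : u₂ * z₂ - v₂ ^ 2 = D₂)
    (h : (u₁ * z₂ + u₂ * z₁ - 2 * v₁ * v₂) ^ 2 ≠ 4 * D₁ * D₂) :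
    ¬(2 * (u₂ * v₁ - v₂ * u₁) = 0 ∧ u₂ * z₁ - z₂ * u₁ = 0) := by
  rintro ⟨h1, h2⟩
  obtain ⟨k, rfl⟩ : ∃ k, u₂ = k * u₁ := ⟨u₂ / u₁, by field_simp⟩
  have e1 : v₂ = k * v₁ := mul_left_cancel₀ hu₁.ne' (by linarith)
  have e2 : z₂ = k * z₁ := mul_left_cancel₀ hu₁.ne' (by linarith)
  subst e1 e2
  exact h (by rw [← hD₁, ← hD₂]; ring)

theorem ThreeBlocks.union_pos (h : ThreeBlocks S₁ S₂ S₃ a c c) (hD₁ : 0 < casimir S₁ x) :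
    0 < casimir (S₁ ∪ S₂) x := by
  have h1 : 2 * casimir S₁ x ≤ 2 * casimir (S₁ ∪ S₂) x := by
    rw [casimir_eq_sum, casimir_eq_sum, Finset.sum_union h.disj₁₂]
    have : ∀ i, ∑ j ∈ S₁, ang i j x ^ 2 ≤ ∑ j ∈ S₁ ∪ S₂, ang i j x ^ 2 := fun i =>
      Finset.sum_le_sum_of_subset_of_nonneg Finset.subset_union_left fun _ _ _ => sq_nonneg _
    have h2 : 0 ≤ ∑ i ∈ S₂, ∑ j ∈ S₁ ∪ S₂, ang i j x ^ 2 :=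
      Finset.sum_nonneg fun _ _ => Finset.sum_nonneg fun _ _ => sq_nonneg _
    linarith [Finset.sum_le_sum fun i (_ : i ∈ S₁) => this i]
  linarith

theorem ThreeBlocks.nonparallel (h : ThreeBlocks S₁ S₂ S₃ a c c) (hD₁ : 0 < casimir S₁ x)
    (hpol : (casimir (S₁ ∪ S₂) x - casimir S₁ x - casimir S₂ x) ^ 2
      ≠ 4 * casimir S₁ x * casimir S₂ x) :
    ¬(2 * (blockDot S₂ x.1 x.1 * blockDot S₁ x.1 x.2 - blockDot S₂ x.1 x.2 * blockDot S₁ x.1 x.1) = 0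
      ∧ blockDot S₂ x.1 x.1 * blockDot S₁ x.2 x.2 - blockDot S₂ x.2 x.2 * blockDot S₁ x.1 x.1 = 0) := by
  refine not_proportional (blockDot_pos_of_casimir hD₁) rfl rfl fun h0 => hpol ?_
  rw [casimir_union h.disj₁₂]
  rw [casimir, casimir, ← h0]
  ring

theorem IsSl₂On.mono {p q r : ℝ} (h : IsSl₂On S x w p q r) (hS : S₁ ⊆ S) :
    IsSl₂On S₁ x w p q r := fun i hi => h i (hS hi)

theorem ThreeBlocks.span_of_eq (h : ThreeBlocks S₁ S₂ S₃ a c c) (hc : 0 < c)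
    (hx : x ∈ cotangentSphere n) (hD₁ : 0 < casimir S₁ x) (hD₂ : 0 < casimir S₂ x)
    (hD₃ : 0 < casimir S₃ x) (hmin : AboveMin (S₁ ∪ S₂) S₃ a c x)
    (hpol : (casimir (S₁ ∪ S₂) x - casimir S₁ x - casimir S₂ x) ^ 2
      ≠ 4 * casimir S₁ x * casimir S₂ x) (hw : w ∈ tangentAt x)
    (hE : fderiv ℝ (neumannE a) x w = 0) (hG : fderiv ℝ (neumannG a) x w = 0)
    (h₁ : KillsAng S₁ x w) (h₂ : KillsAng S₂ x w) (h₃ : KillsAng S₃ x w) :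
    ∃ r s t₁ t₂ t₃ : ℝ, w = r • fieldE a x + s • fieldG a x + t₁ • fieldBlock S₁ x
      + t₂ • fieldBlock S₂ x + t₃ • fieldBlock S₃ x := by
  have hT := h.twoBlocks
  have hD := h.union_pos hD₁
  obtain ⟨r, k, k'⟩ := hT.exists_killsGram hx hD hD₃ hmin hw hE
    (hT.casimir_variation hc hx hw hE hG h₃) h₃
  have hX₁ := (hT.fieldE_isSl₂On₁ hx).mono Finset.subset_union_left
  have hX₂ := (hT.fieldE_isSl₂On₁ hx).mono Finset.subset_union_right
  have m₁ := h₁.sub (hX₁.killsAng.smul r)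
  have m₂ := h₂.sub (hX₂.killsAng.smul r)
  have m₃ := h₃.sub ((hT.fieldE_isSl₂On₂ hx).killsAng.smul r)
  set w' := w - r • fieldE a x with hw'
  obtain ⟨g₁, g₂, g₃⟩ := k
  simp only [blockDot_union h.disj₁₂] at g₁ g₂ g₃
  have n₁ := m₁.casimir_variation
  have n₂ := m₂.casimir_variation
  obtain ⟨t, e₁, e₂⟩ := exists_smul_of_mul_eq_mul
    (r := 2 * blockDot S₁ x.1 w'.1) (t := blockDot S₁ x.1 w'.2 + blockDot S₁ x.2 w'.1)
    (by linear_combination blockDot S₁ x.1 x.1 * blockDot S₂ x.2 x.2 * g₁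
          + blockDot S₁ x.1 x.1 * blockDot S₂ x.1 x.1 * g₃
          - 2 * blockDot S₁ x.1 x.1 * blockDot S₂ x.1 x.2 * g₂
          - blockDot S₂ x.1 x.1 * n₁ - blockDot S₁ x.1 x.1 * n₂)
    (h.nonparallel hD₁ hpol)
  have hB₁ := (fieldBlock_isSl₂On (S := S₁ ∪ S₂) (x := x)).mono
    (Finset.subset_union_left (s₁ := S₁) (s₂ := S₂))
  have hB₂ := (fieldBlock_isSl₂On (S := S₁ ∪ S₂) (x := x)).mono
    (Finset.subset_union_right (s₁ := S₁) (s₂ := S₂))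
  simp only [blockDot_union h.disj₁₂] at hB₁ hB₂
  obtain ⟨i₁, j₁, -⟩ := (hB₁.smul t).gram
  obtain ⟨i₂, j₂, -⟩ := (hB₂.smul t).gram
  obtain ⟨t₁, f₁⟩ := (m₁.sub (hB₁.killsAng.smul t)).gram_of_casimir hD₁
    (by simp only [Prod.fst_sub, blockDot_sub]; linear_combination e₁ - i₁)
    (by simp only [Prod.fst_sub, Prod.snd_sub, blockDot_sub]
        linear_combination e₂ - j₁)
  obtain ⟨t₂, f₂⟩ := (m₂.sub (hB₂.killsAng.smul t)).gram_of_casimir hD₂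
    (by simp only [Prod.fst_sub, blockDot_sub]; linear_combination g₁ - e₁ - i₂)
    (by simp only [Prod.fst_sub, Prod.snd_sub, blockDot_sub]
        linear_combination g₂ - e₂ - j₂)
  obtain ⟨t₃, f₃⟩ := k'.rotation m₃ hD₃
  have f₁' := fun i hi => f₁.eq_of (i := i) hi
  have f₂' := fun i hi => f₂.eq_of (i := i) hi
  have hsum : w' = t • fieldBlock (S₁ ∪ S₂) x + t₁ • fieldBlock S₁ x + t₂ • fieldBlock S₂ x
      + t₃ • fieldBlock S₃ x := by
    refine hT.eq_of_blocks (fun i hi => ?_) fun i hi => ?_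
    · have n₃ := fieldBlock_of_notMem (x := x) (Finset.disjoint_left.1 hT.disj hi)
      rcases Finset.mem_union.1 hi with hi | hi
      · have n₂ := fieldBlock_of_notMem (x := x) (Finset.disjoint_left.1 h.disj₁₂ hi)
        have := f₁' i hi
        simp only [Prod.fst_sub, Prod.snd_sub, Prod.smul_fst, Prod.smul_snd, Pi.sub_apply,
          Pi.smul_apply, smul_eq_mul] at this
        simp only [Prod.fst_add, Prod.snd_add, Prod.smul_fst, Prod.smul_snd, Pi.add_apply,
          Pi.smul_apply, smul_eq_mul, n₂, n₃]
        constructor <;> linarith [this.1, this.2]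
      · have n₁ := fieldBlock_of_notMem (x := x) (Finset.disjoint_right.1 h.disj₁₂ hi)
        have := f₂' i hi
        simp only [Prod.fst_sub, Prod.snd_sub, Prod.smul_fst, Prod.smul_snd, Pi.sub_apply,
          Pi.smul_apply, smul_eq_mul] at this
        simp only [Prod.fst_add, Prod.snd_add, Prod.smul_fst, Prod.smul_snd, Pi.add_apply,
          Pi.smul_apply, smul_eq_mul, n₁, n₃]
        constructor <;> linarith [this.1, this.2]
    · have n₀ := fieldBlock_of_notMem (x := x) (Finset.disjoint_right.1 hT.disj hi)
      have n₁ := fieldBlock_of_notMem (x := x) (Finset.disjoint_right.1 h.disj₁₃ hi)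
      have n₂ := fieldBlock_of_notMem (x := x) (Finset.disjoint_right.1 h.disj₂₃ hi)
      rw [(f₃ i hi).1, (f₃ i hi).2]
      simp [n₀, n₁, n₂]
  obtain ⟨q, rfl⟩ : ∃ q, t = q * c := ⟨t / c, (div_mul_cancel₀ _ hc.ne').symm⟩
  refine ⟨r - q * c, q, t₁, t₂, t₃ + q * c, ?_⟩
  have hw'' : w = w' + r • fieldE a x := by rw [hw']; abel
  rw [hw'', hsum, hT.fieldG_eq hx]
  module

theorem ThreeBlocks.eq_zero_of_eq (h : ThreeBlocks S₁ S₂ S₃ a c c) (hc : 0 < c)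
    (hx : x ∈ cotangentSphere n) (hD₁ : 0 < casimir S₁ x) (hD₂ : 0 < casimir S₂ x)
    (hD₃ : 0 < casimir S₃ x) (hmin : AboveMin (S₁ ∪ S₂) S₃ a c x)
    (hpol : (casimir (S₁ ∪ S₂) x - casimir S₁ x - casimir S₂ x) ^ 2
      ≠ 4 * casimir S₁ x * casimir S₂ x) {r s t₁ t₂ t₃ : ℝ}
    (h0 : r • fieldE a x + s • fieldG a x + t₁ • fieldBlock S₁ x + t₂ • fieldBlock S₂ x
      + t₃ • fieldBlock S₃ x = 0) : r = 0 ∧ s = 0 ∧ t₁ = 0 ∧ t₂ = 0 ∧ t₃ = 0 := by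
  have hT := h.twoBlocks
  have hD := h.union_pos hD₁
  have e0 : (r + s * c) • fieldE a x + (s * c) • fieldBlock (S₁ ∪ S₂) x + t₁ • fieldBlock S₁ x
      + t₂ • fieldBlock S₂ x + (t₃ - s * c) • fieldBlock S₃ x = 0 := by
    rw [← h0, hT.fieldG_eq hx]
    module
  have hrs : r + s * c = 0 := by
    refine hT.eq_zero_of_fieldE hx hD hD₃ hmin (t := t₃ - s * c) fun i hi => ?_
    have n₀ := fieldBlock_of_notMem (x := x) (Finset.disjoint_right.1 hT.disj hi)
    have n₁ := fieldBlock_of_notMem (x := x) (Finset.disjoint_right.1 h.disj₁₃ hi)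
    have n₂ := fieldBlock_of_notMem (x := x) (Finset.disjoint_right.1 h.disj₂₃ hi)
    have e1 := congrFun (congrArg Prod.fst e0) i
    have e2 := congrFun (congrArg Prod.snd e0) i
    simp only [Prod.fst_add, Prod.snd_add, Prod.smul_fst, Prod.smul_snd, Pi.add_apply,
      Pi.smul_apply, n₀, n₁, n₂, smul_zero, add_zero, Prod.fst_zero, Prod.snd_zero,
      Pi.zero_apply] at e1 e2 ⊢
    exact ⟨e1, e2⟩
  rw [hrs, zero_smul, zero_add] at e0
  have hB₁ := (fieldBlock_isSl₂On (S := S₁ ∪ S₂) (x := x)).mono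
    (Finset.subset_union_left (s₁ := S₁) (s₂ := S₂))
  simp only [blockDot_union h.disj₁₂] at hB₁
  have k₁ := (((hB₁.smul (s * c)).add (fieldBlock_isSl₂On.smul t₁)).add
    ((fieldBlock_isSl₂On_of_disjoint h.disj₁₂).smul t₂)).add
      ((fieldBlock_isSl₂On_of_disjoint h.disj₁₃).smul (t₃ - s * c))
  simp only [mul_zero, add_zero, e0] at k₁
  obtain ⟨p, q⟩ := k₁.gram_add_block fun _ _ => ⟨rfl, rfl⟩
  have hs : s * c = 0 := by
    by_contra hsc
    refine h.nonparallel hD₁ hpol ⟨mul_left_cancel₀ hsc ?_, mul_left_cancel₀ hsc ?_⟩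
    · linear_combination 2 * p
    · linear_combination q
  obtain rfl : s = 0 := (mul_eq_zero.1 hs).resolve_right hc.ne'
  obtain rfl : r = 0 := by linarith
  refine ⟨rfl, rfl, eq_zero_of_blocks h.disj₁₂ h.disj₁₃ h.disj₂₃ hD₁ hD₂ hD₃ ?_⟩
  simpa using h0

end MagneticSphere

namespace MagneticSphere

theorem exists_mul_of_conj_mul {M M' J : Matrix (Fin 2) (Fin 2) ℂ} (hu : IsUnit M.det)
    (h : M' * J * Mᴴ + M * J * M'ᴴ = 0) : ∃ N, M * N = M' ∧ N * J + J * Nᴴ = 0 := by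
  have hu' : IsUnit (Mᴴ).det := by
    rw [Matrix.det_conjTranspose]
    exact hu.star
  have hMN : M * (M⁻¹ * M') = M' := by rw [← mul_assoc, Matrix.mul_nonsing_inv _ hu, one_mul]
  refine ⟨M⁻¹ * M', hMN, ?_⟩
  generalize M⁻¹ * M' = N at hMN
  subst hMN
  have h0 : M * (N * J + J * Nᴴ) * Mᴴ = 0 := by
    rw [← h, Matrix.conjTranspose_mul]
    simp only [mul_add, add_mul, mul_assoc]
  have := congrArg (fun A => M⁻¹ * A * (Mᴴ)⁻¹) h0
  simp only [mul_zero, zero_mul] at this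
  rwa [mul_assoc M, ← mul_assoc M⁻¹, Matrix.nonsing_inv_mul _ hu, one_mul, mul_assoc,
    Matrix.mul_nonsing_inv _ hu', mul_one] at this

open ComplexConjugate in
/-- The variations of a pair of independent vectors in `ℂ²` that preserve the moment of the action
of `U(2)`. -/
theorem exists_of_unitary_moment {z₁ z₂ w₁ w₂ dz₁ dz₂ dw₁ dw₂ : ℂ} (hdet : z₁ * w₂ - w₁ * z₂ ≠ 0)
    (h₁₁ : dz₁ * conj w₁ + z₁ * conj dw₁ - dw₁ * conj z₁ - w₁ * conj dz₁ = 0)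
    (h₁₂ : dz₁ * conj w₂ + z₁ * conj dw₂ - dw₁ * conj z₂ - w₁ * conj dz₂ = 0)
    (h₂₁ : dz₂ * conj w₁ + z₂ * conj dw₁ - dw₂ * conj z₁ - w₂ * conj dz₁ = 0)
    (h₂₂ : dz₂ * conj w₂ + z₂ * conj dw₂ - dw₂ * conj z₂ - w₂ * conj dz₂ = 0) :
    ∃ (α : ℂ) (β γ : ℝ), dz₁ = α * z₁ + β * w₁ ∧ dz₂ = α * z₂ + β * w₂ ∧
      dw₁ = γ * z₁ - conj α * w₁ ∧ dw₂ = γ * z₂ - conj α * w₂ := by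
  have ct : ∀ p q r t : ℂ, (!![p, q; r, t])ᴴ = !![conj p, conj r; conj q, conj t] :=
    fun p q r t => by ext i j; fin_cases i <;> fin_cases j <;> rfl
  obtain ⟨N, hMN, h1⟩ := exists_mul_of_conj_mul (M := !![z₁, w₁; z₂, w₂])
    (M' := !![dz₁, dw₁; dz₂, dw₂]) (J := !![0, 1; -1, 0])
    (by rw [Matrix.det_fin_two_of]; exact hdet.isUnit)
    (by rw [ct, ct, Matrix.mul_fin_two, Matrix.mul_fin_two, Matrix.mul_fin_two, Matrix.mul_fin_two]
        rw [← Matrix.ext_iff]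
        simp only [Fin.forall_fin_two, Matrix.add_apply, Matrix.of_apply, Matrix.cons_val',
          Matrix.cons_val_zero, Matrix.cons_val_one, Matrix.cons_val_fin_one, Matrix.zero_apply]
        refine ⟨⟨?_, ?_⟩, ?_, ?_⟩
        · linear_combination h₁₁
        · linear_combination h₁₂
        · linear_combination h₂₁
        · linear_combination h₂₂)
  have k₁ := congrFun (congrFun h1 0) 0
  have k₂ := congrFun (congrFun h1 0) 1
  have k₃ := congrFun (congrFun h1 1) 1
  simp only [Matrix.add_apply, Matrix.mul_apply, Fin.sum_univ_two, Matrix.of_apply,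
    Matrix.cons_val', Matrix.cons_val_zero, Matrix.cons_val_one, Matrix.conjTranspose_apply,
    Matrix.cons_val_fin_one, Matrix.zero_apply, mul_zero, zero_mul, zero_add,
    add_zero, mul_one, one_mul, mul_neg, neg_mul, RCLike.star_def] at k₁ k₂ k₃
  have hβ : conj (N 1 0) = N 1 0 := by linear_combination -k₃
  have hγ : conj (N 0 1) = N 0 1 := by linear_combination k₁
  obtain ⟨β, hβ⟩ := Complex.conj_eq_iff_real.1 hβ
  obtain ⟨γ, hγ⟩ := Complex.conj_eq_iff_real.1 hγ
  have m : ∀ i j, !![z₁, w₁; z₂, w₂] i 0 * N 0 j + !![z₁, w₁; z₂, w₂] i 1 * N 1 j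
      = !![dz₁, dw₁; dz₂, dw₂] i j := fun i j => by
    rw [← hMN, Matrix.mul_apply, Fin.sum_univ_two]
  have hδ : N 1 1 = -conj (N 0 0) := by
    have := congrArg conj k₂
    simp only [map_add, Complex.conj_conj, map_zero] at this
    linear_combination this
  have m₁ := m 0 0
  have m₂ := m 1 0
  have m₃ := m 0 1
  have m₄ := m 1 1
  simp only [Matrix.of_apply, Matrix.cons_val', Matrix.cons_val_zero,
    Matrix.cons_val_one, Matrix.cons_val_fin_one, hβ, hγ, hδ] at m₁ m₂ m₃ m₄
  exact ⟨N 0 0, β, γ, by linear_combination -m₁, by linear_combination -m₂,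
    by linear_combination -m₃, by linear_combination -m₄⟩

variable {n : ℕ} {a : Fin n → ℝ} {S S' : Finset (Fin n)} {x w : Phase n} {c k : ℝ}
  {κ : Matrix (Fin n) (Fin n) ℝ} {i₀ i₁ i₂ i₃ : Fin n}

/-- The matrix `κ` is a multiple of a complex structure on a block with four coordinates, and
vanishes on the other coordinates. -/
structure UnitaryBlock (κ : Matrix (Fin n) (Fin n) ℝ) (S : Finset (Fin n)) (i₀ i₁ i₂ i₃ : Fin n)
    (k : ℝ) : Prop where
  mem : ∀ i, i ∈ S ↔ i = i₀ ∨ i = i₁ ∨ i = i₂ ∨ i = i₃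
  sum : ∀ f : Fin n → ℝ, ∑ i ∈ S, f i = f i₀ + f i₁ + f i₂ + f i₃
  h₀ : ∀ u, (κ *ᵥ u) i₀ = k * u i₁
  h₁ : ∀ u, (κ *ᵥ u) i₁ = -(k * u i₀)
  h₂ : ∀ u, (κ *ᵥ u) i₂ = k * u i₃
  h₃ : ∀ u, (κ *ᵥ u) i₃ = -(k * u i₂)
  off : ∀ u, ∀ i ∉ S, (κ *ᵥ u) i = 0

theorem UnitaryBlock.exists_isSl₂On (h : UnitaryBlock κ S i₀ i₁ i₂ i₃ k) (hk : k ≠ 0)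
    (hdet : casimir S x ≠ (ang i₀ i₁ x + ang i₂ i₃ x) ^ 2)
    (h₁ : fderiv ℝ (ang i₀ i₁) x w = 0) (h₂ : fderiv ℝ (ang i₂ i₃) x w = 0)
    (h₃ : fderiv ℝ (ang i₁ i₂) x w - fderiv ℝ (ang i₀ i₃) x w = 0)
    (h₄ : fderiv ℝ (ang i₀ i₂) x w + fderiv ℝ (ang i₁ i₃) x w = 0) :
    ∃ t p q r : ℝ, IsSl₂On S x (w - t • fieldRot κ x) p q r := by
  simp only [fderiv_ang] at h₁ h₂ h₃ h₄
  obtain ⟨α, β, γ, e₁, e₂, e₃, e₄⟩ := exists_of_unitary_moment (z₁ := ⟨x.1 i₀, x.1 i₁⟩)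
    (z₂ := ⟨x.1 i₂, x.1 i₃⟩) (w₁ := ⟨x.2 i₀, x.2 i₁⟩) (w₂ := ⟨x.2 i₂, x.2 i₃⟩)
    (dz₁ := ⟨w.1 i₀, w.1 i₁⟩) (dz₂ := ⟨w.1 i₂, w.1 i₃⟩) (dw₁ := ⟨w.2 i₀, w.2 i₁⟩)
    (dw₂ := ⟨w.2 i₂, w.2 i₃⟩)
    (fun h0 => hdet (by
      have hre := congrArg Complex.re h0
      have him := congrArg Complex.im h0
      simp only [Complex.sub_re, Complex.mul_re, Complex.sub_im, Complex.mul_im, Complex.zero_re,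
        Complex.zero_im] at hre him
      simp only [casimir, blockDot, h.sum, ang]
      linear_combination (x.1 i₀ * x.2 i₂ - x.1 i₁ * x.2 i₃ - (x.2 i₀ * x.1 i₂ - x.2 i₁ * x.1 i₃))
        * hre + (x.1 i₀ * x.2 i₃ + x.1 i₁ * x.2 i₂ - (x.2 i₀ * x.1 i₃ + x.2 i₁ * x.1 i₂)) * him))
    (by apply Complex.ext <;> simp
        · ring
        · linear_combination -2 * h₁)
    (by apply Complex.ext <;> simp
        · linear_combination h₄
        · linear_combination h₃)
    (by apply Complex.ext <;> simp
        · linear_combination -h₄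
        · linear_combination h₃)
    (by apply Complex.ext <;> simp
        · ring
        · linear_combination -2 * h₂)
  have hkk : α.im / k * k = α.im := div_mul_cancel₀ _ hk
  have r₁ := congrArg Complex.re e₁
  have r₂ := congrArg Complex.im e₁
  have r₃ := congrArg Complex.re e₂
  have r₄ := congrArg Complex.im e₂
  have s₁ := congrArg Complex.re e₃
  have s₂ := congrArg Complex.im e₃
  have s₃ := congrArg Complex.re e₄
  have s₄ := congrArg Complex.im e₄
  simp only [Complex.add_re, Complex.add_im, Complex.mul_re, Complex.mul_im, Complex.sub_re,
    Complex.sub_im, Complex.ofReal_re, Complex.ofReal_im, Complex.conj_re, Complex.conj_im, zero_mul,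
    sub_zero, add_zero] at r₁ r₂ r₃ r₄ s₁ s₂ s₃ s₄
  refine ⟨-(α.im / k), α.re, β, γ, fun i hi => ?_⟩
  simp only [Prod.fst_sub, Prod.snd_sub, Prod.smul_fst, Prod.smul_snd, Pi.sub_apply, Pi.smul_apply,
    smul_eq_mul, fieldRot]
  rcases (h.mem i).1 hi with rfl | rfl | rfl | rfl <;> simp only [h.h₀, h.h₁, h.h₂, h.h₃]
  · exact ⟨by linear_combination r₁ + x.1 i₁ * hkk, by linear_combination s₁ + x.2 i₁ * hkk⟩
  · exact ⟨by linear_combination r₂ - x.1 i₀ * hkk, by linear_combination s₂ - x.2 i₀ * hkk⟩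
  · exact ⟨by linear_combination r₃ + x.1 i₃ * hkk, by linear_combination s₃ + x.2 i₃ * hkk⟩
  · exact ⟨by linear_combination r₄ - x.1 i₂ * hkk, by linear_combination s₄ - x.2 i₂ * hkk⟩

theorem UnitaryBlock.killsGram (h : UnitaryBlock κ S i₀ i₁ i₂ i₃ k) (x : Phase n) (t : ℝ) :
    KillsGram S x (t • fieldRot κ x) := by
  constructor <;> simp only [blockDot, h.sum, Prod.smul_fst, Prod.smul_snd, Pi.smul_apply,
    smul_eq_mul, fieldRot, h.h₀, h.h₁, h.h₂, h.h₃] <;> ring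

theorem KillsGram.sub {v : Phase n} (h : KillsGram S x w) (h' : KillsGram S x v) :
    KillsGram S x (w - v) := by
  constructor <;> simp only [Prod.fst_sub, Prod.snd_sub, blockDot_sub]
  · linear_combination h.h₁ - h'.h₁
  · linear_combination h.h₂ - h'.h₂
  · linear_combination h.h₃ - h'.h₃

theorem UnitaryBlock.fieldRot_of_notMem (h : UnitaryBlock κ S i₀ i₁ i₂ i₃ k) (x : Phase n)
    {i : Fin n} (hi : i ∉ S) : (fieldRot κ x).1 i = 0 ∧ (fieldRot κ x).2 i = 0 :=
  ⟨h.off _ i hi, h.off _ i hi⟩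

theorem TwoBlocks.span_unitary (h : TwoBlocks S S' a c) (hκ : UnitaryBlock κ S i₀ i₁ i₂ i₃ k)
    (hk : k ≠ 0) (hc : 0 < c) (hx : x ∈ cotangentSphere n) (hD : 0 < casimir S x)
    (hD' : 0 < casimir S' x) (hmin : AboveMin S S' a c x)
    (hdet : casimir S x ≠ (ang i₀ i₁ x + ang i₂ i₃ x) ^ 2) (hw : w ∈ tangentAt x)
    (hE : fderiv ℝ (neumannE a) x w = 0) (hG : fderiv ℝ (neumannG a) x w = 0)
    (h₁ : fderiv ℝ (ang i₀ i₁) x w = 0) (h₂ : fderiv ℝ (ang i₂ i₃) x w = 0)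
    (h₃ : fderiv ℝ (ang i₁ i₂) x w - fderiv ℝ (ang i₀ i₃) x w = 0)
    (h₄ : fderiv ℝ (ang i₀ i₂) x w + fderiv ℝ (ang i₁ i₃) x w = 0) (h' : KillsAng S' x w) :
    ∃ r s t t' : ℝ, w = r • fieldE a x + s • fieldG a x + t • fieldRot κ x
      + t' • fieldBlock S' x := by
  obtain ⟨r, g, g'⟩ := h.exists_killsGram hx hD hD' hmin hw hE
    (h.casimir_variation hc hx hw hE hG h') h'
  have hX := ((h.fieldE_isSl₂On₁ hx).smul r).killsAng
  have m' := h'.sub ((h.fieldE_isSl₂On₂ hx).killsAng.smul r)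
  have d₀ := (hκ.mem i₀).2 (by simp)
  have d₁ := (hκ.mem i₁).2 (by simp)
  have d₂ := (hκ.mem i₂).2 (by simp)
  have d₃ := (hκ.mem i₃).2 (by simp)
  obtain ⟨t, p, q, l, f⟩ := hκ.exists_isSl₂On (w := w - r • fieldE a x) hk hdet
    (by rw [map_sub, h₁, hX _ d₀ _ d₁, sub_zero])
    (by rw [map_sub, h₂, hX _ d₂ _ d₃, sub_zero])
    (by rw [map_sub, map_sub, hX _ d₁ _ d₂, hX _ d₀ _ d₃, sub_zero, sub_zero, h₃])
    (by rw [map_sub, map_sub, hX _ d₀ _ d₂, hX _ d₁ _ d₃, sub_zero, sub_zero, h₄])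
  obtain ⟨q, e⟩ := (g.sub (hκ.killsGram x t)).rotation f.killsAng hD
  obtain ⟨t', e'⟩ := g'.rotation m' hD'
  obtain ⟨q, rfl⟩ : ∃ q', q = q' * c := ⟨q / c, (div_mul_cancel₀ _ hc.ne').symm⟩
  have hsum : w - r • fieldE a x - t • fieldRot κ x
      = (q * c) • fieldBlock S x + t' • fieldBlock S' x := by
    refine h.eq_of_blocks (fun i hi => ?_) fun i hi => ?_
    · rw [(e i hi).1, (e i hi).2]
      simp [fieldBlock_of_notMem (x := x) (Finset.disjoint_left.1 h.disj hi)]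
    · have hi' := Finset.disjoint_right.1 h.disj hi
      simpa [fieldBlock_of_notMem (x := x) hi', hκ.fieldRot_of_notMem x hi'] using e' i hi
  refine ⟨r - q * c, q, t, t' + q * c, ?_⟩
  have hw' : w = (q * c) • fieldBlock S x + t' • fieldBlock S' x + t • fieldRot κ x
      + r • fieldE a x := by rw [← hsum]; abel
  rw [hw', h.fieldG_eq hx]
  module

theorem TwoBlocks.eq_zero_unitary (h : TwoBlocks S S' a c) (hκ : UnitaryBlock κ S i₀ i₁ i₂ i₃ k)
    (hk : k ≠ 0) (hc : 0 < c) (hx : x ∈ cotangentSphere n) (hD : 0 < casimir S x)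
    (hD' : 0 < casimir S' x) (hmin : AboveMin S S' a c x)
    (hdet : casimir S x ≠ (ang i₀ i₁ x + ang i₂ i₃ x) ^ 2) {r s t t' : ℝ}
    (h0 : r • fieldE a x + s • fieldG a x + t • fieldRot κ x + t' • fieldBlock S' x = 0) :
    r = 0 ∧ s = 0 ∧ t = 0 ∧ t' = 0 := by
  have e0 : (r + s * c) • fieldE a x + (s * c) • fieldBlock S x + t • fieldRot κ x
      + (t' - s * c) • fieldBlock S' x = 0 := by
    rw [← h0, h.fieldG_eq hx]
    module
  have hrs : r + s * c = 0 := by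
    refine h.eq_zero_of_fieldE hx hD hD' hmin (t := t' - s * c) fun i hi => ?_
    have hi' := Finset.disjoint_right.1 h.disj hi
    have n₀ := fieldBlock_of_notMem (x := x) hi'
    have n₁ := hκ.fieldRot_of_notMem x hi'
    have e1 := congrFun (congrArg Prod.fst e0) i
    have e2 := congrFun (congrArg Prod.snd e0) i
    simp only [Prod.fst_add, Prod.snd_add, Prod.smul_fst, Prod.smul_snd, Pi.add_apply,
      Pi.smul_apply, n₀, n₁, smul_zero, add_zero, Prod.fst_zero, Prod.snd_zero,
      Pi.zero_apply] at e1 e2 ⊢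
    exact ⟨e1, e2⟩
  rw [hrs, zero_smul, zero_add] at e0
  have hi : ∀ i ∈ S, s * c * (blockDot S x.1 x.1 * x.2 i - blockDot S x.1 x.2 * x.1 i)
      + t * (κ *ᵥ x.1) i = 0 := fun i hi => by
    have e1 := congrFun (congrArg Prod.fst e0) i
    have n' := fieldBlock_of_notMem (x := x) (Finset.disjoint_left.1 h.disj hi)
    have n := (fieldBlock_isSl₂On (S := S) (x := x) i hi).1
    simp only [Prod.fst_add, Prod.smul_fst, Pi.add_apply, Pi.smul_apply, n', n, smul_eq_mul,
      Prod.fst_zero, Pi.zero_apply, fieldRot, mul_zero, add_zero] at e1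
    linear_combination e1
  have b₀ := hi i₀ ((hκ.mem i₀).2 (by simp))
  have b₁ := hi i₁ ((hκ.mem i₁).2 (by simp))
  have b₂ := hi i₂ ((hκ.mem i₂).2 (by simp))
  have b₃ := hi i₃ ((hκ.mem i₃).2 (by simp))
  rw [hκ.h₀] at b₀
  rw [hκ.h₁] at b₁
  rw [hκ.h₂] at b₂
  rw [hκ.h₃] at b₃
  have hu := blockDot_pos_of_casimir hD
  have p₁ : s * c * casimir S x - t * k * (ang i₀ i₁ x + ang i₂ i₃ x) = 0 := by
    have : s * c * casimir S x = s * c * (blockDot S x.1 x.1 * blockDot S x.2 x.2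
      - blockDot S x.1 x.2 * blockDot S x.1 x.2) := by rw [casimir]; ring
    rw [this]
    have e₁ : blockDot S x.2 x.2 = x.2 i₀ * x.2 i₀ + x.2 i₁ * x.2 i₁ + x.2 i₂ * x.2 i₂
      + x.2 i₃ * x.2 i₃ := hκ.sum _
    have e₂ : blockDot S x.1 x.2 = x.1 i₀ * x.2 i₀ + x.1 i₁ * x.2 i₁ + x.1 i₂ * x.2 i₂
      + x.1 i₃ * x.2 i₃ := hκ.sum _
    rw [e₁]
    nth_rewrite 2 [e₂]
    rw [ang, ang]
    linear_combination x.2 i₀ * b₀ + x.2 i₁ * b₁ + x.2 i₂ * b₂ + x.2 i₃ * b₃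
  have p₂ : t * k - s * c * (ang i₀ i₁ x + ang i₂ i₃ x) = 0 := by
    refine (mul_eq_zero.1 ?_).resolve_left hu.ne'
    have e₁ : blockDot S x.1 x.1 = x.1 i₀ * x.1 i₀ + x.1 i₁ * x.1 i₁ + x.1 i₂ * x.1 i₂
      + x.1 i₃ * x.1 i₃ := hκ.sum _
    rw [mul_sub]
    nth_rewrite 1 [e₁]
    rw [ang, ang]
    linear_combination x.1 i₁ * b₀ - x.1 i₀ * b₁ + x.1 i₃ * b₂ - x.1 i₂ * b₃
  have hs : s * c = 0 := by
    refine (mul_eq_zero.1 (?_ : s * c * (casimir S x - (ang i₀ i₁ x + ang i₂ i₃ x) ^ 2)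
      = 0)).resolve_right (sub_ne_zero.2 hdet)
    linear_combination p₁ + (ang i₀ i₁ x + ang i₂ i₃ x) * p₂
  have hs' : s = 0 := (mul_eq_zero.1 hs).resolve_right hc.ne'
  have ht : t = 0 := (mul_eq_zero.1 (by linear_combination p₂
    + (ang i₀ i₁ x + ang i₂ i₃ x) * hs : t * k = 0)).resolve_right hk
  subst hs' ht
  obtain rfl : r = 0 := by linarith
  refine ⟨rfl, rfl, rfl, eq_zero_of_smul_fieldBlock hD' ?_⟩
  simpa using h0

end MagneticSphere

namespace MagneticSphere

variable {n : ℕ} {k : ℕ → ℝ} {m s : ℝ} {x y w : Phase n}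

/-! The matrix in normal form. -/

theorem blockField_skew (n : ℕ) (k : ℕ → ℝ) : (blockField n k)ᵀ = -blockField n k := by
  ext i j
  simp only [blockField, Matrix.transpose_apply, Matrix.of_apply, Matrix.neg_apply]
  split_ifs <;> first | rfl | simp | omega

theorem blockField_mulVec_even {i j : Fin n} (hi : (i : ℕ) % 2 = 0) (hj : (j : ℕ) = i + 1)
    (u : Fin n → ℝ) : (blockField n k *ᵥ u) i = k ((i : ℕ) / 2) * u j := by
  rw [Matrix.mulVec, dotProduct, Finset.sum_eq_single j]
  · simp [blockField, hi, hj]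
  · intro l _ hl
    have h1 : (l : ℕ) ≠ i + 1 := fun h => hl (Fin.ext (h.trans hj.symm))
    have h2 : ¬((l : ℕ) % 2 = 0 ∧ (i : ℕ) = l + 1) := by omega
    simp [blockField, h1, h2]
  · simp

theorem blockField_mulVec_odd {i j : Fin n} (hi : (i : ℕ) % 2 = 0) (hj : (j : ℕ) = i + 1)
    (u : Fin n → ℝ) : (blockField n k *ᵥ u) j = -(k ((i : ℕ) / 2) * u i) := by
  rw [Matrix.mulVec, dotProduct, Finset.sum_eq_single i]
  · have h1 : ¬((j : ℕ) % 2 = 0 ∧ (i : ℕ) = j + 1) := by omega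
    rw [blockField, Matrix.of_apply, if_neg h1, if_pos ⟨hi, hj⟩, neg_mul]
  · intro l _ hl
    have h1 : (l : ℕ) ≠ i := fun h => hl (Fin.ext h)
    have h2 : ¬((j : ℕ) % 2 = 0 ∧ (l : ℕ) = j + 1) := by omega
    have h3 : ¬((l : ℕ) % 2 = 0 ∧ (j : ℕ) = l + 1) := by omega
    simp [blockField, h2, h3]
  · simp

theorem blockField_apply_eq_zero {i : Fin n} (hi : k ((i : ℕ) / 2) = 0) (j : Fin n) :
    blockField n k i j = 0 := by
  simp only [blockField, Matrix.of_apply]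
  split_ifs with h1 h2
  · exact hi
  · rw [show (j : ℕ) / 2 = (i : ℕ) / 2 by omega, hi, neg_zero]
  · rfl

theorem blockField_mulVec_eq_zero {i : Fin n} (hi : k ((i : ℕ) / 2) = 0) (u : Fin n → ℝ) :
    (blockField n k *ᵥ u) i = 0 := by
  rw [Matrix.mulVec, dotProduct]
  exact Finset.sum_eq_zero fun j _ => by rw [blockField_apply_eq_zero hi, zero_mul]

/-- The eigenvalues of `-(s²/4) κ²` for a matrix `κ` in normal form. -/
noncomputable def potential (n : ℕ) (s : ℝ) (k : ℕ → ℝ) (i : Fin n) : ℝ :=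
  s ^ 2 / 4 * k ((i : ℕ) / 2) ^ 2

theorem cases_of_lt_four (hn : 4 ≤ n) (i : Fin n) : i = ⟨0, by omega⟩ ∨ i = ⟨1, by omega⟩ ∨
    i = ⟨2, by omega⟩ ∨ i = ⟨3, by omega⟩ ∨ 4 ≤ (i : ℕ) := by
  simp only [Fin.ext_iff]
  omega

theorem field_eq_zero (hk : ∀ l, 2 ≤ l → k l = 0) {i : Fin n} (hi : 4 ≤ (i : ℕ)) :
    k ((i : ℕ) / 2) = 0 :=
  hk _ (by omega)

theorem mulVec₀ (hn : 4 ≤ n) (u : Fin n → ℝ) :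
    (blockField n k *ᵥ u) ⟨0, by omega⟩ = k 0 * u ⟨1, by omega⟩ := by
  simpa using blockField_mulVec_even (k := k) (i := ⟨0, by omega⟩) (j := ⟨1, by omega⟩)
    (by simp) (by simp) u

theorem mulVec₁ (hn : 4 ≤ n) (u : Fin n → ℝ) :
    (blockField n k *ᵥ u) ⟨1, by omega⟩ = -(k 0 * u ⟨0, by omega⟩) := by
  simpa using blockField_mulVec_odd (k := k) (i := ⟨0, by omega⟩) (j := ⟨1, by omega⟩)
    (by simp) (by simp) u

theorem mulVec₂ (hn : 4 ≤ n) (u : Fin n → ℝ) :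
    (blockField n k *ᵥ u) ⟨2, by omega⟩ = k 1 * u ⟨3, by omega⟩ := by
  simpa using blockField_mulVec_even (k := k) (i := ⟨2, by omega⟩) (j := ⟨3, by omega⟩)
    (by simp) (by simp) u

theorem mulVec₃ (hn : 4 ≤ n) (u : Fin n → ℝ) :
    (blockField n k *ᵥ u) ⟨3, by omega⟩ = -(k 1 * u ⟨2, by omega⟩) := by
  simpa using blockField_mulVec_odd (k := k) (i := ⟨2, by omega⟩) (j := ⟨3, by omega⟩)
    (by simp) (by simp) u

theorem isHalfSquare_potential (hn : 4 ≤ n) (hk : ∀ l, 2 ≤ l → k l = 0) :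
    IsHalfSquare (potential n s k) s (blockField n k) := fun u => by
  ext i
  rw [Pi.smul_apply, Pi.neg_apply, Pi.mul_apply, potential, smul_eq_mul]
  rcases cases_of_lt_four hn i with rfl | rfl | rfl | rfl | hi
  · rw [mulVec₀ hn, mulVec₁ hn]; simp; ring
  · rw [mulVec₁ hn, mulVec₀ hn]; simp; ring
  · rw [mulVec₂ hn, mulVec₃ hn]; simp; ring
  · rw [mulVec₃ hn, mulVec₂ hn]; simp; ring
  · rw [blockField_mulVec_eq_zero (field_eq_zero hk hi), field_eq_zero hk hi]; simp

theorem sum_eq_of_four (hn : 4 ≤ n) {f : Fin n → ℝ} (hf : ∀ i : Fin n, 4 ≤ (i : ℕ) → f i = 0) :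
    ∑ i, f i = f ⟨0, by omega⟩ + f ⟨1, by omega⟩ + f ⟨2, by omega⟩ + f ⟨3, by omega⟩ := by
  have hs : ∑ i, f i = ∑ i ∈ {(⟨0, by omega⟩ : Fin n), ⟨1, by omega⟩, ⟨2, by omega⟩,
      ⟨3, by omega⟩}, f i := by
    symm
    refine Finset.sum_subset (Finset.subset_univ _) fun i _ hi => hf i ?_
    rcases cases_of_lt_four hn i with rfl | rfl | rfl | rfl | h
    · simp at hi
    · simp at hi
    · simp at hi
    · simp at hi
    · exact h
  rw [hs, Finset.sum_insert (by simp), Finset.sum_insert (by simp), Finset.sum_insert (by simp),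
    Finset.sum_singleton]
  ring

theorem momentum_blockField (hn : 4 ≤ n) (hk : ∀ l, 2 ≤ l → k l = 0) (x : Phase n) :
    momentum (blockField n k) x = -(k 0 * ang ⟨0, by omega⟩ ⟨1, by omega⟩ x)
      - k 1 * ang ⟨2, by omega⟩ ⟨3, by omega⟩ x := by
  rw [momentum, dotProduct, sum_eq_of_four hn fun i hi => by
    rw [blockField_mulVec_eq_zero (field_eq_zero hk hi), mul_zero], mulVec₀ hn, mulVec₁ hn,
    mulVec₂ hn, mulVec₃ hn, ang, ang]
  ring

theorem momentum_blockField_cube (hn : 4 ≤ n) (hk : ∀ l, 2 ≤ l → k l = 0) (x : Phase n) :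
    momentum (blockField n k * blockField n k * blockField n k) x
      = k 0 ^ 3 * ang ⟨0, by omega⟩ ⟨1, by omega⟩ x
        + k 1 ^ 3 * ang ⟨2, by omega⟩ ⟨3, by omega⟩ x := by
  rw [momentum, ← Matrix.mulVec_mulVec, ← Matrix.mulVec_mulVec, dotProduct,
    sum_eq_of_four hn fun i hi => by
    rw [blockField_mulVec_eq_zero (field_eq_zero hk hi), mul_zero]]
  simp only [mulVec₀ hn, mulVec₁ hn, mulVec₂ hn, mulVec₃ hn, ang]
  ring

/-! The integrals in the canonical momenta. -/

theorem energy_shift_eq (hn : 4 ≤ n) (hk : ∀ l, 2 ≤ l → k l = 0) (x : Phase n) :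
    energy m (shift s (blockField n k) x) = (neumannE (potential n s k) x
      - s * (k 0 * ang ⟨0, by omega⟩ ⟨1, by omega⟩ x
        + k 1 * ang ⟨2, by omega⟩ ⟨3, by omega⟩ x)) / (2 * m) := by
  rw [energy_shift (isHalfSquare_potential hn hk) (blockField_skew n k),
    momentum_blockField hn hk]
  ring

theorem integralJ_shift_eq (hn : 4 ≤ n) (hk : ∀ l, 2 ≤ l → k l = 0) (x : Phase n) :
    integralJ m s (blockField n k) (shift s (blockField n k) x)
      = (4 * neumannG (potential n s k) x - neumannE (potential n s k) x ^ 2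
        - s ^ 3 * (k 0 ^ 3 * ang ⟨0, by omega⟩ ⟨1, by omega⟩ x
          + k 1 ^ 3 * ang ⟨2, by omega⟩ ⟨3, by omega⟩ x)) / m ^ 2 := by
  rw [integralJ_shift (isHalfSquare_potential hn hk) (blockField_skew n k),
    momentum_blockField_cube hn hk]

theorem integralΦ_shift {κ : Matrix (Fin n) (Fin n) ℝ} {i j : Fin n}
    (h₁ : (κ *ᵥ x.1) i = κ i j * x.1 j) (h₂ : (κ *ᵥ x.1) j = -(κ i j * x.1 i)) :
    integralΦ s κ i j (shift s κ x) = ang i j x := by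
  simp only [integralΦ, shift_apply, Pi.add_apply, Pi.smul_apply, smul_eq_mul, h₁, h₂, ang]
  ring

theorem blockField₀₁ (hn : 4 ≤ n) : blockField n k ⟨0, by omega⟩ ⟨1, by omega⟩ = k 0 := by
  simp [blockField]

theorem blockField₂₃ (hn : 4 ≤ n) : blockField n k ⟨2, by omega⟩ ⟨3, by omega⟩ = k 1 := by
  simp [blockField]

theorem integralΦ₀₁_shift (hn : 4 ≤ n) (x : Phase n) :
    integralΦ s (blockField n k) ⟨0, by omega⟩ ⟨1, by omega⟩ (shift s (blockField n k) x)
      = ang ⟨0, by omega⟩ ⟨1, by omega⟩ x :=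
  integralΦ_shift (by rw [mulVec₀ hn, blockField₀₁ hn]) (by rw [mulVec₁ hn, blockField₀₁ hn])

theorem integralΦ₂₃_shift (hn : 4 ≤ n) (x : Phase n) :
    integralΦ s (blockField n k) ⟨2, by omega⟩ ⟨3, by omega⟩ (shift s (blockField n k) x)
      = ang ⟨2, by omega⟩ ⟨3, by omega⟩ x :=
  integralΦ_shift (by rw [mulVec₂ hn, blockField₂₃ hn]) (by rw [mulVec₃ hn, blockField₂₃ hn])

theorem integralΦ_shift_of_eq_zero {i j : Fin n} (hi : k ((i : ℕ) / 2) = 0)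
    (hj : k ((j : ℕ) / 2) = 0) (x : Phase n) :
    integralΦ s (blockField n k) i j (shift s (blockField n k) x) = ang i j x :=
  integralΦ_shift (by rw [blockField_mulVec_eq_zero hi, blockField_apply_eq_zero hi, zero_mul])
    (by rw [blockField_mulVec_eq_zero hj, blockField_apply_eq_zero hi, zero_mul, neg_zero])

theorem integralΨ₁_shift (hn : 4 ≤ n) (h : k 0 = k 1) (x : Phase n) :
    integralΨ₁ s (blockField n k) ⟨0, by omega⟩ ⟨1, by omega⟩ ⟨2, by omega⟩ ⟨3, by omega⟩
      (shift s (blockField n k) x)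
      = ang ⟨1, by omega⟩ ⟨2, by omega⟩ x - ang ⟨0, by omega⟩ ⟨3, by omega⟩ x := by
  simp only [integralΨ₁, shift_apply, Pi.add_apply, Pi.smul_apply, smul_eq_mul, mulVec₀ hn,
    mulVec₁ hn, mulVec₂ hn, mulVec₃ hn, blockField₀₁ hn, ang, ← h]
  ring

theorem integralΨ₂_shift (hn : 4 ≤ n) (h : k 0 = k 1) (x : Phase n) :
    integralΨ₂ s (blockField n k) ⟨0, by omega⟩ ⟨1, by omega⟩ ⟨2, by omega⟩ ⟨3, by omega⟩
      (shift s (blockField n k) x)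
      = ang ⟨0, by omega⟩ ⟨2, by omega⟩ x + ang ⟨1, by omega⟩ ⟨3, by omega⟩ x := by
  simp only [integralΨ₂, shift_apply, Pi.add_apply, Pi.smul_apply, smul_eq_mul, mulVec₀ hn,
    mulVec₁ hn, mulVec₂ hn, mulVec₃ hn, blockField₀₁ hn, ang, ← h]
  ring

theorem fderiv_energy_shift (hn : 4 ≤ n) (hk : ∀ l, 2 ≤ l → k l = 0) (x w : Phase n) :
    fderiv ℝ (energy m) (shift s (blockField n k) x) (shift s (blockField n k) w)
      = (fderiv ℝ (neumannE (potential n s k)) x w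
        - s * (k 0 * fderiv ℝ (ang ⟨0, by omega⟩ ⟨1, by omega⟩) x w
          + k 1 * fderiv ℝ (ang ⟨2, by omega⟩ ⟨3, by omega⟩) x w)) / (2 * m) := by
  rw [← fderiv_comp_shift]
  simp only [energy_shift_eq hn hk]
  have hd : ∀ i j, HasFDerivAt (ang i j) (fderiv ℝ (ang i j) x) x := fun i j =>
    ((contDiff_ang i j).differentiable (n := 1) (by simp) x).hasFDerivAt
  have hE := (contDiff_neumannE (a := potential n s k)).differentiable (n := 1) (by simp) x
    |>.hasFDerivAt
  have := (hE.sub ((((hd ⟨0, by omega⟩ ⟨1, by omega⟩).const_mul (k 0)).add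
    ((hd ⟨2, by omega⟩ ⟨3, by omega⟩).const_mul (k 1))).const_mul s)).mul_const (2 * m)⁻¹
  simp only [div_eq_mul_inv]
  erw [this.fderiv]
  simp
  ring

theorem fderiv_integralJ_shift (hn : 4 ≤ n) (hk : ∀ l, 2 ≤ l → k l = 0) (x w : Phase n) :
    fderiv ℝ (integralJ m s (blockField n k)) (shift s (blockField n k) x)
        (shift s (blockField n k) w)
      = (4 * fderiv ℝ (neumannG (potential n s k)) x w
        - 2 * neumannE (potential n s k) x * fderiv ℝ (neumannE (potential n s k)) x w
        - s ^ 3 * (k 0 ^ 3 * fderiv ℝ (ang ⟨0, by omega⟩ ⟨1, by omega⟩) x w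
          + k 1 ^ 3 * fderiv ℝ (ang ⟨2, by omega⟩ ⟨3, by omega⟩) x w)) / m ^ 2 := by
  rw [← fderiv_comp_shift]
  simp only [integralJ_shift_eq hn hk]
  have hd : ∀ i j, HasFDerivAt (ang i j) (fderiv ℝ (ang i j) x) x := fun i j =>
    ((contDiff_ang i j).differentiable (n := 1) (by simp) x).hasFDerivAt
  have hE := (contDiff_neumannE (a := potential n s k)).differentiable (n := 1) (by simp) x
    |>.hasFDerivAt
  have hG := (contDiff_neumannG (a := potential n s k)).differentiable (n := 1) (by simp) x
    |>.hasFDerivAt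
  have := (((hG.const_mul 4).sub (hE.pow 2)).sub
    ((((hd ⟨0, by omega⟩ ⟨1, by omega⟩).const_mul (k 0 ^ 3)).add
    ((hd ⟨2, by omega⟩ ⟨3, by omega⟩).const_mul (k 1 ^ 3))).const_mul (s ^ 3))).mul_const (m ^ 2)⁻¹
  simp only [div_eq_mul_inv]
  erw [this.fderiv]
  simp
  ring

/-! Blocks of consecutive coordinates. -/

/-- The coordinates with indices from `p` to `q - 1`. -/
def slab (n p q : ℕ) : Finset (Fin n) := Finset.univ.filter fun i => p ≤ (i : ℕ) ∧ (i : ℕ) < q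

theorem mem_slab {p q : ℕ} {i : Fin n} : i ∈ slab n p q ↔ p ≤ (i : ℕ) ∧ (i : ℕ) < q := by
  simp [slab]

theorem slab_disjoint {p q r t : ℕ} (h : q ≤ r) : Disjoint (slab n p q) (slab n r t) :=
  Finset.disjoint_left.2 fun i hi hi' => by
    rw [mem_slab] at hi hi'
    omega

theorem slab_union {p q r : ℕ} (h : p ≤ q) (h' : q ≤ r) :
    slab n p q ∪ slab n q r = slab n p r := by
  ext i
  simp only [Finset.mem_union, mem_slab]
  omega

theorem casimirSum_eq (s : ℝ) (κ : Matrix (Fin n) (Fin n) ℝ) (p q : ℕ) (x : Phase n)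
    (h : ∀ i ∈ slab n p q, ∀ j ∈ slab n p q,
      integralΦ s κ i j (shift s κ x) = ang i j x) :
    casimirSum s κ p q (shift s κ x) = casimir (slab n p q) x := by
  have h2 : 2 * casimir (slab n p q) x = ∑ i, ∑ j,
      if i ∈ slab n p q ∧ j ∈ slab n p q then ang i j x ^ 2 else 0 := by
    rw [casimir_eq_sum, ← Finset.sum_filter_add_sum_filter_not Finset.univ (· ∈ slab n p q)]
    simp only [Finset.filter_mem_eq_inter, Finset.univ_inter]
    rw [Finset.sum_eq_zero (s := Finset.univ.filter (· ∉ slab n p q)), add_zero]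
    · refine Finset.sum_congr rfl fun i hi => ?_
      simp only [hi, true_and, ← Finset.sum_filter, Finset.filter_mem_eq_inter, Finset.univ_inter]
    · intro i hi
      simp [(Finset.mem_filter.1 hi).2]
  have h3 : ∀ i j : Fin n, (if i ∈ slab n p q ∧ j ∈ slab n p q then ang i j x ^ 2 else 0)
      = (if p ≤ (i : ℕ) ∧ i < j ∧ (j : ℕ) < q then integralΦ s κ i j (shift s κ x) ^ 2 else 0)
        + (if p ≤ (j : ℕ) ∧ j < i ∧ (i : ℕ) < q then integralΦ s κ j i (shift s κ x) ^ 2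
          else 0) := by
    intro i j
    by_cases hij : i ∈ slab n p q ∧ j ∈ slab n p q
    · have hi := mem_slab.1 hij.1
      have hj := mem_slab.1 hij.2
      rcases lt_trichotomy i j with hlt | rfl | hlt
      · have : ¬ j < i := not_lt.2 hlt.le
        simp [hij, hi, hj, hlt, this, h i hij.1 j hij.2]
      · simp [ang]
      · have : ¬ i < j := not_lt.2 hlt.le
        simp [hij, hi, hj, hlt, this, h j hij.2 i hij.1, ang_swap j i]
    · rw [if_neg hij, if_neg, if_neg, add_zero]
      · rintro ⟨h1, h2, h3⟩
        rw [Fin.lt_def] at h2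
        exact hij ⟨mem_slab.2 ⟨by omega, by omega⟩, mem_slab.2 ⟨by omega, by omega⟩⟩
      · rintro ⟨h1, h2, h3⟩
        rw [Fin.lt_def] at h2
        exact hij ⟨mem_slab.2 ⟨by omega, by omega⟩, mem_slab.2 ⟨by omega, by omega⟩⟩
  have h4 : 2 * casimir (slab n p q) x = 2 * casimirSum s κ p q (shift s κ x) := by
    rw [h2]
    simp only [h3, Finset.sum_add_distrib]
    rw [Finset.sum_comm (f := fun i j : Fin n => if p ≤ (j : ℕ) ∧ j < i ∧ (i : ℕ) < q then
      integralΦ s κ j i (shift s κ x) ^ 2 else 0), two_mul]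
    rfl
  linarith

end MagneticSphere

namespace MagneticSphere

variable {n : ℕ} {k : ℕ → ℝ} {m s c : ℝ} {x y w : Phase n} {a : Fin n → ℝ}
  {κ : Matrix (Fin n) (Fin n) ℝ} {S S' S₁ S₂ S₃ : Finset (Fin n)}

/-! Frames of commuting fields that are in involution. -/

/-- A smooth field on the phase space that is tangent to `T*Sⁿ⁻¹`. -/
structure TangentField (X : Phase n → Phase n) : Prop where
  smooth : ContDiff ℝ ∞ X
  phi₁ : ∀ y, fderiv ℝ phi₁ y (X y) = 0
  phi₂ : ∀ y, fderiv ℝ phi₂ y (X y) = 0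

theorem tangentField_fieldE : TangentField (fieldE a) :=
  ⟨contDiff_fieldE, fieldE_phi₁, fieldE_phi₂⟩

theorem tangentField_fieldG : TangentField (fieldG a) :=
  ⟨contDiff_fieldG, fieldG_phi₁, fieldG_phi₂⟩

theorem tangentField_fieldBlock : TangentField (fieldBlock S) :=
  ⟨contDiff_fieldBlock, fieldBlock_phi₁, fieldBlock_phi₂⟩

theorem tangentField_fieldRot (h : κᵀ = -κ) : TangentField (fieldRot κ) :=
  ⟨contDiff_fieldRot, fieldRot_phi₁ h, fieldRot_phi₂ h⟩

/-- Two fields that commute and are in involution along `T*Sⁿ⁻¹`. -/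
def InInvolution (X Y : Phase n → Phase n) : Prop :=
  ∀ y ∈ cotangentSphere n, fderiv ℝ X y (Y y) = fderiv ℝ Y y (X y) ∧ canon (X y) (Y y) = 0

theorem InInvolution.symm {X Y : Phase n → Phase n} (h : InInvolution X Y) : InInvolution Y X :=
  fun y hy => ⟨(h y hy).1.symm, by rw [canon_swap, (h y hy).2, neg_zero]⟩

theorem inInvolution_self (X : Phase n → Phase n) : InInvolution X X :=
  fun y _ => ⟨rfl, canon_self (X y)⟩

theorem inInvolution_fieldE_fieldG : InInvolution (fieldE a) (fieldG a) :=
  fun _ hy => ⟨fieldE_comm_fieldG hy, canon_fieldE_fieldG hy⟩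

theorem inInvolution_fieldE_fieldBlock (ha : ∀ i ∈ S, a i = c) :
    InInvolution (fieldE a) (fieldBlock S) :=
  fun _ hy => ⟨fieldE_comm_fieldBlock hy ha, canon_fieldE_fieldBlock hy ha⟩

theorem inInvolution_fieldG_fieldBlock (ha : ∀ i ∈ S, a i = c) :
    InInvolution (fieldG a) (fieldBlock S) :=
  fun _ hy => ⟨fieldG_comm_fieldBlock hy ha, canon_fieldG_fieldBlock hy ha⟩

theorem inInvolution_fieldBlock (h : Disjoint S S') :
    InInvolution (fieldBlock S) (fieldBlock S') :=
  fun _ _ => ⟨fieldBlock_comm_fieldBlock h, canon_fieldBlock_fieldBlock h⟩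

theorem inInvolution_fieldE_fieldRot (h : IsSymmetry a κ) :
    InInvolution (fieldE a) (fieldRot κ) :=
  fun y hy => ⟨by rw [fieldE_comm_fieldRot h, fderiv_fieldRot], canon_fieldE_fieldRot h hy⟩

theorem inInvolution_fieldG_fieldRot (h : IsSymmetry a κ) :
    InInvolution (fieldG a) (fieldRot κ) :=
  fun y hy => ⟨by rw [fieldG_comm_fieldRot h, fderiv_fieldRot], canon_fieldG_fieldRot h hy⟩

theorem killsAng_of_eq_zero (h : ∀ i ∈ S, w.1 i = 0 ∧ w.2 i = 0) : KillsAng S x w := by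
  intro i hi j hj
  rw [fderiv_ang, (h i hi).1, (h i hi).2, (h j hj).1, (h j hj).2]
  ring

theorem UnitaryBlock.mulVec_eq_zero {i₀ i₁ i₂ i₃ : Fin n} {r : ℝ}
    (h : UnitaryBlock κ S i₀ i₁ i₂ i₃ r) {u : Fin n → ℝ} (hu : ∀ i ∈ S, u i = 0) :
    κ *ᵥ u = 0 := by
  have e₀ := hu i₀ ((h.mem _).2 (by simp))
  have e₁ := hu i₁ ((h.mem _).2 (by simp))
  have e₂ := hu i₂ ((h.mem _).2 (by simp))
  have e₃ := hu i₃ ((h.mem _).2 (by simp))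
  funext i
  by_cases hi : i ∈ S
  · rcases (h.mem i).1 hi with rfl | rfl | rfl | rfl
    · rw [h.h₀, e₁]; simp
    · rw [h.h₁, e₀]; simp
    · rw [h.h₂, e₃]; simp
    · rw [h.h₃, e₂]; simp
  · rw [h.off _ i hi]; rfl

theorem UnitaryBlock.inInvolution {i₀ i₁ i₂ i₃ : Fin n} {r : ℝ}
    (h : UnitaryBlock κ S i₀ i₁ i₂ i₃ r) (hd : Disjoint S S') :
    InInvolution (fieldRot κ) (fieldBlock S') := by
  have hS : ∀ i ∈ S', ∀ x : Phase n, (fieldRot κ x).1 i = 0 ∧ (fieldRot κ x).2 i = 0 :=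
    fun i hi x => h.fieldRot_of_notMem x (Finset.disjoint_right.1 hd hi)
  intro y _
  refine ⟨?_, ?_⟩
  · rw [fderiv_fieldRot, fderiv_fieldBlock (killsAng_of_eq_zero fun i hi => hS i hi y)]
    ext1
    · change κ *ᵥ (fieldBlock S' y).1 = blockRot S' y *ᵥ (fieldRot κ y).1
      rw [h.mulVec_eq_zero fun i hi => (fieldBlock_of_notMem (Finset.disjoint_left.1 hd hi)).1,
        blockRot_mulVec_eq_zero fun i hi => (hS i hi y).1]
    · change κ *ᵥ (fieldBlock S' y).2 = blockRot S' y *ᵥ (fieldRot κ y).2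
      rw [h.mulVec_eq_zero fun i hi => (fieldBlock_of_notMem (Finset.disjoint_left.1 hd hi)).2,
        blockRot_mulVec_eq_zero fun i hi => (hS i hi y).2]
  · simp only [canon, dotProduct]
    rw [Finset.sum_eq_zero, Finset.sum_eq_zero, sub_zero]
    · intro i _
      by_cases hi : i ∈ S'
      · rw [(hS i hi y).1, zero_mul]
      · rw [(fieldBlock_of_notMem hi).2, mul_zero]
    · intro i _
      by_cases hi : i ∈ S'
      · rw [(hS i hi y).2, zero_mul]
      · rw [(fieldBlock_of_notMem hi).1, mul_zero]

/-- A family of tangent fields that commute and are in involution. -/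
structure InvolutiveFrame {d : ℕ} (X : Fin d → Phase n → Phase n) : Prop where
  field : ∀ j, TangentField (X j)
  involution : ∀ i j, InInvolution (X i) (X j)

theorem involutiveFrame_nil : InvolutiveFrame (![] : Fin 0 → Phase n → Phase n) :=
  ⟨fun j => j.elim0, fun j => j.elim0⟩

theorem InvolutiveFrame.cons {d : ℕ} {X : Fin d → Phase n → Phase n} (h : InvolutiveFrame X)
    {Y : Phase n → Phase n} (hY : TangentField Y) (hYX : ∀ j, InInvolution Y (X j)) :
    InvolutiveFrame (Matrix.vecCons Y X) := by
  refine ⟨fun j => ?_, fun i j => ?_⟩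
  · refine Fin.cases ?_ (fun j => ?_) j
    · exact hY
    · exact h.field j
  · refine Fin.cases ?_ (fun i => ?_) i <;> refine Fin.cases ?_ (fun j => ?_) j
    · exact inInvolution_self Y
    · exact hYX j
    · exact (hYX i).symm
    · exact h.involution i j

theorem TwoBlocks.involutiveFrame (h : TwoBlocks S S' a c) :
    InvolutiveFrame ![fieldE a, fieldBlock S, fieldBlock S'] := by
  refine ((involutiveFrame_nil.cons tangentField_fieldBlock fun j => j.elim0).cons
    tangentField_fieldBlock ?_).cons tangentField_fieldE ?_
  · simpa using inInvolution_fieldBlock h.disj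
  · simpa [Fin.forall_fin_succ] using ⟨inInvolution_fieldE_fieldBlock h.h₁,
      inInvolution_fieldE_fieldBlock h.h₂⟩

theorem ThreeBlocks.involutiveFrame {c₁ c₂ : ℝ} (h : ThreeBlocks S₁ S₂ S₃ a c₁ c₂) :
    InvolutiveFrame ![fieldE a, fieldG a, fieldBlock S₁, fieldBlock S₂, fieldBlock S₃] := by
  refine ((((involutiveFrame_nil.cons tangentField_fieldBlock fun j => j.elim0).cons
    tangentField_fieldBlock ?_).cons tangentField_fieldBlock ?_).cons tangentField_fieldG ?_).cons
    tangentField_fieldE ?_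
  · simpa using inInvolution_fieldBlock h.disj₂₃
  · simpa [Fin.forall_fin_succ] using ⟨inInvolution_fieldBlock h.disj₁₂,
      inInvolution_fieldBlock h.disj₁₃⟩
  · simpa [Fin.forall_fin_succ] using ⟨inInvolution_fieldG_fieldBlock h.h₁,
      inInvolution_fieldG_fieldBlock h.h₂, inInvolution_fieldG_fieldBlock h.h₃⟩
  · simpa [Fin.forall_fin_succ] using ⟨inInvolution_fieldE_fieldG,
      inInvolution_fieldE_fieldBlock h.h₁, inInvolution_fieldE_fieldBlock h.h₂,
      inInvolution_fieldE_fieldBlock h.h₃⟩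

theorem TwoBlocks.involutiveFrame_unitary (h : TwoBlocks S S' a c) {i₀ i₁ i₂ i₃ : Fin n} {r : ℝ}
    (hκ : UnitaryBlock κ S i₀ i₁ i₂ i₃ r) (hs : IsSymmetry a κ) :
    InvolutiveFrame ![fieldE a, fieldG a, fieldRot κ, fieldBlock S'] := by
  refine (((involutiveFrame_nil.cons tangentField_fieldBlock fun j => j.elim0).cons
    (tangentField_fieldRot hs.skew) ?_).cons tangentField_fieldG ?_).cons tangentField_fieldE ?_
  · simpa using hκ.inInvolution h.disj
  · simpa [Fin.forall_fin_succ] using ⟨inInvolution_fieldG_fieldRot hs,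
      inInvolution_fieldG_fieldBlock h.h₂⟩
  · simpa [Fin.forall_fin_succ] using ⟨inInvolution_fieldE_fieldG,
      inInvolution_fieldE_fieldRot hs, inInvolution_fieldE_fieldBlock h.h₂⟩

theorem InvolutiveFrame.generic {ι : Type} [Fintype ι] {d : ℕ} {X : Fin d → Phase n → Phase n}
    (h : InvolutiveFrame X) (hm : 0 < m) (hκ : κᵀ = -κ) (ha : IsHalfSquare a s κ)
    {f : ι → Phase n → ℝ} (hf : ∀ i, ContDiff ℝ ∞ (f i)) {i₀ : ι} (hi₀ : f i₀ = energy m)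
    (hx : x ∈ cotangentSphere n)
    (hXf : ∀ y ∈ cotangentSphere n, ∀ j i,
      fderiv ℝ (f i) (shift s κ y) (shift s κ (X j y)) = 0)
    (hind : ∀ y ∈ canonicalLevel s κ f x, ∀ t : Fin d → ℝ, ∑ j, t j • X j y = 0 → t = 0)
    (hspan : ∀ y ∈ canonicalLevel s κ f x, ∀ v ∈ tangentAt y,
      (∀ i, fderiv ℝ (f i) (shift s κ y) (shift s κ v) = 0) →
        ∃ t : Fin d → ℝ, v = ∑ j, t j • X j y)
    {ν : Fin d → ℝ} (hν : ∀ y ∈ canonicalLevel s κ f x,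
      fieldE a y + (s / 2) • fieldRot κ y = ∑ j, ν j • X j y) :
    ddimAt f (shift s κ x) + dindAt s κ f (shift s κ x) = 2 * (n - 1) ∧
      dindAt s κ f (shift s κ x) = d ∧
      IsIsotropicInvariantTorus m s κ d (levelComponent f (shift s κ x)) := by
  refine generic_of_frame hm hκ ha hf hi₀ hx X (fun j => (h.field j).smooth)
    (fun j => (h.field j).phi₁) (fun j => (h.field j).phi₂) (fun i j y hy => hXf y hy j i)
    (fun i j y hy => (h.involution i j y hy).1) (fun y hy => ?_)
    (fun i j y hy => (h.involution i j y hy).2) (fun y hy v hv hvf => ?_) hν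
  · rw [Fintype.linearIndependent_iff]
    exact fun t ht j => congrFun (hind y hy t ht) j
  · obtain ⟨t, rfl⟩ := hspan y hy v hv hvf
    exact Submodule.sum_mem _ fun j _ =>
      Submodule.smul_mem _ _ (Submodule.subset_span (mem_range_self j))

/-! Hamiltonian vectors in the canonical momenta and brackets. -/

/-- `X` is the Hamiltonian vector at `x` of `g` on `T*Sⁿ⁻¹`, in the canonical momenta. -/
def IsHamVector (g : Phase n → ℝ) (x X : Phase n) : Prop :=
  X ∈ tangentAt x ∧ ∀ v ∈ tangentAt x, canon X v = -fderiv ℝ g x v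

theorem IsHamVector.diracBracket (hκ : κᵀ = -κ) {f g : Phase n → ℝ} (hx : x ∈ cotangentSphere n)
    {X : Phase n} (h : IsHamVector (fun y => g (shift s κ y)) x X) :
    diracBracket s κ f g (shift s κ x) = fderiv ℝ (fun y => f (shift s κ y)) x X := by
  rw [fderiv_comp_shift]
  refine diracBracket_eq_of_twistedForm hκ f ((shift_mem_cotangentSphere hκ x).2 hx)
    ((shift_mem_tangentAt hκ x X).2 h.1) fun v hv => ?_
  obtain ⟨w, rfl⟩ := (shift s κ).surjective v
  rw [twistedForm_shift hκ, h.2 w ((shift_mem_tangentAt hκ x w).1 hv), fderiv_comp_shift]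

theorem isHamVector_neumannE (hx : x ∈ cotangentSphere n) :
    IsHamVector (neumannE a) x ((2 : ℝ) • fieldE a x) := by
  refine ⟨Submodule.smul_mem _ _ (fieldE_mem x), fun v hv => ?_⟩
  rw [← canon_fieldE hx hv]
  simp [canon, smul_dotProduct, mul_sub]

theorem isHamVector_neumannG (hx : x ∈ cotangentSphere n) :
    IsHamVector (neumannG a) x ((2 : ℝ) • fieldG a x) := by
  refine ⟨Submodule.smul_mem _ _ (fieldG_mem x), fun v hv => ?_⟩
  rw [← canon_fieldG hx hv]
  simp [canon, smul_dotProduct, mul_sub]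

theorem canon_add (u v w : Phase n) : canon (u + v) w = canon u w + canon v w := by
  simp [canon, add_dotProduct]
  ring

theorem canon_smul (r : ℝ) (u w : Phase n) : canon (r • u) w = r * canon u w := by
  simp [canon, smul_dotProduct]
  ring

theorem IsHamVector.smul {g g' : Phase n → ℝ} {X : Phase n} (h : IsHamVector g x X) (r : ℝ)
    (hg : fderiv ℝ g' x = r • fderiv ℝ g x) : IsHamVector g' x (r • X) := by
  refine ⟨Submodule.smul_mem _ _ h.1, fun v hv => ?_⟩
  rw [hg, canon_smul, h.2 v hv]
  simp

theorem IsHamVector.add {g₁ g₂ g' : Phase n → ℝ} {X₁ X₂ : Phase n} (h₁ : IsHamVector g₁ x X₁)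
    (h₂ : IsHamVector g₂ x X₂) (hg : fderiv ℝ g' x = fderiv ℝ g₁ x + fderiv ℝ g₂ x) :
    IsHamVector g' x (X₁ + X₂) := by
  refine ⟨Submodule.add_mem _ h₁.1 h₂.1, fun v hv => ?_⟩
  rw [hg, canon_add, h₁.2 v hv, h₂.2 v hv, _root_.add_apply]
  ring

/-- The generator of the rotations in the plane of the coordinates `p` and `q`. -/
def rotGen (p q : Fin n) : Matrix (Fin n) (Fin n) ℝ :=
  Matrix.single q p 1 - Matrix.single p q 1

theorem rotGen_skew (p q : Fin n) : (rotGen p q)ᵀ = -rotGen p q := by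
  simp [rotGen, Matrix.transpose_sub, Matrix.transpose_single]

theorem rotGen_mulVec (p q : Fin n) (u : Fin n → ℝ) (i : Fin n) :
    (rotGen p q *ᵥ u) i = (if i = q then u p else 0) - if i = p then u q else 0 := by
  rw [rotGen, Matrix.sub_mulVec, Pi.sub_apply, Matrix.single_mulVec, Matrix.single_mulVec]
  simp [Function.update_apply]

theorem momentum_rotGen (p q : Fin n) : momentum (rotGen p q) = ang p q := by
  funext x
  simp only [momentum, dotProduct, rotGen_mulVec, mul_sub, Finset.sum_sub_distrib, mul_ite,
    mul_zero, Finset.sum_ite_eq', Finset.mem_univ, if_true, ang]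
  ring

theorem isHamVector_ang (p q : Fin n) (x : Phase n) :
    IsHamVector (ang p q) x (fieldRot (rotGen p q) x) :=
  ⟨fieldRot_mem (rotGen_skew p q) x, fun v _ => by
    rw [canon_fieldRot (rotGen_skew p q), momentum_rotGen]⟩

theorem rotGen_isSymmetry {p q : Fin n} (h : a p = a q) : IsSymmetry a (rotGen p q) := by
  refine ⟨rotGen_skew p q, fun u => ?_⟩
  funext i
  simp only [rotGen_mulVec, Pi.mul_apply]
  split_ifs with h₁ h₂ h₂
  · rw [h₁, h]; ring
  · rw [h₁, h]; ring
  · rw [h₂, h]; ring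
  · ring

theorem fderiv_ang_rotGen (i j p q : Fin n) (x : Phase n) :
    fderiv ℝ (ang i j) x (fieldRot (rotGen p q) x)
      = (if i = q then ang p j x else 0) - (if i = p then ang q j x else 0)
        + (if j = q then ang i p x else 0) - if j = p then ang i q x else 0 := by
  rw [fderiv_ang]
  simp only [fieldRot, rotGen_mulVec, ang]
  split_ifs <;> ring

end MagneticSphere

namespace MagneticSphere

variable {n : ℕ} {k : ℕ → ℝ} {m s c r : ℝ} {x y w : Phase n} {a : Fin n → ℝ}
  {κ Ω : Matrix (Fin n) (Fin n) ℝ} {S S' : Finset (Fin n)}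

theorem fderiv_energy_comp_shift (ha : IsHalfSquare a s κ) (hκ : κᵀ = -κ) (x : Phase n) :
    fderiv ℝ (fun y => energy m (shift s κ y)) x
      = (2 * m)⁻¹ • (fderiv ℝ (neumannE a) x + s • fderiv ℝ (momentum κ) x) := by
  have hE := (contDiff_neumannE (a := a)).differentiable (n := 1) (by simp) x |>.hasFDerivAt
  have hM := (contDiff_momentum (Ω := κ)).differentiable (n := 1) (by simp) x |>.hasFDerivAt
  simp only [energy_shift ha hκ, div_eq_inv_mul]
  exact ((hE.add (hM.const_mul s)).const_mul (2 * m)⁻¹).fderiv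

theorem fderiv_integralJ_comp_shift (ha : IsHalfSquare a s κ) (hκ : κᵀ = -κ) (x : Phase n) :
    fderiv ℝ (fun y => integralJ m s κ (shift s κ y)) x
      = (m ^ 2)⁻¹ • ((4 : ℝ) • fderiv ℝ (neumannG a) x
        + (-(2 * neumannE a x)) • fderiv ℝ (neumannE a) x
        + (-s ^ 3) • fderiv ℝ (momentum (κ * κ * κ)) x) := by
  have hE := (contDiff_neumannE (a := a)).differentiable (n := 1) (by simp) x |>.hasFDerivAt
  have hG := (contDiff_neumannG (a := a)).differentiable (n := 1) (by simp) x |>.hasFDerivAt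
  have hM := (contDiff_momentum (Ω := κ * κ * κ)).differentiable (n := 1) (by simp) x
    |>.hasFDerivAt
  simp only [integralJ_shift ha hκ, div_eq_inv_mul]
  have h := ((((hG.const_mul 4).sub (hE.pow 2)).sub (hM.const_mul (s ^ 3))).const_mul
    (m ^ 2)⁻¹).fderiv
  refine Eq.trans h (congrArg _ (ContinuousLinearMap.ext fun v => ?_))
  simp
  ring

theorem isHamVector_energy (ha : IsHalfSquare a s κ) (hκ : κᵀ = -κ) (hx : x ∈ cotangentSphere n) :
    IsHamVector (fun y => energy m (shift s κ y)) x
      ((2 * m)⁻¹ • ((2 : ℝ) • fieldE a x + s • fieldRot κ x)) := by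
  have hM : IsHamVector (momentum κ) x (fieldRot κ x) :=
    ⟨fieldRot_mem hκ x, fun v _ => canon_fieldRot hκ x v⟩
  refine ⟨Submodule.smul_mem _ _ (Submodule.add_mem _ (isHamVector_neumannE hx).1
    (Submodule.smul_mem _ _ hM.1)), fun v hv => ?_⟩
  rw [fderiv_energy_comp_shift ha hκ, canon_smul, canon_add, (isHamVector_neumannE hx).2 v hv,
    canon_smul, hM.2 v hv]
  simp
  ring

theorem isHamVector_integralJ (ha : IsHalfSquare a s κ) (hκ : κᵀ = -κ)
    (hx : x ∈ cotangentSphere n) :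
    IsHamVector (fun y => integralJ m s κ (shift s κ y)) x
      ((m ^ 2)⁻¹ • ((4 : ℝ) • (2 : ℝ) • fieldG a x + (-(2 * neumannE a x)) • (2 : ℝ) • fieldE a x
        + (-s ^ 3) • fieldRot (κ * κ * κ) x)) := by
  have hc := (ha.isSymmetry_cube hκ).skew
  have hM : IsHamVector (momentum (κ * κ * κ)) x (fieldRot (κ * κ * κ) x) :=
    ⟨fieldRot_mem hc x, fun v _ => canon_fieldRot hc x v⟩
  refine ⟨Submodule.smul_mem _ _ (Submodule.add_mem _ (Submodule.add_mem _
    (Submodule.smul_mem _ _ (isHamVector_neumannG hx).1)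
    (Submodule.smul_mem _ _ (isHamVector_neumannE hx).1)) (Submodule.smul_mem _ _ hM.1)),
    fun v hv => ?_⟩
  have hE := canon_fieldE (a := a) hx hv
  have hG := canon_fieldG (a := a) hx hv
  rw [fderiv_integralJ_comp_shift ha hκ]
  simp only [canon_add, canon_smul, hM.2 v hv, hE, hG]
  simp
  ring

/-- `f`, expressed in the canonical momenta, is constant along the fields from which the
Hamiltonian fields of the energy and of `J` are composed. -/
structure Conserved (a : Fin n → ℝ) (s : ℝ) (κ : Matrix (Fin n) (Fin n) ℝ)
    (f : Phase n → ℝ) : Prop where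
  fieldE : ∀ x ∈ cotangentSphere n, fderiv ℝ (fun y => f (shift s κ y)) x (fieldE a x) = 0
  fieldG : ∀ x ∈ cotangentSphere n, fderiv ℝ (fun y => f (shift s κ y)) x (fieldG a x) = 0
  rot : ∀ x ∈ cotangentSphere n, fderiv ℝ (fun y => f (shift s κ y)) x (fieldRot κ x) = 0
  rot_cube : ∀ x ∈ cotangentSphere n,
    fderiv ℝ (fun y => f (shift s κ y)) x (fieldRot (κ * κ * κ) x) = 0

theorem forall_cotangentSphere (hκ : κᵀ = -κ) {P : Phase n → Prop}
    (h : ∀ x ∈ cotangentSphere n, P (shift s κ x)) : ∀ z ∈ cotangentSphere n, P z := by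
  intro z hz
  obtain ⟨x, rfl⟩ := (shift s κ).surjective z
  exact h x ((shift_mem_cotangentSphere hκ x).1 hz)

namespace Conserved

variable {f : Phase n → ℝ}

theorem isFirstIntegral (h : Conserved a s κ f) (ha : IsHalfSquare a s κ) (hκ : κᵀ = -κ) :
    IsFirstIntegral m s κ f := by
  refine forall_cotangentSphere (s := s) hκ fun x hx => ?_
  rw [magneticField_shift ha hκ hx, ← fderiv_comp_shift, map_smul, map_add, map_smul,
    h.fieldE x hx, h.rot x hx]
  simp

theorem bracket_energy (h : Conserved a s κ f) (ha : IsHalfSquare a s κ) (hκ : κᵀ = -κ) :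
    ∀ z ∈ cotangentSphere n, diracBracket s κ f (energy m) z = 0 := by
  refine forall_cotangentSphere (s := s) hκ fun x hx => ?_
  rw [(isHamVector_energy ha hκ hx).diracBracket hκ hx]
  simp only [map_smul, map_add, h.fieldE x hx, h.rot x hx, smul_zero, add_zero]

theorem bracket_integralJ (h : Conserved a s κ f) (ha : IsHalfSquare a s κ) (hκ : κᵀ = -κ) :
    ∀ z ∈ cotangentSphere n, diracBracket s κ f (integralJ m s κ) z = 0 := by
  refine forall_cotangentSphere (s := s) hκ fun x hx => ?_
  rw [(isHamVector_integralJ ha hκ hx).diracBracket hκ hx]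
  simp only [map_smul, map_add, h.fieldE x hx, h.fieldG x hx, h.rot_cube x hx, smul_zero, add_zero]

end Conserved

theorem fderiv_momentum_comm (h : Ωᵀ = -Ω) {Ω' : Matrix (Fin n) (Fin n) ℝ}
    (hc : Ω' * Ω = Ω * Ω') (x : Phase n) : fderiv ℝ (momentum Ω') x (fieldRot Ω x) = 0 := by
  rw [fderiv_momentum_fieldRot h, hc, sub_self, momentum, Matrix.zero_mulVec, dotProduct_zero]

theorem conserved_energy (ha : IsHalfSquare a s κ) (hκ : κᵀ = -κ) :
    Conserved a s κ (energy m) := by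
  have h₁ := ha.isSymmetry hκ
  have h₃ := ha.isSymmetry_cube hκ
  constructor <;> intro x hx <;> rw [fderiv_energy_comp_shift ha hκ] <;>
    simp only [_root_.add_apply, _root_.smul_apply]
  · rw [fderiv_neumannE_fieldE hx, fderiv_momentum_fieldE h₁ hx]; simp
  · rw [fderiv_neumannE_fieldG hx, fderiv_momentum_fieldG h₁ hx]; simp
  · rw [fderiv_neumannE_fieldRot h₁, fderiv_momentum_comm hκ rfl]; simp
  · rw [fderiv_neumannE_fieldRot h₃, fderiv_momentum_comm h₃.skew (by simp only [mul_assoc])]; simp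

theorem conserved_integralJ (ha : IsHalfSquare a s κ) (hκ : κᵀ = -κ) :
    Conserved a s κ (integralJ m s κ) := by
  have h₁ := ha.isSymmetry hκ
  have h₃ := ha.isSymmetry_cube hκ
  constructor <;> intro x hx <;> rw [fderiv_integralJ_comp_shift ha hκ] <;>
    simp only [_root_.add_apply, _root_.smul_apply]
  · rw [fderiv_neumannE_fieldE hx, fderiv_neumannG_fieldE hx, fderiv_momentum_fieldE h₃ hx]; simp
  · rw [fderiv_neumannE_fieldG hx, fderiv_neumannG_fieldG hx, fderiv_momentum_fieldG h₃ hx]; simp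
  · rw [fderiv_neumannE_fieldRot h₁, fderiv_neumannG_fieldRot h₁,
      fderiv_momentum_comm hκ (by simp only [mul_assoc])]
    simp
  · rw [fderiv_neumannE_fieldRot h₃, fderiv_neumannG_fieldRot h₃,
      fderiv_momentum_comm h₃.skew rfl]
    simp

/-- `Ω` is `r` times a rotation generator in the plane of the coordinates `i`, `j`. -/
def IsPlane (Ω : Matrix (Fin n) (Fin n) ℝ) (i j : Fin n) (r : ℝ) : Prop :=
  ∀ u, (Ω *ᵥ u) i = r * u j ∧ (Ω *ᵥ u) j = -(r * u i)

theorem IsPlane.cube {i j : Fin n} (h : IsPlane Ω i j r) : IsPlane (Ω * Ω * Ω) i j (-r ^ 3) := by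
  intro u
  rw [← Matrix.mulVec_mulVec, ← Matrix.mulVec_mulVec]
  constructor
  · rw [(h _).1, (h _).2, (h _).1]; ring
  · rw [(h _).2, (h _).1, (h _).2]; ring

theorem IsPlane.fderiv_ang {i j : Fin n} (h : IsPlane Ω i j r) (x : Phase n) :
    fderiv ℝ (ang i j) x (fieldRot Ω x) = 0 := by
  rw [MagneticSphere.fderiv_ang]
  simp only [fieldRot, (h _).1, (h _).2]
  ring

theorem IsPlane.fderiv_ang₁ {i₀ i₁ i₂ i₃ : Fin n} (h : IsPlane Ω i₀ i₁ r)
    (h' : IsPlane Ω i₂ i₃ r) (x : Phase n) :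
    fderiv ℝ (ang i₁ i₂) x (fieldRot Ω x) - fderiv ℝ (ang i₀ i₃) x (fieldRot Ω x) = 0 := by
  rw [MagneticSphere.fderiv_ang, MagneticSphere.fderiv_ang]
  simp only [fieldRot, (h _).1, (h _).2, (h' _).1, (h' _).2]
  ring

theorem IsPlane.fderiv_ang₂ {i₀ i₁ i₂ i₃ : Fin n} (h : IsPlane Ω i₀ i₁ r)
    (h' : IsPlane Ω i₂ i₃ r) (x : Phase n) :
    fderiv ℝ (ang i₀ i₂) x (fieldRot Ω x) + fderiv ℝ (ang i₁ i₃) x (fieldRot Ω x) = 0 := by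
  rw [MagneticSphere.fderiv_ang, MagneticSphere.fderiv_ang]
  simp only [fieldRot, (h _).1, (h _).2, (h' _).1, (h' _).2]
  ring

theorem conserved_of_ang {i j : Fin n} {f : Phase n → ℝ}
    (hf : ∀ x, f (shift s κ x) = ang i j x) (haij : a i = a j) (hp : IsPlane κ i j r) :
    Conserved a s κ f := by
  have ha : ∀ l ∈ ({i, j} : Finset (Fin n)), a l = a j := by simp [haij]
  have h : (fun y => f (shift s κ y)) = ang i j := funext hf
  constructor <;> intro x hx <;> rw [h]
  · exact (fieldE_isSl₂On hx ha).killsAng i (by simp) j (by simp)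
  · exact (fieldG_isSl₂On hx ha).killsAng i (by simp) j (by simp)
  · exact hp.fderiv_ang x
  · exact hp.cube.fderiv_ang x

theorem conserved_of_ang_sub {i₀ i₁ i₂ i₃ : Fin n} {f : Phase n → ℝ}
    (hf : ∀ x, f (shift s κ x) = ang i₁ i₂ x - ang i₀ i₃ x)
    (ha : ∀ l ∈ ({i₀, i₁, i₂, i₃} : Finset (Fin n)), a l = c)
    (hp : IsPlane κ i₀ i₁ r) (hp' : IsPlane κ i₂ i₃ r) : Conserved a s κ f := by
  have hd : ∀ i j x, HasFDerivAt (ang i j) (fderiv ℝ (ang i j) x) (x : Phase n) := fun i j x =>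
    ((contDiff_ang i j).differentiable (n := 1) (by simp) x).hasFDerivAt
  have h : ∀ x w, fderiv ℝ (fun y => f (shift s κ y)) x w
      = fderiv ℝ (ang i₁ i₂) x w - fderiv ℝ (ang i₀ i₃) x w := fun x w => by
    simp only [hf]
    exact congrArg (· w) ((hd i₁ i₂ x).sub (hd i₀ i₃ x)).fderiv
  constructor <;> intro x hx <;> rw [h]
  · rw [(fieldE_isSl₂On hx ha).killsAng i₁ (by simp) i₂ (by simp),
      (fieldE_isSl₂On hx ha).killsAng i₀ (by simp) i₃ (by simp), sub_zero]
  · rw [(fieldG_isSl₂On hx ha).killsAng i₁ (by simp) i₂ (by simp),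
      (fieldG_isSl₂On hx ha).killsAng i₀ (by simp) i₃ (by simp), sub_zero]
  · exact hp.fderiv_ang₁ hp' x
  · exact hp.cube.fderiv_ang₁ hp'.cube x

theorem conserved_of_ang_add {i₀ i₁ i₂ i₃ : Fin n} {f : Phase n → ℝ}
    (hf : ∀ x, f (shift s κ x) = ang i₀ i₂ x + ang i₁ i₃ x)
    (ha : ∀ l ∈ ({i₀, i₁, i₂, i₃} : Finset (Fin n)), a l = c)
    (hp : IsPlane κ i₀ i₁ r) (hp' : IsPlane κ i₂ i₃ r) : Conserved a s κ f := by
  have hd : ∀ i j x, HasFDerivAt (ang i j) (fderiv ℝ (ang i j) x) (x : Phase n) := fun i j x =>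
    ((contDiff_ang i j).differentiable (n := 1) (by simp) x).hasFDerivAt
  have h : ∀ x w, fderiv ℝ (fun y => f (shift s κ y)) x w
      = fderiv ℝ (ang i₀ i₂) x w + fderiv ℝ (ang i₁ i₃) x w := fun x w => by
    simp only [hf]
    exact congrArg (· w) ((hd i₀ i₂ x).add (hd i₁ i₃ x)).fderiv
  constructor <;> intro x hx <;> rw [h]
  · rw [(fieldE_isSl₂On hx ha).killsAng i₀ (by simp) i₂ (by simp),
      (fieldE_isSl₂On hx ha).killsAng i₁ (by simp) i₃ (by simp), add_zero]
  · rw [(fieldG_isSl₂On hx ha).killsAng i₀ (by simp) i₂ (by simp),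
      (fieldG_isSl₂On hx ha).killsAng i₁ (by simp) i₃ (by simp), add_zero]
  · exact hp.fderiv_ang₂ hp' x
  · exact hp.cube.fderiv_ang₂ hp'.cube x

theorem fderiv_blockDot {E : Type*} [NormedAddCommGroup E] [NormedSpace ℝ E]
    (S : Finset (Fin n)) (f g : E →L[ℝ] (Fin n → ℝ)) (x v : E) :
    fderiv ℝ (fun x => blockDot S (f x) (g x)) x v
      = blockDot S (f v) (g x) + blockDot S (f x) (g v) := by
  have h : HasFDerivAt (fun x => blockDot S (f x) (g x))
      (∑ i ∈ S, (f x i • ((ContinuousLinearMap.proj i).comp g : E →L[ℝ] ℝ)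
        + g x i • ((ContinuousLinearMap.proj i).comp f : E →L[ℝ] ℝ))) x := by
    refine HasFDerivAt.fun_sum fun i _ => ?_
    exact ((ContinuousLinearMap.proj i).comp f : E →L[ℝ] ℝ).hasFDerivAt.mul
      ((ContinuousLinearMap.proj i).comp g : E →L[ℝ] ℝ).hasFDerivAt
  rw [h.fderiv]
  simp only [blockDot, _root_.sum_apply, _root_.add_apply, _root_.smul_apply,
    ContinuousLinearMap.comp_apply, ContinuousLinearMap.proj_apply, smul_eq_mul,
    ← Finset.sum_add_distrib]
  exact Finset.sum_congr rfl fun i _ => by ring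

theorem fderiv_casimir (x w : Phase n) :
    fderiv ℝ (casimir S) x w = blockDot S x.2 x.2 * (2 * blockDot S x.1 w.1)
      + blockDot S x.1 x.1 * (2 * blockDot S x.2 w.2)
      - 2 * blockDot S x.1 x.2 * (blockDot S x.1 w.2 + blockDot S x.2 w.1) := by
  have e : ∀ f g : Phase n →L[ℝ] (Fin n → ℝ), HasFDerivAt (fun x => blockDot S (f x) (g x))
      (fderiv ℝ (fun x => blockDot S (f x) (g x)) x) x := fun f g =>
    ((contDiff_blockDot f.contDiff g.contDiff).differentiable (n := 1) (by simp) x).hasFDerivAt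
  set p := ContinuousLinearMap.fst ℝ (Fin n → ℝ) (Fin n → ℝ)
  set q := ContinuousLinearMap.snd ℝ (Fin n → ℝ) (Fin n → ℝ)
  have h : HasFDerivAt (casimir S) _ x := ((e p p).mul (e q q)).sub ((e p q).pow 2)
  rw [h.fderiv]
  simp only [_root_.sub_apply, _root_.add_apply, _root_.smul_apply, fderiv_blockDot]
  simp only [p, q, ContinuousLinearMap.coe_fst', ContinuousLinearMap.coe_snd', smul_eq_mul,
    blockDot_comm w.1, blockDot_comm w.2]
  simp
  ring

theorem contDiff_casimir {k : WithTop ℕ∞} : ContDiff ℝ k (casimir (n := n) S) :=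
  ((contDiff_blockDot contDiff_fst contDiff_fst).mul
    (contDiff_blockDot contDiff_snd contDiff_snd)).sub
    ((contDiff_blockDot contDiff_fst contDiff_snd).pow 2)

theorem KillsAng.fderiv_casimir (h : KillsAng S x w) : fderiv ℝ (casimir S) x w = 0 := by
  rw [MagneticSphere.fderiv_casimir, h.casimir_variation]

theorem fieldBlock_mem (x : Phase n) : fieldBlock S x ∈ tangentAt x :=
  mem_tangentAt_iff_fderiv.2 ⟨fieldBlock_phi₁ x, fieldBlock_phi₂ x⟩

theorem dotProduct_eq_blockDot {u : Fin n → ℝ} (hu : ∀ i ∉ S, u i = 0) (v : Fin n → ℝ) :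
    u ⬝ᵥ v = blockDot S v u := by
  rw [dotProduct, blockDot, ← Finset.sum_subset (Finset.subset_univ S) fun i _ hi => by
    rw [hu i hi, zero_mul]]
  exact Finset.sum_congr rfl fun i _ => mul_comm _ _

theorem isHamVector_casimir (S : Finset (Fin n)) (x : Phase n) :
    IsHamVector (casimir S) x ((2 : ℝ) • fieldBlock S x) := by
  refine ⟨Submodule.smul_mem _ _ (fieldBlock_mem x), fun v _ => ?_⟩
  have h := fieldBlock_isSl₂On (S := S) (x := x)
  rw [canon_smul, canon, dotProduct_eq_blockDot fun i hi => (fieldBlock_of_notMem hi).2,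
    dotProduct_comm, dotProduct_comm, dotProduct_eq_blockDot fun i hi => (fieldBlock_of_notMem hi).1,
    h.dot₁, h.dot₂, fderiv_casimir, blockDot_comm v.1, blockDot_comm v.2, blockDot_comm v.1,
    blockDot_comm v.2]
  ring

theorem conserved_of_casimir {f : Phase n → ℝ} (hf : ∀ x, f (shift s κ x) = casimir S x)
    (ha : ∀ i ∈ S, a i = c) (hκ : ∀ i ∈ S, ∀ u, (κ *ᵥ u) i = 0) : Conserved a s κ f := by
  have h : (fun y => f (shift s κ y)) = casimir S := funext hf
  constructor <;> intro x hx <;> rw [h]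
  · exact (fieldE_isSl₂On hx ha).killsAng.fderiv_casimir
  · exact (fieldG_isSl₂On hx ha).killsAng.fderiv_casimir
  · exact (killsAng_of_eq_zero fun i hi => ⟨hκ i hi _, hκ i hi _⟩).fderiv_casimir
  · refine (killsAng_of_eq_zero fun i hi => ?_).fderiv_casimir
    simp only [fieldRot, ← Matrix.mulVec_mulVec]
    exact ⟨hκ i hi _, hκ i hi _⟩

/-! Smoothness of the integrals. -/

theorem contDiff_energy {l : WithTop ℕ∞} : ContDiff ℝ l (energy (n := n) m) :=
  (contDiff_dotProduct contDiff_snd contDiff_snd).div_const _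

theorem contDiff_multiplier {l : WithTop ℕ∞} : ContDiff ℝ l (multiplier m s κ) :=
  ((contDiff_const.mul (contDiff_dotProduct contDiff_snd (contDiff_mulVec contDiff_fst))).sub
    (contDiff_dotProduct contDiff_snd contDiff_snd)).div_const _

theorem contDiff_integralJ {l : WithTop ℕ∞} : ContDiff ℝ l (integralJ m s κ) :=
  (contDiff_const.mul (contDiff_dotProduct (contDiff_mulVec contDiff_snd)
    (contDiff_mulVec contDiff_snd))).sub (contDiff_multiplier.pow 2)

theorem contDiff_integralΦ {l : WithTop ℕ∞} (i j : Fin n) : ContDiff ℝ l (integralΦ s κ i j) := by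
  unfold integralΦ
  fun_prop

theorem contDiff_integralΨ₁ {l : WithTop ℕ∞} (p q i j : Fin n) :
    ContDiff ℝ l (integralΨ₁ s κ p q i j) := by
  unfold integralΨ₁
  fun_prop

theorem contDiff_integralΨ₂ {l : WithTop ℕ∞} (p q i j : Fin n) :
    ContDiff ℝ l (integralΨ₂ s κ p q i j) := by
  unfold integralΨ₂
  fun_prop

theorem contDiff_casimirSum {l : WithTop ℕ∞} (p q : ℕ) : ContDiff ℝ l (casimirSum s κ p q) := by
  refine ContDiff.sum fun i _ => ContDiff.sum fun j _ => ?_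
  split_ifs
  · exact (contDiff_integralΦ i j).pow 2
  · exact contDiff_const

/-! The integrals are conserved. -/

theorem isPlane₀₁ (hn : 4 ≤ n) :
    IsPlane (blockField n k) ⟨0, by omega⟩ ⟨1, by omega⟩ (k 0) :=
  fun u => ⟨mulVec₀ hn u, mulVec₁ hn u⟩

theorem isPlane₂₃ (hn : 4 ≤ n) :
    IsPlane (blockField n k) ⟨2, by omega⟩ ⟨3, by omega⟩ (k 1) :=
  fun u => ⟨mulVec₂ hn u, mulVec₃ hn u⟩

theorem isPlane_of_eq_zero {i j : Fin n} (hi : k ((i : ℕ) / 2) = 0) (hj : k ((j : ℕ) / 2) = 0) :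
    IsPlane (blockField n k) i j 0 := fun u => by
  rw [blockField_mulVec_eq_zero hi, blockField_mulVec_eq_zero hj]
  simp

theorem potential_eq_zero {i : Fin n} (hi : k ((i : ℕ) / 2) = 0) : potential n s k i = 0 := by
  rw [potential, hi]
  ring

theorem potential_slab₀ : ∀ i ∈ slab n 0 2, potential n s k i = s ^ 2 / 4 * k 0 ^ 2 := by
  intro i hi
  rw [mem_slab] at hi
  rw [potential, show (i : ℕ) / 2 = 0 by omega]

theorem potential_slab₂ : ∀ i ∈ slab n 2 4, potential n s k i = s ^ 2 / 4 * k 1 ^ 2 := by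
  intro i hi
  rw [mem_slab] at hi
  rw [potential, show (i : ℕ) / 2 = 1 by omega]

theorem potential_slab {q : ℕ} (hk : ∀ i, q ≤ i → k (i / 2) = 0) :
    ∀ i ∈ slab n q n, potential n s k i = 0 :=
  fun i hi => potential_eq_zero (hk i (mem_slab.1 hi).1)

theorem conserved_integralΦ₀₁ (hn : 4 ≤ n) : Conserved (potential n s k) s (blockField n k)
    (integralΦ s (blockField n k) ⟨0, by omega⟩ ⟨1, by omega⟩) :=
  conserved_of_ang (integralΦ₀₁_shift hn) (by simp [potential]) (isPlane₀₁ hn)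

theorem conserved_integralΦ₂₃ (hn : 4 ≤ n) : Conserved (potential n s k) s (blockField n k)
    (integralΦ s (blockField n k) ⟨2, by omega⟩ ⟨3, by omega⟩) :=
  conserved_of_ang (integralΦ₂₃_shift hn) (by simp [potential]) (isPlane₂₃ hn)

theorem conserved_integralΦ {i j : Fin n} (hi : k ((i : ℕ) / 2) = 0) (hj : k ((j : ℕ) / 2) = 0) :
    Conserved (potential n s k) s (blockField n k) (integralΦ s (blockField n k) i j) :=
  conserved_of_ang (integralΦ_shift_of_eq_zero hi hj)
    (by rw [potential_eq_zero hi, potential_eq_zero hj]) (isPlane_of_eq_zero hi hj)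

theorem mem_four (hn : 4 ≤ n) (h : k 0 = k 1) : ∀ l ∈ ({⟨0, by omega⟩, ⟨1, by omega⟩, ⟨2, by omega⟩,
    ⟨3, by omega⟩} : Finset (Fin n)), potential n s k l = s ^ 2 / 4 * k 0 ^ 2 := by
  intro l hl
  simp only [Finset.mem_insert, Finset.mem_singleton] at hl
  rcases hl with rfl | rfl | rfl | rfl <;> simp [potential, h]

theorem conserved_integralΨ₁ (hn : 4 ≤ n) (h : k 0 = k 1) :
    Conserved (potential n s k) s (blockField n k) (integralΨ₁ s (blockField n k)
      ⟨0, by omega⟩ ⟨1, by omega⟩ ⟨2, by omega⟩ ⟨3, by omega⟩) :=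
  conserved_of_ang_sub (integralΨ₁_shift hn h) (mem_four hn h) (isPlane₀₁ hn)
    (h ▸ isPlane₂₃ hn)

theorem conserved_integralΨ₂ (hn : 4 ≤ n) (h : k 0 = k 1) :
    Conserved (potential n s k) s (blockField n k) (integralΨ₂ s (blockField n k)
      ⟨0, by omega⟩ ⟨1, by omega⟩ ⟨2, by omega⟩ ⟨3, by omega⟩) :=
  conserved_of_ang_add (integralΨ₂_shift hn h) (mem_four hn h) (isPlane₀₁ hn)
    (h ▸ isPlane₂₃ hn)

theorem casimirSum_shift {p : ℕ} (hk : ∀ i, p ≤ i → k (i / 2) = 0) (q : ℕ) (x : Phase n) :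
    casimirSum s (blockField n k) p q (shift s (blockField n k) x) = casimir (slab n p q) x :=
  casimirSum_eq s _ p q x fun i hi j hj =>
    integralΦ_shift_of_eq_zero (hk i (mem_slab.1 hi).1) (hk j (mem_slab.1 hj).1) x

theorem conserved_casimirSum {p : ℕ} (hk : ∀ i, p ≤ i → k (i / 2) = 0) (q : ℕ) :
    Conserved (potential n s k) s (blockField n k) (casimirSum s (blockField n k) p q) :=
  conserved_of_casimir (casimirSum_shift hk q)
    (fun i hi => potential_eq_zero (hk i (mem_slab.1 hi).1))
    fun i hi u => blockField_mulVec_eq_zero (hk i (mem_slab.1 hi).1) u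

/-! The algebra generated by the integrals. -/

section Realizes

variable {ι : Type} {f : ι → Phase n → ℝ}

/-- `h` is, in the canonical momenta, an element of the algebra generated by the functions `fᵢ`. -/
def Realizes (s : ℝ) (κ : Matrix (Fin n) (Fin n) ℝ) (f : ι → Phase n → ℝ) (h : Phase n → ℝ) : Prop :=
  ∃ g ∈ Algebra.adjoin ℝ (range f), ∀ x, g (shift s κ x) = h x

theorem realizes_apply (i : ι) : Realizes s κ f fun x => f i (shift s κ x) :=
  ⟨f i, Algebra.subset_adjoin (mem_range_self i), fun _ => rfl⟩

theorem Realizes.congr {h h' : Phase n → ℝ} (hr : Realizes s κ f h) (e : ∀ x, h' x = h x) :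
    Realizes s κ f h' := by
  obtain ⟨g, hg, hgh⟩ := hr
  exact ⟨g, hg, fun x => by rw [hgh, e]⟩

theorem realizes_zero : Realizes s κ f fun _ => 0 :=
  ⟨0, Subalgebra.zero_mem _, fun _ => rfl⟩

theorem Realizes.add {h h' : Phase n → ℝ} (hr : Realizes s κ f h) (hr' : Realizes s κ f h') :
    Realizes s κ f fun x => h x + h' x := by
  obtain ⟨g, hg, hgh⟩ := hr
  obtain ⟨g', hg', hgh'⟩ := hr'
  exact ⟨g + g', Subalgebra.add_mem _ hg hg', fun x => by rw [Pi.add_apply, hgh, hgh']⟩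

theorem Realizes.smul {h : Phase n → ℝ} (hr : Realizes s κ f h) (r : ℝ) :
    Realizes s κ f fun x => r * h x := by
  obtain ⟨g, hg, hgh⟩ := hr
  exact ⟨r • g, Subalgebra.smul_mem _ hg r, fun x => by rw [Pi.smul_apply, hgh, smul_eq_mul]⟩

theorem Realizes.neg {h : Phase n → ℝ} (hr : Realizes s κ f h) : Realizes s κ f fun x => -h x :=
  (hr.smul (-1)).congr fun x => by ring

theorem Realizes.sub {h h' : Phase n → ℝ} (hr : Realizes s κ f h) (hr' : Realizes s κ f h') :
    Realizes s κ f fun x => h x - h' x :=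
  (hr.add hr'.neg).congr fun x => by ring

theorem Realizes.ite {h : Phase n → ℝ} {P : Prop} [Decidable P] (hr : P → Realizes s κ f h) :
    Realizes s κ f fun x => if P then h x else 0 := by
  by_cases hP : P
  · exact (hr hP).congr fun x => by rw [if_pos hP]
  · exact realizes_zero.congr fun x => by rw [if_neg hP]

theorem Realizes.exists_bracket (hκ : κᵀ = -κ) {g g' h : Phase n → ℝ} (hr : Realizes s κ f h)
    (hb : ∀ x ∈ cotangentSphere n, diracBracket s κ g g' (shift s κ x) = h x) :
    ∃ b ∈ Algebra.adjoin ℝ (range f), ∀ z ∈ cotangentSphere n, diracBracket s κ g g' z = b z := by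
  obtain ⟨b, hb', hbh⟩ := hr
  exact ⟨b, hb', forall_cotangentSphere hκ fun x hx => by rw [hb x hx, hbh]⟩

theorem bracket_of_ang (hκ : κᵀ = -κ) {g g' : Phase n → ℝ} {i j p q : Fin n}
    (hg : ∀ x, g (shift s κ x) = ang i j x) (hg' : ∀ x, g' (shift s κ x) = ang p q x)
    (hx : x ∈ cotangentSphere n) :
    diracBracket s κ g g' (shift s κ x)
      = (if i = q then ang p j x else 0) - (if i = p then ang q j x else 0)
        + (if j = q then ang i p x else 0) - if j = p then ang i q x else 0 := by
  have h' : (fun y => g' (shift s κ y)) = ang p q := funext hg'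
  have h : (fun y => g (shift s κ y)) = ang i j := funext hg
  rw [IsHamVector.diracBracket (X := fieldRot (rotGen p q) x) hκ hx
    (by rw [h']; exact isHamVector_ang p q x), h, fderiv_ang_rotGen]

theorem realizes_bracket_of_ang {β : Fin n → ℕ} (hβ : ∀ i j, β i = β j → Realizes s κ f (ang i j))
    {i j p q : Fin n} (hij : β i = β j) (hpq : β p = β q) :
    Realizes s κ f fun x => (if i = q then ang p j x else 0) - (if i = p then ang q j x else 0)
        + (if j = q then ang i p x else 0) - if j = p then ang i q x else 0 :=
  (((Realizes.ite fun h => hβ p j (by rw [← hij, h, hpq])).sub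
    (Realizes.ite fun h => hβ q j (by rw [← hij, h, hpq]))).add
    (Realizes.ite fun h => hβ i p (by rw [hij, h, hpq]))).sub
    (Realizes.ite fun h => hβ i q (by rw [hij, h, hpq]))

/-- The brackets of a family that contains, apart from the energy and `J`, only angular momenta. -/
theorem closed_of_ang (ha : IsHalfSquare a s κ) (hκ : κᵀ = -κ) {β : Fin n → ℕ}
    (hβ : ∀ i j, β i = β j → Realizes s κ f (ang i j)) (hc : ∀ i, Conserved a s κ (f i))
    (hf : ∀ i, f i = energy m ∨ f i = integralJ m s κ ∨
      ∃ p q, β p = β q ∧ ∀ x, f i (shift s κ x) = ang p q x) (i j : ι) :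
    ∃ b ∈ Algebra.adjoin ℝ (range f),
      ∀ z ∈ cotangentSphere n, diracBracket s κ (f i) (f j) z = b z := by
  have hz : ∀ i j, (f j = energy m ∨ f j = integralJ m s κ) →
      ∀ z ∈ cotangentSphere n, diracBracket s κ (f i) (f j) z = 0 := by
    rintro i j (h | h) <;> rw [h]
    · exact (hc i).bracket_energy ha hκ
    · exact (hc i).bracket_integralJ ha hκ
  have h0 : ∀ i j, (f j = energy m ∨ f j = integralJ m s κ) →
      ∀ z ∈ cotangentSphere n, diracBracket s κ (f j) (f i) z = 0 := fun i j h z hz' => by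
    rw [diracBracket_swap hκ _ _ hz', hz i j h z hz', neg_zero]
  rcases or_assoc.2 (hf j) with hj | ⟨p, q, hpq, hj⟩
  · exact ⟨0, Subalgebra.zero_mem _, hz i j hj⟩
  rcases or_assoc.2 (hf i) with hi | ⟨p', q', hpq', hi⟩
  · exact ⟨0, Subalgebra.zero_mem _, h0 j i hi⟩
  exact (realizes_bracket_of_ang hβ hpq' hpq).exists_bracket hκ fun x hx =>
    bracket_of_ang hκ hi hj hx

end Realizes

/-! The values and the differentials of the integrals. -/

theorem rotationIntegrals_shift {q : ℕ} (hk : ∀ i, q ≤ i → k (i / 2) = 0)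
    (ij : {ij : Fin n × Fin n // q ≤ (ij.1 : ℕ) ∧ ij.1 < ij.2}) (x : Phase n) :
    rotationIntegrals s (blockField n k) q ij (shift s (blockField n k) x)
      = ang ij.1.1 ij.1.2 x :=
  integralΦ_shift_of_eq_zero (hk _ ij.2.1)
    (hk _ (ij.2.1.trans (Fin.lt_def.1 ij.2.2).le)) x

theorem forall_slab_of_rotationIntegrals {q : ℕ} {P : Fin n → Fin n → Prop}
    (hP : ∀ i, P i i) (hP' : ∀ i j, P i j → P j i)
    (h : ∀ ij : {ij : Fin n × Fin n // q ≤ (ij.1 : ℕ) ∧ ij.1 < ij.2}, P ij.1.1 ij.1.2) :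
    ∀ i ∈ slab n q n, ∀ j ∈ slab n q n, P i j := by
  intro i hi j hj
  rcases lt_trichotomy i j with hij | rfl | hij
  · exact h ⟨(i, j), (mem_slab.1 hi).1, hij⟩
  · exact hP i
  · exact hP' _ _ (h ⟨(j, i), (mem_slab.1 hj).1, hij⟩)

theorem ang_self (i : Fin n) (x : Phase n) : ang i i x = 0 := by
  rw [ang]
  ring

theorem fderiv_ang_self (i : Fin n) (x w : Phase n) : fderiv ℝ (ang i i) x w = 0 := by
  rw [fderiv_ang]
  ring

theorem fderiv_ang_swap (i j : Fin n) (x w : Phase n) :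
    fderiv ℝ (ang j i) x w = -fderiv ℝ (ang i j) x w := by
  rw [fderiv_ang, fderiv_ang]
  ring

theorem fderiv_shift_of_ang {f : Phase n → ℝ} {i j : Fin n}
    (h : ∀ x, f (shift s κ x) = ang i j x) (x w : Phase n) :
    fderiv ℝ f (shift s κ x) (shift s κ w) = fderiv ℝ (ang i j) x w := by
  rw [← fderiv_comp_shift]
  simp only [h]

theorem rotGen_blockField (hn : 4 ≤ n) (hk : ∀ l, 2 ≤ l → k l = 0) (x : Phase n) :
    fieldRot (blockField n k) x = (-k 0) • fieldRot (rotGen ⟨0, by omega⟩ ⟨1, by omega⟩) x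
      + (-k 1) • fieldRot (rotGen ⟨2, by omega⟩ ⟨3, by omega⟩) x := by
  have h : ∀ u, blockField n k *ᵥ u = (-k 0) • (rotGen ⟨0, by omega⟩ ⟨1, by omega⟩ *ᵥ u)
      + (-k 1) • (rotGen ⟨2, by omega⟩ ⟨3, by omega⟩ *ᵥ u) := by
    intro u
    funext i
    simp only [Pi.add_apply, Pi.smul_apply, rotGen_mulVec, smul_eq_mul]
    rcases cases_of_lt_four hn i with rfl | rfl | rfl | rfl | hi
    · rw [mulVec₀ hn]; simp
    · rw [mulVec₁ hn]; simp
    · rw [mulVec₂ hn]; simp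
    · rw [mulVec₃ hn]; simp
    · rw [blockField_mulVec_eq_zero (field_eq_zero hk hi)]
      simp only [Fin.ext_iff]
      rw [if_neg (by omega), if_neg (by omega), if_neg (by omega), if_neg (by omega)]
      ring
  ext1
  · exact h x.1
  · exact h x.2

theorem fieldBlock_pair {p q : Fin n} (hpq : p ≠ q) (hS : ∀ i, i ∈ S ↔ i = p ∨ i = q)
    (x : Phase n) : fieldBlock S x = ang p q x • fieldRot (rotGen p q) x := by
  have hS' : S = {p, q} := by
    ext i
    simp [hS]
  have h : ∀ u, blockRot S x *ᵥ u = ang p q x • (rotGen p q *ᵥ u) := by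
    intro u
    funext i
    rw [Pi.smul_apply, rotGen_mulVec, smul_eq_mul, ang]
    by_cases hi : i ∈ S
    · rw [blockRot_mulVec_of_mem u hi, blockDot, blockDot, hS', Finset.sum_pair hpq,
        Finset.sum_pair hpq]
      rcases (hS i).1 hi with rfl | rfl
      · simp [hpq]; ring
      · simp [hpq.symm]; ring
    · rw [blockRot_mulVec_of_notMem u hi]
      have h₁ : i ≠ p := fun h => hi ((hS i).2 (Or.inl h))
      have h₂ : i ≠ q := fun h => hi ((hS i).2 (Or.inr h))
      simp [h₁, h₂]
  ext1
  · exact h x.1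
  · exact h x.2

theorem mem_slab₀ (hn : 4 ≤ n) (i : Fin n) :
    i ∈ slab n 0 2 ↔ i = ⟨0, by omega⟩ ∨ i = ⟨1, by omega⟩ := by
  rw [mem_slab, Fin.ext_iff, Fin.ext_iff]
  simp only
  omega

theorem mem_slab₂ (hn : 4 ≤ n) (i : Fin n) :
    i ∈ slab n 2 4 ↔ i = ⟨2, by omega⟩ ∨ i = ⟨3, by omega⟩ := by
  rw [mem_slab, Fin.ext_iff, Fin.ext_iff]
  simp only
  omega

/-- Away from the zeros of the angular momenta, the rotations of the magnetic field are
combinations of the block fields. -/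
theorem fieldRot_blockField (hn : 4 ≤ n) (hk : ∀ l, 2 ≤ l → k l = 0)
    (h₁ : ang ⟨0, by omega⟩ ⟨1, by omega⟩ x ≠ 0)
    (h₂ : k 1 = 0 ∨ ang ⟨2, by omega⟩ ⟨3, by omega⟩ x ≠ 0) :
    fieldRot (blockField n k) x
      = (-k 0 / ang ⟨0, by omega⟩ ⟨1, by omega⟩ x) • fieldBlock (slab n 0 2) x
        + (-k 1 / ang ⟨2, by omega⟩ ⟨3, by omega⟩ x) • fieldBlock (slab n 2 4) x := by
  rw [rotGen_blockField hn hk, fieldBlock_pair (by simp) (mem_slab₀ hn),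
    fieldBlock_pair (by simp) (mem_slab₂ hn), smul_smul, smul_smul, div_mul_cancel₀ _ h₁]
  rcases h₂ with h₂ | h₂
  · rw [h₂]
    simp
  · rw [div_mul_cancel₀ _ h₂]

/-! Vectors with prescribed first coordinates. -/

/-- The vector whose first coordinates are the entries of a list, and the others zero. -/
noncomputable def vecOf (n : ℕ) (l : List ℝ) : Fin n → ℝ := fun i => l.getD i 0

theorem sum_vecOf {l : List ℝ} (hl : l.length ≤ n) (P : ℕ → Prop) [DecidablePred P] (l' : List ℝ) :
    (∑ i : Fin n, if P i then vecOf n l i * vecOf n l' i else 0)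
      = ∑ j ∈ Finset.range l.length, if P j then l.getD j 0 * l'.getD j 0 else 0 := by
  simp only [vecOf]
  rw [← Finset.sum_range fun j => if P j then l.getD j 0 * l'.getD j 0 else 0]
  symm
  refine Finset.sum_subset (Finset.range_mono hl) fun j _ hj => ?_
  rw [List.getD_eq_default l 0 (by simpa using hj), zero_mul, ite_self]

theorem blockDot_vecOf {l : List ℝ} (hl : l.length ≤ n) (p q : ℕ) (l' : List ℝ) :
    blockDot (slab n p q) (vecOf n l) (vecOf n l')
      = ∑ j ∈ Finset.range l.length, if p ≤ j ∧ j < q then l.getD j 0 * l'.getD j 0 else 0 := by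
  rw [← sum_vecOf hl fun j => p ≤ j ∧ j < q, blockDot, slab, Finset.sum_filter]

theorem blockDot_vecOf_tail {l : List ℝ} (hl : l.length ≤ n) (p : ℕ) (l' : List ℝ) :
    blockDot (slab n p n) (vecOf n l) (vecOf n l')
      = ∑ j ∈ Finset.range l.length, if p ≤ j then l.getD j 0 * l'.getD j 0 else 0 := by
  rw [blockDot_vecOf hl]
  refine Finset.sum_congr rfl fun j hj => ?_
  have : j < n := (Finset.mem_range.1 hj).trans_le hl
  simp [this]

theorem dot_vecOf {l : List ℝ} (hl : l.length ≤ n) (l' : List ℝ) :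
    vecOf n l ⬝ᵥ vecOf n l' = ∑ j ∈ Finset.range l.length, l.getD j 0 * l'.getD j 0 := by
  have := sum_vecOf hl (fun _ => True) l'
  simpa [dotProduct] using this

/-! The invariants of a level set. -/

theorem neumannE_eq_of_energy (hn : 4 ≤ n) (hk : ∀ l, 2 ≤ l → k l = 0) (hm : 0 < m)
    (h : energy m (shift s (blockField n k) y) = energy m (shift s (blockField n k) x))
    (h₁ : ang ⟨0, by omega⟩ ⟨1, by omega⟩ y = ang ⟨0, by omega⟩ ⟨1, by omega⟩ x)
    (h₂ : k 1 * ang ⟨2, by omega⟩ ⟨3, by omega⟩ y = k 1 * ang ⟨2, by omega⟩ ⟨3, by omega⟩ x) :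
    neumannE (potential n s k) y = neumannE (potential n s k) x := by
  rw [energy_shift_eq hn hk, energy_shift_eq hn hk, div_left_inj' (by positivity), h₁, h₂] at h
  linarith

theorem neumannG_eq_of_integralJ (hn : 4 ≤ n) (hk : ∀ l, 2 ≤ l → k l = 0) (hm : 0 < m)
    (h : integralJ m s (blockField n k) (shift s (blockField n k) y)
      = integralJ m s (blockField n k) (shift s (blockField n k) x))
    (hE : neumannE (potential n s k) y = neumannE (potential n s k) x)
    (h₁ : ang ⟨0, by omega⟩ ⟨1, by omega⟩ y = ang ⟨0, by omega⟩ ⟨1, by omega⟩ x)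
    (h₂ : k 1 * ang ⟨2, by omega⟩ ⟨3, by omega⟩ y = k 1 * ang ⟨2, by omega⟩ ⟨3, by omega⟩ x) :
    neumannG (potential n s k) y = neumannG (potential n s k) x := by
  rw [integralJ_shift_eq hn hk, integralJ_shift_eq hn hk, div_left_inj' (by positivity), h₁,
    hE] at h
  linear_combination h / 4 + s ^ 3 * k 1 ^ 2 / 4 * h₂

theorem fderiv_neumannE_eq_zero (hn : 4 ≤ n) (hk : ∀ l, 2 ≤ l → k l = 0) (hm : 0 < m)
    (h : fderiv ℝ (energy m) (shift s (blockField n k) x) (shift s (blockField n k) w) = 0)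
    (h₁ : fderiv ℝ (ang ⟨0, by omega⟩ ⟨1, by omega⟩) x w = 0)
    (h₂ : k 1 * fderiv ℝ (ang ⟨2, by omega⟩ ⟨3, by omega⟩) x w = 0) :
    fderiv ℝ (neumannE (potential n s k)) x w = 0 := by
  rw [fderiv_energy_shift hn hk, div_eq_zero_iff, h₁, h₂] at h
  rcases h with h | h
  · linarith
  · linarith

theorem fderiv_neumannG_eq_zero (hn : 4 ≤ n) (hk : ∀ l, 2 ≤ l → k l = 0) (hm : 0 < m)
    (h : fderiv ℝ (integralJ m s (blockField n k)) (shift s (blockField n k) x)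
      (shift s (blockField n k) w) = 0)
    (hE : fderiv ℝ (neumannE (potential n s k)) x w = 0)
    (h₁ : fderiv ℝ (ang ⟨0, by omega⟩ ⟨1, by omega⟩) x w = 0)
    (h₂ : k 1 * fderiv ℝ (ang ⟨2, by omega⟩ ⟨3, by omega⟩) x w = 0) :
    fderiv ℝ (neumannG (potential n s k)) x w = 0 := by
  rw [fderiv_integralJ_shift hn hk, div_eq_zero_iff, h₁, hE] at h
  rcases h with h | h
  · linear_combination h / 4 + s ^ 3 * k 1 ^ 2 / 4 * h₂
  · exact absurd h (by positivity)

theorem fderiv_energy_eq_zero (hn : 4 ≤ n) (hk : ∀ l, 2 ≤ l → k l = 0)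
    (hE : fderiv ℝ (neumannE (potential n s k)) x w = 0)
    (h₁ : fderiv ℝ (ang ⟨0, by omega⟩ ⟨1, by omega⟩) x w = 0)
    (h₂ : fderiv ℝ (ang ⟨2, by omega⟩ ⟨3, by omega⟩) x w = 0) :
    fderiv ℝ (energy m) (shift s (blockField n k) x) (shift s (blockField n k) w) = 0 := by
  rw [fderiv_energy_shift hn hk, h₁, h₂, hE]
  simp

theorem fderiv_integralJ_eq_zero (hn : 4 ≤ n) (hk : ∀ l, 2 ≤ l → k l = 0)
    (hE : fderiv ℝ (neumannE (potential n s k)) x w = 0)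
    (hG : fderiv ℝ (neumannG (potential n s k)) x w = 0)
    (h₁ : fderiv ℝ (ang ⟨0, by omega⟩ ⟨1, by omega⟩) x w = 0)
    (h₂ : fderiv ℝ (ang ⟨2, by omega⟩ ⟨3, by omega⟩) x w = 0) :
    fderiv ℝ (integralJ m s (blockField n k)) (shift s (blockField n k) x)
      (shift s (blockField n k) w) = 0 := by
  rw [fderiv_integralJ_shift hn hk, h₁, h₂, hE, hG]
  simp

theorem casimir_pair {p q : Fin n} (hpq : p ≠ q) (hS : ∀ i, i ∈ S ↔ i = p ∨ i = q)
    (x : Phase n) : casimir S x = ang p q x ^ 2 := by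
  have hS' : S = {p, q} := by
    ext i
    simp [hS]
  simp only [casimir, blockDot, hS', Finset.sum_pair hpq, ang]
  ring

theorem killsAng_slab₀ (hn : 4 ≤ n) :
    KillsAng (slab n 0 2) x w ↔ fderiv ℝ (ang ⟨0, by omega⟩ ⟨1, by omega⟩) x w = 0 := by
  refine ⟨fun h => h _ ((mem_slab₀ hn _).2 (by simp)) _ ((mem_slab₀ hn _).2 (by simp)),
    fun h i hi j hj => ?_⟩
  rcases (mem_slab₀ hn _).1 hi with rfl | rfl <;> rcases (mem_slab₀ hn _).1 hj with rfl | rfl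
  · exact fderiv_ang_self _ _ _
  · exact h
  · rw [fderiv_ang_swap, h, neg_zero]
  · exact fderiv_ang_self _ _ _

theorem killsAng_slab₂ (hn : 4 ≤ n) :
    KillsAng (slab n 2 4) x w ↔ fderiv ℝ (ang ⟨2, by omega⟩ ⟨3, by omega⟩) x w = 0 := by
  refine ⟨fun h => h _ ((mem_slab₂ hn _).2 (by simp)) _ ((mem_slab₂ hn _).2 (by simp)),
    fun h i hi j hj => ?_⟩
  rcases (mem_slab₂ hn _).1 hi with rfl | rfl <;> rcases (mem_slab₂ hn _).1 hj with rfl | rfl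
  · exact fderiv_ang_self _ _ _
  · exact h
  · rw [fderiv_ang_swap, h, neg_zero]
  · exact fderiv_ang_self _ _ _

theorem killsAng_of_rotationIntegrals {q : ℕ} (hk : ∀ i, q ≤ i → k (i / 2) = 0)
    (h : ∀ ij, fderiv ℝ (rotationIntegrals s (blockField n k) q ij) (shift s (blockField n k) x)
      (shift s (blockField n k) w) = 0) : KillsAng (slab n q n) x w := by
  refine forall_slab_of_rotationIntegrals (P := fun i j => fderiv ℝ (ang i j) x w = 0)
    (fun i => fderiv_ang_self i x w) (fun i j hij => by rw [fderiv_ang_swap, hij, neg_zero])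
    fun ij => ?_
  rw [← fderiv_shift_of_ang (rotationIntegrals_shift hk ij)]
  exact h ij

theorem fderiv_rotationIntegrals_eq_zero {q : ℕ} (hk : ∀ i, q ≤ i → k (i / 2) = 0)
    (h : KillsAng (slab n q n) x w)
    (ij : {ij : Fin n × Fin n // q ≤ (ij.1 : ℕ) ∧ ij.1 < ij.2}) :
    fderiv ℝ (rotationIntegrals s (blockField n k) q ij) (shift s (blockField n k) x)
      (shift s (blockField n k) w) = 0 := by
  rw [fderiv_shift_of_ang (rotationIntegrals_shift hk ij)]
  exact h _ (mem_slab.2 ⟨ij.2.1, ij.1.1.2⟩) _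
    (mem_slab.2 ⟨ij.2.1.trans (Fin.lt_def.1 ij.2.2).le, ij.1.2.2⟩)

theorem ang_eq_of_rotationIntegrals {q : ℕ} (hk : ∀ i, q ≤ i → k (i / 2) = 0)
    (h : ∀ ij, rotationIntegrals s (blockField n k) q ij (shift s (blockField n k) y)
      = rotationIntegrals s (blockField n k) q ij (shift s (blockField n k) x)) :
    ∀ i ∈ slab n q n, ∀ j ∈ slab n q n, ang i j y = ang i j x := by
  refine forall_slab_of_rotationIntegrals
    (fun i => by rw [ang_self, ang_self]) (fun i j hij => by rw [ang_swap, hij, ang_swap i j])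
    fun ij => ?_
  rw [← rotationIntegrals_shift hk ij, ← rotationIntegrals_shift hk ij, h ij]

theorem conserved_rotationIntegrals {q : ℕ} (hk : ∀ i, q ≤ i → k (i / 2) = 0)
    (ij : {ij : Fin n × Fin n // q ≤ (ij.1 : ℕ) ∧ ij.1 < ij.2}) :
    Conserved (potential n s k) s (blockField n k)
      (rotationIntegrals s (blockField n k) q ij) :=
  conserved_integralΦ (hk _ ij.2.1) (hk _ (ij.2.1.trans (Fin.lt_def.1 ij.2.2).le))

theorem Conserved.killed_fieldE {f : Phase n → ℝ} (h : Conserved a s κ f)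
    (hx : x ∈ cotangentSphere n) : fderiv ℝ f (shift s κ x) (shift s κ (MagneticSphere.fieldE a x)) = 0 := by
  rw [← fderiv_comp_shift, h.fieldE x hx]

theorem Conserved.killed_fieldG {f : Phase n → ℝ} (h : Conserved a s κ f)
    (hx : x ∈ cotangentSphere n) : fderiv ℝ f (shift s κ x) (shift s κ (MagneticSphere.fieldG a x)) = 0 := by
  rw [← fderiv_comp_shift, h.fieldG x hx]

theorem Conserved.killed_rot {f : Phase n → ℝ} (h : Conserved a s κ f)
    (hx : x ∈ cotangentSphere n) : fderiv ℝ f (shift s κ x) (shift s κ (fieldRot κ x)) = 0 := by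
  rw [← fderiv_comp_shift, h.rot x hx]

theorem killsAng_fieldBlock_self : KillsAng S x (fieldBlock S x) :=
  fieldBlock_isSl₂On.killsAng

theorem killsAng_fieldBlock_of_subset (h : S' ⊆ S) : KillsAng S' x (fieldBlock S x) :=
  (fieldBlock_isSl₂On.mono h).killsAng

theorem killsAng_fieldBlock_of_disjoint (h : Disjoint S S') : KillsAng S x (fieldBlock S' x) :=
  (fieldBlock_isSl₂On_of_disjoint h).killsAng

theorem realizes_ang_of_rotationIntegrals {ι : Type} {f : ι → Phase n → ℝ} {q : ℕ}
    (hk : ∀ i, q ≤ i → k (i / 2) = 0)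
    (hf : ∀ ij : {ij : Fin n × Fin n // q ≤ (ij.1 : ℕ) ∧ ij.1 < ij.2},
      ∃ l, f l = rotationIntegrals s (blockField n k) q ij) :
    ∀ i ∈ slab n q n, ∀ j ∈ slab n q n, Realizes s (blockField n k) f (ang i j) := by
  refine forall_slab_of_rotationIntegrals
    (fun i => realizes_zero.congr fun x => ang_self i x)
    (fun i j h => h.neg.congr fun x => ang_swap i j x) fun ij => ?_
  obtain ⟨l, hl⟩ := hf ij
  refine (realizes_apply l).congr fun x => ?_
  rw [hl, rotationIntegrals_shift hk]

theorem aboveMin_of_ne_zero (h : TwoBlocks S S' a c) (hx : x ∈ cotangentSphere n)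
    (hD : 0 < casimir S x) (hD' : 0 < casimir S' x) (hv : blockDot S x.1 x.2 ≠ 0) :
    AboveMin S S' a c x := by
  have hu := blockDot_pos_of_casimir hD
  have hu' := blockDot_pos_of_casimir hD'
  have h1 : blockDot S x.1 x.1 + blockDot S' x.1 x.1 = 1 := by
    rw [← h.dot, (mem_cotangentSphere.1 hx).1]
  have h2 : blockDot S x.1 x.2 + blockDot S' x.1 x.2 = 0 := by
    rw [← h.dot, (mem_cotangentSphere.1 hx).2]
  refine ⟨blockDot S x.1 x.1, hu, by linarith, ?_⟩
  rw [h.neumannE_eq, show 1 - blockDot S x.1 x.1 = blockDot S' x.1 x.1 by linarith, casimir,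
    casimir, sub_div, sub_div, mul_div_cancel_left₀ _ hu.ne', mul_div_cancel_left₀ _ hu'.ne']
  have h3 : 0 < blockDot S x.1 x.2 ^ 2 / blockDot S x.1 x.1 := by positivity
  have h4 : 0 ≤ blockDot S' x.1 x.2 ^ 2 / blockDot S' x.1 x.1 := by positivity
  linarith

theorem AboveMin.congr (h : AboveMin S S' a c x) (h₁ : casimir S y = casimir S x)
    (h₂ : casimir S' y = casimir S' x) (h₃ : neumannE a y = neumannE a x) :
    AboveMin S S' a c y := by
  obtain ⟨t, ht⟩ := h
  exact ⟨t, by rw [h₁, h₂, h₃]; exact ht⟩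

theorem casimir_pos_of_ne_zero (h : casimir S x ≠ 0) : 0 < casimir S x :=
  lt_of_le_of_ne (casimir_nonneg S x) h.symm

theorem half_eq_zero₂ (hk : ∀ l, 1 ≤ l → k l = 0) : ∀ i, 2 ≤ i → k (i / 2) = 0 :=
  fun i hi => hk _ (by omega)

theorem half_eq_zero₄ (hk : ∀ l, 2 ≤ l → k l = 0) : ∀ i, 4 ≤ i → k (i / 2) = 0 :=
  fun i hi => hk _ (by omega)

theorem twoBlocks_slab₂ (hk : ∀ l, 1 ≤ l → k l = 0) :
    TwoBlocks (slab n 0 2) (slab n 2 n) (potential n s k) (s ^ 2 / 4 * k 0 ^ 2) where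
  disj := slab_disjoint le_rfl
  cover i := by
    simp only [mem_slab]
    omega
  h₁ := potential_slab₀
  h₂ := potential_slab (half_eq_zero₂ hk)

/-- The energy, `J`, `Φ₁₂` and the integrals of the rotations of the other coordinates. -/
noncomputable abbrev onePlaneFamily (hn : 4 ≤ n) (m s : ℝ) (k : ℕ → ℝ) :
    Fin 3 ⊕ {ij : Fin n × Fin n // 2 ≤ (ij.1 : ℕ) ∧ ij.1 < ij.2} → Phase n → ℝ :=
  Sum.elim
    ![energy m, integralJ m s (blockField n k),
      integralΦ s (blockField n k) ⟨0, by omega⟩ ⟨1, by omega⟩]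
    (rotationIntegrals s (blockField n k) 2)

theorem conserved_onePlane (hn : 4 ≤ n) (hk : ∀ l, 1 ≤ l → k l = 0) (i) :
    Conserved (potential n s k) s (blockField n k) ((onePlaneFamily hn m s k) i) := by
  have hk' : ∀ l, 2 ≤ l → k l = 0 := fun l hl => hk l (by omega)
  have ha := isHalfSquare_potential (s := s) hn hk'
  have hκ := blockField_skew n k
  rcases i with i | ij
  · revert i
    simpa [Fin.forall_fin_succ] using ⟨conserved_energy ha hκ, conserved_integralJ ha hκ,
      conserved_integralΦ₀₁ hn⟩
  · exact conserved_rotationIntegrals (half_eq_zero₂ hk) ij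

theorem closed_onePlane (hn : 4 ≤ n) (hk : ∀ l, 1 ≤ l → k l = 0) (i j) :
    ∃ b ∈ Algebra.adjoin ℝ (range (onePlaneFamily hn m s k)), ∀ z ∈ cotangentSphere n,
      diracBracket s (blockField n k) ((onePlaneFamily hn m s k) i) ((onePlaneFamily hn m s k) j) z = b z := by
  have hk' : ∀ l, 2 ≤ l → k l = 0 := fun l hl => hk l (by omega)
  refine closed_of_ang (m := m) (β := fun i => if (i : ℕ) < 2 then 0 else 1)
    (isHalfSquare_potential (s := s) hn hk') (blockField_skew n k) ?_
    (conserved_onePlane hn hk) ?_ i j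
  · intro i j hij
    by_cases hi : (i : ℕ) < 2
    · have hj : (j : ℕ) < 2 := by
        by_contra hj
        simp [hi, hj] at hij
      have h01 : Realizes s (blockField n k) (onePlaneFamily hn m s k) (ang ⟨0, by omega⟩ ⟨1, by omega⟩) :=
        (realizes_apply (Sum.inl 2)).congr fun x => (integralΦ₀₁_shift hn x).symm
      rcases (mem_slab₀ hn i).1 (mem_slab.2 ⟨by omega, hi⟩) with rfl | rfl <;>
        rcases (mem_slab₀ hn j).1 (mem_slab.2 ⟨by omega, hj⟩) with rfl | rfl
      · exact realizes_zero.congr fun x => ang_self _ x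
      · exact h01
      · exact h01.neg.congr fun x => ang_swap _ _ x
      · exact realizes_zero.congr fun x => ang_self _ x
    · have hj : ¬(j : ℕ) < 2 := by
        intro hj
        simp [hi, hj] at hij
      exact realizes_ang_of_rotationIntegrals (half_eq_zero₂ hk) (fun ij => ⟨Sum.inr ij, rfl⟩)
        i (mem_slab.2 ⟨by omega, i.2⟩) j (mem_slab.2 ⟨by omega, j.2⟩)
  · rintro (i | ij)
    · fin_cases i
      · exact Or.inl rfl
      · exact Or.inr (Or.inl rfl)
      · exact Or.inr (Or.inr ⟨⟨0, by omega⟩, ⟨1, by omega⟩, by simp, integralΦ₀₁_shift hn⟩)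
    · refine Or.inr (Or.inr ⟨ij.1.1, ij.1.2, ?_, rotationIntegrals_shift (half_eq_zero₂ hk) ij⟩)
      have h1 := ij.2.1
      have h2 := Fin.lt_def.1 ij.2.2
      rw [if_neg (by omega), if_neg (by omega)]

theorem generic_onePlane (hn : 4 ≤ n) (hm : 0 < m) (hk : ∀ l, 1 ≤ l → k l = 0)
    (hx : x ∈ cotangentSphere n) (hL : ang ⟨0, by omega⟩ ⟨1, by omega⟩ x ≠ 0)
    (hD : casimir (slab n 2 n) x ≠ 0) (hv : blockDot (slab n 0 2) x.1 x.2 ≠ 0) :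
    let f := onePlaneFamily hn m s k
    ddimAt f (shift s (blockField n k) x) + dindAt s (blockField n k) f (shift s (blockField n k) x)
        = 2 * (n - 1) ∧
      dindAt s (blockField n k) f (shift s (blockField n k) x) = 3 ∧
      IsIsotropicInvariantTorus m s (blockField n k) 3
        (levelComponent f (shift s (blockField n k) x)) := by
  intro f
  have hk' : ∀ l, 2 ≤ l → k l = 0 := fun l hl => hk l (by omega)
  have hk₁ : k 1 = 0 := hk 1 le_rfl
  have hk₂ := half_eq_zero₂ hk
  have hκ := blockField_skew n k
  have ha := isHalfSquare_potential (s := s) hn hk'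
  have hB : TwoBlocks (slab n 0 2) (slab n 2 n) (potential n s k) (s ^ 2 / 4 * k 0 ^ 2) :=
    twoBlocks_slab₂ hk
  have hf : ∀ i, ContDiff ℝ ∞ (f i) := by
    rintro (i | ij)
    · revert i
      simpa [f, Fin.forall_fin_succ] using ⟨contDiff_energy, contDiff_integralJ,
        contDiff_integralΦ _ _⟩
    · exact contDiff_integralΦ _ _
  have hc : ∀ i, Conserved (potential n s k) s (blockField n k) (f i) := conserved_onePlane hn hk
  have hcas : ∀ y : Phase n, casimir (slab n 0 2) y = ang ⟨0, by omega⟩ ⟨1, by omega⟩ y ^ 2 :=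
    casimir_pair (by simp) (mem_slab₀ hn)
  have hsub : slab n 2 4 ⊆ slab n 2 n := fun i hi => by
    rw [mem_slab] at hi ⊢
    omega
  have hD₀ : 0 < casimir (slab n 0 2) x := by
    rw [hcas]
    positivity
  have hmin := aboveMin_of_ne_zero hB hx hD₀ (casimir_pos_of_ne_zero hD) hv
  have hlev : ∀ y ∈ canonicalLevel s (blockField n k) f x,
      ang ⟨0, by omega⟩ ⟨1, by omega⟩ y = ang ⟨0, by omega⟩ ⟨1, by omega⟩ x ∧
      0 < casimir (slab n 0 2) y ∧ 0 < casimir (slab n 2 n) y ∧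
      AboveMin (slab n 0 2) (slab n 2 n) (potential n s k) (s ^ 2 / 4 * k 0 ^ 2) y := by
    intro y hy
    have e₁ : ang ⟨0, by omega⟩ ⟨1, by omega⟩ y = ang ⟨0, by omega⟩ ⟨1, by omega⟩ x := by
      rw [← integralΦ₀₁_shift hn (s := s) (k := k), ← integralΦ₀₁_shift hn (s := s) (k := k)]
      exact hy.2 (Sum.inl 2)
    have e₂ : casimir (slab n 0 2) y = casimir (slab n 0 2) x := by rw [hcas, hcas, e₁]
    have e₃ : casimir (slab n 2 n) y = casimir (slab n 2 n) x :=
      casimir_congr (ang_eq_of_rotationIntegrals hk₂ fun ij => hy.2 (Sum.inr ij))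
    have e₄ := neumannE_eq_of_energy hn hk' hm (hy.2 (Sum.inl 0)) e₁ (by rw [hk₁]; ring)
    exact ⟨e₁, e₂ ▸ hD₀, e₃ ▸ casimir_pos_of_ne_zero hD, hmin.congr e₂ e₃ e₄⟩
  refine hB.involutiveFrame.generic (f := f) hm hκ ha hf (i₀ := Sum.inl 0) rfl hx ?_ ?_ ?_
    (ν := ![1, s / 2 * (-k 0 / ang ⟨0, by omega⟩ ⟨1, by omega⟩ x), 0]) ?_
  · intro y hy
    have hkill : ∀ w, fderiv ℝ (neumannE (potential n s k)) y w = 0 →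
        fderiv ℝ (neumannG (potential n s k)) y w = 0 → KillsAng (slab n 0 2) y w →
        KillsAng (slab n 2 n) y w →
        ∀ i, fderiv ℝ (f i) (shift s (blockField n k) y) (shift s (blockField n k) w) = 0 := by
      intro w hE hG h₁ h₂
      have h₁' := (killsAng_slab₀ hn).1 h₁
      have h₂' := (killsAng_slab₂ hn).1 fun i hi j hj => h₂ i (hsub hi) j (hsub hj)
      rintro (i | ij)
      · revert i
        simpa [f, Fin.forall_fin_succ] using ⟨fderiv_energy_eq_zero hn hk' hE h₁' h₂',
          fderiv_integralJ_eq_zero hn hk' hE hG h₁' h₂',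
          (fderiv_shift_of_ang (integralΦ₀₁_shift hn) y w).trans h₁'⟩
      · exact fderiv_rotationIntegrals_eq_zero hk₂ h₂ ij
    simpa only [Fin.forall_fin_succ, Matrix.cons_val_zero, Matrix.cons_val_succ,
      IsEmpty.forall_iff, and_true] using
      ⟨fun i => (hc i).killed_fieldE hy,
        hkill _ (fderiv_neumannE_fieldBlock hB.h₁ y) (fderiv_neumannG_fieldBlock hB.h₁ y)
          killsAng_fieldBlock_self (killsAng_fieldBlock_of_disjoint hB.disj.symm),
        hkill _ (fderiv_neumannE_fieldBlock hB.h₂ y) (fderiv_neumannG_fieldBlock hB.h₂ y)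
          (killsAng_fieldBlock_of_disjoint hB.disj) killsAng_fieldBlock_self⟩
  · intro y hy t ht
    obtain ⟨-, h1, h2, h3⟩ := hlev y hy
    have := hB.eq_zero hy.1 h1 h2 h3 (r := t 0) (t := t 1) (t' := t 2)
      (by simpa [Fin.sum_univ_succ, add_assoc] using ht)
    ext i
    fin_cases i
    exacts [this.1, this.2.1, this.2.2]
  · intro y hy v hv hvf
    obtain ⟨-, h1, h2, h3⟩ := hlev y hy
    have h₁ : fderiv ℝ (ang ⟨0, by omega⟩ ⟨1, by omega⟩) y v = 0 :=
      (fderiv_shift_of_ang (integralΦ₀₁_shift hn) y v).symm.trans (hvf (Sum.inl 2))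
    have hE := fderiv_neumannE_eq_zero hn hk' hm (hvf (Sum.inl 0)) h₁ (by rw [hk₁]; ring)
    obtain ⟨r, t, t', h⟩ := hB.span hy.1 h1 h2 h3 hv hE ((killsAng_slab₀ hn).2 h₁)
      (killsAng_of_rotationIntegrals hk₂ fun ij => hvf (Sum.inr ij))
    exact ⟨![r, t, t'], by simpa [Fin.sum_univ_succ, add_assoc] using h⟩
  · intro y hy
    obtain ⟨h1, -, -, -⟩ := hlev y hy
    rw [fieldRot_blockField hn hk' (by rwa [h1]) (Or.inl hk₁), h1, hk₁]
    simp [Fin.sum_univ_succ, smul_smul]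

/-- Generic points satisfy the conditions of nondegeneracy of a problem with one plane. -/
theorem generically_onePlane (hn : 4 ≤ n) (hκ : κᵀ = -κ) {P : Phase n → Prop}
    (h : ∀ x ∈ cotangentSphere n, ang ⟨0, by omega⟩ ⟨1, by omega⟩ x ≠ 0 →
      casimir (slab n 2 n) x ≠ 0 → blockDot (slab n 0 2) x.1 x.2 ≠ 0 → P (shift s κ x)) :
    Generically P := by
  have hl : ([3 / 5, 0, 4 / 5, 0] : List ℝ).length ≤ n := by simpa using hn
  have hl' : ([4, 1, -3, 1] : List ℝ).length ≤ n := by simpa using hn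
  refine generically_of_ne_zero (s := s) (by omega) hκ
    (g := fun x => ang ⟨0, by omega⟩ ⟨1, by omega⟩ x * casimir (slab n 2 n) x
      * blockDot (slab n 0 2) x.1 x.2) ?_
    (z := (vecOf n [3 / 5, 0, 4 / 5, 0], vecOf n [4, 1, -3, 1])) ?_ ?_ fun x hx hg => ?_
  · exact ((contDiff_ang _ _).mul contDiff_casimir).mul
      (contDiff_blockDot contDiff_fst contDiff_snd)
  · rw [mem_cotangentSphere, dot_vecOf hl, dot_vecOf hl]
    norm_num [Finset.sum_range_succ]
  · simp only [casimir, blockDot_vecOf_tail hl, blockDot_vecOf_tail hl', blockDot_vecOf hl, ang]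
    norm_num [Finset.sum_range_succ, vecOf]
  · exact h x hx (fun h0 => hg (by rw [h0]; ring)) (fun h0 => hg (by rw [h0]; ring))
      fun h0 => hg (by rw [h0]; ring)

theorem integrable_onePlane (hn : 4 ≤ n) (hm : 0 < m) (hk : ∀ l, 1 ≤ l → k l = 0) :
    IsNoncommutativelyIntegrable m s (blockField n k)
      (onePlaneFamily hn m s k) 3 where
  smooth := by
    rintro (i | ij)
    · revert i
      simpa [Fin.forall_fin_succ] using ⟨contDiff_energy, contDiff_integralJ,
        contDiff_integralΦ _ _⟩
    · exact contDiff_integralΦ _ _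
  first_integral i := (conserved_onePlane (by omega) hk i).isFirstIntegral
    (isHalfSquare_potential (by omega) fun l hl => hk l (by omega)) (blockField_skew n k)
  closed := closed_onePlane (by omega) hk
  generic := generically_onePlane hn (blockField_skew n k) fun _ hx hL hD hv =>
    generic_onePlane hn hm hk hx hL hD hv

end MagneticSphere

namespace MagneticSphere

/-- The resultant of the polynomials `interp a b u₁ u₂ u₃` and `interp a b v₁ v₂ v₃` for
`u₁ + u₂ + u₃ = 1` and `v₁ + v₂ + v₃ = 0`. -/
def interpResultant (a b u₁ u₂ u₃ v₁ v₂ v₃ : ℝ) : ℝ :=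
  (a * b * v₃) ^ 2 + (b * u₁ + a * u₂ + (a + b) * u₃) * (a * v₁ + b * v₂) * (a * b * v₃)
    + a * b * u₃ * (a * v₁ + b * v₂) ^ 2

theorem interp_ne_zero {a b u₁ u₂ u₃ v₁ v₂ v₃ l : ℝ} (hu : u₁ + u₂ + u₃ = 1)
    (hv : v₁ + v₂ + v₃ = 0) (hR : interpResultant a b u₁ u₂ u₃ v₁ v₂ v₃ ≠ 0)
    (hU : interp a b u₁ u₂ u₃ l = 0) : interp a b v₁ v₂ v₃ l ≠ 0 := by
  intro hV
  apply hR
  have hU' : l ^ 2 - (b * u₁ + a * u₂ + (a + b) * u₃) * l + a * b * u₃ = 0 := by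
    rw [interp] at hU
    linear_combination hU + (-l ^ 2) * hu
  have hV' : (a * v₁ + b * v₂) * l + a * b * v₃ = 0 := by
    rw [interp] at hV
    linear_combination hV - (l ^ 2 - a * l - b * l) * hv
  have hA : a * b * v₃ = -((a * v₁ + b * v₂) * l) := by linarith
  rw [interpResultant, hA]
  linear_combination (a * v₁ + b * v₂) ^ 2 * hU'

theorem exists_gaps {a b u₁ u₂ u₃ v₁ v₂ v₃ z₁ z₂ z₃ : ℝ} (hu : u₁ + u₂ + u₃ = 1)
    (hv : v₁ + v₂ + v₃ = 0) (hu₁ : 0 < u₁) (hu₂ : 0 < u₂) (hu₃ : 0 < u₃) (ha : 0 < a) (hab : a < b)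
    (hR : interpResultant a b u₁ u₂ u₃ v₁ v₂ v₃ ≠ 0) :
    ∃ p q, 0 < p ∧ p < a ∧ a < q ∧ ∀ l ∈ ({p, q} : Set ℝ),
      0 < spectral a b (z₁ + z₂ + z₃ + (a * u₁ + b * u₂))
        (a ^ 2 * u₁ + b ^ 2 * u₂ + (z₁ + z₂ + z₃) * (a * u₁ + b * u₂) + (a * z₁ + b * z₂))
        (u₁ * z₁ - v₁ ^ 2) (u₂ * z₂ - v₂ ^ 2) (u₃ * z₃ - v₃ ^ 2) l := by
  have hb : 0 < b := ha.trans hab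
  have hba : 0 < b - a := sub_pos.2 hab
  have hcont : Continuous (interp a b u₁ u₂ u₃) := by
    unfold interp
    fun_prop
  have h0 : 0 < interp a b u₁ u₂ u₃ 0 := by
    have : 0 < u₃ * (a * b) := by positivity
    simpa [interp] using this
  have h1 : interp a b u₁ u₂ u₃ a < 0 := by
    have : 0 < u₁ * ((b - a) * a) := by positivity
    rw [interp]
    linarith
  have h2 : 0 < interp a b u₁ u₂ u₃ b := by
    have : 0 < u₂ * ((b - a) * b) := by positivity
    rw [interp]
    linarith
  obtain ⟨p, hp, hp0⟩ := intermediate_value_Ioo' ha.le hcont.continuousOn ⟨h1, h0⟩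
  obtain ⟨q, hq, hq0⟩ := intermediate_value_Ioo hab.le hcont.continuousOn ⟨h1, h2⟩
  refine ⟨p, q, hp.1, hp.2, hq.1, fun l hl => ?_⟩
  have hl0 : interp a b u₁ u₂ u₃ l = 0 := by
    rcases hl with rfl | rfl
    exacts [hp0, hq0]
  rw [← spectral_eq hu hv, hl0, zero_mul, sub_zero]
  exact sq_pos_of_ne_zero (interp_ne_zero hu hv hR hl0)

variable {n : ℕ} {k : ℕ → ℝ} {m s c c₁ c₂ r : ℝ} {x y w : Phase n} {a : Fin n → ℝ}
  {κ Ω : Matrix (Fin n) (Fin n) ℝ} {S S' S₁ S₂ S₃ : Finset (Fin n)}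

/-- The resultant of `U` and `V` at a point of the phase space. -/
noncomputable def blockResultant (S₁ S₂ S₃ : Finset (Fin n)) (c₁ c₂ : ℝ) (x : Phase n) : ℝ :=
  interpResultant c₁ c₂ (blockDot S₁ x.1 x.1) (blockDot S₂ x.1 x.1) (blockDot S₃ x.1 x.1)
    (blockDot S₁ x.1 x.2) (blockDot S₂ x.1 x.2) (blockDot S₃ x.1 x.2)

theorem contDiff_blockResultant {l : WithTop ℕ∞} :
    ContDiff ℝ l (blockResultant S₁ S₂ S₃ c₁ c₂ : Phase n → ℝ) := by
  have h1 : ∀ S : Finset (Fin n), ContDiff ℝ l fun x : Phase n => blockDot S x.1 x.1 :=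
    fun S => contDiff_blockDot contDiff_fst contDiff_fst
  have h2 : ∀ S : Finset (Fin n), ContDiff ℝ l fun x : Phase n => blockDot S x.1 x.2 :=
    fun S => contDiff_blockDot contDiff_fst contDiff_snd
  unfold blockResultant interpResultant
  fun_prop

theorem blockResultant_symm (S₁ S₂ S₃ : Finset (Fin n)) (c₁ c₂ : ℝ) (x : Phase n) :
    blockResultant S₂ S₁ S₃ c₂ c₁ x = blockResultant S₁ S₂ S₃ c₁ c₂ x := by
  simp only [blockResultant, interpResultant]
  ring

namespace ThreeBlocks

theorem hasGaps_of_lt (h : ThreeBlocks S₁ S₂ S₃ a c₁ c₂) (hc₁ : 0 < c₁) (hc : c₁ < c₂)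
    (hx : x ∈ cotangentSphere n) (hD₁ : 0 < casimir S₁ x) (hD₂ : 0 < casimir S₂ x)
    (hD₃ : 0 < casimir S₃ x) (hR : blockResultant S₁ S₂ S₃ c₁ c₂ x ≠ 0) :
    HasGaps S₁ S₂ S₃ a c₁ c₂ x := by
  obtain ⟨p, q, h1, h2, h3, h4⟩ := exists_gaps (z₁ := blockDot S₁ x.2 x.2)
    (z₂ := blockDot S₂ x.2 x.2) (z₃ := blockDot S₃ x.2 x.2)
    ((h.dot _ _).symm.trans (mem_cotangentSphere.1 hx).1)
    ((h.dot _ _).symm.trans (mem_cotangentSphere.1 hx).2) (blockDot_pos_of_casimir hD₁)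
    (blockDot_pos_of_casimir hD₂) (blockDot_pos_of_casimir hD₃) hc₁ hc hR
  rw [h.neumannE_eq, h.neumannG_eq] at h4
  refine ⟨p, q, h1, ?_, ?_, h4 p (by simp), h4 q (by simp)⟩
  · rwa [min_eq_left hc.le]
  · rwa [min_eq_left hc.le]

theorem hasGaps (h : ThreeBlocks S₁ S₂ S₃ a c₁ c₂) (hc₁ : 0 < c₁) (hc₂ : 0 < c₂) (hc : c₁ ≠ c₂)
    (hx : x ∈ cotangentSphere n) (hD₁ : 0 < casimir S₁ x) (hD₂ : 0 < casimir S₂ x)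
    (hD₃ : 0 < casimir S₃ x) (hR : blockResultant S₁ S₂ S₃ c₁ c₂ x ≠ 0) :
    HasGaps S₁ S₂ S₃ a c₁ c₂ x := by
  rcases lt_or_gt_of_ne hc with hlt | hlt
  · exact h.hasGaps_of_lt hc₁ hlt hx hD₁ hD₂ hD₃ hR
  · exact (h.symm.hasGaps_of_lt hc₂ hlt hx hD₂ hD₁ hD₃
      (by rwa [blockResultant_symm])).symm

end ThreeBlocks

/-- At `x`, the fields of `E`, `G` and of the three blocks are independent, and they span the
common kernel of the differentials of `E`, `G` and of the angular momenta of the blocks. -/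
structure IsFrameAt (S₁ S₂ S₃ : Finset (Fin n)) (a : Fin n → ℝ) (x : Phase n) : Prop where
  span : ∀ w ∈ tangentAt x, fderiv ℝ (neumannE a) x w = 0 → fderiv ℝ (neumannG a) x w = 0 →
    KillsAng S₁ x w → KillsAng S₂ x w → KillsAng S₃ x w →
    ∃ r s t₁ t₂ t₃ : ℝ, w = r • fieldE a x + s • fieldG a x + t₁ • fieldBlock S₁ x
      + t₂ • fieldBlock S₂ x + t₃ • fieldBlock S₃ x
  eq_zero : ∀ r s t₁ t₂ t₃ : ℝ, r • fieldE a x + s • fieldG a x + t₁ • fieldBlock S₁ x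
    + t₂ • fieldBlock S₂ x + t₃ • fieldBlock S₃ x = 0 → r = 0 ∧ s = 0 ∧ t₁ = 0 ∧ t₂ = 0 ∧ t₃ = 0

/-- The invariants of a level set of the integrals of a problem with three blocks. -/
structure SameInvariants (S₁ S₂ S₃ : Finset (Fin n)) (a : Fin n → ℝ) (x y : Phase n) : Prop where
  neumannE : neumannE a y = neumannE a x
  neumannG : neumannG a y = neumannG a x
  h₁ : casimir S₁ y = casimir S₁ x
  h₂ : casimir S₂ y = casimir S₂ x
  h₃ : casimir S₃ y = casimir S₃ x

theorem SameInvariants.refl (S₁ S₂ S₃ : Finset (Fin n)) (a : Fin n → ℝ) (x : Phase n) :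
    SameInvariants S₁ S₂ S₃ a x x :=
  ⟨rfl, rfl, rfl, rfl, rfl⟩

/-- The nonvanishing of these functions singles out the generic points. -/
structure IsRegular (S₁ S₂ S₃ : Finset (Fin n)) (c₁ c₂ : ℝ) (x : Phase n) : Prop where
  h₁ : casimir S₁ x ≠ 0
  h₂ : casimir S₂ x ≠ 0
  h₃ : casimir S₃ x ≠ 0
  resultant : c₁ ≠ c₂ → blockResultant S₁ S₂ S₃ c₁ c₂ x ≠ 0
  dot : c₁ = c₂ → blockDot (S₁ ∪ S₂) x.1 x.2 ≠ 0
  polar : c₁ = c₂ → (casimir (S₁ ∪ S₂) x - casimir S₁ x - casimir S₂ x) ^ 2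
    - 4 * casimir S₁ x * casimir S₂ x ≠ 0

theorem ThreeBlocks.isFrameAt (h : ThreeBlocks S₁ S₂ S₃ a c₁ c₂) (hc₁ : 0 < c₁) (hc₂ : 0 < c₂)
    (hx : x ∈ cotangentSphere n) (hr : IsRegular S₁ S₂ S₃ c₁ c₂ x) (hy : y ∈ cotangentSphere n)
    (hxy : SameInvariants S₁ S₂ S₃ a x y) : IsFrameAt S₁ S₂ S₃ a y := by
  have hD₁ := casimir_pos_of_ne_zero hr.h₁
  have hD₂ := casimir_pos_of_ne_zero hr.h₂
  have hD₃ := casimir_pos_of_ne_zero hr.h₃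
  have hy₁ : 0 < casimir S₁ y := hxy.h₁ ▸ hD₁
  have hy₂ : 0 < casimir S₂ y := hxy.h₂ ▸ hD₂
  have hy₃ : 0 < casimir S₃ y := hxy.h₃ ▸ hD₃
  rcases eq_or_ne c₁ c₂ with rfl | hc
  · have hU := h.twoBlocks
    have e : casimir (S₁ ∪ S₂) y = casimir (S₁ ∪ S₂) x := by
      have e₁ := hU.neumannG_eq hx
      have e₂ := hU.neumannG_eq hy
      rw [hxy.neumannE, hxy.neumannG, hxy.h₃, e₁] at e₂
      have := mul_left_cancel₀ hc₁.ne' (add_left_cancel e₂)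
      linarith
    have hmin : AboveMin (S₁ ∪ S₂) S₃ a c₁ y :=
      (aboveMin_of_ne_zero hU hx (h.union_pos hD₁) hD₃ (hr.dot rfl)).congr e hxy.h₃ hxy.neumannE
    have hpol : (casimir (S₁ ∪ S₂) y - casimir S₁ y - casimir S₂ y) ^ 2
        ≠ 4 * casimir S₁ y * casimir S₂ y := by
      rw [e, hxy.h₁, hxy.h₂]
      exact sub_ne_zero.1 (hr.polar rfl)
    exact ⟨fun w hw hE hG h₁ h₂ h₃ =>
        h.span_of_eq hc₁ hy hy₁ hy₂ hy₃ hmin hpol hw hE hG h₁ h₂ h₃,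
      fun _ _ _ _ _ h0 => h.eq_zero_of_eq hc₁ hy hy₁ hy₂ hy₃ hmin hpol h0⟩
  · have hgap : HasGaps S₁ S₂ S₃ a c₁ c₂ y := by
      obtain ⟨p, q, hpq⟩ := h.hasGaps hc₁ hc₂ hc hx hD₁ hD₂ hD₃ (hr.resultant hc)
      refine ⟨p, q, ?_⟩
      rwa [hxy.neumannE, hxy.neumannG, hxy.h₁, hxy.h₂, hxy.h₃]
    exact ⟨fun w hw hE hG h₁ h₂ h₃ => h.span hc₁ hc₂ hc hy hy₁ hy₂ hy₃ hgap hw hE hG h₁ h₂ h₃,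
      fun _ _ _ _ _ h0 => h.eq_zero hc₁ hc₂ hc hy hy₁ hy₂ hy₃ hgap h0⟩

theorem threeBlocks_slab (hk : ∀ l, 2 ≤ l → k l = 0) :
    ThreeBlocks (slab n 0 2) (slab n 2 4) (slab n 4 n) (potential n s k)
      (s ^ 2 / 4 * k 0 ^ 2) (s ^ 2 / 4 * k 1 ^ 2) where
  disj₁₂ := slab_disjoint le_rfl
  disj₁₃ := slab_disjoint (by omega)
  disj₂₃ := slab_disjoint le_rfl
  cover i := by
    simp only [mem_slab]
    omega
  h₁ := potential_slab₀
  h₂ := potential_slab₂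
  h₃ := potential_slab (half_eq_zero₄ hk)

/-- Generic points are regular. -/
theorem generically_isRegular (hn : 6 ≤ n) (h₁ : c₁ ≠ 0) (h₂ : c₂ ≠ 0) (hκ : κᵀ = -κ)
    {P : Phase n → Prop} (h : ∀ x ∈ cotangentSphere n,
      IsRegular (slab n 0 2) (slab n 2 4) (slab n 4 n) c₁ c₂ x → P (shift s κ x)) :
    Generically P := by
  have hU : slab n 0 2 ∪ slab n 2 4 = slab n 0 4 := slab_union (by omega) (by omega)
  rcases eq_or_ne c₁ c₂ with rfl | hc
  · have hl : ([2 / 3, 0, 2 / 3, 0, 1 / 3, 0] : List ℝ).length ≤ n := by simpa using hn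
    have hl' : ([1, 1, 0, 1, -2, 1] : List ℝ).length ≤ n := by simpa using hn
    refine generically_of_ne_zero (s := s) (κ := κ) (by omega) hκ
      (g := fun x => casimir (slab n 0 2) x * casimir (slab n 2 4) x * casimir (slab n 4 n) x
        * blockDot (slab n 0 4) x.1 x.2
        * ((casimir (slab n 0 4) x - casimir (slab n 0 2) x - casimir (slab n 2 4) x) ^ 2
          - 4 * casimir (slab n 0 2) x * casimir (slab n 2 4) x)) ?_
      (z := (vecOf n [2 / 3, 0, 2 / 3, 0, 1 / 3, 0], vecOf n [1, 1, 0, 1, -2, 1])) ?_ ?_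
      fun x hx hg => h x hx ?_
    · have h1 : ∀ S : Finset (Fin n), ContDiff ℝ ω fun x => casimir S x :=
        fun S => contDiff_casimir
      have h2 : ContDiff ℝ ω fun x : Phase n => blockDot (slab n 0 4) x.1 x.2 :=
        contDiff_blockDot contDiff_fst contDiff_snd
      fun_prop
    · rw [mem_cotangentSphere, dot_vecOf hl, dot_vecOf hl]
      norm_num [Finset.sum_range_succ]
    · simp only [casimir, blockDot_vecOf_tail hl, blockDot_vecOf_tail hl', blockDot_vecOf hl,
        blockDot_vecOf hl']
      norm_num [Finset.sum_range_succ]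
    · refine ⟨?_, ?_, ?_, fun hc => absurd rfl hc, fun _ => ?_, fun _ => ?_⟩ <;> intro h0 <;>
        apply hg
      · rw [h0]; ring
      · rw [h0]; ring
      · rw [h0]; ring
      · rw [hU] at h0; rw [h0]; ring
      · rw [hU] at h0; rw [h0]; ring
  · have hl : ([2 / 3, 0, 2 / 3, 0, 1 / 3, 0] : List ℝ).length ≤ n := by simpa using hn
    have hl' : ([1, 1, -1, 1, 0, 1] : List ℝ).length ≤ n := by simpa using hn
    refine generically_of_ne_zero (s := s) (κ := κ) (by omega) hκ
      (g := fun x => casimir (slab n 0 2) x * casimir (slab n 2 4) x * casimir (slab n 4 n) x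
        * blockResultant (slab n 0 2) (slab n 2 4) (slab n 4 n) c₁ c₂ x) ?_
      (z := (vecOf n [2 / 3, 0, 2 / 3, 0, 1 / 3, 0], vecOf n [1, 1, -1, 1, 0, 1])) ?_ ?_
      fun x hx hg => h x hx ?_
    · exact ((contDiff_casimir.mul contDiff_casimir).mul contDiff_casimir).mul
        contDiff_blockResultant
    · rw [mem_cotangentSphere, dot_vecOf hl, dot_vecOf hl]
      norm_num [Finset.sum_range_succ]
    · simp only [casimir, blockResultant, interpResultant, blockDot_vecOf_tail hl,
        blockDot_vecOf_tail hl', blockDot_vecOf hl, blockDot_vecOf hl']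
      norm_num [Finset.sum_range_succ, h₁, h₂]
      intro h0
      apply hc
      linarith
    · refine ⟨?_, ?_, ?_, fun _ => ?_, fun hc' => absurd hc' hc, fun hc' => absurd hc' hc⟩ <;>
        intro h0 <;> apply hg <;> rw [h0] <;> ring

end MagneticSphere

namespace MagneticSphere

variable {n : ℕ} {k : ℕ → ℝ} {m s c r : ℝ} {x y w : Phase n} {a : Fin n → ℝ}
  {κ Ω : Matrix (Fin n) (Fin n) ℝ} {S S' : Finset (Fin n)}

/-- The energy, `J`, `Φ₁₂`, `Φ₃₄` and the integrals of the rotations of the other coordinates. -/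
noncomputable abbrev twoPlaneFamily (hn : 4 ≤ n) (m s : ℝ) (k : ℕ → ℝ) :
    Fin 4 ⊕ {ij : Fin n × Fin n // 4 ≤ (ij.1 : ℕ) ∧ ij.1 < ij.2} → Phase n → ℝ :=
  Sum.elim
    ![energy m, integralJ m s (blockField n k),
      integralΦ s (blockField n k) ⟨0, by omega⟩ ⟨1, by omega⟩,
      integralΦ s (blockField n k) ⟨2, by omega⟩ ⟨3, by omega⟩]
    (rotationIntegrals s (blockField n k) 4)

theorem contDiff_twoPlane {l : WithTop ℕ∞} (hn : 4 ≤ n) (i) :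
    ContDiff ℝ l (twoPlaneFamily hn m s k i) := by
  rcases i with i | ij
  · revert i
    simpa [Fin.forall_fin_succ] using ⟨contDiff_energy, contDiff_integralJ,
      contDiff_integralΦ _ _, contDiff_integralΦ _ _⟩
  · exact contDiff_integralΦ _ _

theorem conserved_twoPlane (hn : 4 ≤ n) (hk : ∀ l, 2 ≤ l → k l = 0) (i) :
    Conserved (potential n s k) s (blockField n k) (twoPlaneFamily hn m s k i) := by
  have ha := isHalfSquare_potential (s := s) hn hk
  have hκ := blockField_skew n k
  rcases i with i | ij
  · revert i
    simpa [Fin.forall_fin_succ] using ⟨conserved_energy ha hκ, conserved_integralJ ha hκ,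
      conserved_integralΦ₀₁ hn, conserved_integralΦ₂₃ hn⟩
  · exact conserved_rotationIntegrals (half_eq_zero₄ hk) ij

theorem closed_twoPlane (hn : 4 ≤ n) (hk : ∀ l, 2 ≤ l → k l = 0) (i j) :
    ∃ b ∈ Algebra.adjoin ℝ (range (twoPlaneFamily hn m s k)), ∀ z ∈ cotangentSphere n,
      diracBracket s (blockField n k) (twoPlaneFamily hn m s k i) (twoPlaneFamily hn m s k j) z
        = b z := by
  refine closed_of_ang (m := m) (β := fun i => min ((i : ℕ) / 2) 2)
    (isHalfSquare_potential (s := s) hn hk) (blockField_skew n k) ?_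
    (conserved_twoPlane hn hk) ?_ i j
  · intro i j hij
    have h01 : Realizes s (blockField n k) (twoPlaneFamily hn m s k)
        (ang ⟨0, by omega⟩ ⟨1, by omega⟩) :=
      (realizes_apply (Sum.inl 2)).congr fun x => (integralΦ₀₁_shift hn x).symm
    have h23 : Realizes s (blockField n k) (twoPlaneFamily hn m s k)
        (ang ⟨2, by omega⟩ ⟨3, by omega⟩) :=
      (realizes_apply (Sum.inl 3)).congr fun x => (integralΦ₂₃_shift hn x).symm
    rcases cases_of_lt_four hn i with rfl | rfl | rfl | rfl | hi <;>
      rcases cases_of_lt_four hn j with rfl | rfl | rfl | rfl | hj <;>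
      first
        | exact realizes_zero.congr fun x => ang_self _ x
        | exact h01
        | exact h23
        | exact h01.neg.congr fun x => ang_swap _ _ x
        | exact h23.neg.congr fun x => ang_swap _ _ x
        | (exfalso; simp at hij; done)
        | (exfalso; simp at hij; omega)
        | exact realizes_ang_of_rotationIntegrals (half_eq_zero₄ hk) (fun ij => ⟨Sum.inr ij, rfl⟩)
            i (mem_slab.2 ⟨hi, i.2⟩) j (mem_slab.2 ⟨hj, j.2⟩)
  · rintro (i | ij)
    · fin_cases i
      · exact Or.inl rfl
      · exact Or.inr (Or.inl rfl)
      · exact Or.inr (Or.inr ⟨⟨0, by omega⟩, ⟨1, by omega⟩, by simp, integralΦ₀₁_shift hn⟩)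
      · exact Or.inr (Or.inr ⟨⟨2, by omega⟩, ⟨3, by omega⟩, by simp, integralΦ₂₃_shift hn⟩)
    · refine Or.inr (Or.inr ⟨ij.1.1, ij.1.2, ?_, rotationIntegrals_shift (half_eq_zero₄ hk) ij⟩)
      have h1 := ij.2.1
      have h2 := Fin.lt_def.1 ij.2.2
      omega

theorem generic_twoPlane (hn : 4 ≤ n) (hm : 0 < m) (hs : s ≠ 0) (hk : ∀ l, 2 ≤ l → k l = 0)
    (hk₀ : k 0 ≠ 0) (hk₁ : k 1 ≠ 0) (hx : x ∈ cotangentSphere n)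
    (hr : IsRegular (slab n 0 2) (slab n 2 4) (slab n 4 n) (s ^ 2 / 4 * k 0 ^ 2)
      (s ^ 2 / 4 * k 1 ^ 2) x) :
    let f := twoPlaneFamily hn m s k
    ddimAt f (shift s (blockField n k) x) + dindAt s (blockField n k) f (shift s (blockField n k) x)
        = 2 * (n - 1) ∧
      dindAt s (blockField n k) f (shift s (blockField n k) x) = 5 ∧
      IsIsotropicInvariantTorus m s (blockField n k) 5
        (levelComponent f (shift s (blockField n k) x)) := by
  intro f
  have hk₂ := half_eq_zero₄ hk
  have hκ := blockField_skew n k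
  have ha := isHalfSquare_potential (s := s) hn hk
  have hB := threeBlocks_slab (n := n) (s := s) hk
  have hc : ∀ i, Conserved (potential n s k) s (blockField n k) (f i) := conserved_twoPlane hn hk
  have hcas₀ : ∀ y : Phase n, casimir (slab n 0 2) y = ang ⟨0, by omega⟩ ⟨1, by omega⟩ y ^ 2 :=
    casimir_pair (by simp) (mem_slab₀ hn)
  have hcas₂ : ∀ y : Phase n, casimir (slab n 2 4) y = ang ⟨2, by omega⟩ ⟨3, by omega⟩ y ^ 2 :=
    casimir_pair (by simp) (mem_slab₂ hn)
  have hL₀ : ang ⟨0, by omega⟩ ⟨1, by omega⟩ x ≠ 0 := fun h0 => hr.h₁ (by rw [hcas₀, h0]; ring)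
  have hL₂ : ang ⟨2, by omega⟩ ⟨3, by omega⟩ x ≠ 0 := fun h0 => hr.h₂ (by rw [hcas₂, h0]; ring)
  have hlev : ∀ y ∈ canonicalLevel s (blockField n k) f x,
      ang ⟨0, by omega⟩ ⟨1, by omega⟩ y = ang ⟨0, by omega⟩ ⟨1, by omega⟩ x ∧
      ang ⟨2, by omega⟩ ⟨3, by omega⟩ y = ang ⟨2, by omega⟩ ⟨3, by omega⟩ x ∧
      IsFrameAt (slab n 0 2) (slab n 2 4) (slab n 4 n) (potential n s k) y := by
    intro y hy
    have e₁ : ang ⟨0, by omega⟩ ⟨1, by omega⟩ y = ang ⟨0, by omega⟩ ⟨1, by omega⟩ x := by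
      rw [← integralΦ₀₁_shift hn (s := s) (k := k), ← integralΦ₀₁_shift hn (s := s) (k := k)]
      exact hy.2 (Sum.inl 2)
    have e₂ : ang ⟨2, by omega⟩ ⟨3, by omega⟩ y = ang ⟨2, by omega⟩ ⟨3, by omega⟩ x := by
      rw [← integralΦ₂₃_shift hn (s := s) (k := k), ← integralΦ₂₃_shift hn (s := s) (k := k)]
      exact hy.2 (Sum.inl 3)
    have hE := neumannE_eq_of_energy hn hk hm (hy.2 (Sum.inl 0)) e₁ (by rw [e₂])
    exact ⟨e₁, e₂, hB.isFrameAt (by positivity) (by positivity) hx hr hy.1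
      ⟨hE, neumannG_eq_of_integralJ hn hk hm (hy.2 (Sum.inl 1)) hE e₁ (by rw [e₂]),
        by rw [hcas₀, hcas₀, e₁], by rw [hcas₂, hcas₂, e₂],
        casimir_congr (ang_eq_of_rotationIntegrals hk₂ fun ij => hy.2 (Sum.inr ij))⟩⟩
  refine hB.involutiveFrame.generic (f := f) hm hκ ha (contDiff_twoPlane hn) (i₀ := Sum.inl 0)
    rfl hx ?_ ?_ ?_ (ν := ![1, 0, s / 2 * (-k 0 / ang ⟨0, by omega⟩ ⟨1, by omega⟩ x),
      s / 2 * (-k 1 / ang ⟨2, by omega⟩ ⟨3, by omega⟩ x), 0]) ?_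
  · intro y hy
    have hkill : ∀ w, fderiv ℝ (neumannE (potential n s k)) y w = 0 →
        fderiv ℝ (neumannG (potential n s k)) y w = 0 → KillsAng (slab n 0 2) y w →
        KillsAng (slab n 2 4) y w → KillsAng (slab n 4 n) y w →
        ∀ i, fderiv ℝ (f i) (shift s (blockField n k) y) (shift s (blockField n k) w) = 0 := by
      intro w hE hG h₁ h₂ h₃
      have h₁' := (killsAng_slab₀ hn).1 h₁
      have h₂' := (killsAng_slab₂ hn).1 h₂
      rintro (i | ij)
      · revert i
        simpa [f, Fin.forall_fin_succ] using ⟨fderiv_energy_eq_zero hn hk hE h₁' h₂',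
          fderiv_integralJ_eq_zero hn hk hE hG h₁' h₂',
          (fderiv_shift_of_ang (integralΦ₀₁_shift hn) y w).trans h₁',
          (fderiv_shift_of_ang (integralΦ₂₃_shift hn) y w).trans h₂'⟩
      · exact fderiv_rotationIntegrals_eq_zero hk₂ h₃ ij
    simpa only [Fin.forall_fin_succ, Matrix.cons_val_zero, Matrix.cons_val_succ,
      IsEmpty.forall_iff, and_true] using
      ⟨fun i => (hc i).killed_fieldE hy, fun i => (hc i).killed_fieldG hy,
        hkill _ (fderiv_neumannE_fieldBlock hB.h₁ y) (fderiv_neumannG_fieldBlock hB.h₁ y)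
          killsAng_fieldBlock_self (killsAng_fieldBlock_of_disjoint hB.disj₁₂.symm)
          (killsAng_fieldBlock_of_disjoint hB.disj₁₃.symm),
        hkill _ (fderiv_neumannE_fieldBlock hB.h₂ y) (fderiv_neumannG_fieldBlock hB.h₂ y)
          (killsAng_fieldBlock_of_disjoint hB.disj₁₂) killsAng_fieldBlock_self
          (killsAng_fieldBlock_of_disjoint hB.disj₂₃.symm),
        hkill _ (fderiv_neumannE_fieldBlock hB.h₃ y) (fderiv_neumannG_fieldBlock hB.h₃ y)
          (killsAng_fieldBlock_of_disjoint hB.disj₁₃)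
          (killsAng_fieldBlock_of_disjoint hB.disj₂₃) killsAng_fieldBlock_self⟩
  · intro y hy t ht
    obtain ⟨-, -, hF⟩ := hlev y hy
    have := hF.eq_zero (t 0) (t 1) (t 2) (t 3) (t 4)
      (by simpa [Fin.sum_univ_succ, add_assoc] using ht)
    ext i
    fin_cases i
    exacts [this.1, this.2.1, this.2.2.1, this.2.2.2.1, this.2.2.2.2]
  · intro y hy v hv hvf
    obtain ⟨-, -, hF⟩ := hlev y hy
    have h₁ : fderiv ℝ (ang ⟨0, by omega⟩ ⟨1, by omega⟩) y v = 0 :=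
      (fderiv_shift_of_ang (integralΦ₀₁_shift hn) y v).symm.trans (hvf (Sum.inl 2))
    have h₂ : fderiv ℝ (ang ⟨2, by omega⟩ ⟨3, by omega⟩) y v = 0 :=
      (fderiv_shift_of_ang (integralΦ₂₃_shift hn) y v).symm.trans (hvf (Sum.inl 3))
    have hE := fderiv_neumannE_eq_zero hn hk hm (hvf (Sum.inl 0)) h₁ (by rw [h₂]; ring)
    have hG := fderiv_neumannG_eq_zero hn hk hm (hvf (Sum.inl 1)) hE h₁ (by rw [h₂]; ring)
    obtain ⟨r, t, t₁, t₂, t₃, h⟩ := hF.span v hv hE hG ((killsAng_slab₀ hn).2 h₁)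
      ((killsAng_slab₂ hn).2 h₂) (killsAng_of_rotationIntegrals hk₂ fun ij => hvf (Sum.inr ij))
    exact ⟨![r, t, t₁, t₂, t₃], by simpa [Fin.sum_univ_succ, add_assoc] using h⟩
  · intro y hy
    obtain ⟨h1, h2, -⟩ := hlev y hy
    rw [fieldRot_blockField hn hk (by rwa [h1]) (Or.inr (by rwa [h2])), h1, h2]
    simp [Fin.sum_univ_succ, smul_smul]

theorem integrable_twoPlane (hn : 6 ≤ n) (hm : 0 < m) (hs : s ≠ 0) (hk : ∀ l, 2 ≤ l → k l = 0)
    (hk₀ : k 0 ≠ 0) (hk₁ : k 1 ≠ 0) :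
    IsNoncommutativelyIntegrable m s (blockField n k) (twoPlaneFamily (by omega) m s k) 5 where
  smooth := contDiff_twoPlane _
  first_integral i := (conserved_twoPlane _ hk i).isFirstIntegral
    (isHalfSquare_potential (by omega) hk) (blockField_skew n k)
  closed := closed_twoPlane _ hk
  generic := generically_isRegular hn (by positivity) (by positivity) (blockField_skew n k)
    fun _ hx hr => generic_twoPlane _ hm hs hk hk₀ hk₁ hx hr

/-! Two planes with the same magnetic parameter. -/

/-- The integrals for two planes with the same magnetic parameter. -/
noncomputable abbrev equalPlaneFamily (hn : 4 ≤ n) (m s : ℝ) (k : ℕ → ℝ) :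
    Fin 6 ⊕ {ij : Fin n × Fin n // 4 ≤ (ij.1 : ℕ) ∧ ij.1 < ij.2} → Phase n → ℝ :=
  Sum.elim
    ![energy m, integralJ m s (blockField n k),
      integralΦ s (blockField n k) ⟨0, by omega⟩ ⟨1, by omega⟩,
      integralΦ s (blockField n k) ⟨2, by omega⟩ ⟨3, by omega⟩,
      integralΨ₁ s (blockField n k) ⟨0, by omega⟩ ⟨1, by omega⟩ ⟨2, by omega⟩ ⟨3, by omega⟩,
      integralΨ₂ s (blockField n k) ⟨0, by omega⟩ ⟨1, by omega⟩ ⟨2, by omega⟩ ⟨3, by omega⟩]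
    (rotationIntegrals s (blockField n k) 4)

theorem contDiff_equalPlane {l : WithTop ℕ∞} (hn : 4 ≤ n) (i) :
    ContDiff ℝ l (equalPlaneFamily hn m s k i) := by
  rcases i with i | ij
  · revert i
    simpa [Fin.forall_fin_succ] using ⟨contDiff_energy, contDiff_integralJ,
      contDiff_integralΦ _ _, contDiff_integralΦ _ _, contDiff_integralΨ₁ _ _ _ _,
      contDiff_integralΨ₂ _ _ _ _⟩
  · exact contDiff_integralΦ _ _

theorem conserved_equalPlane (hn : 4 ≤ n) (hk : ∀ l, 2 ≤ l → k l = 0) (h : k 0 = k 1) (i) :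
    Conserved (potential n s k) s (blockField n k) (equalPlaneFamily hn m s k i) := by
  have ha := isHalfSquare_potential (s := s) hn hk
  have hκ := blockField_skew n k
  rcases i with i | ij
  · revert i
    simpa [Fin.forall_fin_succ] using ⟨conserved_energy ha hκ, conserved_integralJ ha hκ,
      conserved_integralΦ₀₁ hn, conserved_integralΦ₂₃ hn, conserved_integralΨ₁ hn h,
      conserved_integralΨ₂ hn h⟩
  · exact conserved_rotationIntegrals (half_eq_zero₄ hk) ij

theorem twoBlocks_slab₄ (hk : ∀ l, 2 ≤ l → k l = 0) (h : k 0 = k 1) :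
    TwoBlocks (slab n 0 4) (slab n 4 n) (potential n s k) (s ^ 2 / 4 * k 0 ^ 2) where
  disj := slab_disjoint le_rfl
  cover i := by
    simp only [mem_slab]
    omega
  h₁ i hi := by
    rw [← slab_union (q := 2) (by omega) (by omega), Finset.mem_union] at hi
    rcases hi with hi | hi
    · exact potential_slab₀ i hi
    · rw [h]
      exact potential_slab₂ i hi
  h₂ := potential_slab (half_eq_zero₄ hk)

theorem unitaryBlock_slab (hn : 4 ≤ n) (hk : ∀ l, 2 ≤ l → k l = 0) (h : k 0 = k 1) :
    UnitaryBlock (blockField n k) (slab n 0 4) ⟨0, by omega⟩ ⟨1, by omega⟩ ⟨2, by omega⟩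
      ⟨3, by omega⟩ (k 0) where
  mem i := by
    rw [mem_slab]
    simp only [Fin.ext_iff]
    omega
  sum f := by
    have := sum_eq_of_four hn (f := fun i => if i ∈ slab n 0 4 then f i else 0) fun i hi => by
      rw [if_neg]
      rw [mem_slab]
      omega
    rw [Finset.sum_ite_mem, Finset.univ_inter] at this
    rw [this]
    simp [mem_slab]
  h₀ := mulVec₀ hn
  h₁ := mulVec₁ hn
  h₂ u := by rw [mulVec₂ hn, h]
  h₃ u := by rw [mulVec₃ hn, h]
  off u i hi := blockField_mulVec_eq_zero (half_eq_zero₄ hk i (by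
    rw [mem_slab] at hi
    omega)) u

/-- The momenta of the action of `U(2)` on two planes. -/
noncomputable def unitaryMomentum (i₀ i₁ i₂ i₃ : Fin n) : Fin 4 → Phase n → ℝ :=
  ![ang i₀ i₁, ang i₂ i₃, fun x => ang i₁ i₂ x - ang i₀ i₃ x, fun x => ang i₀ i₂ x + ang i₁ i₃ x]

/-- The Hamiltonian fields of the momenta of the action of `U(2)`. -/
noncomputable def unitaryField (i₀ i₁ i₂ i₃ : Fin n) : Fin 4 → Phase n → Phase n :=
  ![fieldRot (rotGen i₀ i₁), fieldRot (rotGen i₂ i₃),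
    fun x => fieldRot (rotGen i₁ i₂) x + (-1 : ℝ) • fieldRot (rotGen i₀ i₃) x,
    fun x => fieldRot (rotGen i₀ i₂) x + fieldRot (rotGen i₁ i₃) x]

variable {i₀ i₁ i₂ i₃ : Fin n}

theorem hasFDerivAt_ang (i j : Fin n) (x : Phase n) :
    HasFDerivAt (ang i j) (fderiv ℝ (ang i j) x) x :=
  ((contDiff_ang i j).differentiable (n := 1) (by simp) x).hasFDerivAt

theorem fderiv_ang_sub (i j p q : Fin n) (x : Phase n) :
    fderiv ℝ (fun x => ang i j x - ang p q x) x = fderiv ℝ (ang i j) x - fderiv ℝ (ang p q) x :=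
  ((hasFDerivAt_ang i j x).sub (hasFDerivAt_ang p q x)).fderiv

theorem fderiv_ang_add (i j p q : Fin n) (x : Phase n) :
    fderiv ℝ (fun x => ang i j x + ang p q x) x = fderiv ℝ (ang i j) x + fderiv ℝ (ang p q) x :=
  ((hasFDerivAt_ang i j x).add (hasFDerivAt_ang p q x)).fderiv

theorem isHamVector_unitaryMomentum (l : Fin 4) (x : Phase n) :
    IsHamVector (unitaryMomentum i₀ i₁ i₂ i₃ l) x (unitaryField i₀ i₁ i₂ i₃ l x) := by
  fin_cases l
  · exact isHamVector_ang i₀ i₁ x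
  · exact isHamVector_ang i₂ i₃ x
  · have h : fderiv ℝ (fun y => -1 * ang i₀ i₃ y) x = (-1 : ℝ) • fderiv ℝ (ang i₀ i₃) x :=
      ((hasFDerivAt_ang i₀ i₃ x).const_mul (-1)).fderiv
    exact (isHamVector_ang i₁ i₂ x).add ((isHamVector_ang i₀ i₃ x).smul (-1) h)
      ((fderiv_ang_sub _ _ _ _ _).trans (by rw [h]; module))
  · exact (isHamVector_ang i₀ i₂ x).add (isHamVector_ang i₁ i₃ x) (fderiv_ang_add _ _ _ _ _)

theorem fderiv_unitaryMomentum (l : Fin 4) (x w : Phase n) :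
    fderiv ℝ (unitaryMomentum i₀ i₁ i₂ i₃ l) x w
      = ![fderiv ℝ (ang i₀ i₁) x w, fderiv ℝ (ang i₂ i₃) x w,
        fderiv ℝ (ang i₁ i₂) x w - fderiv ℝ (ang i₀ i₃) x w,
        fderiv ℝ (ang i₀ i₂) x w + fderiv ℝ (ang i₁ i₃) x w] l := by
  fin_cases l
  · rfl
  · rfl
  · exact congrArg (· w) (fderiv_ang_sub i₁ i₂ i₀ i₃ x)
  · exact congrArg (· w) (fderiv_ang_add i₀ i₂ i₁ i₃ x)

/-- The structure constants of `𝔲(2)`. -/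
def unitaryConst : Fin 4 → Fin 4 → Fin 4 → ℝ :=
  ![![![0, 0, 0, 0], ![0, 0, 0, 0], ![0, 0, 0, -1], ![0, 0, 1, 0]],
    ![![0, 0, 0, 0], ![0, 0, 0, 0], ![0, 0, 0, 1], ![0, 0, -1, 0]],
    ![![0, 0, 0, 1], ![0, 0, 0, -1], ![0, 0, 0, 0], ![-2, 2, 0, 0]],
    ![![0, 0, -1, 0], ![0, 0, 1, 0], ![2, -2, 0, 0], ![0, 0, 0, 0]]]

theorem unitaryMomentum_bracket (h₀₁ : i₀ ≠ i₁) (h₀₂ : i₀ ≠ i₂) (h₀₃ : i₀ ≠ i₃) (h₁₂ : i₁ ≠ i₂)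
    (h₁₃ : i₁ ≠ i₃) (h₂₃ : i₂ ≠ i₃) (l l' : Fin 4) (x : Phase n) :
    fderiv ℝ (unitaryMomentum i₀ i₁ i₂ i₃ l) x (unitaryField i₀ i₁ i₂ i₃ l' x)
      = unitaryConst l l' 0 * unitaryMomentum i₀ i₁ i₂ i₃ 0 x
        + unitaryConst l l' 1 * unitaryMomentum i₀ i₁ i₂ i₃ 1 x
        + unitaryConst l l' 2 * unitaryMomentum i₀ i₁ i₂ i₃ 2 x
        + unitaryConst l l' 3 * unitaryMomentum i₀ i₁ i₂ i₃ 3 x := by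
  rw [fderiv_unitaryMomentum]
  fin_cases l <;> fin_cases l' <;>
    simp [unitaryField, unitaryConst, unitaryMomentum, fderiv_ang_rotGen, h₀₁, h₀₂, h₀₃, h₁₂, h₁₃,
      h₂₃, h₀₁.symm, h₀₂.symm, h₀₃.symm, h₁₂.symm, h₁₃.symm, h₂₃.symm, ang_self] <;>
    simp only [ang] <;> ring

theorem KillsAng.fderiv_unitaryMomentum {l : Fin 4} (h : KillsAng S x w)
    (h₀ : i₀ ∈ S) (h₁ : i₁ ∈ S) (h₂ : i₂ ∈ S) (h₃ : i₃ ∈ S) :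
    fderiv ℝ (unitaryMomentum i₀ i₁ i₂ i₃ l) x w = 0 := by
  rw [MagneticSphere.fderiv_unitaryMomentum, h _ h₀ _ h₁, h _ h₂ _ h₃, h _ h₁ _ h₂, h _ h₀ _ h₃, h _ h₀ _ h₂,
    h _ h₁ _ h₃]
  fin_cases l <;> simp

theorem unitaryMomentum_shift (hn : 4 ≤ n) (h : k 0 = k 1) (l : Fin 4) (x : Phase n) :
    equalPlaneFamily hn m s k (Sum.inl (Fin.natAdd 2 l)) (shift s (blockField n k) x)
      = unitaryMomentum ⟨0, by omega⟩ ⟨1, by omega⟩ ⟨2, by omega⟩ ⟨3, by omega⟩ l x := by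
  fin_cases l
  · exact integralΦ₀₁_shift hn x
  · exact integralΦ₂₃_shift hn x
  · exact integralΨ₁_shift hn h x
  · exact integralΨ₂_shift hn h x

theorem closed_equalPlane (hn : 4 ≤ n) (hk : ∀ l, 2 ≤ l → k l = 0) (h : k 0 = k 1) (i j) :
    ∃ b ∈ Algebra.adjoin ℝ (range (equalPlaneFamily hn m s k)), ∀ z ∈ cotangentSphere n,
      diracBracket s (blockField n k) (equalPlaneFamily hn m s k i) (equalPlaneFamily hn m s k j) z
        = b z := by
  have ha := isHalfSquare_potential (s := s) hn hk
  have hκ := blockField_skew n k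
  have hk₂ := half_eq_zero₄ hk
  have hc := conserved_equalPlane (m := m) (s := s) hn hk h
  set f := equalPlaneFamily hn m s k with hf
  have hcases : ∀ i, (f i = energy m ∨ f i = integralJ m s (blockField n k)) ∨
      (∃ l, ∀ x, f i (shift s (blockField n k) x) = unitaryMomentum ⟨0, by omega⟩ ⟨1, by omega⟩
        ⟨2, by omega⟩ ⟨3, by omega⟩ l x) ∨
      ∃ p q, p ∈ slab n 4 n ∧ q ∈ slab n 4 n ∧ ∀ x, f i (shift s (blockField n k) x)
        = ang p q x := by
    rintro (i | ij)
    · fin_cases i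
      · exact Or.inl (Or.inl rfl)
      · exact Or.inl (Or.inr rfl)
      · exact Or.inr (Or.inl ⟨0, unitaryMomentum_shift hn h 0⟩)
      · exact Or.inr (Or.inl ⟨1, unitaryMomentum_shift hn h 1⟩)
      · exact Or.inr (Or.inl ⟨2, unitaryMomentum_shift hn h 2⟩)
      · exact Or.inr (Or.inl ⟨3, unitaryMomentum_shift hn h 3⟩)
    · exact Or.inr (Or.inr ⟨ij.1.1, ij.1.2, mem_slab.2 ⟨ij.2.1, ij.1.1.2⟩,
        mem_slab.2 ⟨ij.2.1.trans (Fin.lt_def.1 ij.2.2).le, ij.1.2.2⟩,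
        rotationIntegrals_shift hk₂ ij⟩)
  have hz : ∀ i j, (f j = energy m ∨ f j = integralJ m s (blockField n k)) →
      ∀ z ∈ cotangentSphere n, diracBracket s (blockField n k) (f i) (f j) z = 0 := by
    rintro i j (h | h) <;> rw [h]
    · exact (hc i).bracket_energy ha hκ
    · exact (hc i).bracket_integralJ ha hκ
  have hU : ∀ l, Realizes s (blockField n k) f (unitaryMomentum ⟨0, by omega⟩ ⟨1, by omega⟩
      ⟨2, by omega⟩ ⟨3, by omega⟩ l) := fun l =>
    (realizes_apply (Sum.inl (Fin.natAdd 2 l))).congr fun x => (unitaryMomentum_shift hn h l x).symm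
  have hR := realizes_ang_of_rotationIntegrals (f := f) (s := s) hk₂ fun ij => ⟨Sum.inr ij, rfl⟩
  have hUang : ∀ (i j : Fin 6 ⊕ {ij : Fin n × Fin n // 4 ≤ (ij.1 : ℕ) ∧ ij.1 < ij.2}) (l : Fin 4)
      (p q : Fin n), p ∈ slab n 4 n → q ∈ slab n 4 n →
      (∀ x, f i (shift s (blockField n k) x) = unitaryMomentum ⟨0, by omega⟩ ⟨1, by omega⟩
        ⟨2, by omega⟩ ⟨3, by omega⟩ l x) →
      (∀ x, f j (shift s (blockField n k) x) = ang p q x) →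
      ∀ z ∈ cotangentSphere n, diracBracket s (blockField n k) (f i) (f j) z = 0 := by
    intro i j l p q hp hq hi hj
    refine forall_cotangentSphere (s := s) hκ fun x hx => ?_
    have hj' : (fun y => f j (shift s (blockField n k) y)) = ang p q := funext hj
    have hi' : (fun y => f i (shift s (blockField n k) y)) = _ := funext hi
    rw [IsHamVector.diracBracket (X := fieldRot (rotGen p q) x) hκ hx
      (by rw [hj']; exact isHamVector_ang p q x), hi']
    refine KillsAng.fderiv_unitaryMomentum (S := slab n 0 4) (fun i hi j hj => ?_)
      (by simp [mem_slab]) (by simp [mem_slab]) (by simp [mem_slab]) (by simp [mem_slab])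
    rw [mem_slab] at hp hq hi hj
    rw [fderiv_ang_rotGen]
    simp only [Fin.ext_iff]
    rw [if_neg (by omega), if_neg (by omega), if_neg (by omega), if_neg (by omega)]
    ring
  rcases hcases j with hj | ⟨l', hj⟩ | ⟨p, q, hp, hq, hj⟩
  · exact ⟨0, Subalgebra.zero_mem _, hz i j hj⟩
  · rcases hcases i with hi | ⟨l, hi⟩ | ⟨p, q, hp, hq, hi⟩
    · exact ⟨0, Subalgebra.zero_mem _, fun z hz' => by
        rw [diracBracket_swap hκ _ _ hz', hz j i hi z hz', neg_zero]; rfl⟩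
    · refine Realizes.exists_bracket hκ (((((hU 0).smul (unitaryConst l l' 0)).add
        ((hU 1).smul (unitaryConst l l' 1))).add ((hU 2).smul (unitaryConst l l' 2))).add
        ((hU 3).smul (unitaryConst l l' 3))) fun x hx => ?_
      have hj' : (fun y => f j (shift s (blockField n k) y)) = _ := funext hj
      have hi' : (fun y => f i (shift s (blockField n k) y)) = _ := funext hi
      rw [IsHamVector.diracBracket (X := unitaryField ⟨0, by omega⟩ ⟨1, by omega⟩ ⟨2, by omega⟩
        ⟨3, by omega⟩ l' x) hκ hx (by rw [hj']; exact isHamVector_unitaryMomentum l' x), hi']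
      exact unitaryMomentum_bracket (by simp) (by simp) (by simp) (by simp) (by simp) (by simp)
        l l' x
    · exact ⟨0, Subalgebra.zero_mem _, fun z hz' => by
        rw [diracBracket_swap hκ _ _ hz', hUang j i l' p q hp hq hj hi z hz', neg_zero]; rfl⟩
  · rcases hcases i with hi | ⟨l, hi⟩ | ⟨p', q', hp', hq', hi⟩
    · exact ⟨0, Subalgebra.zero_mem _, fun z hz' => by
        rw [diracBracket_swap hκ _ _ hz', hz j i hi z hz', neg_zero]; rfl⟩
    · exact ⟨0, Subalgebra.zero_mem _, hUang i j l p q hp hq hi hj⟩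
    · refine (((((Realizes.ite (P := p' = q) fun _ => hR p hp q' hq').sub
        (Realizes.ite (P := p' = p) fun _ => hR q hq q' hq')).add
        (Realizes.ite (P := q' = q) fun _ => hR p' hp' p hp))).sub
        (Realizes.ite (P := q' = p) fun _ => hR p' hp' q hq)).exists_bracket hκ fun x hx =>
        bracket_of_ang hκ hi hj hx

theorem generic_equalPlane (hn : 4 ≤ n) (hm : 0 < m) (hs : s ≠ 0) (hk : ∀ l, 2 ≤ l → k l = 0)
    (h : k 0 = k 1) (hk₀ : k 0 ≠ 0) (hx : x ∈ cotangentSphere n)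
    (hD : casimir (slab n 0 4) x ≠ 0) (hD' : casimir (slab n 4 n) x ≠ 0)
    (hv : blockDot (slab n 0 4) x.1 x.2 ≠ 0)
    (hdet : casimir (slab n 0 4) x ≠ (ang ⟨0, by omega⟩ ⟨1, by omega⟩ x
      + ang ⟨2, by omega⟩ ⟨3, by omega⟩ x) ^ 2) :
    let f := equalPlaneFamily hn m s k
    ddimAt f (shift s (blockField n k) x) + dindAt s (blockField n k) f (shift s (blockField n k) x)
        = 2 * (n - 1) ∧
      dindAt s (blockField n k) f (shift s (blockField n k) x) = 4 ∧
      IsIsotropicInvariantTorus m s (blockField n k) 4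
        (levelComponent f (shift s (blockField n k) x)) := by
  intro f
  have hk₂ := half_eq_zero₄ hk
  have hκ := blockField_skew n k
  have ha := isHalfSquare_potential (s := s) hn hk
  have hB := twoBlocks_slab₄ (n := n) (s := s) hk h
  have hU := unitaryBlock_slab hn hk h
  have hc₀ : 0 < s ^ 2 / 4 * k 0 ^ 2 := by positivity
  have hc : ∀ i, Conserved (potential n s k) s (blockField n k) (f i) :=
    conserved_equalPlane hn hk h
  have hmin := aboveMin_of_ne_zero hB hx (casimir_pos_of_ne_zero hD) (casimir_pos_of_ne_zero hD')
    hv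
  have hlev : ∀ y ∈ canonicalLevel s (blockField n k) f x,
      0 < casimir (slab n 0 4) y ∧ 0 < casimir (slab n 4 n) y ∧
      AboveMin (slab n 0 4) (slab n 4 n) (potential n s k) (s ^ 2 / 4 * k 0 ^ 2) y ∧
      casimir (slab n 0 4) y ≠ (ang ⟨0, by omega⟩ ⟨1, by omega⟩ y
        + ang ⟨2, by omega⟩ ⟨3, by omega⟩ y) ^ 2 := by
    intro y hy
    have e₁ : ang ⟨0, by omega⟩ ⟨1, by omega⟩ y = ang ⟨0, by omega⟩ ⟨1, by omega⟩ x := by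
      rw [← integralΦ₀₁_shift hn (s := s) (k := k), ← integralΦ₀₁_shift hn (s := s) (k := k)]
      exact hy.2 (Sum.inl 2)
    have e₂ : ang ⟨2, by omega⟩ ⟨3, by omega⟩ y = ang ⟨2, by omega⟩ ⟨3, by omega⟩ x := by
      rw [← integralΦ₂₃_shift hn (s := s) (k := k), ← integralΦ₂₃_shift hn (s := s) (k := k)]
      exact hy.2 (Sum.inl 3)
    have hE := neumannE_eq_of_energy hn hk hm (hy.2 (Sum.inl 0)) e₁ (by rw [e₂])
    have hG := neumannG_eq_of_integralJ hn hk hm (hy.2 (Sum.inl 1)) hE e₁ (by rw [e₂])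
    have e₃ : casimir (slab n 4 n) y = casimir (slab n 4 n) x :=
      casimir_congr (ang_eq_of_rotationIntegrals hk₂ fun ij => hy.2 (Sum.inr ij))
    have e₄ : casimir (slab n 0 4) y = casimir (slab n 0 4) x := by
      rw [hB.neumannG_eq hy.1, hB.neumannG_eq hx, hE, e₃] at hG
      have := mul_left_cancel₀ hc₀.ne' (add_left_cancel hG)
      linarith
    exact ⟨e₄ ▸ casimir_pos_of_ne_zero hD, e₃ ▸ casimir_pos_of_ne_zero hD', hmin.congr e₄ e₃ hE,
      by rw [e₁, e₂, e₄]; exact hdet⟩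
  have hmem : ∀ i : Fin n, (i : ℕ) < 4 → i ∈ slab n 0 4 := fun i hi => mem_slab.2 ⟨by omega, hi⟩
  have hUf : ∀ (l : Fin 4) (y w : Phase n), fderiv ℝ (f (Sum.inl (Fin.natAdd 2 l)))
      (shift s (blockField n k) y) (shift s (blockField n k) w)
      = fderiv ℝ (unitaryMomentum ⟨0, by omega⟩ ⟨1, by omega⟩ ⟨2, by omega⟩ ⟨3, by omega⟩ l)
        y w := fun l y w => by
    rw [← fderiv_comp_shift]
    exact congrArg (fun g => fderiv ℝ g y w) (funext (unitaryMomentum_shift hn h l))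
  refine (hB.involutiveFrame_unitary hU (ha.isSymmetry hκ)).generic (f := f) hm hκ ha
    (contDiff_equalPlane hn) (i₀ := Sum.inl 0) rfl hx ?_ ?_ ?_ (ν := ![1, 0, s / 2, 0]) ?_
  · intro y hy
    have hblock : ∀ i, fderiv ℝ (f i) (shift s (blockField n k) y)
        (shift s (blockField n k) (fieldBlock (slab n 4 n) y)) = 0 := by
      have hE := fderiv_neumannE_fieldBlock hB.h₂ y
      have hG := fderiv_neumannG_fieldBlock hB.h₂ y
      have h₁ : KillsAng (slab n 0 4) y (fieldBlock (slab n 4 n) y) :=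
        killsAng_fieldBlock_of_disjoint hB.disj
      have h₂ := fun l => (hUf l y _).trans (KillsAng.fderiv_unitaryMomentum (l := l) h₁
        (hmem _ (by simp)) (hmem _ (by simp)) (hmem _ (by simp)) (hmem _ (by simp)))
      have h₃ := h₁ ⟨0, by omega⟩ (hmem _ (by simp)) ⟨1, by omega⟩ (hmem _ (by simp))
      have h₄ := h₁ ⟨2, by omega⟩ (hmem _ (by simp)) ⟨3, by omega⟩ (hmem _ (by simp))
      rintro (i | ij)
      · fin_cases i
        · exact fderiv_energy_eq_zero hn hk hE h₃ h₄
        · exact fderiv_integralJ_eq_zero hn hk hE hG h₃ h₄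
        · exact h₂ 0
        · exact h₂ 1
        · exact h₂ 2
        · exact h₂ 3
      · exact fderiv_rotationIntegrals_eq_zero hk₂ killsAng_fieldBlock_self ij
    simpa only [Fin.forall_fin_succ, Matrix.cons_val_zero, Matrix.cons_val_succ,
      IsEmpty.forall_iff, and_true] using
      ⟨fun i => (hc i).killed_fieldE hy, fun i => (hc i).killed_fieldG hy,
        fun i => (hc i).killed_rot hy, hblock⟩
  · intro y hy t ht
    obtain ⟨h1, h2, h3, h4⟩ := hlev y hy
    have := hB.eq_zero_unitary hU hk₀ hc₀ hy.1 h1 h2 h3 h4 (r := t 0) (s := t 1) (t := t 2)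
      (t' := t 3) (by simpa [Fin.sum_univ_succ, add_assoc] using ht)
    ext i
    fin_cases i
    exacts [this.1, this.2.1, this.2.2.1, this.2.2.2]
  · intro y hy v hv hvf
    obtain ⟨h1, h2, h3, h4⟩ := hlev y hy
    have hu := fun l => (hUf l y v).symm.trans (hvf (Sum.inl (Fin.natAdd 2 l)))
    simp only [fderiv_unitaryMomentum, Fin.forall_fin_succ] at hu
    obtain ⟨u₀, u₁, u₂, u₃, -⟩ := hu
    have hE := fderiv_neumannE_eq_zero hn hk hm (hvf (Sum.inl 0)) u₀ (mul_eq_zero_of_right _ u₁)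
    have hG := fderiv_neumannG_eq_zero hn hk hm (hvf (Sum.inl 1)) hE u₀
      (mul_eq_zero_of_right _ u₁)
    obtain ⟨r, t, t₁, t₂, h⟩ := hB.span_unitary hU hk₀ hc₀ hy.1 h1 h2 h3 h4 hv hE hG u₀ u₁ u₂ u₃
      (killsAng_of_rotationIntegrals hk₂ fun ij => hvf (Sum.inr ij))
    exact ⟨![r, t, t₁, t₂], by simpa [Fin.sum_univ_succ, add_assoc] using h⟩
  · intro y hy
    simp [Fin.sum_univ_succ]

theorem integrable_equalPlane (hn : 6 ≤ n) (hm : 0 < m) (hs : s ≠ 0)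
    (hk : ∀ l, 2 ≤ l → k l = 0) (h : k 0 = k 1) (hk₀ : k 0 ≠ 0) :
    IsNoncommutativelyIntegrable m s (blockField n k) (equalPlaneFamily (by omega) m s k) 4 where
  smooth := contDiff_equalPlane _
  first_integral i := (conserved_equalPlane _ hk h i).isFirstIntegral
    (isHalfSquare_potential (by omega) hk) (blockField_skew n k)
  closed := closed_equalPlane _ hk h
  generic := by
    have hl : ([3 / 5, 0, 0, 0, 4 / 5, 0] : List ℝ).length ≤ n := by simpa using hn
    have hl' : ([4, 1, 1, 0, -3, 1] : List ℝ).length ≤ n := by simpa using hn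
    refine generically_of_ne_zero (s := s) (by omega) (blockField_skew n k)
      (g := fun x => casimir (slab n 0 4) x * casimir (slab n 4 n) x
        * blockDot (slab n 0 4) x.1 x.2 * (casimir (slab n 0 4) x
          - (ang ⟨0, by omega⟩ ⟨1, by omega⟩ x + ang ⟨2, by omega⟩ ⟨3, by omega⟩ x) ^ 2)) ?_
      (z := (vecOf n [3 / 5, 0, 0, 0, 4 / 5, 0], vecOf n [4, 1, 1, 0, -3, 1])) ?_ ?_
      fun x hx hg => ?_
    · exact ((contDiff_casimir.mul contDiff_casimir).mul
        (contDiff_blockDot contDiff_fst contDiff_snd)).mul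
        (contDiff_casimir.sub (((contDiff_ang _ _).add (contDiff_ang _ _)).pow 2))
    · rw [mem_cotangentSphere, dot_vecOf hl, dot_vecOf hl]
      norm_num [Finset.sum_range_succ]
    · simp only [casimir, blockDot_vecOf_tail hl, blockDot_vecOf_tail hl', blockDot_vecOf hl,
        blockDot_vecOf hl', ang]
      norm_num [Finset.sum_range_succ, vecOf]
    · refine generic_equalPlane _ hm hs hk h hk₀ hx ?_ ?_ ?_ ?_ <;> intro h0 <;> apply hg <;>
        rw [h0] <;> ring

end MagneticSphere

namespace MagneticSphere

variable {n : ℕ} {k : ℕ → ℝ} {m s c r : ℝ} {x y w : Phase n} {a : Fin n → ℝ}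
  {κ Ω : Matrix (Fin n) (Fin n) ℝ} {S S' : Finset (Fin n)}

/-! Involution of the integrals of a chain of rotation groups. -/

theorem fderiv_ang_fieldBlock {p q : Fin n} (h : p ∈ S ↔ q ∈ S) (x : Phase n) :
    fderiv ℝ (ang p q) x (fieldBlock S x) = 0 := by
  by_cases hp : p ∈ S
  · exact killsAng_fieldBlock_self p hp q (h.1 hp)
  · have hd : Disjoint {p, q} S := by
      rw [Finset.disjoint_left]
      intro i hi
      rcases Finset.mem_insert.1 hi with rfl | hi
      · exact hp
      · rw [Finset.mem_singleton.1 hi]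
        exact fun hq => hp (h.2 hq)
    exact killsAng_fieldBlock_of_disjoint hd p (by simp) q (by simp)

theorem fderiv_casimir_rotGen (p q : Fin n) (x : Phase n) :
    fderiv ℝ (casimir S) x (fieldRot (rotGen p q) x)
      = -(2 * fderiv ℝ (ang p q) x (fieldBlock S x)) := by
  have h₁ := (isHamVector_casimir S x).2 _ (isHamVector_ang p q x).1
  have h₂ := (isHamVector_ang p q x).2 _ (isHamVector_casimir S x).1
  rw [canon_swap, h₂, map_smul, smul_eq_mul] at h₁
  linarith

theorem bracket_eq_zero_of_ang_casimir (hκ : κᵀ = -κ) {f g : Phase n → ℝ} {p q : Fin n}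
    (hf : ∀ x, f (shift s κ x) = ang p q x) (hg : ∀ x, g (shift s κ x) = casimir S x)
    (h : p ∈ S ↔ q ∈ S) : ∀ z ∈ cotangentSphere n, diracBracket s κ f g z = 0 := by
  refine forall_cotangentSphere (s := s) hκ fun x hx => ?_
  have hf' : (fun y => f (shift s κ y)) = _ := funext hf
  have hg' : (fun y => g (shift s κ y)) = _ := funext hg
  rw [IsHamVector.diracBracket (X := (2 : ℝ) • fieldBlock S x) hκ hx
    (by rw [hg']; exact isHamVector_casimir S x), hf', map_smul, fderiv_ang_fieldBlock h, smul_zero]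

theorem bracket_eq_zero_of_casimir (hκ : κᵀ = -κ) {f g : Phase n → ℝ}
    (hf : ∀ x, f (shift s κ x) = casimir S x) (hg : ∀ x, g (shift s κ x) = casimir S' x)
    (h : S ⊆ S') : ∀ z ∈ cotangentSphere n, diracBracket s κ f g z = 0 := by
  refine forall_cotangentSphere (s := s) hκ fun x hx => ?_
  have hf' : (fun y => f (shift s κ y)) = _ := funext hf
  have hg' : (fun y => g (shift s κ y)) = _ := funext hg
  rw [IsHamVector.diracBracket (X := (2 : ℝ) • fieldBlock S' x) hκ hx
    (by rw [hg']; exact isHamVector_casimir S' x), hf', map_smul,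
    (killsAng_fieldBlock_of_subset h).fderiv_casimir, smul_zero]

theorem bracket_eq_zero_of_ang (hκ : κᵀ = -κ) {f g : Phase n → ℝ} {p q p' q' : Fin n}
    (hf : ∀ x, f (shift s κ x) = ang p q x) (hg : ∀ x, g (shift s κ x) = ang p' q' x)
    (hp : (p : ℕ) % 2 = 0) (hq : (q : ℕ) = p + 1) (hp' : (p' : ℕ) % 2 = 0)
    (hq' : (q' : ℕ) = p' + 1) : ∀ z ∈ cotangentSphere n, diracBracket s κ f g z = 0 := by
  refine forall_cotangentSphere (s := s) hκ fun x hx => ?_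
  rw [bracket_of_ang hκ hf hg hx]
  have hpq : p ≠ q := fun h => by
    rw [Fin.ext_iff] at h
    omega
  by_cases h : p = p'
  · have h' : q = q' := by
      rw [Fin.ext_iff] at h ⊢
      omega
    subst h h'
    simp [ang_self, hpq, hpq.symm]
  · rw [Fin.ext_iff] at h
    simp only [Fin.ext_iff]
    rw [if_neg (by omega), if_neg (by omega), if_neg (by omega), if_neg (by omega)]
    ring

/-- The integrals of a Liouville integrable problem: the energy, `J`, angular momenta in coordinate
planes, and the Casimir functions of a chain of rotation groups. -/
theorem commute_of_chain {ι : Type} {f : ι → Phase n → ℝ} (ha : IsHalfSquare a s κ) (hκ : κᵀ = -κ)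
    {d : ℕ} (hd : d % 2 = 0) (hc : ∀ i, Conserved a s κ (f i))
    (hf : ∀ i, (f i = energy m ∨ f i = integralJ m s κ) ∨
      (∃ p q : Fin n, (p : ℕ) % 2 = 0 ∧ (q : ℕ) = p + 1 ∧ (p : ℕ) ≤ d ∧
        ∀ x, f i (shift s κ x) = ang p q x) ∨
      ∃ l, d + 2 ≤ l ∧ ∀ x, f i (shift s κ x) = casimir (slab n d l) x) (i j : ι) :
    ∀ z ∈ cotangentSphere n, diracBracket s κ (f i) (f j) z = 0 := by
  have hswap : ∀ i j, (∀ z ∈ cotangentSphere n, diracBracket s κ (f i) (f j) z = 0) →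
      ∀ z ∈ cotangentSphere n, diracBracket s κ (f j) (f i) z = 0 := fun i j h z hz => by
    rw [diracBracket_swap hκ _ _ hz, h z hz, neg_zero]
  have hz : ∀ i j, (f j = energy m ∨ f j = integralJ m s κ) →
      ∀ z ∈ cotangentSphere n, diracBracket s κ (f i) (f j) z = 0 := by
    rintro i j (h | h) <;> rw [h]
    · exact (hc i).bracket_energy ha hκ
    · exact (hc i).bracket_integralJ ha hκ
  have hmix : ∀ {i j : ι} {p q : Fin n} {l : ℕ}, (p : ℕ) % 2 = 0 → (q : ℕ) = p + 1 →
      (p : ℕ) ≤ d → (∀ x, f i (shift s κ x) = ang p q x) → d + 2 ≤ l →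
      (∀ x, f j (shift s κ x) = casimir (slab n d l) x) →
      ∀ z ∈ cotangentSphere n, diracBracket s κ (f i) (f j) z = 0 := by
    intro i j p q l hp hq hpd hi hl hj
    refine bracket_eq_zero_of_ang_casimir hκ hi hj ?_
    rw [mem_slab, mem_slab]
    omega
  rcases hf j with hj | ⟨p, q, hp, hq, hpd, hj⟩ | ⟨l, hl, hj⟩
  · exact hz i j hj
  · rcases hf i with hi | ⟨p', q', hp', hq', -, hi⟩ | ⟨l, hl, hi⟩
    · exact hswap j i (hz j i hi)
    · exact bracket_eq_zero_of_ang hκ hi hj hp' hq' hp hq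
    · exact hswap j i (hmix hp hq hpd hj hl hi)
  · rcases hf i with hi | ⟨p, q, hp, hq, hpd, hi⟩ | ⟨l', hl', hi⟩
    · exact hswap j i (hz j i hi)
    · exact hmix hp hq hpd hi hl hj
    · have hmono : ∀ {l l' : ℕ}, l ≤ l' → slab n d l ⊆ slab n d l' := fun h i hi => by
        rw [mem_slab] at hi ⊢
        omega
      rcases le_total l l' with h | h
      · exact hswap j i (bracket_eq_zero_of_casimir hκ hj hi (hmono h))
      · exact bracket_eq_zero_of_casimir hκ hi hj (hmono h)

/-! Independence of the integrals of a chain of rotation groups. -/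

/-- The points at which the integrals of the chain of rotation groups of the coordinates from `d`
on are independent modulo the Casimir function of the whole group. -/
structure IsChainRegular (d : ℕ) (x : Phase n) : Prop where
  ang : ∀ p q : Fin n, (p : ℕ) = d → (q : ℕ) = d + 2 → MagneticSphere.ang p q x ≠ 0
  casimir : ∀ p q : Fin n, d + 2 ≤ (p : ℕ) → (q : ℕ) = p + 1 →
    fderiv ℝ (MagneticSphere.casimir (slab n d q)) x (fieldRot (rotGen p q) x) ≠ 0

theorem IsChainRegular.eq_zero {d N : ℕ} (hN : d + 2 + N = n) (hx : IsChainRegular d x)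
    {D : Phase n → ℝ} (hD : ∀ p q : Fin n, d ≤ (p : ℕ) → (q : ℕ) = p + 1 →
      D (fieldRot (rotGen p q) x) = 0) {p₀ q₀ : Fin n} (hp₀ : (p₀ : ℕ) = d) (hq₀ : (q₀ : ℕ) = d + 1)
    (h3 : d + 3 ≤ n) {b : ℝ} {t : Fin N → ℝ} (h : ∀ w ∈ tangentAt x,
      D w + b * fderiv ℝ (MagneticSphere.ang p₀ q₀) x w
        + ∑ i, t i * fderiv ℝ (MagneticSphere.casimir (slab n d (d + 3 + i))) x w = 0) :
    b = 0 ∧ ∀ i : Fin N, d + 3 + (i : ℕ) < n → t i = 0 := by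
  have hcas : ∀ (p q : Fin n) (l : ℕ), d ≤ (p : ℕ) → (q : ℕ) = p + 1 → (q : ℕ) ≠ l →
      fderiv ℝ (MagneticSphere.casimir (slab n d l)) x (fieldRot (rotGen p q) x) = 0 := by
    intro p q l hp hq hl
    rw [fderiv_casimir_rotGen, fderiv_ang_fieldBlock, mul_zero, neg_zero]
    rw [mem_slab, mem_slab]
    omega
  have hmem : ∀ p q : Fin n, fieldRot (rotGen p q) x ∈ tangentAt x := fun p q =>
    (isHamVector_ang p q x).1
  constructor
  · have h1 := h _ (hmem q₀ ⟨d + 2, by omega⟩)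
    rw [hD _ _ (by omega) (by simp; omega), Finset.sum_eq_zero fun i _ => by
      rw [hcas _ _ _ (by omega) (by simp; omega) (by simp; omega), mul_zero], fderiv_ang_rotGen,
      if_neg (by rw [Fin.ext_iff]; simp; omega), if_neg (by rw [Fin.ext_iff]; omega),
      if_neg (by rw [Fin.ext_iff]; simp; omega), if_pos rfl] at h1
    have h2 := hx.ang p₀ ⟨d + 2, by omega⟩ hp₀ rfl
    have h4 : b * MagneticSphere.ang p₀ ⟨d + 2, by omega⟩ x = 0 := by linarith
    exact (mul_eq_zero.1 h4).resolve_right h2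
  · intro i hi
    have hp : d + 2 + (i : ℕ) < n := by omega
    have h1 := h _ (hmem ⟨d + 2 + i, hp⟩ ⟨d + 3 + i, hi⟩)
    rw [hD _ _ (by simp; omega) (by simp; omega), Finset.sum_eq_single i (fun j _ hj => by
      rw [hcas _ _ _ (by simp; omega) (by simp; omega)
        (by simpa using fun h => hj (Fin.ext h.symm)), mul_zero]) (by simp), fderiv_ang_rotGen,
      if_neg (by rw [Fin.ext_iff]; simp; omega), if_neg (by rw [Fin.ext_iff]; simp; omega),
      if_neg (by rw [Fin.ext_iff]; simp; omega), if_neg (by rw [Fin.ext_iff]; simp; omega)] at h1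
    have h2 := hx.casimir ⟨d + 2 + i, hp⟩ ⟨d + 3 + i, hi⟩ (by simp) (by simp; omega)
    have h4 : t i * fderiv ℝ (MagneticSphere.casimir (slab n d (d + 3 + i))) x
        (fieldRot (rotGen ⟨d + 2 + i, hp⟩ ⟨d + 3 + i, hi⟩) x) = 0 := by linarith
    exact (mul_eq_zero.1 h4).resolve_right h2

theorem generically_true (n : ℕ) : Generically fun _ : Phase n => True :=
  ⟨univ, isOpen_univ, by rw [univ_inter]; exact subset_closure, fun _ _ => trivial⟩

theorem generically_forall_finset {ι : Type*} (T : Finset ι) {P : ι → Phase n → Prop}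
    (h : ∀ i ∈ T, Generically (P i)) : Generically fun x => ∀ i ∈ T, P i x := by
  classical
  induction T using Finset.induction_on with
  | empty => exact (generically_true n).mono fun _ _ _ => by simp
  | insert i T hi ih =>
    refine ((h i (Finset.mem_insert_self i T)).and
      (ih fun j hj => h j (Finset.mem_insert_of_mem hj))).mono fun x _ hx j hj => ?_
    rcases Finset.mem_insert.1 hj with rfl | hj
    · exact hx.1
    · exact hx.2 j hj

theorem single_mem_cotangentSphere {p : Fin n} {u : Fin n → ℝ} (hu : u p = 0) :
    ((Pi.single p 1, u) : Phase n) ∈ cotangentSphere n := by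
  rw [mem_cotangentSphere]
  simp [hu]

theorem generically_isChainRegular (hn : 2 ≤ n) (hκ : κᵀ = -κ) (d : ℕ) :
    Generically fun z => IsChainRegular d ((shift s κ).symm z) := by
  have h1 : Generically fun z : Phase n => ∀ pq ∈ (Finset.univ : Finset (Fin n × Fin n)),
      (pq.1 : ℕ) = d → (pq.2 : ℕ) = d + 2 → ang pq.1 pq.2 ((shift s κ).symm z) ≠ 0 := by
    refine generically_forall_finset _ fun pq _ => ?_
    by_cases hp : (pq.1 : ℕ) = d ∧ (pq.2 : ℕ) = d + 2
    · have hne : pq.1 ≠ pq.2 := fun h => by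
        rw [Fin.ext_iff] at h
        omega
      refine generically_of_ne_zero (s := s) hn hκ (contDiff_ang pq.1 pq.2)
        (single_mem_cotangentSphere (p := pq.1) (u := Pi.single pq.2 1) (by simp [hne])) ?_
        fun x _ hg _ _ => by rwa [ContinuousLinearEquiv.symm_apply_apply]
      simp [ang, hne, hne.symm]
    · exact (generically_true n).mono fun z _ _ h h' => absurd ⟨h, h'⟩ hp
  have h2 : Generically fun z : Phase n => ∀ pq ∈ (Finset.univ : Finset (Fin n × Fin n)),
      d + 2 ≤ (pq.1 : ℕ) → (pq.2 : ℕ) = pq.1 + 1 →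
      fderiv ℝ (casimir (slab n d pq.2)) ((shift s κ).symm z)
        (fieldRot (rotGen pq.1 pq.2) ((shift s κ).symm z)) ≠ 0 := by
    refine generically_forall_finset _ fun pq _ => ?_
    by_cases hp : d + 2 ≤ (pq.1 : ℕ) ∧ (pq.2 : ℕ) = pq.1 + 1
    · obtain ⟨⟨p, q⟩, rfl⟩ : ∃ x, x = pq := ⟨pq, rfl⟩
      simp only at hp ⊢
      have hd : d < n := by omega
      have hpd : p ≠ ⟨d, hd⟩ := fun h => by
        rw [Fin.ext_iff] at h
        simp at h
        omega
      have hqd : q ≠ ⟨d, hd⟩ := fun h => by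
        rw [Fin.ext_iff] at h
        simp at h
        omega
      have hpq : p ≠ q := fun h => by
        rw [Fin.ext_iff] at h
        omega
      have hpS : p ∈ slab n d q := mem_slab.2 ⟨by omega, by omega⟩
      have hqS : q ∉ slab n d q := fun h => by
        rw [mem_slab] at h
        omega
      have hdS : (⟨d, hd⟩ : Fin n) ∈ slab n d q := mem_slab.2 ⟨le_rfl, by simp; omega⟩
      have hg : ContDiff ℝ ω fun x : Phase n =>
          fderiv ℝ (casimir (slab n d q)) x (fieldRot (rotGen p q) x) :=
        ((contDiff_casimir (k := ω)).fderiv_right (m := ω) le_rfl).clm_apply contDiff_fieldRot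
      refine generically_of_ne_zero (s := s) hn hκ hg
        (single_mem_cotangentSphere (p := ⟨d, hd⟩) (u := Pi.single p 1 + Pi.single q 1)
          (by simp [hpd.symm, hqd.symm])) ?_
        fun x _ hg _ _ => by rwa [ContinuousLinearEquiv.symm_apply_apply]
      rw [fderiv_casimir_rotGen, fderiv_ang]
      simp only [fieldBlock, fieldRot]
      rw [blockRot_mulVec_of_mem _ hpS, blockRot_mulVec_of_mem _ hpS,
        blockRot_mulVec_of_notMem _ hqS, blockRot_mulVec_of_notMem _ hqS]
      simp [blockDot, hpd, hqd, hpd.symm, hqd.symm, hpq, hpq.symm, hdS, Pi.single_apply]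
    · exact (generically_true n).mono fun z _ _ h h' => absurd ⟨h, h'⟩ hp
  exact (h1.and h2).mono fun z _ h =>
    ⟨fun p q => h.1 (p, q) (Finset.mem_univ _), fun p q => h.2 (p, q) (Finset.mem_univ _)⟩

theorem eq_zero_of_canon {X : Phase n} (hx : x ∈ cotangentSphere n) (hX : X ∈ tangentAt x)
    (h : ∀ v ∈ tangentAt x, canon X v = 0) : X = 0 :=
  eq_zero_of_twistedForm (s := 0) (κ := 0) (by simp) hx hX fun v hv => by
    simpa [twistedForm, canon] using h v hv

/-! The number of independent integrals. -/

/-- The differentials at `x` of functions restricted to `T*Sⁿ⁻¹`. -/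
noncomputable def restrictedDifferential {ι : Type} (f : ι → Phase n → ℝ) (x : Phase n) (i : ι) :
    tangentAt x →L[ℝ] ℝ :=
  (fderiv ℝ (f i) x).comp (tangentAt x).subtypeL

theorem linearIndependent_of_forall_apply {ι E : Type*} [Fintype ι] [NormedAddCommGroup E]
    [NormedSpace ℝ E] {φ : ι → E →L[ℝ] ℝ}
    (h : ∀ t : ι → ℝ, (∀ w, ∑ i, t i * φ i w = 0) → ∀ i, t i = 0) : LinearIndependent ℝ φ := by
  refine Fintype.linearIndependent_iff.2 fun t ht => h t fun w => ?_
  have := congrArg (fun L : E →L[ℝ] ℝ => L w) ht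
  simpa [_root_.sum_apply] using this

theorem linearIndependent_restrictedDifferential {ι : Type} [Fintype ι] (hκ : κᵀ = -κ)
    {f : ι → Phase n → ℝ}
    (h : ∀ t : ι → ℝ, (∀ w ∈ tangentAt x,
      ∑ i, t i * fderiv ℝ (f i) (shift s κ x) (shift s κ w) = 0) → ∀ i, t i = 0) :
    LinearIndependent ℝ (restrictedDifferential f (shift s κ x)) := by
  refine linearIndependent_of_forall_apply fun t ht => h t fun w hw => ?_
  exact ht ⟨shift s κ w, (shift_mem_tangentAt hκ x w).2 hw⟩

theorem ddimAt_eq_card {ι : Type} [Fintype ι] {f : ι → Phase n → ℝ}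
    (h : LinearIndependent ℝ (restrictedDifferential f x)) : ddimAt f x = Fintype.card ι :=
  finrank_span_eq_card h

theorem fderiv_casimirSum_shift {d : ℕ} (hk : ∀ i, d ≤ i → k (i / 2) = 0) (q : ℕ)
    (x w : Phase n) :
    fderiv ℝ (casimirSum s (blockField n k) d q) (shift s (blockField n k) x)
      (shift s (blockField n k) w) = fderiv ℝ (casimir (slab n d q)) x w := by
  rw [← fderiv_comp_shift]
  exact congrArg (fun g => fderiv ℝ g x w) (funext (casimirSum_shift hk q))

theorem potential_eq_potential {d : ℕ} (hk : ∀ i, d ≤ i → k (i / 2) = 0) {p q : Fin n}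
    (hp : d ≤ (p : ℕ)) (hq : d ≤ (q : ℕ)) : potential n s k p = potential n s k q := by
  rw [potential_eq_zero (hk p hp), potential_eq_zero (hk q hq)]

theorem fderiv_ang_rotGen_of_lt {d : ℕ} {i j p q : Fin n} (hi : (i : ℕ) < d) (hj : (j : ℕ) < d)
    (hp : d ≤ (p : ℕ)) (hq : d ≤ (q : ℕ)) (x : Phase n) :
    fderiv ℝ (ang i j) x (fieldRot (rotGen p q) x) = 0 := by
  rw [fderiv_ang_rotGen]
  simp only [Fin.ext_iff]
  rw [if_neg (by omega), if_neg (by omega), if_neg (by omega), if_neg (by omega)]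
  ring

theorem Generically.symm_shift {P Q : Phase n → Prop} (hκ : κᵀ = -κ)
    (h : Generically fun z => P ((shift s κ).symm z))
    (hPQ : ∀ x ∈ cotangentSphere n, P x → Q (shift s κ x)) : Generically Q :=
  h.mono fun z hz hP => by
    have := hPQ ((shift s κ).symm z) ((shift_mem_cotangentSphere (s := s) hκ _).1
      (by rwa [ContinuousLinearEquiv.apply_symm_apply])) hP
    rwa [ContinuousLinearEquiv.apply_symm_apply] at this

/-- In a relation between the differentials of a chain of integrals only the last one can enter. -/
theorem IsChainRegular.reduce {d N : ℕ} (hN : d + 2 + N = n) (hx : IsChainRegular d x)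
    {D : Phase n → ℝ} (hD : ∀ p q : Fin n, d ≤ (p : ℕ) → (q : ℕ) = p + 1 →
      D (fieldRot (rotGen p q) x) = 0) {p₀ q₀ : Fin n} (hp₀ : (p₀ : ℕ) = d) (hq₀ : (q₀ : ℕ) = d + 1)
    (h3 : d + 3 ≤ n) {b : ℝ} {t : Fin N → ℝ} (h : ∀ w ∈ tangentAt x,
      D w + b * fderiv ℝ (MagneticSphere.ang p₀ q₀) x w
        + ∑ i, t i * fderiv ℝ (MagneticSphere.casimir (slab n d (d + 3 + i))) x w = 0) :
    b = 0 ∧ ∃ τ, (∀ i, t i = if d + 3 + (i : ℕ) = n then τ else 0) ∧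
      ∀ w ∈ tangentAt x, D w + τ * fderiv ℝ (MagneticSphere.casimir (slab n d n)) x w = 0 := by
  obtain ⟨hb, ht⟩ := hx.eq_zero hN hD hp₀ hq₀ h3 h
  have hlast : d + 3 + (N - 1) = n := by omega
  refine ⟨hb, t ⟨N - 1, by omega⟩, fun i => ?_, fun w hw => ?_⟩
  · split_ifs with hi
    · congr 1
      exact Fin.ext (by simp only; omega)
    · exact ht i (by omega)
  · have := h w hw
    rwa [hb, zero_mul, add_zero, Finset.sum_eq_single ⟨N - 1, by omega⟩, hlast] at this
    · intro i _ hi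
      have : (i : ℕ) ≠ N - 1 := fun h0 => hi (Fin.ext h0)
      rw [ht i (by omega), zero_mul]
    · simp

theorem fieldRot_rotGen_eq {p q : Fin n} (hpq : p ≠ q) (hS : ∀ i, i ∈ S ↔ i = p ∨ i = q)
    (h : ang p q x ≠ 0) : fieldRot (rotGen p q) x = (ang p q x)⁻¹ • fieldBlock S x := by
  rw [fieldBlock_pair hpq hS, inv_smul_smul₀ h]

theorem independent_twoPlane (hn : 6 < n) (hm : 0 < m) (hs : s ≠ 0) (hk : ∀ l, 2 ≤ l → k l = 0)
    (hk₀ : k 0 ≠ 0) (hk₁ : k 1 ≠ 0) (hx : x ∈ cotangentSphere n)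
    (hr : IsRegular (slab n 0 2) (slab n 2 4) (slab n 4 n) (s ^ 2 / 4 * k 0 ^ 2)
      (s ^ 2 / 4 * k 1 ^ 2) x) (hch : IsChainRegular 4 x) :
    LinearIndependent ℝ (restrictedDifferential (Sum.elim
      ![energy m, integralJ m s (blockField n k),
        integralΦ s (blockField n k) ⟨0, by omega⟩ ⟨1, by omega⟩,
        integralΦ s (blockField n k) ⟨2, by omega⟩ ⟨3, by omega⟩,
        integralΦ s (blockField n k) ⟨4, by omega⟩ ⟨5, by omega⟩]
      (fun q : Fin (n - 6) => casimirSum s (blockField n k) 4 (7 + q)))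
      (shift s (blockField n k) x)) := by
  have hn' : 4 ≤ n := by omega
  have hk₂ := half_eq_zero₄ hk
  have hκ := blockField_skew n k
  have hB := threeBlocks_slab (n := n) (s := s) hk
  have hF := hB.isFrameAt (by positivity) (by positivity) hx hr hx (SameInvariants.refl _ _ _ _ x)
  refine linearIndependent_restrictedDifferential hκ fun t ht => ?_
  have hΦ : ∀ x : Phase n, integralΦ s (blockField n k) ⟨4, by omega⟩ ⟨5, by omega⟩
      (shift s (blockField n k) x) = ang ⟨4, by omega⟩ ⟨5, by omega⟩ x :=
    integralΦ_shift_of_eq_zero (hk₂ 4 le_rfl) (hk₂ 5 (by omega))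
  simp only [Fintype.sum_sum_type, Fin.sum_univ_five, Sum.elim_inl, Sum.elim_inr, Matrix.cons_val,
    fderiv_casimirSum_shift hk₂, fderiv_energy_shift hn' hk, fderiv_integralJ_shift hn' hk,
    fderiv_shift_of_ang (integralΦ₀₁_shift hn'), fderiv_shift_of_ang (integralΦ₂₃_shift hn'),
    fderiv_shift_of_ang hΦ] at ht
  set E := neumannE (potential n s k) x with hEdef
  set α := t (Sum.inl 0) / (2 * m) - 2 * E * t (Sum.inl 1) / m ^ 2 with hα
  set β := 4 * t (Sum.inl 1) / m ^ 2 with hβ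
  set l₁ := t (Sum.inl 2) - s * k 0 * t (Sum.inl 0) / (2 * m)
    - s ^ 3 * k 0 ^ 3 * t (Sum.inl 1) / m ^ 2 with hl₁
  set l₂ := t (Sum.inl 3) - s * k 1 * t (Sum.inl 0) / (2 * m)
    - s ^ 3 * k 1 ^ 3 * t (Sum.inl 1) / m ^ 2 with hl₂
  obtain ⟨h4, τ, hτ, hrel⟩ := hch.reduce (N := n - 6) (by omega)
    (D := fun w => α * fderiv ℝ (neumannE (potential n s k)) x w
      + β * fderiv ℝ (neumannG (potential n s k)) x w
      + l₁ * fderiv ℝ (ang ⟨0, by omega⟩ ⟨1, by omega⟩) x w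
      + l₂ * fderiv ℝ (ang ⟨2, by omega⟩ ⟨3, by omega⟩) x w)
    (p₀ := ⟨4, by omega⟩) (q₀ := ⟨5, by omega⟩) (b := t (Sum.inl 4)) (t := fun i => t (Sum.inr i))
    (by
      intro p q hp hq
      have hsym : IsSymmetry (potential n s k) (rotGen p q) :=
        rotGen_isSymmetry (potential_eq_potential hk₂ hp (by omega))
      rw [fderiv_neumannE_fieldRot hsym, fderiv_neumannG_fieldRot hsym,
        fderiv_ang_rotGen_of_lt (d := 4) (by simp) (by simp) hp (by omega),
        fderiv_ang_rotGen_of_lt (d := 4) (by simp) (by simp) hp (by omega)]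
      ring)
    rfl rfl (by omega) (by
      intro w hw
      refine Eq.trans ?_ (ht w hw)
      simp only [hα, hβ, hl₁, hl₂]
      field_simp
      ring)
  have hX := eq_zero_of_canon (X := α • (2 : ℝ) • fieldE (potential n s k) x
    + β • (2 : ℝ) • fieldG (potential n s k) x + l₁ • fieldRot (rotGen ⟨0, by omega⟩ ⟨1, by omega⟩) x
    + l₂ • fieldRot (rotGen ⟨2, by omega⟩ ⟨3, by omega⟩) x
    + τ • (2 : ℝ) • fieldBlock (slab n 4 n) x) hx ?_ fun v hv => ?_
  · have hL₁ : ang ⟨0, by omega⟩ ⟨1, by omega⟩ x ≠ 0 := fun h0 => hr.h₁ (by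
      rw [casimir_pair (by simp) (mem_slab₀ hn'), h0]; ring)
    have hL₂ : ang ⟨2, by omega⟩ ⟨3, by omega⟩ x ≠ 0 := fun h0 => hr.h₂ (by
      rw [casimir_pair (by simp) (mem_slab₂ hn'), h0]; ring)
    rw [fieldRot_rotGen_eq (by simp) (mem_slab₀ hn') hL₁,
      fieldRot_rotGen_eq (by simp) (mem_slab₂ hn') hL₂] at hX
    simp only [smul_smul] at hX
    obtain ⟨z₁, z₂, z₃, z₄, z₅⟩ := hF.eq_zero _ _ _ _ _ hX
    have hm' := hm.ne'
    have t1 : t (Sum.inl 1) = 0 := by simpa [hβ, hm'] using z₂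
    have t0 : t (Sum.inl 0) = 0 := by simpa [hα, t1, hm'] using z₁
    have t2 : t (Sum.inl 2) = 0 := by simpa [hl₁, t1, t0, hL₁] using z₃
    have t3 : t (Sum.inl 3) = 0 := by simpa [hl₂, t1, t0, hL₂] using z₄
    have hτ0 : τ = 0 := by simpa using z₅
    rintro (i | i)
    · fin_cases i
      exacts [t0, t1, t2, t3, h4]
    · rw [hτ, hτ0, ite_self]
  · exact Submodule.add_mem _ (Submodule.add_mem _ (Submodule.add_mem _ (Submodule.add_mem _
      (Submodule.smul_mem _ _ (isHamVector_neumannE hx).1)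
      (Submodule.smul_mem _ _ (isHamVector_neumannG hx).1))
      (Submodule.smul_mem _ _ (isHamVector_ang _ _ x).1))
      (Submodule.smul_mem _ _ (isHamVector_ang _ _ x).1))
      (Submodule.smul_mem _ _ (isHamVector_casimir _ x).1)
  · simp only [canon_add, canon_smul α, canon_smul β, canon_smul l₁, canon_smul l₂, canon_smul τ,
      (isHamVector_neumannE hx).2 v hv, (isHamVector_neumannG hx).2 v hv,
      (isHamVector_ang _ _ x).2 v hv, (isHamVector_casimir _ x).2 v hv]
    linear_combination -hrel v hv

/-- The energy, `J`, `Φ₁₂`, `Φ₃₄`, `Φ₅₆` and the Casimir functions of the rotations. -/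
noncomputable abbrev twoPlaneChain (hn : 6 < n) (m s : ℝ) (k : ℕ → ℝ) :
    Fin 5 ⊕ Fin (n - 6) → Phase n → ℝ :=
  Sum.elim
    ![energy m, integralJ m s (blockField n k),
      integralΦ s (blockField n k) ⟨0, by omega⟩ ⟨1, by omega⟩,
      integralΦ s (blockField n k) ⟨2, by omega⟩ ⟨3, by omega⟩,
      integralΦ s (blockField n k) ⟨4, by omega⟩ ⟨5, by omega⟩]
    (fun q : Fin (n - 6) => casimirSum s (blockField n k) 4 (7 + q))

theorem liouville_twoPlane (hn : 6 < n) (hm : 0 < m) (hs : s ≠ 0) (hk : ∀ l, 2 ≤ l → k l = 0)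
    (hk₀ : k 0 ≠ 0) (hk₁ : k 1 ≠ 0) :
    IsLiouvilleIntegrable m s (blockField n k) (twoPlaneChain hn m s k) := by
  have hn' : 4 ≤ n := by omega
  have hk₂ := half_eq_zero₄ hk
  have hκ := blockField_skew n k
  have ha := isHalfSquare_potential (s := s) hn' hk
  have hc : ∀ i, Conserved (potential n s k) s (blockField n k) (twoPlaneChain hn m s k i) := by
    rintro (i | q)
    · revert i
      simpa [Fin.forall_fin_succ] using ⟨conserved_energy ha hκ, conserved_integralJ ha hκ,
        conserved_integralΦ₀₁ hn', conserved_integralΦ₂₃ hn',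
        conserved_integralΦ (i := ⟨4, by omega⟩) (j := ⟨5, by omega⟩) (hk₂ 4 le_rfl)
          (hk₂ 5 (by omega))⟩
    · exact conserved_casimirSum hk₂ _
  refine ⟨?_, fun i => (hc i).isFirstIntegral ha hκ, ?_, ?_⟩
  · rintro (i | q)
    · revert i
      simpa [Fin.forall_fin_succ] using ⟨contDiff_energy, contDiff_integralJ,
        contDiff_integralΦ _ _, contDiff_integralΦ _ _, contDiff_integralΦ _ _⟩
    · exact contDiff_casimirSum _ _
  · refine commute_of_chain (m := m) (d := 4) ha hκ rfl hc ?_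
    rintro (i | q)
    · fin_cases i
      · exact Or.inl (Or.inl rfl)
      · exact Or.inl (Or.inr rfl)
      · exact Or.inr (Or.inl ⟨⟨0, by omega⟩, ⟨1, by omega⟩, by simp, rfl, by simp,
          integralΦ₀₁_shift hn'⟩)
      · exact Or.inr (Or.inl ⟨⟨2, by omega⟩, ⟨3, by omega⟩, by simp, rfl, by simp,
          integralΦ₂₃_shift hn'⟩)
      · exact Or.inr (Or.inl ⟨⟨4, by omega⟩, ⟨5, by omega⟩, by simp, rfl, le_rfl,
          integralΦ_shift_of_eq_zero (hk₂ 4 le_rfl) (hk₂ 5 (by omega))⟩)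
    · exact Or.inr (Or.inr ⟨7 + q, by omega, casimirSum_shift hk₂ _⟩)
  · have h₁ : Generically fun z => IsRegular (slab n 0 2) (slab n 2 4) (slab n 4 n)
        (s ^ 2 / 4 * k 0 ^ 2) (s ^ 2 / 4 * k 1 ^ 2) ((shift s (blockField n k)).symm z) :=
      generically_isRegular (c₁ := s ^ 2 / 4 * k 0 ^ 2) (c₂ := s ^ 2 / 4 * k 1 ^ 2) (by omega)
        (by positivity) (by positivity) hκ fun x _ h => by
        rwa [ContinuousLinearEquiv.symm_apply_apply]
    refine (h₁.and (generically_isChainRegular (by omega) hκ 4)).symm_shift (P := fun x =>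
      IsRegular (slab n 0 2) (slab n 2 4) (slab n 4 n) (s ^ 2 / 4 * k 0 ^ 2)
        (s ^ 2 / 4 * k 1 ^ 2) x ∧ IsChainRegular 4 x) hκ fun x hx h => ?_
    rw [ddimAt_eq_card (independent_twoPlane hn hm hs hk hk₀ hk₁ hx h.1 h.2)]
    simp only [Fintype.card_sum, Fintype.card_fin]
    omega

/-- The energy, `Φ₁₂`, `Φ₃₄` and the Casimir functions of the rotations. -/
noncomputable abbrev onePlaneChain (hn : 4 < n) (m s : ℝ) (k : ℕ → ℝ) :
    Fin 3 ⊕ Fin (n - 4) → Phase n → ℝ :=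
  Sum.elim
    ![energy m,
      integralΦ s (blockField n k) ⟨0, by omega⟩ ⟨1, by omega⟩,
      integralΦ s (blockField n k) ⟨2, by omega⟩ ⟨3, by omega⟩]
    (fun q : Fin (n - 4) => casimirSum s (blockField n k) 2 (5 + q))

theorem independent_onePlane (hn : 4 < n) (hm : 0 < m) (hk : ∀ l, 1 ≤ l → k l = 0)
    (hx : x ∈ cotangentSphere n) (hL : ang ⟨0, by omega⟩ ⟨1, by omega⟩ x ≠ 0)
    (hD : casimir (slab n 2 n) x ≠ 0) (hv : blockDot (slab n 0 2) x.1 x.2 ≠ 0)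
    (hch : IsChainRegular 2 x) :
    LinearIndependent ℝ (restrictedDifferential (onePlaneChain hn m s k)
      (shift s (blockField n k) x)) := by
  have hn' : 4 ≤ n := by omega
  have hk' : ∀ l, 2 ≤ l → k l = 0 := fun l hl => hk l (by omega)
  have hk₁ : k 1 = 0 := hk 1 le_rfl
  have hk₂ := half_eq_zero₂ hk
  have hκ := blockField_skew n k
  have hB : TwoBlocks (slab n 0 2) (slab n 2 n) (potential n s k) (s ^ 2 / 4 * k 0 ^ 2) :=
    twoBlocks_slab₂ hk
  have hD₀ : 0 < casimir (slab n 0 2) x := by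
    rw [casimir_pair (by simp) (mem_slab₀ hn')]
    positivity
  have hmin := aboveMin_of_ne_zero hB hx hD₀ (casimir_pos_of_ne_zero hD) hv
  refine linearIndependent_restrictedDifferential hκ fun t ht => ?_
  simp only [Fintype.sum_sum_type, Fin.sum_univ_three, Sum.elim_inl, Sum.elim_inr, Matrix.cons_val,
    fderiv_casimirSum_shift hk₂, fderiv_energy_shift hn' hk',
    fderiv_shift_of_ang (integralΦ₀₁_shift hn'), fderiv_shift_of_ang (integralΦ₂₃_shift hn')] at ht
  obtain ⟨h2, τ, hτ, hrel⟩ := hch.reduce (N := n - 4) (by omega)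
    (D := fun w => t (Sum.inl 0) / (2 * m) * fderiv ℝ (neumannE (potential n s k)) x w
      + (t (Sum.inl 1) - s * k 0 * t (Sum.inl 0) / (2 * m))
        * fderiv ℝ (ang ⟨0, by omega⟩ ⟨1, by omega⟩) x w)
    (p₀ := ⟨2, by omega⟩) (q₀ := ⟨3, by omega⟩) (b := t (Sum.inl 2)) (t := fun i => t (Sum.inr i))
    (fun p q hp hq => by
      rw [fderiv_neumannE_fieldRot (rotGen_isSymmetry (potential_eq_potential hk₂ hp (by omega))),
        fderiv_ang_rotGen_of_lt (d := 2) (by simp) (by simp) hp (by omega)]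
      ring)
    rfl rfl (by omega) (fun w hw => by
      refine Eq.trans ?_ (ht w hw)
      rw [hk₁]
      field_simp
      ring)
  have hX := eq_zero_of_canon (X := (t (Sum.inl 0) / (2 * m)) • (2 : ℝ) • fieldE (potential n s k) x
    + (t (Sum.inl 1) - s * k 0 * t (Sum.inl 0) / (2 * m))
      • fieldRot (rotGen ⟨0, by omega⟩ ⟨1, by omega⟩) x
    + τ • (2 : ℝ) • fieldBlock (slab n 2 n) x) hx ?_ fun v hv => ?_
  · rw [fieldRot_rotGen_eq (by simp) (mem_slab₀ hn') hL] at hX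
    simp only [smul_smul] at hX
    obtain ⟨z₁, z₂, z₃⟩ := hB.eq_zero hx hD₀ (casimir_pos_of_ne_zero hD) hmin hX
    have hm' := hm.ne'
    have t0 : t (Sum.inl 0) = 0 := by simpa [hm'] using z₁
    have t1 : t (Sum.inl 1) = 0 := by simpa [t0, hL] using z₂
    have hτ0 : τ = 0 := by simpa using z₃
    rintro (i | i)
    · fin_cases i
      exacts [t0, t1, h2]
    · rw [hτ, hτ0, ite_self]
  · exact Submodule.add_mem _ (Submodule.add_mem _
      (Submodule.smul_mem _ _ (isHamVector_neumannE hx).1)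
      (Submodule.smul_mem _ _ (isHamVector_ang _ _ x).1))
      (Submodule.smul_mem _ _ (isHamVector_casimir _ x).1)
  · simp only [canon_add, canon_smul (t (Sum.inl 0) / (2 * m)), canon_smul τ,
      canon_smul (t (Sum.inl 1) - s * k 0 * t (Sum.inl 0) / (2 * m)),
      (isHamVector_neumannE hx).2 v hv,
      (isHamVector_ang _ _ x).2 v hv, (isHamVector_casimir _ x).2 v hv]
    linear_combination -hrel v hv

/-- The integral `J` of a field with one plane depends on the other integrals. -/
theorem fderiv_integralJ_onePlane (hn : 4 ≤ n) (hm : 0 < m) (hk : ∀ l, 1 ≤ l → k l = 0)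
    (hx : x ∈ cotangentSphere n) : ∃ A B C : ℝ, ∀ w ∈ tangentAt x,
    fderiv ℝ (integralJ m s (blockField n k)) (shift s (blockField n k) x)
        (shift s (blockField n k) w)
      = A * fderiv ℝ (energy m) (shift s (blockField n k) x) (shift s (blockField n k) w)
        + B * fderiv ℝ (ang ⟨0, by omega⟩ ⟨1, by omega⟩) x w
        + C * fderiv ℝ (casimir (slab n 2 n)) x w := by
  have hk' : ∀ l, 2 ≤ l → k l = 0 := fun l hl => hk l (by omega)
  have hB : TwoBlocks (slab n 0 2) (slab n 2 n) (potential n s k) (s ^ 2 / 4 * k 0 ^ 2) :=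
    twoBlocks_slab₂ hk
  have hcas : ∀ w, fderiv ℝ (casimir (slab n 0 2)) x w
      = 2 * ang ⟨0, by omega⟩ ⟨1, by omega⟩ x * fderiv ℝ (ang ⟨0, by omega⟩ ⟨1, by omega⟩) x w := by
    intro w
    have h : casimir (slab n 0 2) = fun y : Phase n => ang ⟨0, by omega⟩ ⟨1, by omega⟩ y ^ 2 :=
      funext (casimir_pair (by simp) (mem_slab₀ hn))
    rw [h, fderiv_fun_pow _ ((contDiff_ang (k := 1) _ _).differentiable (by simp) x)]
    simp
  refine ⟨2 * m * (4 * (s ^ 2 / 4 * k 0 ^ 2) - 2 * neumannE (potential n s k) x) / m ^ 2,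
    ((4 * (s ^ 2 / 4 * k 0 ^ 2) - 2 * neumannE (potential n s k) x) * (s * k 0)
      + 8 * (s ^ 2 / 4 * k 0 ^ 2) * ang ⟨0, by omega⟩ ⟨1, by omega⟩ x - s ^ 3 * k 0 ^ 3) / m ^ 2,
    -(4 * (s ^ 2 / 4 * k 0 ^ 2)) / m ^ 2, fun w hw => ?_⟩
  rw [fderiv_integralJ_shift hn hk', fderiv_energy_shift hn hk', hB.fderiv_neumannG_eq hx hw,
    ← fderiv_casimir, ← fderiv_casimir, hcas, hk 1 le_rfl]
  field_simp
  ring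

theorem ddimAt_congr {ι ι' : Type} [Fintype ι] [Fintype ι'] {f : ι → Phase n → ℝ}
    {g : ι' → Phase n → ℝ} (hf : ∀ i, restrictedDifferential f x i ∈
      Submodule.span ℝ (range (restrictedDifferential g x)))
    (hg : ∀ i, restrictedDifferential g x i ∈
      Submodule.span ℝ (range (restrictedDifferential f x))) : ddimAt f x = ddimAt g x := by
  have : Submodule.span ℝ (range (restrictedDifferential f x))
      = Submodule.span ℝ (range (restrictedDifferential g x)) :=
    le_antisymm (Submodule.span_le.2 (range_subset_iff.2 hf))
      (Submodule.span_le.2 (range_subset_iff.2 hg))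
  exact congrArg (fun V : Submodule ℝ (tangentAt x →L[ℝ] ℝ) => Module.finrank ℝ V) this

/-- The chain of integrals for one plane, completed by `J`. -/
noncomputable abbrev onePlaneChainJ (hn : 4 < n) (m s : ℝ) (k : ℕ → ℝ) :
    Fin 4 ⊕ Fin (n - 4) → Phase n → ℝ :=
  Sum.elim
    ![energy m, integralJ m s (blockField n k),
      integralΦ s (blockField n k) ⟨0, by omega⟩ ⟨1, by omega⟩,
      integralΦ s (blockField n k) ⟨2, by omega⟩ ⟨3, by omega⟩]
    (fun q : Fin (n - 4) => casimirSum s (blockField n k) 2 (5 + q))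

theorem ddimAt_onePlaneChainJ (hn : 4 < n) (hm : 0 < m) (hk : ∀ l, 1 ≤ l → k l = 0)
    (hx : x ∈ cotangentSphere n) :
    ddimAt (onePlaneChainJ hn m s k) (shift s (blockField n k) x)
      = ddimAt (onePlaneChain hn m s k) (shift s (blockField n k) x) := by
  have hn' : 4 ≤ n := by omega
  have hκ := blockField_skew n k
  refine ddimAt_congr ?_ ?_
  · set φ := restrictedDifferential (onePlaneChain hn m s k) (shift s (blockField n k) x) with hφ
    have hmem : ∀ i, φ i ∈ Submodule.span ℝ (range φ) := fun i =>
      Submodule.subset_span ⟨i, rfl⟩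
    rintro (i | i)
    · fin_cases i
      · exact hmem (Sum.inl 0)
      · obtain ⟨A, B, C, h⟩ := fderiv_integralJ_onePlane (m := m) (s := s) hn' hm hk hx
        have hJ : restrictedDifferential (onePlaneChainJ hn m s k) (shift s (blockField n k) x)
            (Sum.inl 1) = A • φ (Sum.inl 0) + B • φ (Sum.inl 1)
              + C • φ (Sum.inr ⟨n - 5, by omega⟩) := by
          refine ContinuousLinearMap.ext fun ⟨w, hw⟩ => ?_
          obtain ⟨w, rfl⟩ := (shift s (blockField n k)).surjective w
          refine (h w ((shift_mem_tangentAt hκ x w).1 hw)).trans ?_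
          have hlast : 5 + (n - 5) = n := by omega
          rw [← fderiv_shift_of_ang (integralΦ₀₁_shift (s := s) (k := k) hn') x w,
            ← fderiv_casimirSum_shift (s := s) (half_eq_zero₂ hk) n x w]
          simp [hφ, restrictedDifferential, hlast]
        exact hJ ▸ Submodule.add_mem _ (Submodule.add_mem _ (Submodule.smul_mem _ _ (hmem _))
          (Submodule.smul_mem _ _ (hmem _))) (Submodule.smul_mem _ _ (hmem _))
      · exact hmem (Sum.inl 1)
      · exact hmem (Sum.inl 2)
    · exact hmem (Sum.inr i)
  · have hmem := fun i => Submodule.subset_span (R := ℝ) (mem_range_self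
      (f := restrictedDifferential (onePlaneChainJ hn m s k) (shift s (blockField n k) x)) i)
    rintro (i | i)
    · fin_cases i
      exacts [hmem (Sum.inl 0), hmem (Sum.inl 2), hmem (Sum.inl 3)]
    · exact hmem (Sum.inr i)

theorem liouville_onePlane (hn : 4 < n) (hm : 0 < m) (hk : ∀ l, 1 ≤ l → k l = 0) :
    IsLiouvilleIntegrable m s (blockField n k) (onePlaneChainJ hn m s k) := by
  have hn' : 4 ≤ n := by omega
  have hk' : ∀ l, 2 ≤ l → k l = 0 := fun l hl => hk l (by omega)
  have hk₂ := half_eq_zero₂ hk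
  have hκ := blockField_skew n k
  have ha := isHalfSquare_potential (s := s) hn' hk'
  have hc : ∀ i, Conserved (potential n s k) s (blockField n k) (onePlaneChainJ hn m s k i) := by
    rintro (i | q)
    · revert i
      simpa [Fin.forall_fin_succ] using ⟨conserved_energy ha hκ, conserved_integralJ ha hκ,
        conserved_integralΦ₀₁ hn', conserved_integralΦ₂₃ hn'⟩
    · exact conserved_casimirSum hk₂ _
  refine ⟨?_, fun i => (hc i).isFirstIntegral ha hκ, ?_, ?_⟩
  · rintro (i | q)
    · revert i
      simpa [Fin.forall_fin_succ] using ⟨contDiff_energy, contDiff_integralJ,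
        contDiff_integralΦ _ _, contDiff_integralΦ _ _⟩
    · exact contDiff_casimirSum _ _
  · refine commute_of_chain (m := m) (d := 2) ha hκ rfl hc ?_
    rintro (i | q)
    · fin_cases i
      · exact Or.inl (Or.inl rfl)
      · exact Or.inl (Or.inr rfl)
      · exact Or.inr (Or.inl ⟨⟨0, by omega⟩, ⟨1, by omega⟩, by simp, rfl, by simp,
          integralΦ₀₁_shift hn'⟩)
      · exact Or.inr (Or.inl ⟨⟨2, by omega⟩, ⟨3, by omega⟩, by simp, rfl, le_rfl,
          integralΦ₂₃_shift hn'⟩)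
    · exact Or.inr (Or.inr ⟨5 + q, by omega, casimirSum_shift hk₂ _⟩)
  · set P : Phase n → Prop := fun x => ang ⟨0, by omega⟩ ⟨1, by omega⟩ x ≠ 0 ∧
      casimir (slab n 2 n) x ≠ 0 ∧ blockDot (slab n 0 2) x.1 x.2 ≠ 0 with hP
    have h₁ : Generically fun z => P ((shift s (blockField n k)).symm z) :=
      generically_onePlane hn' hκ fun x _ hL hD hv => by
        rw [ContinuousLinearEquiv.symm_apply_apply]
        exact ⟨hL, hD, hv⟩
    refine (h₁.and (generically_isChainRegular (by omega) hκ 2)).symm_shift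
      (P := fun x => P x ∧ IsChainRegular 2 x) hκ fun x hx h => ?_
    obtain ⟨⟨hL, hD, hv⟩, hch⟩ := h
    rw [ddimAt_onePlaneChainJ hn hm hk hx,
      ddimAt_eq_card (independent_onePlane hn hm hk hx hL hD hv hch)]
    simp only [Fintype.card_sum, Fintype.card_fin]
    omega

end MagneticSphere

end

theorem theorem4 (n : ℕ) (m s : ℝ) (hm : 0 < m) (hs : s ≠ 0) (k : ℕ → ℝ) :
    -- (i) only `κ₁₂` is different from zero
    (∀ hn : 5 ≤ n, k 0 ≠ 0 → (∀ l, 1 ≤ l → k l = 0) →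
      IsNoncommutativelyIntegrable m s (blockField n k)
        (Sum.elim
          ![energy m, integralJ m s (blockField n k),
            integralΦ s (blockField n k) ⟨0, by omega⟩ ⟨1, by omega⟩]
          (rotationIntegrals s (blockField n k) 2)) 3 ∧
      IsLiouvilleIntegrable m s (blockField n k)
        (Sum.elim
          ![energy m, integralJ m s (blockField n k),
            integralΦ s (blockField n k) ⟨0, by omega⟩ ⟨1, by omega⟩,
            integralΦ s (blockField n k) ⟨2, by omega⟩ ⟨3, by omega⟩]
          (fun q : Fin (n - 4) => casimirSum s (blockField n k) 2 (5 + q)))) ∧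
    -- (ii) `κ₁₂ = κ₃₄ ≠ 0`
    (∀ hn : 7 ≤ n, k 0 ≠ 0 → k 0 = k 1 → (∀ l, 2 ≤ l → k l = 0) →
      IsNoncommutativelyIntegrable m s (blockField n k)
        (Sum.elim
          ![energy m, integralJ m s (blockField n k),
            integralΦ s (blockField n k) ⟨0, by omega⟩ ⟨1, by omega⟩,
            integralΦ s (blockField n k) ⟨2, by omega⟩ ⟨3, by omega⟩,
            integralΨ₁ s (blockField n k)
              ⟨0, by omega⟩ ⟨1, by omega⟩ ⟨2, by omega⟩ ⟨3, by omega⟩,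
            integralΨ₂ s (blockField n k)
              ⟨0, by omega⟩ ⟨1, by omega⟩ ⟨2, by omega⟩ ⟨3, by omega⟩]
          (rotationIntegrals s (blockField n k) 4)) 4) ∧
    -- (iii) `κ₁₂ ≠ κ₃₄`, both different from zero
    (∀ hn : 7 ≤ n, k 0 ≠ 0 → k 1 ≠ 0 → k 0 ≠ k 1 → (∀ l, 2 ≤ l → k l = 0) →
      IsNoncommutativelyIntegrable m s (blockField n k)
        (Sum.elim
          ![energy m, integralJ m s (blockField n k),
            integralΦ s (blockField n k) ⟨0, by omega⟩ ⟨1, by omega⟩,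
            integralΦ s (blockField n k) ⟨2, by omega⟩ ⟨3, by omega⟩]
          (rotationIntegrals s (blockField n k) 4)) 5) ∧
    -- Liouville integrability in (ii) and (iii)
    (∀ hn : 7 ≤ n, k 0 ≠ 0 → k 1 ≠ 0 → (∀ l, 2 ≤ l → k l = 0) →
      IsLiouvilleIntegrable m s (blockField n k)
        (Sum.elim
          ![energy m, integralJ m s (blockField n k),
            integralΦ s (blockField n k) ⟨0, by omega⟩ ⟨1, by omega⟩,
            integralΦ s (blockField n k) ⟨2, by omega⟩ ⟨3, by omega⟩,
            integralΦ s (blockField n k) ⟨4, by omega⟩ ⟨5, by omega⟩]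
          (fun q : Fin (n - 6) => casimirSum s (blockField n k) 4 (7 + q)))) :=
  ⟨fun hn _ hk => ⟨integrable_onePlane (by omega) hm hk, liouville_onePlane hn hm hk⟩,
    fun _ hk₀ h hk => integrable_equalPlane (by omega) hm hs hk h hk₀,
    fun _ hk₀ hk₁ _ hk => integrable_twoPlane (by omega) hm hs hk hk₀ hk₁,
    fun hn hk₀ hk₁ hk => liouville_twoPlane hn hm hs hk hk₀ hk₁⟩
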